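/- Conventions. Links are classical, unoriented, with at least one component, and are considered up to isotopy. Diagrams are generic diagrams on the sphere $\mathbb{S}^2$, up to isotopy of $\mathbb{S}^2$. A diagram is \emph{minimal} for $L$ if it has $c(L)$ crossings, where $c(L)$ is the minimal number of crossings of a diagram of $L$. A link is \emph{trivial} if it has a diagram without crossings (an unlink with any number of components), and \emph{split} if it has a disconnected diagram. The Reidemeister moves are $\Omega_1^{\uparrow},\Omega_1^{\downarrow}$ (adding / removing a kink), $\Omega_2^{\uparrow},\Omega_2^{\downarrow}$ (adding / removing a bigon one of whose sides lies over the other) and the $\Omega_3$-type moves; an \emph{$\Omega_3$-triangle} of a diagram is a triangular region at which an $\Omega_3$-type move can be made, i.e. a triangular region with three different crossings as vertices, one of whose sides lies over, and one of whose sides lies under, the two other sides. A \emph{hard diagram} of a link $L$ is a reduced diagram of $L$ (one without nugatory crossings) that has more than $c(L)$ crossings and that cannot be transformed into a minimal diagram of $L$ by a finite sequence of Reidemeister moves (and isotopies of $\mathbb{S}^2$) none of which increases the number of crossings. It is \emph{rigid} if no $\Omega_3$-type move can be made on it. Theorem. Every link $L$ has a rigid hard diagram. Moreover, if $L$ is non-split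 and non-trivial, then $L$ has a rigid hard diagram $D$ with $$\#\mathrm{crossings}(D)\le 7\cdot \mathrm{tri}(L)+c(L),$$ where $\mathrm{tri}(L)$ is the minimum, over all minimal diagrams of $L$, of the number of $\Omega_3$-triangles, except that $\mathrm{tri}(L)=1$ if this minimum is $0$. -/

import Mathlib

/-- A link diagram on the oriented 2-sphere, as a combinatorial object (a planar diagram code that
also records the regions, so that diagrams with a disconnected underlying graph and diagrams with
crossingless circles are included, together with the relative position of their pieces).

The four edge-ends at a crossing `x` are numbered counterclockwise by `ZMod 4`, in such a way that
the ends `0, 2` form the lower strand and the ends `1, 3` the upper strand. `edge x i` is the edge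
leaving `x` through the end `i`; an edge has two ends, or none, in which case it is a crossingless
circle. `corner x i` is the region that contains the corner between the ends `i` and `i + 1`, and
`sides e` is the pair of regions on the two sides of `e`.

The diagram lies on the sphere: thicken the underlying curves to an oriented surface, and glue in,
for every region, a sphere with holes along the boundary circles that belong to this region.
`connected` and `euler` say that the resulting closed oriented surface is connected and has Euler
characteristic `2`; the equation `2 * #regions = #crossings + #faces + 2 * #circles + 2` is
`#crossings - #edges + ∑ r, (2 - #(boundary circles of r)) = 2`. -/
structure LinkDiagram where
  Crossing : Type
  Edge : Type
  Region : Type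
  finite_crossing : Finite Crossing
  finite_edge : Finite Edge
  finite_region : Finite Region
  edge : Crossing → ZMod 4 → Edge
  corner : Crossing → ZMod 4 → Region
  sides : Edge → Sym2 Region
  ends_edge : ∀ e, {p : Crossing × ZMod 4 | edge p.1 p.2 = e}.ncard = 0 ∨
    {p : Crossing × ZMod 4 | edge p.1 p.2 = e}.ncard = 2
  corner_eq : ∀ x i y j, (x, i) ≠ (y, j) → edge x i = edge y j → corner x i = corner y (j - 1)
  sides_edge : ∀ x i, sides (edge x i) = s(corner x i, corner x (i - 1))
  connected : ∀ r s : Region, Relation.ReflTransGen (fun r s => ∃ e, sides e = s(r, s)) r s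
  euler : 2 * Nat.card Region = Nat.card Crossing +
    Nat.card (Quot fun p q : Crossing × ZMod 4 =>
      ∃ j, p ≠ (q.1, j) ∧ edge p.1 p.2 = edge q.1 j ∧ q.2 = j - 1) +
    2 * Nat.card {e : Edge // ∀ x i, edge x i ≠ e} + 2

namespace LinkDiagram

/-- The number of crossings. -/
noncomputable def numCrossings (D : LinkDiagram) : ℕ := Nat.card D.Crossing

/-- The edge-end `i` of a crossing belongs to the upper strand. -/
def IsOver (i : ZMod 4) : Prop := i = 1 ∨ i = 3

/-- `e` is a crossingless circle. -/
def IsFreeLoop (D : LinkDiagram) (e : D.Edge) : Prop := ∀ x i, D.edge x i ≠ e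

/-- The region `r` has no corners besides those in `C`, and no crossingless circle on its
boundary. If `C` is the set of corners of a single face then the region `r` is an open disc. -/
def OnlyCorners (D : LinkDiagram) (r : D.Region) (C : Set (D.Crossing × ZMod 4)) : Prop :=
  (∀ x i, D.corner x i = r → (x, i) ∈ C) ∧ ∀ e, D.IsFreeLoop e → r ∉ D.sides e

/-- Isotopy on the oriented sphere: an isomorphism of diagrams. The numbering of the edge-ends of
a crossing may be turned by two places, which exchanges the two ends of each strand. -/
def Isotopic (D D' : LinkDiagram) : Prop :=
  ∃ (f : D.Crossing ≃ D'.Crossing) (g : D.Edge ≃ D'.Edge) (h : D.Region ≃ D'.Region)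
    (t : D.Crossing → ZMod 4),
    (∀ x, t x = 0 ∨ t x = 2) ∧
    (∀ x i, D'.edge (f x) (i + t x) = g (D.edge x i)) ∧
    (∀ x i, D'.corner (f x) (i + t x) = h (D.corner x i)) ∧
    ∀ e, D'.sides (g e) = (D.sides e).map h

/-- `D'` is obtained from `D` by deleting the crossings in `S`, the edges in `B` and the region
`r`, and identifying the remaining edges according to `M` and the remaining regions according
to `N`. -/
def DeletesTo (D D' : LinkDiagram) (S : Set D.Crossing) (B : Set D.Edge) (r : D.Region)
    (M : D.Edge → D.Edge → Prop) (N : D.Region → D.Region → Prop) : Prop :=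
  ∃ (f : D'.Crossing → D.Crossing) (g : D.Edge → D'.Edge) (h : D.Region → D'.Region),
    Function.Injective f ∧ Set.range f = Sᶜ ∧
    g '' Bᶜ = Set.univ ∧
    (∀ e e', e ∉ B → e' ∉ B → (g e = g e' ↔ Relation.EqvGen M e e')) ∧
    h '' {r}ᶜ = Set.univ ∧
    (∀ s s', s ≠ r → s' ≠ r → (h s = h s' ↔ Relation.EqvGen N s s')) ∧
    (∀ x i, D'.edge x i = g (D.edge (f x) i)) ∧
    (∀ x i, D'.corner x i = h (D.corner (f x) i)) ∧
    ∀ e, e ∉ B → D'.sides (g e) = (D.sides e).map h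

/-- The move `Ω₁↓`: a crossing `x` with an (empty) one-sided region at its corner `i` is removed,
together with the edge around this region, and the two other edges at `x` are joined. -/
def Omega1Down (D D' : LinkDiagram) : Prop :=
  ∃ (x : D.Crossing) (i : ZMod 4),
    D.edge x i = D.edge x (i + 1) ∧
    D.OnlyCorners (D.corner x i) {(x, i)} ∧
    D.DeletesTo D' {x} {D.edge x i} (D.corner x i)
      (fun e e' => e = D.edge x (i + 2) ∧ e' = D.edge x (i + 3))
      (fun _ _ => False)

/-- The move `Ω₂↓`: two crossings `x ≠ y` are the corners of an (empty) two-sided region, one side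
of which lies above the other. Both crossings and both sides are removed, the strands are joined,
and the two regions opposite to the two-sided region at `x` and at `y` become one region. -/
def Omega2Down (D D' : LinkDiagram) : Prop :=
  ∃ (x y : D.Crossing) (i j : ZMod 4),
    x ≠ y ∧
    D.edge x i = D.edge y (j + 1) ∧ D.edge y j = D.edge x (i + 1) ∧
    (IsOver i ↔ IsOver (j + 1)) ∧
    D.OnlyCorners (D.corner x i) {(x, i), (y, j)} ∧
    D.DeletesTo D' {x, y} {D.edge x i, D.edge y j} (D.corner x i)
      (fun e e' => (e = D.edge x (i + 2) ∧ e' = D.edge y (j + 3)) ∨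
        (e = D.edge x (i + 3) ∧ e' = D.edge y (j + 2)))
      (fun s s' => s = D.corner x (i + 2) ∧ s' = D.corner y (j + 2))

/-- The corners `(x, i)`, `(y, j)`, `(z, k)` at three different crossings, in counterclockwise
order, bound an (empty) triangular region to which an `Ω₃`-type move applies: of the three sides,
one lies above the two others at both of its ends, and one lies below them. The excluded case is
that each side passes over the next one in cyclic order, i.e. that `i`, `j`, `k` have the same
parity. -/
def Omega3Config (D : LinkDiagram) (x y z : D.Crossing) (i j k : ZMod 4) : Prop :=
  x ≠ y ∧ y ≠ z ∧ z ≠ x ∧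
  D.edge x i = D.edge y (j + 1) ∧ D.edge y j = D.edge z (k + 1) ∧ D.edge z k = D.edge x (i + 1) ∧
  ¬ ((IsOver i ↔ IsOver j) ∧ (IsOver j ↔ IsOver k)) ∧
  D.OnlyCorners (D.corner x i) {(x, i), (y, j), (z, k)}

/-- The surroundings of the crossing `x` after the triangle with the corners `(x, i)`, `(y, j)`,
`(z, k)` has been turned over. On the strand from `x` to `y` the crossing `x` is now the last one,
so its end `i` continues as the end `j + 3` of `y` did; similarly for the strand from `z`
to `x`. The new triangular region lies at the opposite corner of `x`. -/
def FlippedAt (D D' : LinkDiagram) (f : D.Crossing → D'.Crossing) (g : D.Edge → D'.Edge)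
    (h : D.Region → D'.Region) (x y z : D.Crossing) (i j k : ZMod 4) : Prop :=
  D'.edge (f x) i = g (D.edge y (j + 3)) ∧
  D'.edge (f x) (i + 1) = g (D.edge z (k + 2)) ∧
  D'.edge (f x) (i + 2) = g (D.edge x i) ∧
  D'.edge (f x) (i + 3) = g (D.edge x (i + 1)) ∧
  D'.corner (f x) i = h (D.corner y (j + 3)) ∧
  D'.corner (f x) (i + 1) = h (D.corner z (k + 2)) ∧
  D'.corner (f x) (i + 2) = h (D.corner x i) ∧
  D'.corner (f x) (i + 3) = h (D.corner y (j + 2))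

/-- The `Ω₃`-type moves (all over/under variants). Everything outside the triangle stays. -/
def Omega3 (D D' : LinkDiagram) : Prop :=
  ∃ (x y z : D.Crossing) (i j k : ZMod 4),
    D.Omega3Config x y z i j k ∧
    ∃ (f : D.Crossing ≃ D'.Crossing) (g : D.Edge ≃ D'.Edge) (h : D.Region ≃ D'.Region),
      D.FlippedAt D' f g h x y z i j k ∧
      D.FlippedAt D' f g h y z x j k i ∧
      D.FlippedAt D' f g h z x y k i j ∧
      (∀ w, w ≠ x → w ≠ y → w ≠ z → ∀ m,
        D'.edge (f w) m = g (D.edge w m) ∧ D'.corner (f w) m = h (D.corner w m)) ∧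
      ∀ e, D.IsFreeLoop e → D'.sides (g e) = (D.sides e).map h

/-- One isotopy or one Reidemeister move that does not increase the number of crossings. The
moves `Ω₁↑` and `Ω₂↑` are the inverses of `Ω₁↓` and `Ω₂↓`. -/
def NonIncreasingStep (D D' : LinkDiagram) : Prop :=
  D.Isotopic D' ∨ D.Omega1Down D' ∨ D.Omega2Down D' ∨ D.Omega3 D'

/-- Two diagrams represent the same link if they are related by a finite sequence of isotopies
and Reidemeister moves, in both directions. -/
def linkSetoid : Setoid LinkDiagram := Relation.EqvGen.setoid NonIncreasingStep

/-- The underlying graph (union of curves) is nonempty and connected. -/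
def IsConnected (D : LinkDiagram) : Prop :=
  Nonempty D.Edge ∧ ∀ e e' : D.Edge,
    Relation.ReflTransGen (fun a b => ∃ x i j, D.edge x i = a ∧ D.edge x j = b) e e'

/-- A diagram is reduced if it has no nugatory crossing, i.e. no crossing at which two opposite
corners belong to the same region. -/
def IsReduced (D : LinkDiagram) : Prop := ∀ x i, D.corner x i ≠ D.corner x (i + 2)

/-- `r` is an `Ω₃`-triangle. -/
def IsOmega3Triangle (D : LinkDiagram) (r : D.Region) : Prop :=
  ∃ x y z i j k, D.Omega3Config x y z i j k ∧ D.corner x i = r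

/-- The number of `Ω₃`-triangles of a diagram. -/
noncomputable def numOmega3Triangles (D : LinkDiagram) : ℕ :=
  Nat.card {r : D.Region // D.IsOmega3Triangle r}

end LinkDiagram

/-- An (unoriented) link type in 3-space: a link diagram up to isotopy and Reidemeister moves. -/
def Link : Type 1 := Quotient LinkDiagram.linkSetoid

namespace Link

/-- `D` is a diagram of the link `L`. -/
def HasDiagram (L : Link) (D : LinkDiagram) : Prop := Quotient.mk LinkDiagram.linkSetoid D = L

/-- `L` has at least one component. -/
def IsNonempty (L : Link) : Prop := ∃ D, L.HasDiagram D ∧ Nonempty D.Edge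

/-- The crossing number `c(L)`. -/
noncomputable def crossingNumber (L : Link) : ℕ :=
  sInf {n | ∃ D, L.HasDiagram D ∧ D.numCrossings = n}

/-- `L` is trivial (an unlink): it has a diagram without crossings. -/
def IsTrivial (L : Link) : Prop := ∃ D, L.HasDiagram D ∧ IsEmpty D.Crossing

/-- `L` is split: it has a diagram that is not connected. -/
def IsSplit (L : Link) : Prop := ∃ D, L.HasDiagram D ∧ Nonempty D.Edge ∧ ¬ D.IsConnected

/-- `D` is a minimal diagram of `L`. -/
def IsMinimalDiagram (L : Link) (D : LinkDiagram) : Prop :=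
  L.HasDiagram D ∧ D.numCrossings = L.crossingNumber

/-- `D` is a hard diagram of `L`: a reduced diagram with more than `c(L)` crossings from which no
minimal diagram of `L` is reached by isotopies and moves `Ω₁↓`, `Ω₂↓`, `Ω₃`. -/
def IsHardDiagram (L : Link) (D : LinkDiagram) : Prop :=
  L.HasDiagram D ∧ D.IsReduced ∧ L.crossingNumber < D.numCrossings ∧
  ∀ D', L.IsMinimalDiagram D' → ¬ Relation.ReflTransGen LinkDiagram.NonIncreasingStep D D'

/-- A hard diagram to which no `Ω₃`-type move can be applied. -/
def IsRigidHardDiagram (L : Link) (D : LinkDiagram) : Prop :=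
  L.IsHardDiagram D ∧ ¬ ∃ D', D.Omega3 D'

/-- The minimal number of `Ω₃`-triangles in a minimal diagram of `L`, replaced by `1` if it
is `0`. -/
noncomputable def tri (L : Link) : ℕ :=
  max 1 (sInf {n | ∃ D, L.IsMinimalDiagram D ∧ D.numOmega3Triangles = n})

end Link

/-! The proof rests on one local modification. `gadget` is a diagram of an unknotted long arc with
seven crossings. Inside it no crossing is nugatory, every two-sided region has alternating sides,
and every triangle is of the excluded cyclic kind, so no move Ω₁↓, Ω₂↓ or Ω₃ applies there
(`gadget_inner`, `gadget_bigon`, `gadget_triangle`). Moreover the regions on the left and on the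
right of the arc each meet at least three of its corners (`gadget_left`, `gadget_right`). Inserting
the gadget into an edge of a diagram does not change the link (`eqvGen_insert_gadget`), keeps the
diagram reduced, creates no region at which Ω₂↓ or Ω₃ can be made, and gives the regions beside that
edge four corners or more, so that such moves are no longer possible at them
(`isMovable_insert_gadget`).

Call a region movable if Ω₂↓ or Ω₃ can be made at it. On a reduced diagram without movable regions
only isotopies are non-increasing steps, because Ω₁↓ needs a nugatory crossing; so its number of
crossings never changes (`IsStuck.numCrossings_eq`), and if this number exceeds `c(L)` the diagram
is hard and rigid. A reduced diagram with `m` movable regions becomes stuck after at most `max 1 m`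
gadgets of seven crossings each (`exists_isStuck`).

For the first statement any diagram will do as a start. If it has no crossing, it gets a kink; its
nugatory crossings are made harmless by moves Ω₂↑ (`exists_isReduced`).

For the bound the start is a minimal diagram with the fewest Ω₃-triangles. It has to be shown that
for a non-split, non-trivial link it is reduced and admits no Ω₂↓, so that its movable regions are
its Ω₃-triangles. A move Ω₂↓ leads either to a connected diagram with two crossings less or to a
disconnected one, and both are excluded (`IsMinimalDiagram.not_omega2Config`). At a nugatory
crossing a strand is swept over one half of the diagram: it is passed across the crossings of that
half one by one and then pulled tight by Ω₂↓ and a final Ω₁↓, with a net loss of one crossing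
(`IsSweep.exists_sweep`, `IsMinimalDiagram.isReduced`).

The topology of the sphere enters only through linear algebra over `ZMod 2`. For a connected
four-valent map Euler's inequality `|R| ≤ |X| + 2` holds, and in the case of equality every cycle
bounds a colouring of the regions (`IsMap.card_le_and_exact`). This is the Jordan curve theorem in
the form needed, and it also decides whether the result of a move is connected. -/

open Relation

/-! ### Mod 2 homology of four-valent ribbon graphs -/

/-- The dart that precedes `p` at its crossing. -/
def cw {X : Type} (p : X × ZMod 4) : X × ZMod 4 := (p.1, p.2 - 1)

@[simp] lemma cw_fst {X : Type} (p : X × ZMod 4) : (cw p).1 = p.1 := rfl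
@[simp] lemma cw_snd {X : Type} (p : X × ZMod 4) : (cw p).2 = p.2 - 1 := rfl

/-- `γ` is constant along the faces of the ribbon graph whose darts are matched by `ε`. -/
def IsFaceMap {X E R : Type} (ε : X × ZMod 4 → E) (γ : X × ZMod 4 → R) : Prop :=
  ∀ p q, p ≠ q → ε p = ε q → γ p = γ (cw q)

/-- A connected four-valent ribbon graph with a face map. -/
structure IsMap {X E R : Type} (ε : X × ZMod 4 → E) (γ : X × ZMod 4 → R) : Prop where
  ends : ∀ e, ∃ p q, p ≠ q ∧ ∀ s, ε s = e ↔ s = p ∨ s = q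
  face : IsFaceMap ε γ
  conn : ∀ x y, ReflTransGen (fun x y => ∃ i j, ε (x, i) = ε (y, j)) x y
  surj : Function.Surjective γ

namespace IsMap

variable {X E R : Type} {ε : X × ZMod 4 → E} {γ : X × ZMod 4 → R}

lemma card_edge [Finite X] [Finite E] (h : IsMap ε γ) : Nat.card E = 2 * Nat.card X := by
  classical
  cases nonempty_fintype X
  cases nonempty_fintype E
  have h1 : Fintype.card (X × ZMod 4) = ∑ e : E, (Finset.univ.filter fun p => ε p = e).card := by
    rw [← Finset.card_univ]
    exact Finset.card_eq_sum_card_fiberwise (fun _ _ => Finset.mem_univ _)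
  have h2 : ∀ e : E, (Finset.univ.filter fun p => ε p = e).card = 2 := by
    intro e
    obtain ⟨p, q, hpq, hs⟩ := h.ends e
    have : (Finset.univ.filter fun p => ε p = e) = {p, q} := by
      ext s; simp [hs]
    rw [this, Finset.card_pair hpq]
  simp only [h2, Finset.sum_const, Finset.card_univ, smul_eq_mul, Fintype.card_prod,
    ZMod.card] at h1
  rw [Nat.card_eq_fintype_card, Nat.card_eq_fintype_card]
  omega

/-- The coboundary of a colouring of the regions. -/
lemma exists_coboundary (h : IsMap ε γ) :
    ∃ δ : (R → ZMod 2) →ₗ[ZMod 2] (E → ZMod 2), ∀ c p, δ c (ε p) = c (γ p) + c (γ (cw p)) := by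
  choose a b hab hs using h.ends
  refine ⟨{ toFun := fun c e => c (γ (a e)) + c (γ (cw (a e)))
            map_add' := ?_, map_smul' := ?_ }, ?_⟩
  · intro c d; ext e; simp; ring
  · intro m c; ext e; simp; ring
  · intro c p
    simp only [LinearMap.coe_mk, AddHom.coe_mk]
    by_cases hp : p = a (ε p)
    · rw [← hp]
    · have ha : ε (a (ε p)) = ε p := (hs (ε p) (a (ε p))).2 (Or.inl rfl)
      -- Seen from the other end of the edge the two regions trade places, which does not affect
      -- their sum.
      rw [h.face p (a (ε p)) hp ha.symm, ← h.face (a (ε p)) p (Ne.symm hp) ha, add_comm]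

/-- The boundary map from edges to crossings. -/
def boundary (ε : X × ZMod 4 → E) : (E → ZMod 2) →ₗ[ZMod 2] (X → ZMod 2) where
  toFun z x := ∑ i, z (ε (x, i))
  map_add' := by intro z w; ext x; simp [Finset.sum_add_distrib]
  map_smul' := by intro m z; ext x; simp [Finset.mul_sum]

lemma boundary_apply (z : E → ZMod 2) (x : X) : boundary ε z x = ∑ i, z (ε (x, i)) := rfl

/-- A loop is allowed: then both ends lie at one crossing and the two terms cancel. -/
lemma boundary_single [DecidableEq E] [DecidableEq X] {e : E} {p q : X × ZMod 4} (hpq : p ≠ q)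
    (hs : ∀ s, ε s = e ↔ s = p ∨ s = q) :
    boundary ε (Pi.single e 1) = Pi.single p.1 1 + Pi.single q.1 1 := by
  ext x
  rw [boundary_apply]
  have : ∀ i, (Pi.single e 1 : E → ZMod 2) (ε (x, i)) =
      (if (x, i) = p then 1 else 0) + (if (x, i) = q then 1 else 0) := by
    intro i
    rw [Pi.single_apply]
    by_cases h1 : (x, i) = p
    · have h2 : (x, i) ≠ q := h1 ▸ hpq
      simp [hs, h1]; rw [← h1]; simp [h2]
    · simp [hs, h1]
  simp only [this, Finset.sum_add_distrib, Pi.add_apply, Pi.single_apply, Prod.ext_iff]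
  congr 1
  · by_cases hx : x = p.1 <;> simp [hx]
  · by_cases hx : x = q.1 <;> simp [hx]

/-- Turning around a crossing passes through all its corners, and two crossings on a common edge
share a face; so connectedness of the graph makes the regions connected across edges. This bounds
the kernel of the coboundary by one dimension, and it also supplies the field `connected` of
diagrams. -/
lemma color_const (h : IsMap ε γ) {α : Type} (c : R → α) (hc : ∀ p, c (γ p) = c (γ (cw p)))
    (r s : R) : c r = c s := by
  have h1 : ∀ x : X, ∀ i j, c (γ (x, i)) = c (γ (x, j)) := by
    intro x
    have key : ∀ i : ZMod 4, c (γ (x, i)) = c (γ (x, 0)) := by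
      have h1 := hc (x, 1)
      have h2 := hc (x, 2)
      have h3 := hc (x, 3)
      simp only [cw] at h1 h2 h3
      rw [show (1 : ZMod 4) - 1 = 0 by decide] at h1
      rw [show (2 : ZMod 4) - 1 = 1 by decide] at h2
      rw [show (3 : ZMod 4) - 1 = 2 by decide] at h3
      intro i
      fin_cases i
      · rfl
      · exact h1
      · exact h2.trans h1
      · exact h3.trans (h2.trans h1)
    intro i j; rw [key i, key j]
  obtain ⟨⟨x, i⟩, rfl⟩ := h.surj r
  obtain ⟨⟨y, j⟩, rfl⟩ := h.surj s
  have : ∀ y, c (γ (x, 0)) = c (γ (y, 0)) := by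
    intro y
    induction h.conn x y with
    | refl => rfl
    | @tail y z _ hyz ih =>
      rw [ih]
      obtain ⟨i, j, hij⟩ := hyz
      by_cases he : (y, i) = (z, j)
      · obtain rfl : y = z := congrArg Prod.fst he
        rfl
      · rw [h1 y 0 i, h.face _ _ he hij]
        exact h1 z _ _
  rw [h1 x i 0, this y]
  exact h1 _ _ _

/-- Modulo boundaries the classes of all crossings coincide, because an edge bounds the sum of its
two ends. So the image together with the single class of `x₀` spans everything. -/
lemma finrank_range_boundary [Fintype X] [Fintype E] (h : IsMap ε γ) :
    Fintype.card X ≤ Module.finrank (ZMod 2) (LinearMap.range (boundary ε)) + 1 := by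
  classical
  rcases isEmpty_or_nonempty X with hX | ⟨⟨x₀⟩⟩
  · simp
  let S : Submodule (ZMod 2) (X → ZMod 2) := Submodule.span (ZMod 2) {Pi.single x₀ 1}
  have hmem : ∀ x : X, (Pi.single x 1 : X → ZMod 2) ∈ LinearMap.range (boundary ε) ⊔ S := by
    intro x
    induction h.conn x₀ x with
    | refl => exact Submodule.mem_sup_right (Submodule.subset_span rfl)
    | @tail y z _ hyz ih =>
      obtain ⟨i, j, hij⟩ := hyz
      by_cases he : (y, i) = (z, j)
      · obtain rfl : y = z := congrArg Prod.fst he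
        exact ih
      · obtain ⟨p, q, hpq, hs⟩ := h.ends (ε (y, i))
        have hs' : ∀ s, ε s = ε (y, i) ↔ s = (y, i) ∨ s = (z, j) := by
          have h1 := (hs (y, i)).1 rfl
          have h2 := (hs (z, j)).1 hij.symm
          intro s
          rw [hs]
          rcases h1 with h1 | h1 <;> rcases h2 with h2 | h2
          · exact absurd (h1.trans h2.symm) he
          · rw [h1, h2]
          · rw [h1, h2, or_comm]
          · exact absurd (h1.trans h2.symm) he
        have hb := boundary_single he hs'
        have : (Pi.single z 1 : X → ZMod 2) =
            boundary ε (Pi.single (ε (y, i)) 1) - Pi.single y 1 := by rw [hb]; simp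
        rw [this]
        exact Submodule.sub_mem _ (Submodule.mem_sup_left ⟨_, rfl⟩) ih
  have htop : LinearMap.range (boundary ε) ⊔ S = ⊤ := by
    rw [eq_top_iff]
    intro w _
    have : w = ∑ x, w x • (Pi.single x 1 : X → ZMod 2) := by
      ext y; simp [Finset.sum_apply, Pi.single_apply]
    rw [this]
    exact Submodule.sum_mem _ fun x _ => Submodule.smul_mem _ _ (hmem x)
  have h1 := Submodule.finrank_add_le_finrank_add_finrank (LinearMap.range (boundary ε)) S
  rw [htop, finrank_top, Module.finrank_fintype_fun_eq_card] at h1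
  have h2 : Module.finrank (ZMod 2) S ≤ 1 := (finrank_span_le_card _).trans (by simp)
  omega

/-- Euler's inequality with its case of equality. The composite of coboundary `δ` and boundary `∂`
is zero, since every corner at a crossing is counted twice. Hence `|R| - 1 ≤ rank δ ≤ dim ker ∂ =
2|X| - rank ∂ ≤ |X| + 1`. If `|R| = |X| + 2`, the chain is tight and every cycle is a coboundary:
the first homology vanishes. -/
theorem card_le_and_exact [Finite X] [Finite E] [Finite R] [Nonempty X] (h : IsMap ε γ) :
    Nat.card R ≤ Nat.card X + 2 ∧ (Nat.card R = Nat.card X + 2 →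
      ∀ z : E → ZMod 2, (∀ x, ∑ i, z (ε (x, i)) = 0) →
        ∃ c : R → ZMod 2, ∀ p, z (ε p) = c (γ p) + c (γ (cw p))) := by
  classical
  have hE := h.card_edge
  cases nonempty_fintype X
  cases nonempty_fintype E
  cases nonempty_fintype R
  obtain ⟨δ, hδ⟩ := h.exists_coboundary
  simp only [Nat.card_eq_fintype_card] at hE ⊢
  have hker : Module.finrank (ZMod 2) (LinearMap.ker δ) ≤ 1 := by
    have hle : LinearMap.ker δ ≤ Submodule.span (ZMod 2) {(fun _ => 1 : R → ZMod 2)} := by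
      intro c hc
      rw [LinearMap.mem_ker] at hc
      have hcc : ∀ p, c (γ p) = c (γ (cw p)) := by
        intro p
        have := hδ c p
        rw [hc] at this
        simp only [Pi.zero_apply] at this
        exact (CharTwo.add_eq_zero.1 this.symm)
      obtain ⟨x⟩ := (inferInstance : Nonempty X)
      rw [Submodule.mem_span_singleton]
      exact ⟨c (γ (x, 0)), by ext r; simp [h.color_const c hcc r (γ (x, 0))]⟩
    exact (Submodule.finrank_mono hle).trans ((finrank_span_le_card _).trans (by simp))
  have hr1 := LinearMap.finrank_range_add_finrank_ker δ
  have hr2 := LinearMap.finrank_range_add_finrank_ker (boundary ε)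
  rw [Module.finrank_fintype_fun_eq_card] at hr1 hr2
  have hr3 := h.finrank_range_boundary
  have hle : LinearMap.range δ ≤ LinearMap.ker (boundary ε) := by
    rintro _ ⟨c, rfl⟩
    rw [LinearMap.mem_ker]
    ext x
    rw [boundary_apply]
    simp only [hδ, Finset.sum_add_distrib, cw, Pi.zero_apply]
    have : ∑ i : ZMod 4, c (γ (x, i - 1)) = ∑ i : ZMod 4, c (γ (x, i)) :=
      Equiv.sum_comp (Equiv.subRight (1 : ZMod 4)) (fun i => c (γ (x, i)))
    rw [this]
    exact CharTwo.add_self_eq_zero _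
  have hfin := Submodule.finrank_mono hle
  refine ⟨by omega, fun heq z hz => ?_⟩
  have : LinearMap.range δ = LinearMap.ker (boundary ε) :=
    Submodule.eq_of_le_of_finrank_le hle (by omega)
  have hz' : z ∈ LinearMap.range δ := by
    rw [this, LinearMap.mem_ker]; ext x; exact hz x
  obtain ⟨c, rfl⟩ := hz'
  exact ⟨c, hδ c⟩

end IsMap

/-! ### Planar ribbon graphs: faces, the Jordan curve theorem, the diagrams they define -/

open Relation

/-- Succession of corners along the faces. -/
def FaceRel {X E : Type} (ε : X × ZMod 4 → E) (p q : X × ZMod 4) : Prop :=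
  ∃ j, p ≠ (q.1, j) ∧ ε p = ε (q.1, j) ∧ q.2 = j - 1

lemma isFaceMap_mk {X E : Type} (ε : X × ZMod 4 → E) :
    IsFaceMap ε (Quot.mk (FaceRel ε)) :=
  fun _ q hpq he => Quot.sound ⟨q.2, hpq, he, rfl⟩

/-- A face map factors through the faces. -/
def IsFaceMap.lift {X E R : Type} {ε : X × ZMod 4 → E} {γ : X × ZMod 4 → R}
    (h : IsFaceMap ε γ) : Quot (FaceRel ε) → R :=
  Quot.lift γ (by
    rintro p ⟨y, k⟩ ⟨j, hp, he, rfl⟩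
    exact h p (y, j) hp he)

lemma IsFaceMap.lift_mk {X E R : Type} {ε : X × ZMod 4 → E} {γ : X × ZMod 4 → R}
    (h : IsFaceMap ε γ) (p) : h.lift (Quot.mk _ p) = γ p := rfl

namespace IsMap

variable {X E R : Type} {ε : X × ZMod 4 → E} {γ : X × ZMod 4 → R}

lemma faces (h : IsMap ε γ) : IsMap ε (Quot.mk (FaceRel ε)) :=
  ⟨h.ends, isFaceMap_mk ε, h.conn, Quot.mk_surjective⟩

/-- A squeeze: the faces form the finest face map and surject onto the regions, while
`card_le_and_exact` bounds both numbers from above by `|X| + 2`. -/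
lemma card_faces [Finite X] [Finite E] [Finite R] [Nonempty X] (h : IsMap ε γ)
    (hR : Nat.card X + 2 ≤ Nat.card R) :
    Nat.card (Quot (FaceRel ε)) = Nat.card X + 2 ∧ Nat.card R = Nat.card X + 2 := by
  have h1 := h.faces.card_le_and_exact.1
  have h2 := h.card_le_and_exact.1
  have hs : Function.Surjective h.face.lift := fun r => by
    obtain ⟨p, rfl⟩ := h.surj r
    exact ⟨Quot.mk _ p, rfl⟩
  have h3 := Nat.card_le_card_of_surjective _ hs
  omega

/-- In the planar case all corners of a region lie on one face. -/
lemma eq_of_region_eq [Finite X] [Finite E] [Finite R] [Nonempty X] (h : IsMap ε γ)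
    (hR : Nat.card X + 2 ≤ Nat.card R) {Y : Type} {α : X × ZMod 4 → Y} (hα : IsFaceMap ε α)
    {p q : X × ZMod 4} (hpq : γ p = γ q) : α p = α q := by
  obtain ⟨h1, h2⟩ := h.card_faces hR
  have hs : Function.Surjective h.face.lift := fun r => by
    obtain ⟨p, rfl⟩ := h.surj r
    exact ⟨Quot.mk _ p, rfl⟩
  have hb : Function.Bijective h.face.lift :=
    (Nat.bijective_iff_surjective_and_card _).2 ⟨hs, h1.trans h2.symm⟩
  have := hb.1 (a₁ := Quot.mk _ p) (a₂ := Quot.mk _ q) hpq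
  rw [← hα.lift_mk, ← hα.lift_mk, this]

/-- The mod 2 Jordan curve theorem. -/
lemma jordan [Finite X] [Finite E] [Finite R] [Nonempty X] (h : IsMap ε γ)
    (hR : Nat.card X + 2 ≤ Nat.card R) (z : E → ZMod 2) (hz : ∀ x, ∑ i, z (ε (x, i)) = 0) :
    ∃ c : R → ZMod 2, ∀ p, z (ε p) = c (γ p) + c (γ (cw p)) :=
  h.card_le_and_exact.2 (h.card_faces hR).2 z hz

/-- All edges together form a cycle, because four is even. The colouring that it bounds is a
checkerboard colouring, which changes across every edge. -/
lemma sides_ne [Finite X] [Finite E] [Finite R] [Nonempty X] (h : IsMap ε γ)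
    (hR : Nat.card X + 2 ≤ Nat.card R) (p : X × ZMod 4) : γ p ≠ γ (cw p) := by
  intro he
  obtain ⟨c, hc⟩ := h.jordan hR (fun _ => 1) (fun _ => by simp; decide)
  have := hc p
  rw [he, CharTwo.add_self_eq_zero] at this
  exact one_ne_zero this

end IsMap

lemma reach_symm {R E : Type} (sides : E → Sym2 R) {r s : R}
    (h : ReflTransGen (fun r s => ∃ e, sides e = s(r, s)) r s) :
    ReflTransGen (fun r s => ∃ e, sides e = s(r, s)) s r := by
  induction h with
  | refl => exact .refl
  | tail _ h ih =>
    obtain ⟨e, he⟩ := h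
    exact ih.head ⟨e, he.trans Sym2.eq_swap⟩

lemma reach_of_adj {R E : Type} (sides : E → Sym2 R) {r s : R} {e : E} (h : sides e = s(r, s)) :
    ReflTransGen (fun r s => ∃ e, sides e = s(r, s)) r s := .single ⟨e, h⟩

/-- The link diagram of a ribbon graph whose regions are connected to each other. -/
noncomputable abbrev diagramOfRegions {X E R : Type} [Finite X] [Finite E] [Finite R]
    (ε : X × ZMod 4 → E) (γ : X × ZMod 4 → R)
    (hends : ∀ e, ∃ p q, p ≠ q ∧ ∀ s, ε s = e ↔ s = p ∨ s = q) (hface : IsFaceMap ε γ)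
    (hcol : ∀ c : R → Set R, (∀ p, c (γ p) = c (γ (cw p))) → ∀ r s, c r = c s)
    (heul : 2 * Nat.card R = Nat.card X + Nat.card (Quot (FaceRel ε)) + 2) : LinkDiagram where
  Crossing := X
  Edge := E
  Region := R
  finite_crossing := inferInstance
  finite_edge := inferInstance
  finite_region := inferInstance
  edge x i := ε (x, i)
  corner x i := γ (x, i)
  sides e := s(γ (hends e).choose, γ (cw (hends e).choose))
  ends_edge e := by
    obtain ⟨p, q, hpq, hs⟩ := hends e
    right
    rw [← Set.ncard_pair hpq]
    congr 1
    ext s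
    exact hs s
  corner_eq x i y j hne he := hface (x, i) (y, j) hne he
  sides_edge x i := by
    obtain ⟨q, hpq, hs⟩ := (hends (ε (x, i))).choose_spec
    set a := (hends (ε (x, i))).choose
    by_cases hp : (x, i) = a
    · rw [← hp]; rfl
    · have ha : ε a = ε (x, i) := (hs a).2 (Or.inl rfl)
      rw [hface _ _ hp ha.symm, hface _ _ (Ne.symm hp) ha, Sym2.eq_swap]; rfl
  connected r s := by
    set sides : E → Sym2 R := fun e => s(γ (hends e).choose, γ (cw (hends e).choose))
    -- The colour of a region is its component. It does not change across edges, so by `hcol` there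
    -- is only one component.
    let c : R → Set R := fun r => {s | ReflTransGen (fun r s => ∃ e, sides e = s(r, s)) r s}
    have hc : ∀ p, c (γ p) = c (γ (cw p)) := by
      intro p
      have hadj : ReflTransGen (fun r s => ∃ e, sides e = s(r, s)) (γ p) (γ (cw p)) := by
        obtain ⟨q, hpq, hs⟩ := (hends (ε p)).choose_spec
        refine reach_of_adj _ (e := ε p) ?_
        simp only [sides]
        set a := (hends (ε p)).choose
        by_cases hp : p = a
        · rw [← hp]
        · have ha : ε a = ε p := (hs a).2 (Or.inl rfl)
          rw [hface _ _ hp ha.symm, hface _ _ (Ne.symm hp) ha, Sym2.eq_swap]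
      ext s
      exact ⟨fun hs => (reach_symm _ hadj).trans hs, fun hs => hadj.trans hs⟩
    have : s ∈ c r := by
      rw [hcol c hc r s]; exact ReflTransGen.refl
    exact this
  euler := by
    have h2 : IsEmpty {e : E // ∀ x i, ε (x, i) ≠ e} := by
      refine ⟨fun ⟨e, he⟩ => ?_⟩
      obtain ⟨p, q, hpq, hs⟩ := hends e
      exact he p.1 p.2 ((hs p).2 (Or.inl rfl))
    have h3 := heul
    unfold FaceRel at h3
    have h4 : Nat.card {e : E // ∀ x i, ε (x, i) ≠ e} = 0 := Nat.card_of_isEmpty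
    rw [h4]
    simp only [Prod.mk.eta] at *
    rw [h3]

/-- The link diagram of a planar connected ribbon graph. -/
noncomputable abbrev IsMap.diagram {X E R : Type} {ε : X × ZMod 4 → E} {γ : X × ZMod 4 → R}
    [Finite X] [Finite E] [Finite R] [Nonempty X] (h : IsMap ε γ)
    (hR : Nat.card X + 2 ≤ Nat.card R) : LinkDiagram :=
  diagramOfRegions ε γ h.ends h.face (fun c hc r s => h.color_const c hc r s) (by
    have h1 := h.card_faces hR
    omega)

/-! ### Mates of darts; connected diagrams as planar ribbon graphs -/

namespace LinkDiagram

attribute [instance] finite_crossing finite_edge finite_region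

/-- The edge at a dart. -/
def edgeAt (D : LinkDiagram) (p : D.Crossing × ZMod 4) : D.Edge := D.edge p.1 p.2

/-- The region at a corner. -/
def cornerAt (D : LinkDiagram) (p : D.Crossing × ZMod 4) : D.Region := D.corner p.1 p.2

lemma isFaceMap (D : LinkDiagram) : IsFaceMap D.edgeAt D.cornerAt :=
  fun p q hpq he => D.corner_eq p.1 p.2 q.1 q.2 hpq he

lemma ends_pair (D : LinkDiagram) (p : D.Crossing × ZMod 4) :
    ∃ q, p ≠ q ∧ ∀ s, D.edgeAt s = D.edgeAt p ↔ s = p ∨ s = q := by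
  rcases D.ends_edge (D.edgeAt p) with h | h
  · rw [Set.ncard_eq_zero (Set.toFinite _)] at h
    have : p ∈ (∅ : Set (D.Crossing × ZMod 4)) := by rw [← h]; rfl
    exact absurd this (Set.notMem_empty _)
  · obtain ⟨a, b, hab, hS⟩ := Set.ncard_eq_two.1 h
    have hmem : ∀ s, D.edgeAt s = D.edgeAt p ↔ s = a ∨ s = b := by
      intro s
      have : s ∈ {q : D.Crossing × ZMod 4 | D.edge q.1 q.2 = D.edgeAt p} ↔ s ∈ ({a, b} : Set _) := by
        rw [hS]
      simpa [edgeAt] using this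
    rcases (hmem p).1 rfl with rfl | rfl
    · exact ⟨b, hab, hmem⟩
    · exact ⟨a, hab.symm, fun s => by rw [hmem, or_comm]⟩

/-- The other end of the edge at a dart. -/
noncomputable def mate (D : LinkDiagram) (p : D.Crossing × ZMod 4) : D.Crossing × ZMod 4 :=
  (D.ends_pair p).choose

lemma mate_ne (D : LinkDiagram) (p) : D.mate p ≠ p := (D.ends_pair p).choose_spec.1.symm

lemma edgeAt_eq_iff (D : LinkDiagram) {p s} :
    D.edgeAt s = D.edgeAt p ↔ s = p ∨ s = D.mate p := (D.ends_pair p).choose_spec.2 s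

@[simp] lemma edgeAt_mate (D : LinkDiagram) (p) : D.edgeAt (D.mate p) = D.edgeAt p :=
  D.edgeAt_eq_iff.2 (Or.inr rfl)

lemma eq_mate (D : LinkDiagram) {p s} (h : D.edgeAt s = D.edgeAt p) (hne : s ≠ p) :
    s = D.mate p := (D.edgeAt_eq_iff.1 h).resolve_left hne

@[simp] lemma mate_mate (D : LinkDiagram) (p) : D.mate (D.mate p) = p :=
  (D.eq_mate (D.edgeAt_mate p).symm (D.mate_ne p).symm).symm

lemma mate_eq_comm (D : LinkDiagram) {p q} : D.mate p = q ↔ p = D.mate q :=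
  ⟨fun h => by rw [← h, mate_mate], fun h => by rw [h, mate_mate]⟩

lemma cornerAt_mate (D : LinkDiagram) (p) : D.cornerAt (D.mate p) = D.cornerAt (cw p) :=
  D.isFaceMap _ _ (D.mate_ne p) (D.edgeAt_mate p)

lemma cornerAt_cw_mate (D : LinkDiagram) (p) : D.cornerAt (cw (D.mate p)) = D.cornerAt p :=
  (D.isFaceMap _ _ (D.mate_ne p).symm (D.edgeAt_mate p).symm).symm

lemma not_isFreeLoop (D : LinkDiagram) (p) : ¬ D.IsFreeLoop (D.edgeAt p) :=
  fun h => h p.1 p.2 rfl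

/-- Every step in a path of edges takes place at a crossing, so a path that starts at an edge with
ends cannot reach a crossingless circle. -/
lemma IsConnected.exists_end {D : LinkDiagram} (h : D.IsConnected) [hX : Nonempty D.Crossing]
    (e : D.Edge) : ∃ p, D.edgeAt p = e := by
  obtain ⟨x⟩ := hX
  rcases (h.2 (D.edge x 0) e).cases_tail with he | ⟨f, _, y, i, j, _, hj⟩
  · exact ⟨(x, 0), he.symm⟩
  · exact ⟨(y, j), hj⟩

lemma IsConnected.not_isFreeLoop {D : LinkDiagram} (h : D.IsConnected) [Nonempty D.Crossing]
    (e : D.Edge) : ¬ D.IsFreeLoop e := by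
  obtain ⟨p, rfl⟩ := h.exists_end e
  exact D.not_isFreeLoop p

lemma IsConnected.isMap {D : LinkDiagram} (h : D.IsConnected) [hX : Nonempty D.Crossing] :
    IsMap D.edgeAt D.cornerAt where
  ends e := by
    obtain ⟨p, rfl⟩ := h.exists_end e
    exact ⟨p, D.mate p, (D.mate_ne p).symm, fun s => D.edgeAt_eq_iff⟩
  face := D.isFaceMap
  conn := by
    have key : ∀ e e' : D.Edge,
        ReflTransGen (fun a b => ∃ x i j, D.edge x i = a ∧ D.edge x j = b) e e' →
        ∀ x i, D.edge x i = e → ∃ y j, D.edge y j = e' ∧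
          ReflTransGen (fun x y => ∃ i j, D.edgeAt (x, i) = D.edgeAt (y, j)) x y := by
      intro e e' hr
      induction hr with
      | refl => intro x i hx; exact ⟨x, i, hx, .refl⟩
      | tail _ hbc ih =>
        intro x i hx
        obtain ⟨y, j, hy, hxy⟩ := ih x i hx
        obtain ⟨z, k, l, hz, hz'⟩ := hbc
        exact ⟨z, l, hz', hxy.tail ⟨j, k, hy.trans hz.symm⟩⟩
    intro x y
    obtain ⟨z, j, hz, hxz⟩ := key _ _ (h.2 (D.edge x 0) (D.edge y 0)) x 0 rfl
    exact hxz.tail ⟨j, 0, hz⟩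
  surj r := by
    have x := Classical.choice hX
    rcases (D.connected (D.corner x 0) r).cases_tail with hr | ⟨s, _, e, he⟩
    · exact ⟨(x, 0), hr.symm⟩
    · obtain ⟨p, rfl⟩ := h.exists_end e
      have := D.sides_edge p.1 p.2
      rw [edgeAt] at he
      rw [he, Sym2.eq_iff] at this
      rcases this with ⟨_, h2⟩ | ⟨_, h2⟩
      · exact ⟨cw p, h2.symm⟩
      · exact ⟨p, h2.symm⟩

/-- The equation `euler` gives `2|R| ≥ |X| + |F| + 2`, and `|F| ≥ |R|` as the faces surject onto the
regions. Together with Euler's inequality this makes the map of a connected diagram planar, with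
regions and faces the same. -/
lemma IsConnected.card_region_le {D : LinkDiagram} (h : D.IsConnected)
    [hX : Nonempty D.Crossing] : Nat.card D.Crossing + 2 ≤ Nat.card D.Region := by
  have he := D.euler
  have hs : Function.Surjective h.isMap.face.lift := fun r => by
    obtain ⟨p, rfl⟩ := h.isMap.surj r
    exact ⟨Quot.mk _ p, rfl⟩
  have h3 := Nat.card_le_card_of_surjective _ hs
  unfold FaceRel at h3
  simp only [edgeAt] at h3
  omega

lemma IsConnected.card_region {D : LinkDiagram} (h : D.IsConnected)
    [hX : Nonempty D.Crossing] : Nat.card D.Region = Nat.card D.Crossing + 2 :=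
  (h.isMap.card_faces h.card_region_le).2

lemma isConnected_diagram {X E R : Type} {ε : X × ZMod 4 → E} {γ : X × ZMod 4 → R}
    [Finite X] [Finite E] [Finite R] [hX : Nonempty X] (h : IsMap ε γ)
    (hR : Nat.card X + 2 ≤ Nat.card R) : (h.diagram hR).IsConnected := by
  have x := Classical.choice hX
  refine ⟨⟨ε (x, 0)⟩, fun e e' => ?_⟩
  obtain ⟨p, q, hpq, hs⟩ := h.ends e
  obtain ⟨p', q', hpq', hs'⟩ := h.ends e'
  have key : ∀ y, ReflTransGen (fun x y => ∃ i j, ε (x, i) = ε (y, j)) p.1 y →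
      ∀ j, ReflTransGen (fun a b => ∃ x i j, (h.diagram hR).edge x i = a ∧
        (h.diagram hR).edge x j = b) (ε p) (ε (y, j)) := by
    intro y hy
    induction hy with
    | refl => intro j; exact .single ⟨p.1, p.2, j, rfl, rfl⟩
    | @tail y z _ hyz ih =>
      intro j
      obtain ⟨a, b, hab⟩ := hyz
      exact (ih a).tail ⟨z, b, j, hab.symm, rfl⟩
  have := key p'.1 (h.conn _ _) p'.2
  rwa [(hs p).2 (Or.inl rfl), (hs' p').2 (Or.inl rfl)] at this

end LinkDiagram

/-! ### Extending a diagram by new crossings and edges -/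

open Relation

namespace LinkDiagram

lemma isFaceMap_iff (D : LinkDiagram) {Y : Type} {c : D.Crossing × ZMod 4 → Y} :
    IsFaceMap D.edgeAt c ↔ ∀ d, c d = c (cw (D.mate d)) := by
  refine ⟨fun h d => h d _ (D.mate_ne d).symm (D.edgeAt_mate d).symm, fun h p q hpq he => ?_⟩
  rw [h p, ← D.eq_mate he.symm hpq.symm]

/-- The faces of a diagram. -/
abbrev Face (D : LinkDiagram) : Type := Quot (FaceRel D.edgeAt)

lemma euler' (D : LinkDiagram) : 2 * Nat.card D.Region = Nat.card D.Crossing +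
    Nat.card D.Face + 2 * Nat.card {e : D.Edge // D.IsFreeLoop e} + 2 := D.euler

lemma sides_edgeAt (D : LinkDiagram) (p) :
    D.sides (D.edgeAt p) = s(D.cornerAt p, D.cornerAt (cw p)) := D.sides_edge p.1 p.2

/-- A matching of darts on a set of crossings, such that every edge of `D` survives with its ends
moved by `σ`, and such that the edges in `K` are new and have the ends `A k` and `B k`. -/
structure Extension (D : LinkDiagram) {X K : Type} (ε : X × ZMod 4 → D.Edge ⊕ K)
    (σ : D.Crossing × ZMod 4 → X × ZMod 4) (A B : K → X × ZMod 4) : Prop where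
  edge_map : ∀ a, ε (σ a) = .inl (D.edgeAt a)
  edge_left : ∀ k, ε (A k) = .inr k
  edge_right : ∀ k, ε (B k) = .inr k
  ne : ∀ k, A k ≠ B k
  inj : Function.Injective σ
  cover : ∀ p, (∃ a, p = σ a) ∨ ∃ k, p = A k ∨ p = B k

namespace Extension

variable {D : LinkDiagram} {X K R : Type} {ε : X × ZMod 4 → D.Edge ⊕ K}
  {σ : D.Crossing × ZMod 4 → X × ZMod 4} {A B : K → X × ZMod 4}

lemma eq_inl_iff (h : D.Extension ε σ A B) {p e} :
    ε p = .inl e ↔ ∃ a, D.edgeAt a = e ∧ p = σ a := by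
  constructor
  · intro hp
    rcases h.cover p with ⟨a, rfl⟩ | ⟨k, rfl | rfl⟩
    · rw [h.edge_map] at hp
      exact ⟨a, Sum.inl.inj hp, rfl⟩
    · rw [h.edge_left] at hp; cases hp
    · rw [h.edge_right] at hp; cases hp
  · rintro ⟨a, rfl, rfl⟩
    exact h.edge_map a

lemma eq_inr_iff (h : D.Extension ε σ A B) {p k} : ε p = .inr k ↔ p = A k ∨ p = B k := by
  constructor
  · intro hp
    rcases h.cover p with ⟨a, rfl⟩ | ⟨k, rfl | rfl⟩
    · rw [h.edge_map] at hp; cases hp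
    · rw [h.edge_left] at hp; cases hp; exact Or.inl rfl
    · rw [h.edge_right] at hp; cases hp; exact Or.inr rfl
  · rintro (rfl | rfl)
    · exact h.edge_left k
    · exact h.edge_right k

/-- Reduces the face rule to the list of matched ends: one condition for each end of an old edge and
two for each new edge. The verifications for `push` and for tangle insertion go through it. -/
lemma isFaceMap_iff (h : D.Extension ε σ A B) {γ : X × ZMod 4 → R} :
    IsFaceMap ε γ ↔ (∀ a, γ (σ a) = γ (cw (σ (D.mate a)))) ∧
      (∀ k, γ (A k) = γ (cw (B k))) ∧ ∀ k, γ (B k) = γ (cw (A k)) := by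
  constructor
  · intro hγ
    refine ⟨fun a => hγ _ _ (fun he => D.mate_ne a (h.inj he).symm) ?_, fun k => hγ _ _ (h.ne k) ?_,
      fun k => hγ _ _ (h.ne k).symm ?_⟩
    · rw [h.edge_map, h.edge_map, edgeAt_mate]
    · rw [h.edge_left, h.edge_right]
    · rw [h.edge_left, h.edge_right]
  · rintro ⟨h1, h2, h3⟩ p q hpq he
    cases hq : ε q with
    | inl e =>
      obtain ⟨b, rfl, rfl⟩ := h.eq_inl_iff.1 hq
      obtain ⟨a, hab, rfl⟩ := h.eq_inl_iff.1 (he.trans hq)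
      have hne : b ≠ a := fun hba => hpq (by rw [hba])
      rw [h1, ← D.eq_mate hab.symm hne]
    | inr k =>
      rcases h.eq_inr_iff.1 hq with rfl | rfl <;> rcases h.eq_inr_iff.1 (he.trans hq) with rfl | rfl
      · exact absurd rfl hpq
      · exact h3 k
      · exact h2 k
      · exact absurd rfl hpq

open Classical in
/-- The sides of the edges of an extension. -/
noncomputable def sides (_ : D.Extension ε σ A B) (γ : X × ZMod 4 → R) (ι : D.Region → R) :
    D.Edge ⊕ K → Sym2 R
  -- The `else` branch concerns the crossingless circles, which keep their two regions.
  | .inl e => if h : ∃ a, D.edgeAt a = e then s(γ (σ h.choose), γ (cw (σ h.choose)))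
      else (D.sides e).map ι
  | .inr k => s(γ (A k), γ (cw (A k)))

lemma sides_eq (h : D.Extension ε σ A B) {γ : X × ZMod 4 → R} (hγ : IsFaceMap ε γ)
    (ι : D.Region → R) (p) : h.sides γ ι (ε p) = s(γ p, γ (cw p)) := by
  have key : ∀ a p, ε a = ε p → s(γ a, γ (cw a)) = s(γ p, γ (cw p)) := by
    intro a p he
    by_cases hp : a = p
    · rw [hp]
    · rw [hγ _ _ hp he, hγ _ _ (Ne.symm hp) he.symm, Sym2.eq_swap]
  cases hp : ε p with
  | inl e =>
    have hex : ∃ a, D.edgeAt a = e := by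
      obtain ⟨a, ha, _⟩ := h.eq_inl_iff.1 hp
      exact ⟨a, ha⟩
    rw [sides, dif_pos hex]
    exact key _ _ (by rw [h.edge_map, hex.choose_spec, hp])
  | inr k => exact key _ _ (by rw [h.edge_left, hp])

lemma sides_loop (h : D.Extension ε σ A B) (γ : X × ZMod 4 → R) (ι : D.Region → R) {e}
    (he : D.IsFreeLoop e) : h.sides γ ι (.inl e) = (D.sides e).map ι := by
  rw [sides, dif_neg]
  rintro ⟨a, rfl⟩
  exact D.not_isFreeLoop a he

/-- The diagram of an extension. -/
noncomputable abbrev diagram [Finite X] [Finite K] [Finite R] (h : D.Extension ε σ A B)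
    {γ : X × ZMod 4 → R} (hγ : IsFaceMap ε γ) (ι : D.Region → R)
    (hcol : ∀ c : R → Set R, (∀ p, c (γ p) = c (γ (cw p))) →
      (∀ a, c (ι (D.cornerAt a)) = c (ι (D.cornerAt (cw a)))) ∧ ∀ r, ∃ s, c r = c (ι s))
    -- The difference of the two `euler` equations; the crossingless circles are the same before and
    -- after and drop out.
    (heul : 2 * Nat.card R + Nat.card D.Crossing + Nat.card D.Face =
      2 * Nat.card D.Region + Nat.card X + Nat.card (Quot (FaceRel ε))) : LinkDiagram where
  Crossing := X
  Edge := D.Edge ⊕ K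
  Region := R
  finite_crossing := inferInstance
  finite_edge := inferInstance
  finite_region := inferInstance
  edge x i := ε (x, i)
  corner x i := γ (x, i)
  sides := h.sides γ ι
  ends_edge e := by
    cases e with
    | inl e =>
      have : {p : X × ZMod 4 | ε (p.1, p.2) = .inl e} =
          σ '' {a : D.Crossing × ZMod 4 | D.edge a.1 a.2 = e} := by
        ext p
        simp only [Prod.mk.eta, Set.mem_ofPred_eq, Set.mem_image]
        rw [h.eq_inl_iff]
        exact exists_congr fun a => and_congr Iff.rfl eq_comm
      rw [this, Set.ncard_image_of_injective _ h.inj]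
      exact D.ends_edge e
    | inr k =>
      right
      rw [← Set.ncard_pair (h.ne k)]
      congr 1
      ext p
      exact h.eq_inr_iff
  corner_eq x i y j hne he := hγ (x, i) (y, j) hne he
  sides_edge x i := h.sides_eq hγ ι (x, i)
  connected r s := by
    -- Components serve as colours. By `hcol` every region has the colour of an old one, and two old
    -- regions are joined by a path in `D`, each step of which crosses a circle or an edge with
    -- ends.
    let c : R → Set R := fun r =>
      {s | ReflTransGen (fun r s => ∃ e, h.sides γ ι e = s(r, s)) r s}
    have hadj : ∀ e r s, h.sides γ ι e = s(r, s) → c r = c s := by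
      intro e r s he
      have := reach_of_adj _ he
      ext t
      exact ⟨fun hs => (reach_symm _ this).trans hs, fun hs => this.trans hs⟩
    obtain ⟨h1, h2⟩ := hcol c fun p => hadj _ _ _ (h.sides_eq hγ ι p)
    have h3 : ∀ r s, c (ι r) = c (ι s) := by
      intro r s
      induction D.connected r s with
      | refl => rfl
      | tail _ hst ih =>
        rw [ih]
        obtain ⟨e, he⟩ := hst
        by_cases hl : D.IsFreeLoop e
        · refine hadj (.inl e) _ _ ?_
          rw [h.sides_loop γ ι hl, he, Sym2.map_mk]
        · simp only [IsFreeLoop, not_forall, not_not] at hl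
          obtain ⟨x, i, rfl⟩ := hl
          have := D.sides_edgeAt (x, i)
          rw [edgeAt, he, Sym2.eq_iff] at this
          rcases this with ⟨h4, h5⟩ | ⟨h4, h5⟩
          · rw [h4, h5, h1]
          · rw [h4, h5]
            exact (h1 _).symm
    obtain ⟨r', hr⟩ := h2 r
    obtain ⟨s', hs⟩ := h2 s
    have : s ∈ c r := by
      rw [hr, h3 r' s', ← hs]; exact ReflTransGen.refl
    exact this
  euler := by
    have h1 := D.euler'
    have h2 : Nat.card {e : D.Edge ⊕ K // ∀ x i, ε (x, i) ≠ e} =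
        Nat.card {e : D.Edge // D.IsFreeLoop e} := by
      symm
      refine Nat.card_congr (Equiv.ofBijective
        (fun e => ⟨.inl e.1, fun x i he => ?_⟩) ⟨fun e f hef => ?_, ?_⟩)
      · obtain ⟨a, ha, _⟩ := h.eq_inl_iff.1 he
        exact e.2 a.1 a.2 ha
      · simpa [Subtype.ext_iff] using hef
      · rintro ⟨e | k, he⟩
        · refine ⟨⟨e, fun x i hx => ?_⟩, rfl⟩
          exact he (σ (x, i)).1 (σ (x, i)).2 (by rw [Prod.mk.eta, h.edge_map, edgeAt, hx])
        · exact absurd (h.edge_left k) (he _ _)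
    unfold FaceRel at *
    simp only [Prod.mk.eta] at *
    rw [h2]
    omega

end Extension

end LinkDiagram

/-! ### The move Ω₂↑: pushing a strand across an edge -/

open Relation

namespace LinkDiagram

/-- The data for pushing the strand at the dart `p` across the edge at the dart `q`, from the
corner `p` to the corner `cw q` of the same region. Between the two darts the face has no corners
besides these. -/
structure Adjacent (D : LinkDiagram) (p q : D.Crossing × ZMod 4) : Prop where
  ne : p ≠ q
  adj : cw q = p ∨ (cw q ≠ p ∧ D.mate (cw q) = (p.1, p.2 + 1))

variable {D : LinkDiagram} {p q : D.Crossing × ZMod 4}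

lemma Adjacent.face (h : D.Adjacent p q) {Y : Type} {c : D.Crossing × ZMod 4 → Y}
    (hc : IsFaceMap D.edgeAt c) : c (cw q) = c p := by
  rcases h.adj with h | ⟨_, h⟩
  · rw [h]
  · rw [D.isFaceMap_iff.1 hc, h]
    simp [cw]

variable (p q)

open Classical in
/-- The edges after the strand at `p` has been pushed across the edge at `q`. -/
noncomputable def pushEdge (o : ZMod 4) : (D.Crossing ⊕ Bool) × ZMod 4 → D.Edge ⊕ Fin 4
  | (.inl w, i) => if (w, i) = p then .inr 0 else if (w, i) = q then .inr 2 else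
      .inl (D.edge w i)
  -- `inr false` is the new crossing next to the darts `p` and `q`, and `inr true` the one behind
  -- it. At both of them the strand of `p` takes the ends `o + 1` and `o + 3`, the strand of `q` the
  -- ends `o` and `o + 2`; so the parity of `o` decides which strand lies above. The new edges `1`
  -- and `3` are the sides of the bigon.
  | (.inr false, i) => (![.inr 2, .inr 0, .inr 3, .inr 1] : Fin 4 → D.Edge ⊕ Fin 4) (i - o)
  | (.inr true, i) => (![.inl (D.edgeAt q), .inr 1, .inr 3, .inl (D.edgeAt p)] :
      Fin 4 → D.Edge ⊕ Fin 4) (i - o)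

open Classical in
/-- The corners after the strand at `p` has been pushed across the edge at `q`. -/
noncomputable def pushCorner {Y : Type} (c : D.Crossing × ZMod 4 → Y) (o : ZMod 4) :
    (D.Crossing ⊕ Bool) × ZMod 4 → Y ⊕ Bool
  -- `inr false` is the part of the region that is cut off between the two darts, `inr true` is the
  -- bigon, and the rest of the region keeps its name.
  | (.inl w, i) => if (w, i) = p ∨ (w, i) = cw q then .inr false else .inl (c (w, i))
  | (.inr false, i) => (![.inr false, .inl (c (cw p)), .inr true, .inl (c q)] :
      Fin 4 → Y ⊕ Bool) (i - o)
  | (.inr true, i) => (![.inl (c q), .inr true, .inl (c (cw p)), .inl (c p)] :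
      Fin 4 → Y ⊕ Bool) (i - o)

open Classical in
/-- The new position of the ends of the old edges. -/
noncomputable def pushDart (o : ZMod 4) (d : D.Crossing × ZMod 4) :
    (D.Crossing ⊕ Bool) × ZMod 4 :=
  if d = p then (.inr true, o + 3) else if d = q then (.inr true, o) else (.inl d.1, d.2)

/-- One end of each new edge. -/
def pushLeft (o : ZMod 4) : Fin 4 → (D.Crossing ⊕ Bool) × ZMod 4 :=
  ![(.inl p.1, p.2), (.inr false, o + 3), (.inl q.1, q.2), (.inr false, o + 2)]

/-- The other end of each new edge. -/
def pushRight (X : Type) (o : ZMod 4) : Fin 4 → (X ⊕ Bool) × ZMod 4 :=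
  ![(.inr false, o + 1), (.inr true, o + 1), (.inr false, o), (.inr true, o + 2)]

variable {p q}

lemma sub_offset_cases (i o : ZMod 4) : i = o ∨ i = o + 1 ∨ i = o + 2 ∨ i = o + 3 := by
  revert i o; decide

@[simp] lemma pushEdge_y0 (o) : pushEdge p q o (.inr false, o) = .inr 2 := by simp [pushEdge]
@[simp] lemma pushEdge_y1 (o) : pushEdge p q o (.inr false, o + 1) = .inr 0 := by
  simp [pushEdge]
@[simp] lemma pushEdge_y2 (o) : pushEdge p q o (.inr false, o + 2) = .inr 3 := by
  simp [pushEdge]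
@[simp] lemma pushEdge_y3 (o) : pushEdge p q o (.inr false, o + 3) = .inr 1 := by
  simp [pushEdge]
@[simp] lemma pushEdge_z0 (o) : pushEdge p q o (.inr true, o) = .inl (D.edgeAt q) := by
  simp [pushEdge]
@[simp] lemma pushEdge_z1 (o) : pushEdge p q o (.inr true, o + 1) = .inr 1 := by
  simp [pushEdge]
@[simp] lemma pushEdge_z2 (o) : pushEdge p q o (.inr true, o + 2) = .inr 3 := by
  simp [pushEdge]
@[simp] lemma pushEdge_z3 (o) : pushEdge p q o (.inr true, o + 3) = .inl (D.edgeAt p) := by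
  simp [pushEdge]
@[simp] lemma pushEdge_p (o) : pushEdge p q o (.inl p.1, p.2) = .inr 0 := by simp [pushEdge]
lemma pushEdge_q (h : p ≠ q) (o) : pushEdge p q o (.inl q.1, q.2) = .inr 2 := by
  simp [pushEdge, h.symm]
lemma pushEdge_old {d} (h1 : d ≠ p) (h2 : d ≠ q) (o) :
    pushEdge p q o (.inl d.1, d.2) = .inl (D.edgeAt d) := by
  simp [pushEdge, h1, h2, edgeAt]

section
variable {Y : Type} {c : D.Crossing × ZMod 4 → Y}
@[simp] lemma pushCorner_y0 (o) : pushCorner p q c o (.inr false, o) = .inr false := by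
  simp [pushCorner]
@[simp] lemma pushCorner_y1 (o) : pushCorner p q c o (.inr false, o + 1) = .inl (c (cw p)) := by
  simp [pushCorner]
@[simp] lemma pushCorner_y2 (o) : pushCorner p q c o (.inr false, o + 2) = .inr true := by
  simp [pushCorner]
@[simp] lemma pushCorner_y3 (o) : pushCorner p q c o (.inr false, o + 3) = .inl (c q) := by
  simp [pushCorner]
@[simp] lemma pushCorner_z0 (o) : pushCorner p q c o (.inr true, o) = .inl (c q) := by
  simp [pushCorner]
@[simp] lemma pushCorner_z1 (o) : pushCorner p q c o (.inr true, o + 1) = .inr true := by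
  simp [pushCorner]
@[simp] lemma pushCorner_z2 (o) : pushCorner p q c o (.inr true, o + 2) = .inl (c (cw p)) := by
  simp [pushCorner]
@[simp] lemma pushCorner_z3 (o) : pushCorner p q c o (.inr true, o + 3) = .inl (c p) := by
  simp [pushCorner]
lemma pushCorner_near {d} (h : d = p ∨ d = cw q) (o) :
    pushCorner p q c o (.inl d.1, d.2) = .inr false := by
  rw [pushCorner, if_pos h]
lemma pushCorner_old {d} (h1 : d ≠ p) (h2 : d ≠ cw q) (o) :
    pushCorner p q c o (.inl d.1, d.2) = .inl (c d) := by
  rw [pushCorner, if_neg (not_or.2 ⟨h1, h2⟩)]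
end

lemma pushDart_p (o) : pushDart p q o p = (.inr true, o + 3) := by simp [pushDart]
lemma pushDart_q (h : p ≠ q) (o) : pushDart p q o q = (.inr true, o) := by
  simp [pushDart, h.symm]
lemma pushDart_old {d} (h1 : d ≠ p) (h2 : d ≠ q) (o) :
    pushDart p q o d = (.inl d.1, d.2) := by simp [pushDart, h1, h2]

lemma cw_inj {X : Type} {p q : X × ZMod 4} : cw p = cw q ↔ p = q := by
  constructor
  · intro h
    have h1 := congrArg Prod.fst h
    have h2 := congrArg Prod.snd h
    exact Prod.ext h1 (sub_left_injective h2)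
  · rintro rfl; rfl

lemma cw_ne {X : Type} (p : X × ZMod 4) : cw p ≠ p := by
  intro h
  have h2 := congrArg Prod.snd h
  have : ∀ i : ZMod 4, i - 1 ≠ i := by decide
  exact this _ h2

lemma add_three_sub_one {o : ZMod 4} : o + 3 - 1 = o + 2 := by revert o; decide
lemma add_two_sub_one {o : ZMod 4} : o + 2 - 1 = o + 1 := by revert o; decide
lemma sub_one_eq_add_three {o : ZMod 4} : o - 1 = o + 3 := by revert o; decide

lemma pushExtension (h : p ≠ q) (o : ZMod 4) :
    D.Extension (pushEdge p q o) (pushDart p q o) (pushLeft p q o)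
      (pushRight D.Crossing o) where
  edge_map d := by
    by_cases h1 : d = p
    · subst h1; rw [pushDart_p, pushEdge_z3]
    · by_cases h2 : d = q
      · subst h2; rw [pushDart_q h, pushEdge_z0]
      · rw [pushDart_old h1 h2, pushEdge_old h1 h2]
  edge_left k := by
    fin_cases k
    · exact pushEdge_p o
    · exact pushEdge_y3 o
    · exact pushEdge_q h o
    · exact pushEdge_y2 o
  edge_right k := by
    fin_cases k
    · exact pushEdge_y1 o
    · exact pushEdge_z1 o
    · exact pushEdge_y0 o
    · exact pushEdge_z2 o
  ne k := by fin_cases k <;> simp [pushLeft, pushRight]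
  inj d e hde := by
    have h3 : ∀ o : ZMod 4, o + 3 ≠ o := by decide
    have h4 : ∀ o : ZMod 4, o ≠ o + 3 := by decide
    replace h3 := h3 o
    replace h4 := h4 o
    unfold pushDart at hde
    split_ifs at hde with a b c d' e' f <;> simp_all [Prod.ext_iff]
  cover d := by
    obtain ⟨w | b, i⟩ := d
    · by_cases h1 : (w, i) = p
      · exact .inr ⟨0, .inl (by subst h1; rfl)⟩
      · by_cases h2 : (w, i) = q
        · exact .inr ⟨2, .inl (by subst h2; rfl)⟩
        · exact .inl ⟨(w, i), by rw [pushDart_old h1 h2]⟩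
    · cases b
      · rcases sub_offset_cases i o with rfl | rfl | rfl | rfl
        · exact .inr ⟨2, .inr rfl⟩
        · exact .inr ⟨0, .inr rfl⟩
        · exact .inr ⟨3, .inl rfl⟩
        · exact .inr ⟨1, .inl rfl⟩
      · rcases sub_offset_cases i o with rfl | rfl | rfl | rfl
        · exact .inl ⟨q, by rw [pushDart_q h]⟩
        · exact .inr ⟨1, .inr rfl⟩
        · exact .inr ⟨3, .inr rfl⟩
        · exact .inl ⟨p, by rw [pushDart_p]⟩

lemma ccw_eq_iff {X : Type} {m p : X × ZMod 4} : cw m = p ↔ m = (p.1, p.2 + 1) := by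
  constructor
  · rintro rfl; simp [cw]
  · rintro rfl; simp [cw]

/-- The pushed strand cuts the old face in two. By `Adjacent` the only old corners on the part cut
off are `p` and `cw q`, which may coincide; with the corner `o` of the first new crossing they make
up a face of their own. -/
lemma pushCorner_isFaceMap (h : D.Adjacent p q) (o : ZMod 4) {Y : Type}
    {c : D.Crossing × ZMod 4 → Y} (hc : IsFaceMap D.edgeAt c) :
    IsFaceMap (pushEdge p q o) (pushCorner p q c o) := by
  rw [(pushExtension h.ne o).isFaceMap_iff]
  have hqp : q ≠ p := h.ne.symm
  have hqcq : q ≠ cw q := (cw_ne q).symm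
  have hcpp : cw p ≠ p := cw_ne p
  have hcpq : cw p ≠ cw q := fun hh => h.ne (cw_inj.1 hh)
  refine ⟨fun d => ?_, fun k => ?_, fun k => ?_⟩
  · -- the old edges
    have hd := D.isFaceMap_iff.1 hc d
    have hR : ∀ m, m ≠ (p.1, p.2 + 1) ∨ m = q → pushCorner p q c o (cw (pushDart p q o m)) =
        .inl (c (cw m)) := by
      intro m hm
      by_cases h1 : m = p
      · subst h1
        rw [pushDart_p]
        simp [cw, add_three_sub_one]
      · by_cases h2 : m = q
        · subst h2
          rw [pushDart_q h.ne]
          simp only [cw, sub_one_eq_add_three, pushCorner_z3]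
          rw [← h.face hc]; simp [cw, sub_one_eq_add_three]
        · have hm := hm.resolve_right h2
          rw [pushDart_old h1 h2]
          exact pushCorner_old (d := cw m) (fun hh => hm (ccw_eq_iff.1 hh))
            (fun hh => h2 (cw_inj.1 hh)) o
    have hL : ∀ d, d ≠ cw q ∨ d = p → pushCorner p q c o (pushDart p q o d) = .inl (c d) := by
      intro d hd
      by_cases h1 : d = p
      · subst h1
        rw [pushDart_p, pushCorner_z3]
      · by_cases h2 : d = q
        · subst h2
          rw [pushDart_q h.ne, pushCorner_z0]
        · rw [pushDart_old h1 h2]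
          exact pushCorner_old h1 (hd.resolve_right h1) o
    -- The exceptional case is the old edge between the two darts, which has the face cut off on one
    -- side. It is present only in the second alternative of `Adjacent`.
    by_cases ha : d ≠ cw q ∨ d = p
    · by_cases hm : D.mate d ≠ (p.1, p.2 + 1) ∨ D.mate d = q
      · rw [hL d ha, hR _ hm, hd]
      · push Not at hm
        exfalso
        rcases h.adj with h1 | ⟨h1, h2⟩
        · exact hm.2 (by rw [hm.1]; exact (ccw_eq_iff.1 h1).symm)
        · have h3 : d = cw q := by
            rw [← D.mate_mate d, hm.1, ← h2, D.mate_mate]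
          rcases ha with ha | ha
          · exact ha h3
          · exact h1 (h3.symm.trans ha)
    · push Not at ha
      rcases h.adj with h1 | ⟨h1, h2⟩
      · exact absurd (ha.1.trans h1) ha.2
      · have hdq : d ≠ q := fun hh => hqcq (hh.symm.trans ha.1)
        rw [ha.1, h2, pushDart_old (ha.1 ▸ ha.2) (ha.1 ▸ hdq), pushCorner_near (.inr rfl)]
        have h4 : ((p.1, p.2 + 1) : D.Crossing × ZMod 4) ≠ p := by
          intro hh
          have : ∀ i : ZMod 4, i + 1 ≠ i := by decide
          exact this _ (congrArg Prod.snd hh)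
        have h5 : ((p.1, p.2 + 1) : D.Crossing × ZMod 4) ≠ q := by
          intro hh
          exact h1 (ccw_eq_iff.2 hh.symm)
        rw [pushDart_old h4 h5]
        have : cw ((Sum.inl p.1 : D.Crossing ⊕ Bool), p.2 + 1) = (.inl p.1, p.2) := by simp [cw]
        rw [this, pushCorner_near (.inl rfl)]
  · fin_cases k
    · simp only [pushLeft, pushRight, cw, Fin.zero_eta, Matrix.cons_val_zero]
      rw [pushCorner_near (.inl rfl)]
      simp
    · simp [pushLeft, pushRight, cw]
    · simp only [pushLeft, pushRight, cw, Fin.reduceFinMk, Matrix.cons_val]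
      rw [pushCorner_old hqp hqcq, sub_one_eq_add_three, pushCorner_y3]
    · simp [pushLeft, pushRight, cw, add_two_sub_one]
  · fin_cases k
    · simp only [pushLeft, pushRight, Fin.zero_eta, Matrix.cons_val_zero]
      rw [pushCorner_y1]
      exact (pushCorner_old hcpp hcpq o).symm
    · simp [pushLeft, pushRight, cw, add_three_sub_one]
    · simp only [pushLeft, pushRight, Fin.reduceFinMk, Matrix.cons_val]
      rw [pushCorner_y0]
      exact (pushCorner_near (.inr rfl) o).symm
    · simp [pushLeft, pushRight, cw, add_two_sub_one]

/-- Faces are counted as orbits, without recourse to planarity, because `D` may be disconnected. The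
lower bound comes from `pushCorner` with values in the old faces. For the upper bound the old faces,
the face cut off and the bigon are shown to exhaust all faces. -/
lemma card_face_push (h : D.Adjacent p q) (o : ZMod 4) :
    Nat.card (Quot (FaceRel (pushEdge p q o))) = Nat.card D.Face + 2 := by
  classical
  have hcard : Nat.card (D.Face ⊕ Bool) = Nat.card D.Face + 2 := by
    rw [Nat.card_sum, Nat.card_eq_fintype_card (α := Bool), Fintype.card_bool]
  rw [← hcard]
  refine le_antisymm ?_ ?_
  · have hE := pushExtension h.ne o
    set mk := Quot.mk (FaceRel (pushEdge p q o))
    obtain ⟨f1, f2, f3⟩ := hE.isFaceMap_iff.1 (isFaceMap_mk (pushEdge p q o))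
    have a0 : mk (.inl p.1, p.2) = mk (.inr false, o) := by
      have := f2 0
      simpa [pushLeft, pushRight, cw] using this
    have a1 : mk (.inr false, o + 1) = mk (.inl p.1, p.2 - 1) := f3 0
    have a2 : mk (.inl q.1, q.2 - 1) = mk (.inr false, o) := (f3 2).symm
    have a3 : mk (.inr false, o + 3) = mk (.inl q.1, q.2) := by
      have := f2 2
      simp only [pushLeft, pushRight, cw, Matrix.cons_val, sub_one_eq_add_three] at this
      exact this.symm
    have a4 : mk (.inr true, o) = mk (.inr false, o + 3) := by
      have := f2 1
      simpa [pushLeft, pushRight, cw] using this.symm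
    have a5 : mk (.inr true, o + 1) = mk (.inr false, o + 2) := by
      have := f2 3
      simp [pushLeft, pushRight, cw, add_two_sub_one] at this
      exact this.symm
    have a6 : mk (.inr true, o + 2) = mk (.inr false, o + 1) := by
      have := f3 3
      simp [pushLeft, pushRight, cw, add_two_sub_one] at this
      exact this
    -- The two corners that were cut off are sent to the other part of their former face, which
    -- makes `c` a face map of `D`.
    let c : D.Crossing × ZMod 4 → Quot (FaceRel (pushEdge p q o)) := fun d =>
      if d = p ∨ d = cw q then mk (.inr true, o + 3) else mk (.inl d.1, d.2)
    have cp : c p = mk (.inr true, o + 3) := if_pos (.inl rfl)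
    have ca : c (cw q) = mk (.inr true, o + 3) := if_pos (.inr rfl)
    have co : ∀ d, d ≠ p → d ≠ cw q → c d = mk (.inl d.1, d.2) := fun d h1 h2 =>
      if_neg (not_or.2 ⟨h1, h2⟩)
    have hqp : q ≠ p := h.ne.symm
    have hqcq : q ≠ cw q := (cw_ne q).symm
    have hcpp : cw p ≠ p := cw_ne p
    have hcpq : cw p ≠ cw q := fun hh => h.ne (cw_inj.1 hh)
    have hc : IsFaceMap D.edgeAt c := by
      rw [D.isFaceMap_iff]
      intro d
      by_cases hda : d = cw q ∧ d ≠ p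
      · rcases h.adj with h1 | ⟨h1, h2⟩
        · exact absurd (hda.1.trans h1) hda.2
        · rw [hda.1, h2, ca]
          have : cw (p.1, p.2 + 1) = p := ccw_eq_iff.2 rfl
          rw [this, cp]
      · have h1 : c d = mk (pushDart p q o d) := by
          by_cases hp : d = p
          · rw [hp, cp, pushDart_p]
          · have ha : d ≠ cw q := fun hh => hda ⟨hh, hp⟩
            by_cases hq : d = q
            · rw [hq, co q hqp hqcq, pushDart_q h.ne, a4, a3]
            · rw [co d hp ha, pushDart_old hp hq]
        refine h1.trans ((f1 d).trans ?_)
        change mk _ = _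
        by_cases hp : D.mate d = p
        · rw [hp, pushDart_p, co _ hcpp hcpq]
          simp only [cw, add_three_sub_one]
          exact a6.trans a1
        · by_cases hq : D.mate d = q
          · rw [hq, pushDart_q h.ne, ca]
            simp only [cw, sub_one_eq_add_three]

          · rw [pushDart_old hp hq, co (cw (D.mate d)) _ (fun hh => hq (cw_inj.1 hh))]
            · rfl
            · intro hh
              rw [ccw_eq_iff] at hh
              rcases h.adj with h2 | ⟨h2, h3⟩
              · exact hq (hh.trans (ccw_eq_iff.1 h2).symm)
              · have h4 : d = cw q := by
                  rw [← D.mate_mate d, hh, ← h3, D.mate_mate]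
                exact hda ⟨h4, fun h5 => h2 (h4.symm.trans h5)⟩
    refine Nat.card_le_card_of_surjective
      (Sum.elim hc.lift fun b : Bool => if b then mk (.inr false, o + 2) else mk (.inr false, o)) ?_
    have hold : ∀ d : D.Crossing × ZMod 4, ∃ x, Sum.elim hc.lift
        (fun b : Bool => if b then mk (.inr false, o + 2) else mk (.inr false, o)) x =
        mk (.inl d.1, d.2) := by
      intro d
      by_cases hp : d = p
      · exact ⟨.inr false, by rw [hp]; simpa using a0.symm⟩
      · by_cases ha : d = cw q
        · exact ⟨.inr false, by rw [ha]; simpa using a2.symm⟩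
        · exact ⟨.inl (Quot.mk _ d), co d hp ha⟩
    intro f
    obtain ⟨⟨w | b, i⟩, rfl⟩ := Quot.exists_rep f
    · exact hold (w, i)
    · cases b <;> rcases sub_offset_cases i o with rfl | rfl | rfl | rfl
      · exact ⟨.inr false, by simp [mk]⟩
      · obtain ⟨x, hx⟩ := hold (cw p)
        exact ⟨x, hx.trans a1.symm⟩
      · exact ⟨.inr true, by simp [mk]⟩
      · obtain ⟨x, hx⟩ := hold q
        exact ⟨x, hx.trans a3.symm⟩
      · obtain ⟨x, hx⟩ := hold q
        exact ⟨x, hx.trans (a4.trans a3).symm⟩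
      · exact ⟨.inr true, by simpa using a5.symm⟩
      · obtain ⟨x, hx⟩ := hold (cw p)
        exact ⟨x, hx.trans (a6.trans a1).symm⟩
      · exact ⟨.inl (Quot.mk _ p), cp⟩
  · have hγ := pushCorner_isFaceMap h o (isFaceMap_mk D.edgeAt)
    refine Nat.card_le_card_of_surjective hγ.lift ?_
    rintro (f | b)
    · obtain ⟨d, rfl⟩ := Quot.exists_rep f
      by_cases hp : d = p
      · exact ⟨Quot.mk _ (.inr true, o + 3), by rw [hγ.lift_mk, pushCorner_z3, hp]⟩
      · by_cases ha : d = cw q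
        · refine ⟨Quot.mk _ (.inr true, o + 3), ?_⟩
          rw [hγ.lift_mk, pushCorner_z3, ha, h.face (isFaceMap_mk D.edgeAt)]
        · exact ⟨Quot.mk _ (.inl d.1, d.2), by rw [hγ.lift_mk, pushCorner_old hp ha]⟩
    · cases b
      · exact ⟨Quot.mk _ (.inr false, o), by rw [hγ.lift_mk, pushCorner_y0]⟩
      · exact ⟨Quot.mk _ (.inr false, o + 2), by rw [hγ.lift_mk, pushCorner_y2]⟩

/-- The diagram after the strand at `p` has been pushed across the edge at `q`. -/
noncomputable abbrev push (h : D.Adjacent p q) (o : ZMod 4) : LinkDiagram :=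
  (pushExtension h.ne o).diagram (pushCorner_isFaceMap h o D.isFaceMap) .inl
    (by
      intro c hc
      -- Both parts of the cut region border on the region of `cw p` on the far side of the strand.
      have hG : c (.inr false) = c (.inl (D.cornerAt p)) := by
        have h1 := hc (.inr false, o + 1)
        have h2 := hc (.inr true, o + 3)
        simp [cw, add_three_sub_one] at h1 h2
        rw [h2, h1]
      have hγ : ∀ d : D.Crossing × ZMod 4,
          c (.inl (D.cornerAt d)) = c (pushCorner p q D.cornerAt o (.inl d.1, d.2)) := by
        intro d
        by_cases hn : d = p ∨ d = cw q
        · rw [pushCorner_near hn, hG]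
          rcases hn with rfl | rfl
          · rfl
          · rw [h.face D.isFaceMap]
        · push Not at hn
          rw [pushCorner_old hn.1 hn.2]
      refine ⟨fun d => ?_, ?_⟩
      · rw [hγ, hγ]; exact hc _
      · rintro (r | b)
        · exact ⟨r, rfl⟩
        · refine ⟨D.cornerAt p, ?_⟩
          rw [← hG]
          cases b
          · rfl
          · have h1 := hc (.inr true, o + 2)
            have h2 := hc (.inr true, o + 3)
            simp [cw, add_three_sub_one, add_two_sub_one] at h1 h2
            rw [hG, h2, h1])
    (by
      have h1 : Nat.card (D.Region ⊕ Bool) = Nat.card D.Region + 2 := by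
        rw [Nat.card_sum, Nat.card_eq_fintype_card (α := Bool), Fintype.card_bool]
      have h2 : Nat.card (D.Crossing ⊕ Bool) = Nat.card D.Crossing + 2 := by
        rw [Nat.card_sum, Nat.card_eq_fintype_card (α := Bool), Fintype.card_bool]
      have h3 := card_face_push h o
      omega)

section
variable (h : D.Adjacent p q) (o : ZMod 4)

lemma push_edgeAt (d) : (push h o).edgeAt d = pushEdge p q o d := rfl
lemma push_edge (x i) : (push h o).edge x i = pushEdge p q o (x, i) := rfl
lemma push_corner (x i) : (push h o).corner x i = pushCorner p q D.cornerAt o (x, i) := rfl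

lemma push_isFreeLoop {e} : (push h o).IsFreeLoop e ↔ ∃ f, e = .inl f ∧ D.IsFreeLoop f := by
  have hE := pushExtension h.ne o
  constructor
  · intro he
    cases e with
    | inl f =>
      refine ⟨f, rfl, fun x i hx => ?_⟩
      subst hx
      exact (push h o).not_isFreeLoop (pushDart p q o (x, i)) (by
        rw [push_edgeAt, hE.edge_map]; exact he)
    | inr k =>
      exact absurd (hE.edge_left k) (he _ _)
  · rintro ⟨f, rfl, hf⟩ x i hx
    obtain ⟨a, ha, _⟩ := hE.eq_inl_iff.1 hx
    exact hf _ _ ha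

lemma push_sides_loop {f} (hf : D.IsFreeLoop f) :
    (push h o).sides (.inl f) = (D.sides f).map .inl :=
  (pushExtension h.ne o).sides_loop _ _ hf

lemma numCrossings_push : (push h o).numCrossings = D.numCrossings + 2 := by
  have : Nat.card (D.Crossing ⊕ Bool) = Nat.card D.Crossing + 2 := by
    rw [Nat.card_sum, Nat.card_eq_fintype_card (α := Bool), Fintype.card_bool]
  exact this

/-- The bigon has the corner `o + 2` at the first new crossing and `o + 1` at the second. The
deleting maps are retractions onto `D`: a piece of a cut edge returns to that edge and the region
cut off to the region of `p`. So they identify exactly what the two given relations generate. -/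
theorem omega2Down_push : (push h o).Omega2Down D := by
  have hE := pushExtension h.ne o
  have e2 : o + 2 + 2 = o := by
    have : ∀ o : ZMod 4, o + 2 + 2 = o := by decide
    exact this o
  have e3 : o + 2 + 3 = o + 1 := by
    have : ∀ o : ZMod 4, o + 2 + 3 = o + 1 := by decide
    exact this o
  have e4 : o + 1 + 3 = o := by
    have : ∀ o : ZMod 4, o + 1 + 3 = o := by decide
    exact this o
  have e5 : o + 1 + 2 = o + 3 := by
    have : ∀ o : ZMod 4, o + 1 + 2 = o + 3 := by decide
    exact this o
  have e6 : o + 2 + 1 = o + 3 := by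
    have : ∀ o : ZMod 4, o + 2 + 1 = o + 3 := by decide
    exact this o
  have e7 : o + 1 + 1 = o + 2 := by
    have : ∀ o : ZMod 4, o + 1 + 1 = o + 2 := by decide
    exact this o
  refine ⟨.inr false, .inr true, o + 2, o + 1, fun hh => ?_, ?_, ?_, ?_, ⟨?_, ?_⟩, ?_⟩
  · exact Bool.noConfusion (Sum.inr.inj hh)
  · rw [push_edge, push_edge, e7, pushEdge_y2, pushEdge_z2]
  · rw [push_edge, push_edge, e6, pushEdge_y3, pushEdge_z1]
  · rw [e7]
  · intro x i hx
    rw [push_corner, push_corner, pushCorner_y2] at hx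
    obtain w | b := x
    · by_cases hn : (w, i) = p ∨ (w, i) = cw q
      · rw [pushCorner_near (d := (w, i)) hn] at hx; simp at hx
      · push Not at hn
        rw [pushCorner_old (d := (w, i)) hn.1 hn.2] at hx; cases hx
    · cases b <;> rcases sub_offset_cases i o with rfl | rfl | rfl | rfl <;> simp at hx ⊢
  · intro e he
    obtain ⟨f, rfl, hf⟩ := (push_isFreeLoop h o).1 he
    rw [push_sides_loop h o hf, push_corner, pushCorner_y2, Sym2.mem_map]
    rintro ⟨r, _, hr⟩
    cases hr
  · simp only [e2, e3, e4, e5, pushEdge_y0, pushEdge_y1, pushEdge_y2,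
      pushEdge_z0, pushEdge_z1, pushEdge_z3, pushCorner_y0, pushCorner_y2, pushCorner_z3]
    -- The values at the deleted edges `1`, `3` and at the bigon do not matter.
    refine ⟨.inl, Sum.elim id ![D.edgeAt p, D.edgeAt p, D.edgeAt q, D.edgeAt q],
      Sum.elim id (fun _ => D.cornerAt p), Sum.inl_injective, ?_, ?_, ?_, ?_, ?_, ?_, ?_, ?_⟩
    · ext x
      obtain w | b := x
      · simp
      · cases b <;> simp
    · rw [Set.eq_univ_iff_forall]
      exact fun e => ⟨.inl e, by simp, rfl⟩
    · intro e e' he he'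
      constructor
      · have key : ∀ e, e ∉ ({.inr 3, .inr 1} : Set (D.Edge ⊕ Fin 4)) → EqvGen (fun e e' =>
            (e = (.inr 2 : D.Edge ⊕ Fin 4) ∧ e' = .inl (D.edgeAt q)) ∨
            (e = .inr 0 ∧ e' = .inl (D.edgeAt p))) e
            (.inl (Sum.elim id ![D.edgeAt p, D.edgeAt p, D.edgeAt q, D.edgeAt q] e)) := by
          rintro (e | k) he
          · exact EqvGen.refl _
          · fin_cases k
            · exact EqvGen.rel _ _ (.inr ⟨rfl, rfl⟩)
            · exact absurd (Or.inr rfl) he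
            · exact EqvGen.rel _ _ (.inl ⟨rfl, rfl⟩)
            · exact absurd (Or.inl rfl) he
        intro hee
        have h1 := key e he
        rw [hee] at h1
        exact h1.trans _ _ _ ((key e' he').symm)
      · intro hr
        clear he he'
        induction hr with
        | rel _ _ hr => rcases hr with ⟨rfl, rfl⟩ | ⟨rfl, rfl⟩ <;> rfl
        | refl => rfl
        | symm _ _ _ ih => exact ih.symm
        | trans _ _ _ _ _ ih1 ih2 => exact ih1.trans ih2
    · rw [Set.eq_univ_iff_forall]
      exact fun e => ⟨.inl e, by simp, rfl⟩
    · intro s s' hs hs'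
      constructor
      · have key : ∀ s, s ≠ .inr true → EqvGen (fun s s' => s = (.inr false : D.Region ⊕ Bool) ∧
            s' = .inl (D.cornerAt p)) s (.inl (Sum.elim id (fun _ => D.cornerAt p) s)) := by
          rintro (s | b) hs
          · exact EqvGen.refl _
          · cases b
            · exact EqvGen.rel _ _ ⟨rfl, rfl⟩
            · exact absurd rfl hs
        intro hss
        have h1 := key s hs
        rw [hss] at h1
        exact h1.trans _ _ _ ((key s' hs').symm)
      · intro hr
        clear hs hs'
        induction hr with
        | rel _ _ hr => obtain ⟨rfl, rfl⟩ := hr; rfl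
        | refl => rfl
        | symm _ _ _ ih => exact ih.symm
        | trans _ _ _ _ _ ih1 ih2 => exact ih1.trans ih2
    · intro x i
      change D.edge x i = Sum.elim id _ (pushEdge p q o (.inl x, i))
      by_cases h1 : (x, i) = p
      · subst h1; rw [pushEdge_p (p := (x, i))]; rfl
      · by_cases h2 : (x, i) = q
        · subst h2; rw [pushEdge_q (q := (x, i)) h.ne]; rfl
        · rw [pushEdge_old (d := (x, i)) h1 h2]; rfl
    · intro x i
      change D.corner x i = Sum.elim id _ (pushCorner p q D.cornerAt o (.inl x, i))
      by_cases hn : (x, i) = p ∨ (x, i) = cw q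
      · rw [pushCorner_near (d := (x, i)) hn]
        rcases hn with hn | hn
        · exact congrArg D.cornerAt hn
        · exact (congrArg D.cornerAt hn).trans (h.face D.isFaceMap)
      · push Not at hn
        rw [pushCorner_old (d := (x, i)) hn.1 hn.2]; rfl
    · intro e he
      have hside : ∀ d, D.sides (Sum.elim id ![D.edgeAt p, D.edgeAt p, D.edgeAt q, D.edgeAt q]
            (pushEdge p q o d)) = s(Sum.elim id (fun _ => D.cornerAt p)
              (pushCorner p q D.cornerAt o d), Sum.elim id (fun _ => D.cornerAt p)
              (pushCorner p q D.cornerAt o (cw d))) →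
          D.sides (Sum.elim id ![D.edgeAt p, D.edgeAt p, D.edgeAt q, D.edgeAt q]
            (pushEdge p q o d)) =
            ((push h o).sides (pushEdge p q o d)).map (Sum.elim id (fun _ => D.cornerAt p)) := by
        intro d hd
        rw [hd, ← push_edgeAt h o, (push h o).sides_edgeAt, Sym2.map_mk]
        rfl
      have hR : ∀ d : D.Crossing × ZMod 4, Sum.elim id (fun _ => D.cornerAt p)
          (pushCorner p q D.cornerAt o (.inl d.1, d.2)) = D.cornerAt d := by
        intro d
        by_cases hn : d = p ∨ d = cw q
        · rw [pushCorner_near hn]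
          rcases hn with hn | hn
          · exact (congrArg D.cornerAt hn).symm
          · exact ((congrArg D.cornerAt hn).trans (h.face D.isFaceMap)).symm
        · push Not at hn
          rw [pushCorner_old hn.1 hn.2]; rfl
      have hq := h.face D.isFaceMap
      have cq : ∀ o : ZMod 4, cw ((.inr true : D.Crossing ⊕ Bool), o) = (.inr true, o + 3) := by
        intro o; simp [cw, sub_one_eq_add_three]
      have cp : ∀ o : ZMod 4, cw ((.inr true : D.Crossing ⊕ Bool), o + 3) = (.inr true, o + 2) := by
        intro o; simp [cw, add_three_sub_one]
      cases e with
      | inl e =>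
        by_cases hl : D.IsFreeLoop e
        · rw [push_sides_loop h o hl, Sym2.map_map]
          simp
        · simp only [IsFreeLoop, not_forall, not_not] at hl
          obtain ⟨x, i, rfl⟩ := hl
          change D.sides (Sum.elim id _ (.inl (D.edgeAt (x, i)))) =
            ((push h o).sides (.inl (D.edgeAt (x, i)))).map _
          rw [← hE.edge_map (x, i)]
          refine hside _ ?_
          rw [hE.edge_map, Sum.elim_inl, id, D.sides_edgeAt]
          by_cases h1 : (x, i) = p
          · rw [h1, pushDart_p, cp, pushCorner_z3, pushCorner_z2]; rfl
          · by_cases h2 : (x, i) = q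
            · rw [h2, pushDart_q h.ne, cq, pushCorner_z3, pushCorner_z0, hq]; rfl
            · rw [pushDart_old h1 h2, hR]
              exact congrArg _ (hR (cw (x, i))).symm
      | inr k =>
        fin_cases k
        · change D.sides (Sum.elim id _ (.inr 0)) = ((push h o).sides (.inr 0)).map _
          rw [← pushEdge_p (p := p) (q := q) o]
          refine hside _ ?_
          rw [pushEdge_p, hR]
          exact (D.sides_edgeAt p).trans (congrArg _ (hR (cw p)).symm)
        · exact absurd (Or.inr rfl) he
        · change D.sides (Sum.elim id _ (.inr 2)) = ((push h o).sides (.inr 2)).map _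
          rw [← pushEdge_q h.ne o]
          refine hside _ ?_
          rw [pushEdge_q h.ne, hR]
          exact (D.sides_edgeAt q).trans (congrArg _ (hR (cw q)).symm)
        · exact absurd (Or.inl rfl) he
end

end LinkDiagram

/-! ### Inserting a tangle with one strand into an edge -/

open Relation

/-- A diagram of a long knot with `n` crossings. The strand passes through the edge-ends
`entry 0`, ..., `entry k`, entering a crossing each time. The edge `a` leads to `entry a`, and
`none` is the edge that leaves the tangle. `inl true` and `inl false` are the regions on the left
and on the right side. -/
structure Tangle (n k : ℕ) where
  entry : Fin (k + 1) → Fin n × ZMod 4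
  edge : Fin n × ZMod 4 → Option (Fin (k + 1))
  corner : Fin n × ZMod 4 → Bool ⊕ Fin n
  rep : Fin n → Fin n × ZMod 4

namespace Tangle

variable {n k : ℕ} (T : Tangle n k)

/-- The end opposite to an end. -/
def opp (d : Fin n × ZMod 4) : Fin n × ZMod 4 := (d.1, d.2 + 2)

/-- The end at which the edge `a` begins. -/
def origin (a : Fin (k + 1)) : Option (Fin n × ZMod 4) :=
  Fin.cases none (fun b => some (opp (T.entry b.castSucc))) a

/-- The last end of the strand. -/
def exit : Fin n × ZMod 4 := opp (T.entry (Fin.last k))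

/-- The face through a corner is followed for `m` steps, until it leaves the tangle or meets the
representing corner of its region. -/
def settled : ℕ → Fin n × ZMod 4 → Bool
  | 0, _ => false
  | m + 1, d => decide (∃ r, d = T.rep r) || match T.edge d with
    | none => true
    | some a => if d = T.entry a then
        match T.origin a with
        | none => true
        | some e => settled m (cw e)
      else settled m (cw (T.entry a))

/-- The tables of a tangle are consistent. -/
structure Valid : Prop where
  edge_entry : ∀ a, T.edge (T.entry a) = some a
  edge_origin : ∀ a, ∀ d ∈ T.origin a, T.edge d = some a
  edge_exit : T.edge T.exit = none
  origin_ne : ∀ a, T.origin a ≠ some (T.entry a)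
  cover : ∀ x i, (x, i) = T.exit ∨ ∃ a, (x, i) = T.entry a ∨ T.origin a = some (x, i)
  right : ∀ a, T.corner (T.entry a) =
    (T.origin a).elim (.inl false) (fun d => T.corner (cw d))
  left : ∀ a, (T.origin a).elim (.inl true) T.corner = T.corner (cw (T.entry a))
  exit_left : T.corner T.exit = .inl true
  exit_right : T.corner (cw T.exit) = .inl false
  corner_rep : ∀ r, T.corner (T.rep r) = .inr r
  -- Twelve is fuel, enough for every face of the tables below. The condition says that inside the
  -- tangle there are no faces besides the `n` listed ones, which makes its planarity decidable.
  settled : ∀ x i, T.settled 12 (x, i) = true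

variable {T} {D : LinkDiagram} {p : D.Crossing × ZMod 4}

lemma Valid.edge_eq_some (hT : T.Valid) {d a} (h : T.edge d = some a) :
    d = T.entry a ∨ T.origin a = some d := by
  rcases hT.cover d.1 d.2 with h1 | ⟨b, h1 | h1⟩
  · rw [Prod.mk.eta] at h1
    rw [h1, hT.edge_exit] at h; cases h
  · rw [Prod.mk.eta] at h1
    rw [h1, hT.edge_entry] at h; cases h; exact .inl h1
  · rw [Prod.mk.eta] at h1
    rw [hT.edge_origin _ _ h1] at h; cases h; exact .inr h1

lemma Valid.edge_eq_none (hT : T.Valid) {d} (h : T.edge d = none) : d = T.exit := by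
  rcases hT.cover d.1 d.2 with h1 | ⟨b, h1 | h1⟩
  · exact h1
  · rw [Prod.mk.eta] at h1
    rw [h1, hT.edge_entry] at h; cases h
  · rw [Prod.mk.eta] at h1
    rw [hT.edge_origin _ _ h1] at h; cases h

lemma origin_succ (b : Fin k) : T.origin b.succ = some (opp (T.entry b.castSucc)) := rfl

variable (D p)

/-- An edge of the tangle inserted at `p`. -/
def embEdge (a : Option (Fin (k + 1))) : D.Edge ⊕ Fin (k + 1) :=
  a.elim (.inl (D.edgeAt p)) .inr

variable {D}

/-- A region of the tangle inserted at `p`. -/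
def embRegion {Y : Type} (c : D.Crossing × ZMod 4 → Y) (r : Bool ⊕ Fin n) : Y ⊕ Fin n :=
  r.map (fun b => if b then c p else c (cw p)) id

variable (T)

open Classical in
/-- The edges after inserting `T` at `p`. -/
noncomputable def insEdge : (D.Crossing ⊕ Fin n) × ZMod 4 → D.Edge ⊕ Fin (k + 1)
  | (.inl w, i) => if (w, i) = p then .inr 0 else .inl (D.edge w i)
  | (.inr x, i) => embEdge D p (T.edge (x, i))

/-- The corners after inserting `T` at `p`. -/
def insCorner {Y : Type} (c : D.Crossing × ZMod 4 → Y) :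
    (D.Crossing ⊕ Fin n) × ZMod 4 → Y ⊕ Fin n
  | (.inl w, i) => .inl (c (w, i))
  | (.inr x, i) => embRegion p c (T.corner (x, i))

open Classical in
/-- The new position of the ends of the old edges. -/
noncomputable def insDart (d : D.Crossing × ZMod 4) : (D.Crossing ⊕ Fin n) × ZMod 4 :=
  if d = p then (.inr T.exit.1, T.exit.2) else (.inl d.1, d.2)

/-- The last end of a new edge. -/
def insRight (X : Type) (a : Fin (k + 1)) : (X ⊕ Fin n) × ZMod 4 :=
  (.inr (T.entry a).1, (T.entry a).2)

/-- The first end of a new edge. -/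
def insLeft (a : Fin (k + 1)) : (D.Crossing ⊕ Fin n) × ZMod 4 :=
  (T.origin a).elim (.inl p.1, p.2) fun d => (.inr d.1, d.2)

variable {T p}

@[simp] lemma insEdge_inr (x i) : T.insEdge p (.inr x, i) = embEdge D p (T.edge (x, i)) := rfl
lemma insEdge_p : T.insEdge p (.inl p.1, p.2) = .inr 0 := by simp [insEdge]
lemma insEdge_old {d} (h : d ≠ p) : T.insEdge p (.inl d.1, d.2) = .inl (D.edgeAt d) := by
  simp [insEdge, h, LinkDiagram.edgeAt]
lemma insDart_p : T.insDart p p = (.inr T.exit.1, T.exit.2) := by simp [insDart]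
lemma insDart_old {d} (h : d ≠ p) : T.insDart p d = (.inl d.1, d.2) := by simp [insDart, h]
@[simp] lemma insCorner_inl {Y : Type} (c : D.Crossing × ZMod 4 → Y) (w i) :
    T.insCorner p c (.inl w, i) = .inl (c (w, i)) := rfl
@[simp] lemma insCorner_inr {Y : Type} (c : D.Crossing × ZMod 4 → Y) (x i) :
    T.insCorner p c (.inr x, i) = embRegion p c (T.corner (x, i)) := rfl

lemma Valid.extension (hT : T.Valid) :
    D.Extension (T.insEdge p) (T.insDart p) (T.insRight D.Crossing) (T.insLeft p) where
  edge_map d := by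
    by_cases h : d = p
    · subst h; rw [insDart_p, insEdge_inr, Prod.mk.eta, hT.edge_exit]; rfl
    · rw [insDart_old h, insEdge_old h]
  edge_left a := by rw [insRight, insEdge_inr, Prod.mk.eta, hT.edge_entry]; rfl
  edge_right a := by
    cases a using Fin.cases with
    | zero => exact insEdge_p
    | succ b =>
      rw [insLeft, origin_succ, Option.elim_some, insEdge_inr, Prod.mk.eta,
        hT.edge_origin _ _ (origin_succ b)]
      rfl
  ne a h := by
    cases ha : T.origin a with
    | none => rw [insLeft, ha] at h; cases congrArg Prod.fst h
    | some d =>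
      rw [insLeft, ha] at h
      refine hT.origin_ne a (ha.trans (congrArg some (Prod.ext ?_ (congrArg Prod.snd h).symm)))
      exact Sum.inr.inj (congrArg Prod.fst h).symm
  inj d e h := by
    unfold insDart at h
    split_ifs at h with h1 h2 h2
    · rw [h1, h2]
    · cases congrArg Prod.fst h
    · cases congrArg Prod.fst h
    · exact Prod.ext (Sum.inl.inj (congrArg Prod.fst h)) (by simpa using congrArg Prod.snd h)
  cover d := by
    obtain ⟨w | x, i⟩ := d
    · by_cases h : (w, i) = p
      · exact .inr ⟨0, .inr (by subst h; rfl)⟩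
      · exact .inl ⟨(w, i), by rw [insDart_old h]⟩
    · rcases hT.cover x i with h | ⟨a, h | h⟩
      · exact .inl ⟨p, by rw [insDart_p, ← h]⟩
      · exact .inr ⟨a, .inl (by rw [insRight, ← h])⟩
      · exact .inr ⟨a, .inr (by rw [insLeft, h]; rfl)⟩

lemma Valid.isFaceMap (hT : T.Valid) {Y : Type} {c : D.Crossing × ZMod 4 → Y}
    (hc : IsFaceMap D.edgeAt c) : IsFaceMap (T.insEdge p) (T.insCorner p c) := by
  rw [hT.extension.isFaceMap_iff]
  rw [D.isFaceMap_iff] at hc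
  refine ⟨fun d => ?_, fun a => ?_, fun a => ?_⟩
  · have hm := D.mate_ne p
    by_cases h : d = p
    · rw [h, insDart_p, insDart_old hm, insCorner_inr, Prod.mk.eta, hT.exit_left]
      exact congrArg Sum.inl (hc p)
    · rw [insDart_old h, insCorner_inl]
      by_cases h' : D.mate d = p
      · rw [h', insDart_p]
        change _ = embRegion p c (T.corner (cw T.exit))
        rw [hT.exit_right, Prod.mk.eta, hc d, h']
        rfl
      · rw [insDart_old h']
        exact congrArg Sum.inl (hc d)
  · have := congrArg (embRegion p c) (hT.right a)
    refine this.trans ?_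
    rw [insLeft]
    cases T.origin a <;> rfl
  · have := congrArg (embRegion p c) (hT.left a)
    refine Eq.trans ?_ this
    rw [insLeft]
    cases T.origin a <;> rfl

/-- A step along a face changes neither the value of `γ` nor the entry of `corner`, so the value can
be read off where the walk stops. The left side of the strand continues as the face of `cw (D.mate
p)`, the right side as that of `cw p`. -/
lemma Valid.eq_of_settled (hT : T.Valid) {Y : Type}
    {γ : (D.Crossing ⊕ Fin n) × ZMod 4 → Y} (hγ : IsFaceMap (T.insEdge p) γ) (m : ℕ) (d)
    (h : T.settled m d = true) : γ (.inr d.1, d.2) = (T.corner d).elim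
      (fun b => if b then γ (.inl (cw (D.mate p)).1, (cw (D.mate p)).2)
        else γ (.inl (cw p).1, (cw p).2))
      (fun r => γ (.inr (T.rep r).1, (T.rep r).2)) := by
  obtain ⟨h1, h2, h3⟩ := hT.extension.isFaceMap_iff.1 hγ
  induction m generalizing d with
  | zero => cases h
  | succ m ih =>
    rw [Tangle.settled, Bool.or_eq_true, decide_eq_true_iff] at h
    rcases h with ⟨r, rfl⟩ | h
    · rw [hT.corner_rep]; rfl
    · cases hd : T.edge d with
      | none =>
        have hd := hT.edge_eq_none hd
        have h4 := h1 p
        rw [insDart_p, insDart_old (D.mate_ne p)] at h4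
        rw [hd, h4, hT.exit_left]
        rfl
      | some a =>
        simp only [hd] at h
        by_cases hda : d = T.entry a
        · rw [if_pos hda] at h
          have h4 := h2 a
          have h5 := hT.right a
          rw [insRight, insLeft, ← hda] at h4
          rw [← hda] at h5
          rw [h4, h5]
          cases he : T.origin a with
          | none => rfl
          | some e =>
            simp only [he] at h
            exact ih _ h
        · rw [if_neg hda] at h
          have h4 := h3 a
          have h5 := hT.left a
          have he : T.origin a = some d := (hT.edge_eq_some hd).resolve_left hda
          rw [insLeft, he] at h4
          rw [he] at h5
          exact h4.trans ((ih _ h).trans (by rw [← h5]; rfl))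

/-- Again a count of orbits without planarity of `D`: by `eq_of_settled` the old faces and the `n`
representatives exhaust the faces, and by `insCorner` they remain different. -/
lemma Valid.card_face (hT : T.Valid) :
    Nat.card (Quot (FaceRel (T.insEdge p))) = Nat.card D.Face + n := by
  have hn : Nat.card (D.Face ⊕ Fin n) = Nat.card D.Face + n := by
    rw [Nat.card_sum, Nat.card_eq_fintype_card (α := Fin n), Fintype.card_fin]
  rw [← hn]
  refine le_antisymm ?_ ?_
  · have hmk := isFaceMap_mk (T.insEdge p)
    have hs := fun d : Fin n × ZMod 4 => hT.eq_of_settled hmk 12 d (hT.settled d.1 d.2)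
    obtain ⟨f1, f2, f3⟩ := hT.extension.isFaceMap_iff.1 hmk
    let mk := Quot.mk (FaceRel (T.insEdge p))
    have hp : mk (.inl p.1, p.2) = mk (.inl (cw (D.mate p)).1, (cw (D.mate p)).2) := by
      refine (f3 0).trans ?_
      have h5 := hT.left 0
      refine (hs (cw (T.entry 0))).trans ?_
      rw [← h5]; rfl
    have hc : IsFaceMap D.edgeAt fun d => mk (.inl d.1, d.2) := by
      rw [D.isFaceMap_iff]
      intro d
      by_cases hd : d = p
      · rw [hd]; exact hp
      · have h1 := f1 d
        rw [insDart_old hd] at h1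
        refine h1.trans ?_
        by_cases hd' : D.mate d = p
        · rw [hd', insDart_p]
          refine (hs (cw T.exit)).trans ?_
          rw [hT.exit_right]; rfl
        · rw [insDart_old hd']; rfl
    refine Nat.card_le_card_of_surjective
      (Sum.elim hc.lift fun r => mk (.inr (T.rep r).1, (T.rep r).2)) ?_
    intro f
    obtain ⟨⟨w | x, i⟩, rfl⟩ := Quot.exists_rep f
    · exact ⟨.inl (Quot.mk _ (w, i)), rfl⟩
    · have := hs (x, i)
      dsimp only at this
      rw [this]
      rcases T.corner (x, i) with (_ | _) | r
      · exact ⟨.inl (Quot.mk _ (cw p)), rfl⟩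
      · exact ⟨.inl (Quot.mk _ (cw (D.mate p))), rfl⟩
      · exact ⟨.inr r, rfl⟩
  · refine Nat.card_le_card_of_surjective
      (hT.isFaceMap (p := p) (isFaceMap_mk D.edgeAt)).lift ?_
    rintro (f | r)
    · obtain ⟨d, rfl⟩ := Quot.exists_rep f
      exact ⟨Quot.mk _ (.inl d.1, d.2), rfl⟩
    · refine ⟨Quot.mk _ (.inr (T.rep r).1, (T.rep r).2), ?_⟩
      rw [IsFaceMap.lift_mk, insCorner_inr, Prod.mk.eta, hT.corner_rep]; rfl

/-- The diagram in which the tangle `T` is inserted at the dart `p`. -/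
noncomputable abbrev insert (hT : T.Valid) (p : D.Crossing × ZMod 4) : LinkDiagram :=
  hT.extension.diagram (hT.isFaceMap (p := p) D.isFaceMap) .inl
    (by
      intro c hc
      refine ⟨fun a => hc (.inl a.1, a.2), ?_⟩
      have hx : ∀ (x : D.Crossing ⊕ Fin n) i j, c (T.insCorner p D.cornerAt (x, i)) =
          c (T.insCorner p D.cornerAt (x, j)) := by
        intro x
        have h1 : ∀ i, c (T.insCorner p D.cornerAt (x, i)) =
            c (T.insCorner p D.cornerAt (x, i + 1)) := by
          intro i
          rw [hc (x, i + 1)]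
          simp [cw]
        have h2 : ∀ i, c (T.insCorner p D.cornerAt (x, i)) =
            c (T.insCorner p D.cornerAt (x, 0)) := by
          intro i
          rcases LinkDiagram.sub_offset_cases i 0 with rfl | rfl | rfl | rfl
          · rfl
          · exact (h1 0).symm
          · exact ((h1 0).trans (h1 (0 + 1))).symm
          · exact ((h1 0).trans ((h1 (0 + 1)).trans (h1 (0 + 1 + 1)))).symm
        intro i j
        rw [h2 i, h2 j]
      have hface := hT.isFaceMap (p := p) D.isFaceMap
      -- Colours are constant around a crossing, and successive crossings of the strand share a
      -- region. So the colour of the region at `p` spreads along the strand, which visits every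
      -- crossing of the tangle.
      have ha : ∀ (a : Fin (k + 1)) i, c (T.insCorner p D.cornerAt (.inr (T.entry a).1, i)) =
          c (.inl (D.cornerAt p)) := by
        intro a
        induction a using Fin.induction with
        | zero =>
          intro i
          rw [hx _ i ((T.entry 0).2 - 1)]
          have := congrArg (embRegion p D.cornerAt) (hT.left 0)
          exact congrArg c this.symm
        | succ b ih =>
          intro i
          rw [hx _ i (T.entry b.succ).2]
          have := congrArg (embRegion p D.cornerAt) (hT.right b.succ)
          exact (congrArg c this).trans (ih _)
      rintro (r | r)
      · exact ⟨r, rfl⟩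
      · refine ⟨D.cornerAt p, ?_⟩
        have h1 : T.insCorner p D.cornerAt (.inr (T.rep r).1, (T.rep r).2) = .inr r := by
          rw [insCorner_inr, Prod.mk.eta, hT.corner_rep]; rfl
        rw [← h1]
        rcases hT.cover (T.rep r).1 (T.rep r).2 with h | ⟨a, h | h⟩
        · rw [congrArg Prod.fst h]; exact ha (Fin.last k) _
        · rw [congrArg Prod.fst h]; exact ha a _
        · cases a using Fin.cases with
          | zero => cases h
          | succ b =>
            rw [← congrArg Prod.fst (Option.some.inj h)]
            exact ha b.castSucc _)
    (by
      have h1 : ∀ α : Type, [Finite α] → Nat.card (α ⊕ Fin n) = Nat.card α + n := by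
        intro α _
        rw [Nat.card_sum, Nat.card_eq_fintype_card (α := Fin n), Fintype.card_fin]
      have h3 := hT.card_face (p := p)
      rw [h1, h1]
      omega)

section
variable (hT : T.Valid) (p)

lemma insert_edge (x i) : (insert hT p).edge x i = T.insEdge p (x, i) := rfl
lemma insert_corner (x i) : (insert hT p).corner x i = T.insCorner p D.cornerAt (x, i) := rfl

lemma insert_isFreeLoop {e} :
    (insert hT p).IsFreeLoop e ↔ ∃ f, e = .inl f ∧ D.IsFreeLoop f := by
  have hE := hT.extension (p := p)
  constructor
  · intro he
    cases e with
    | inl f =>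
      refine ⟨f, rfl, fun x i hx => ?_⟩
      subst hx
      exact (insert hT p).not_isFreeLoop (T.insDart p (x, i)) (by
        change (insert hT p).IsFreeLoop (T.insEdge p (T.insDart p (x, i)))
        rw [hE.edge_map]; exact he)
    | inr k =>
      exact absurd (hE.edge_left k) (he (.inr (T.entry k).1) (T.entry k).2)
  · rintro ⟨f, rfl, hf⟩ x i hx
    obtain ⟨a, ha, _⟩ := hE.eq_inl_iff.1 hx
    exact hf _ _ ha

lemma insert_sides_loop {f} (hf : D.IsFreeLoop f) :
    (insert hT p).sides (.inl f) = (D.sides f).map .inl :=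
  hT.extension.sides_loop _ _ hf

lemma numCrossings_insert : (insert hT p).numCrossings = D.numCrossings + n := by
  have : Nat.card (D.Crossing ⊕ Fin n) = Nat.card D.Crossing + n := by
    rw [Nat.card_sum, Nat.card_eq_fintype_card (α := Fin n), Fintype.card_fin]
  exact this

end

end Tangle

/-! ### Deletions in a tangle described by tables -/

open Relation

namespace Tangle

variable {n k n' k' : ℕ}

/-- Tables for a move that deletes crossings, edges and a region of a tangle. -/
structure Deletion (n k n' k' : ℕ) where
  f : Fin n' → Fin n
  g : Fin (k + 1) → Option (Fin (k' + 1))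
  g' : Fin (k' + 1) → Fin (k + 1)
  h : Fin n → Bool ⊕ Fin n'
  h' : Fin n' → Fin n

namespace Deletion

/-- The new edge that contains an edge. -/
def edge (δ : Deletion n k n' k') (a : Option (Fin (k + 1))) : Option (Fin (k' + 1)) := a.bind δ.g

/-- The new region that contains a region. -/
def region (δ : Deletion n k n' k') (r : Bool ⊕ Fin n) : Bool ⊕ Fin n' := r.elim .inl δ.h

/-- The tables describe the deletion of the crossings in `S`, the edges in `B` and the region `r`,
with the identifications `M` of edges and `N` of regions. -/
structure Valid (δ : Deletion n k n' k') (T : Tangle n k) (T' : Tangle n' k')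
    (S : List (Fin n)) (B : List (Fin (k + 1))) (r : Fin n)
    (M : List (Option (Fin (k + 1)) × Option (Fin (k + 1))))
    (N : List ((Bool ⊕ Fin n) × (Bool ⊕ Fin n))) : Prop where
  injective : ∀ x y, δ.f x = δ.f y → x = y
  mem_iff : ∀ x, x ∈ S ↔ ∀ y, δ.f y ≠ x
  edge_section : ∀ a, δ.g' a ∉ B ∧ δ.g (δ.g' a) = some a
  edge_zero : δ.g 0 = some 0
  edge_rel : ∀ a, a ∉ B → some a = (δ.g a).map δ.g' ∨ (some a, (δ.g a).map δ.g') ∈ M ∨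
    ((δ.g a).map δ.g', some a) ∈ M
  edge_eq : ∀ ab ∈ M, δ.edge ab.1 = δ.edge ab.2
  region_section : ∀ s, δ.h' s ≠ r ∧ δ.h (δ.h' s) = .inr s
  region_rel : ∀ s, s ≠ r → (.inr s : Bool ⊕ Fin n) = (δ.h s).map id δ.h' ∨
    (∃ ab ∈ N, ab.1 = .inr s ∧ ab.2 = (δ.h s).map id δ.h') ∨
    ∃ ab ∈ N, ab.2 = .inr s ∧ ab.1 = (δ.h s).map id δ.h'
  region_eq : ∀ ab ∈ N, δ.region ab.1 = δ.region ab.2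
  edge_map : ∀ x i, T'.edge (x, i) = δ.edge (T.edge (δ.f x, i))
  corner_map : ∀ x i, T'.corner (x, i) = δ.region (T.corner (δ.f x, i))
  sides : ∀ a, a ∉ B → ∃ x i y j, T.edge (x, i) = some a ∧ T'.edge (y, j) = δ.g a ∧
    ((T'.corner (y, j) = δ.region (T.corner (x, i)) ∧
      T'.corner (y, j - 1) = δ.region (T.corner (x, i - 1))) ∨
    (T'.corner (y, j) = δ.region (T.corner (x, i - 1)) ∧
      T'.corner (y, j - 1) = δ.region (T.corner (x, i))))

variable {δ : Deletion n k n' k'} {T : Tangle n k} {T' : Tangle n' k'}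
    {S : List (Fin n)} {B : List (Fin (k + 1))} {r : Fin n}
    {M : List (Option (Fin (k + 1)) × Option (Fin (k + 1)))}
    {N : List ((Bool ⊕ Fin n) × (Bool ⊕ Fin n))} {D : LinkDiagram}

/-- The new edge that contains an edge of the large diagram. -/
def insertEdge (δ : Deletion n k n' k') (p : D.Crossing × ZMod 4) :
    D.Edge ⊕ Fin (k + 1) → D.Edge ⊕ Fin (k' + 1) :=
  Sum.elim .inl fun a => embEdge D p (δ.g a)

/-- The new region that contains a region of the large diagram. -/
def insertRegion (δ : Deletion n k n' k') (p : D.Crossing × ZMod 4) :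
    D.Region ⊕ Fin n → D.Region ⊕ Fin n' :=
  Sum.elim .inl fun a => embRegion p D.cornerAt (δ.h a)

lemma insertEdge_emb (p : D.Crossing × ZMod 4) (a) :
    δ.insertEdge p (embEdge D p a) = embEdge D p (δ.edge a) := by cases a <;> rfl

lemma insertRegion_emb (p : D.Crossing × ZMod 4) (a) :
    δ.insertRegion p (embRegion p D.cornerAt a) = embRegion p D.cornerAt (δ.region a) := by
  rcases a with a | a <;> rfl

/-- The tables are extended by the identity outside the tangle. `g'` and `h'` choose one survivor in
each class of merged edges or regions; since every survivor is equal or directly related to the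
chosen one, the listed pairs generate precisely the fibres of the deleting maps. -/
theorem Valid.deletesTo (hδ : δ.Valid T T' S B r M N) (hT : T.Valid) (hT' : T'.Valid)
    (p : D.Crossing × ZMod 4) {S' B' M' N'} (hS : S' = {x | ∃ y ∈ S, x = .inr y})
    (hB : B' = {a | ∃ b ∈ B, a = .inr b})
    (hM : ∀ a b, M' a b ↔ ∃ ab ∈ M, a = embEdge D p ab.1 ∧ b = embEdge D p ab.2)
    (hN : ∀ a b, N' a b ↔ ∃ ab ∈ N, a = embRegion p D.cornerAt ab.1 ∧
      b = embRegion p D.cornerAt ab.2) :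
    (insert hT p).DeletesTo (insert hT' p) S' B' (.inr r) M' N' := by
  have hedge : ∀ x i, (insert hT' p).edge x i =
      δ.insertEdge p ((insert hT p).edge (x.map id δ.f) i) := by
    rintro (w | x) i
    · change T'.insEdge p (.inl w, i) = δ.insertEdge p (T.insEdge p (.inl w, i))
      by_cases h : (w, i) = p
      · subst h
        rw [insEdge_p (p := (w, i)), insEdge_p (p := (w, i))]
        change _ = embEdge D _ (δ.g 0)
        rw [hδ.edge_zero]; rfl
      · rw [insEdge_old (d := (w, i)) h, insEdge_old (d := (w, i)) h]; rfl
    · change embEdge D p _ = δ.insertEdge p (embEdge D p _)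
      rw [insertEdge_emb, hδ.edge_map]
  have hcorner : ∀ x i, (insert hT' p).corner x i =
      δ.insertRegion p ((insert hT p).corner (x.map id δ.f) i) := by
    rintro (w | x) i
    · rfl
    · change embRegion p _ _ = δ.insertRegion p (embRegion p _ _)
      rw [insertRegion_emb, hδ.corner_map]
  subst hS hB
  refine ⟨Sum.map id δ.f, δ.insertEdge p, δ.insertRegion p,
    Function.injective_id.sumMap hδ.injective, ?_, ?_, ?_, ?_, ?_, hedge, hcorner, ?_⟩
  · ext x
    rcases x with w | x
    · simp
    · have := hδ.mem_iff x
      simp only [Set.mem_range, Set.mem_compl_iff, Set.mem_ofPred_eq, Sum.inr.injEq,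
        exists_eq_right', this, Sum.exists, not_forall, not_not]
      simp
  · rw [Set.eq_univ_iff_forall]
    rintro (e | a)
    · exact ⟨.inl e, by simp, rfl⟩
    · refine ⟨.inr (δ.g' a), by simpa using (hδ.edge_section a).1, ?_⟩
      change embEdge D p _ = _
      rw [(hδ.edge_section a).2]; rfl
  · have key : ∀ e, e ∉ {a : D.Edge ⊕ Fin (k + 1) | ∃ b ∈ B, a = .inr b} →
        EqvGen M' e ((δ.insertEdge p e).map id δ.g') := by
      rintro (e | a) he
      · exact EqvGen.refl _
      · have h2 : embEdge D p ((δ.g a).map δ.g') = (δ.insertEdge p (.inr a)).map id δ.g' := by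
          change _ = (embEdge D p (δ.g a)).map id δ.g'
          cases δ.g a <;> rfl
        rw [← h2]
        rcases hδ.edge_rel a (fun h => he ⟨a, h, rfl⟩) with h | h | h
        · rw [← h]; exact EqvGen.refl _
        · exact EqvGen.rel _ _ ((hM _ _).2 ⟨_, h, rfl, rfl⟩)
        · exact (EqvGen.rel _ _ ((hM _ _).2 ⟨_, h, rfl, rfl⟩)).symm
    intro e e' he he'
    constructor
    · intro hee
      have h1 := key e he
      rw [hee] at h1
      exact h1.trans _ _ _ ((key e' he').symm)
    · intro hr
      clear he he'
      induction hr with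
      | rel _ _ hr =>
        obtain ⟨ab, hab, rfl, rfl⟩ := (hM _ _).1 hr
        rw [insertEdge_emb, insertEdge_emb, hδ.edge_eq _ hab]
      | refl => rfl
      | symm _ _ _ ih => exact ih.symm
      | trans _ _ _ _ _ ih1 ih2 => exact ih1.trans ih2
  · rw [Set.eq_univ_iff_forall]
    rintro (e | a)
    · exact ⟨.inl e, by simp, rfl⟩
    · refine ⟨.inr (δ.h' a), by simpa using (hδ.region_section a).1, ?_⟩
      change embRegion p _ _ = _
      rw [(hδ.region_section a).2]; rfl
  · have key : ∀ s, s ≠ .inr r → EqvGen N' s ((δ.insertRegion p s).map id δ.h') := by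
      rintro (e | a) he
      · exact EqvGen.refl _
      · have h2 : embRegion p D.cornerAt ((δ.h a).map id δ.h') =
            (δ.insertRegion p (.inr a)).map id δ.h' := by
          change _ = (embRegion p D.cornerAt (δ.h a)).map id δ.h'
          rcases δ.h a with b | b <;> rfl
        rw [← h2]
        rcases hδ.region_rel a (fun h => he (congrArg Sum.inr h)) with h | ⟨ab, h, h3, h4⟩ | ⟨ab, h, h3, h4⟩
        · rw [← h]; exact EqvGen.refl _
        · rw [← h4]
          exact EqvGen.rel _ _ ((hN _ _).2 ⟨_, h, by rw [h3]; rfl, rfl⟩)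
        · rw [← h4]
          exact (EqvGen.rel _ _ ((hN _ _).2 ⟨_, h, rfl, by rw [h3]; rfl⟩)).symm
    intro e e' he he'
    constructor
    · intro hee
      have h1 := key e he
      rw [hee] at h1
      exact h1.trans _ _ _ ((key e' he').symm)
    · intro hr
      clear he he'
      induction hr with
      | rel _ _ hr =>
        obtain ⟨ab, hab, rfl, rfl⟩ := (hN _ _).1 hr
        rw [insertRegion_emb, insertRegion_emb, hδ.region_eq _ hab]
      | refl => rfl
      | symm _ _ _ ih => exact ih.symm
      | trans _ _ _ _ _ ih1 ih2 => exact ih1.trans ih2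
  · rintro (e | a) he
    · by_cases hl : D.IsFreeLoop e
      · change (insert hT' p).sides (.inl e) = _
        rw [insert_sides_loop p hT hl, insert_sides_loop p hT' hl, Sym2.map_map]
        rfl
      · simp only [LinkDiagram.IsFreeLoop, not_forall, not_not] at hl
        obtain ⟨x, i, rfl⟩ := hl
        -- The tangle separates the end `p` from its old edge, but the mate of `p` still lies on it.
        have hd : ∃ d, d ≠ p ∧ D.edgeAt d = D.edge x i := by
          by_cases hx : (x, i) = p
          · exact ⟨D.mate p, D.mate_ne p, by rw [← hx, D.edgeAt_mate]; rfl⟩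
          · exact ⟨_, hx, rfl⟩
        obtain ⟨d, hd, hde⟩ := hd
        rw [← hde]
        have h1 : (insert hT p).sides (.inl (D.edgeAt d)) =
            s(.inl (D.cornerAt d), .inl (D.cornerAt (cw d))) := by
          rw [← insEdge_old (T := T) hd]
          exact (insert hT p).sides_edgeAt (.inl d.1, d.2)
        have h2 : (insert hT' p).sides (.inl (D.edgeAt d)) =
            s(.inl (D.cornerAt d), .inl (D.cornerAt (cw d))) := by
          rw [← insEdge_old (T := T') hd]
          exact (insert hT' p).sides_edgeAt (.inl d.1, d.2)
        change (insert hT' p).sides (.inl (D.edgeAt d)) = _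
        rw [h1, h2]
        rfl
    · obtain ⟨x, i, y, j, hx, hy, hs⟩ := hδ.sides a (fun h => he ⟨a, h, rfl⟩)
      have h1 := (insert hT p).sides_edge (.inr x) i
      have h2 := (insert hT' p).sides_edge (.inr y) j
      rw [insert_edge, insert_corner, insert_corner, insEdge_inr, insCorner_inr, insCorner_inr]
        at h1 h2
      rw [hx] at h1
      rw [hy] at h2
      change (insert hT' p).sides (embEdge D p (δ.g a)) =
        ((insert hT p).sides (embEdge D p (some a))).map _
      rw [h1, h2, Sym2.map_mk]
      change _ = s(δ.insertRegion p (embRegion _ _ _), δ.insertRegion p (embRegion _ _ _))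
      rw [insertRegion_emb, insertRegion_emb]
      rcases hs with ⟨h3, h4⟩ | ⟨h3, h4⟩
      · rw [h3, h4]
      · rw [h3, h4, Sym2.eq_swap]

end Deletion
end Tangle

/-! ### Reidemeister moves inside an inserted tangle -/

open Relation

namespace Tangle

variable {n k n' k' : ℕ} {D : LinkDiagram}

lemma embRegion_eq_inr {Y : Type} {c : D.Crossing × ZMod 4 → Y} {p} {s : Bool ⊕ Fin n} {r} :
    embRegion p c s = .inr r ↔ s = .inr r := by
  rcases s with s | s <;> simp [embRegion]

/-- The inner regions of the tangle carry names `inr`, which occur neither at old corners nor beside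
crossingless circles of `D`. -/
lemma insert_onlyCorners {T : Tangle n k} (hT : T.Valid) (p : D.Crossing × ZMod 4) {x : Fin n} {i r}
    {C : Set (Fin n × ZMod 4)} {C' : Set ((D.Crossing ⊕ Fin n) × ZMod 4)}
    (hr : T.corner (x, i) = .inr r) (hC : ∀ y j, T.corner (y, j) = .inr r → (y, j) ∈ C)
    (hC' : ∀ y j, (y, j) ∈ C → (.inr y, j) ∈ C') :
    (insert hT p).OnlyCorners ((insert hT p).corner (.inr x) i) C' := by
  rw [insert_corner, insCorner_inr, hr]
  constructor
  · rintro (w | y) j h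
    · cases h
    · exact hC' _ _ (hC _ _ (embRegion_eq_inr.1 h))
  · intro e he h
    obtain ⟨f, rfl, hf⟩ := (insert_isFreeLoop p hT).1 he
    rw [insert_sides_loop p hT hf, Sym2.mem_map] at h
    obtain ⟨s, _, hs⟩ := h
    cases hs

/-- The tables `δ` describe the removal of a kink of a tangle. -/
structure KinkRemoval (δ : Deletion n k n' k') (T : Tangle n k) (T' : Tangle n' k') (x : Fin n)
    (i : ZMod 4) (a : Fin (k + 1)) (r : Fin n) : Prop where
  edge_left : T.edge (x, i) = some a
  edge_right : T.edge (x, i + 1) = some a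
  corner : T.corner (x, i) = .inr r
  only : ∀ y j, T.corner (y, j) = .inr r → (y, j) = (x, i)
  valid : δ.Valid T T' [x] [a] r [(T.edge (x, i + 2), T.edge (x, i + 3))] []

theorem KinkRemoval.omega1Down {δ : Deletion n k n' k'} {T : Tangle n k} {T' : Tangle n' k'}
    {x i a r} (h : KinkRemoval δ T T' x i a r) (hT : T.Valid) (hT' : T'.Valid)
    (p : D.Crossing × ZMod 4) : (insert hT p).Omega1Down (insert hT' p) := by
  refine ⟨.inr x, i, ?_, insert_onlyCorners hT p h.corner (C := {(x, i)}) h.only ?_, ?_⟩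
  · rw [insert_edge, insert_edge, insEdge_inr, insEdge_inr, h.edge_left, h.edge_right]
  · rintro y j hy
    cases hy
    rfl
  · have hr : (insert hT p).corner (.inr x) i = .inr r := by
      rw [insert_corner, insCorner_inr, h.corner]; rfl
    rw [hr]
    refine h.valid.deletesTo hT hT' p ?_ ?_ ?_ ?_
    · ext; simp
    · rw [insert_edge, insEdge_inr, h.edge_left]
      ext; simp [embEdge]
    · simp
    · simp

/-- The tables `δ` describe the removal of a bigon of a tangle. -/
structure BigonRemoval (δ : Deletion n k n' k') (T : Tangle n k) (T' : Tangle n' k') (x y : Fin n)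
    (i j : ZMod 4) (a b : Fin (k + 1)) (r : Fin n) : Prop where
  ne : x ≠ y
  edge_x : T.edge (x, i) = some a
  edge_y' : T.edge (y, j + 1) = some a
  edge_y : T.edge (y, j) = some b
  edge_x' : T.edge (x, i + 1) = some b
  parity : (i = 1 ∨ i = 3) ↔ (j + 1 = 1 ∨ j + 1 = 3)
  corner : T.corner (x, i) = .inr r
  only : ∀ z l, T.corner (z, l) = .inr r → (z, l) = (x, i) ∨ (z, l) = (y, j)
  valid : δ.Valid T T' [x, y] [a, b] r [(T.edge (x, i + 2), T.edge (y, j + 3)),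
    (T.edge (x, i + 3), T.edge (y, j + 2))] [(T.corner (x, i + 2), T.corner (y, j + 2))]

theorem BigonRemoval.omega2Down {δ : Deletion n k n' k'} {T : Tangle n k} {T' : Tangle n' k'}
    {x y i j a b r} (h : BigonRemoval δ T T' x y i j a b r) (hT : T.Valid) (hT' : T'.Valid)
    (p : D.Crossing × ZMod 4) : (insert hT p).Omega2Down (insert hT' p) := by
  refine ⟨.inr x, .inr y, i, j, fun hxy => h.ne (Sum.inr.inj hxy), ?_, ?_, h.parity,
    insert_onlyCorners hT p h.corner (C := {(x, i), (y, j)}) h.only ?_, ?_⟩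
  · rw [insert_edge, insert_edge, insEdge_inr, insEdge_inr, h.edge_x, h.edge_y']
  · rw [insert_edge, insert_edge, insEdge_inr, insEdge_inr, h.edge_x', h.edge_y]
  · rintro z l (hz | hz)
    · cases hz; exact .inl rfl
    · cases hz; exact .inr rfl
  · have hr : (insert hT p).corner (.inr x) i = .inr r := by
      rw [insert_corner, insCorner_inr, h.corner]; rfl
    rw [hr]
    refine h.valid.deletesTo hT hT' p ?_ ?_ ?_ ?_
    · ext; simp
    · rw [insert_edge, insEdge_inr, h.edge_x, insert_edge, insEdge_inr, h.edge_y]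
      ext; simp [embEdge]
    · simp
    · simp

/-- The surroundings of `x` after a triangle has been turned over. -/
structure FlippedAt (T T' : Tangle n k) (x y z : Fin n) (i j l : ZMod 4) : Prop where
  edge0 : T'.edge (x, i) = T.edge (y, j + 3)
  edge1 : T'.edge (x, i + 1) = T.edge (z, l + 2)
  edge2 : T'.edge (x, i + 2) = T.edge (x, i)
  edge3 : T'.edge (x, i + 3) = T.edge (x, i + 1)
  corner0 : T'.corner (x, i) = T.corner (y, j + 3)
  corner1 : T'.corner (x, i + 1) = T.corner (z, l + 2)
  corner2 : T'.corner (x, i + 2) = T.corner (x, i)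
  corner3 : T'.corner (x, i + 3) = T.corner (y, j + 2)

/-- A triangle move of a tangle. -/
structure TriangleMove (T T' : Tangle n k) (x y z : Fin n) (i j l : ZMod 4) (r : Fin n) :
    Prop where
  ne_xy : x ≠ y
  ne_yz : y ≠ z
  ne_zx : z ≠ x
  edge_xy : T.edge (x, i) = T.edge (y, j + 1)
  edge_yz : T.edge (y, j) = T.edge (z, l + 1)
  edge_zx : T.edge (z, l) = T.edge (x, i + 1)
  parity : ¬ (((i = 1 ∨ i = 3) ↔ (j = 1 ∨ j = 3)) ∧ ((j = 1 ∨ j = 3) ↔ (l = 1 ∨ l = 3)))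
  corner : T.corner (x, i) = .inr r
  only : ∀ w m, T.corner (w, m) = .inr r → (w, m) = (x, i) ∨ (w, m) = (y, j) ∨ (w, m) = (z, l)
  flip_x : FlippedAt T T' x y z i j l
  flip_y : FlippedAt T T' y z x j l i
  flip_z : FlippedAt T T' z x y l i j
  others : ∀ w, w ≠ x → w ≠ y → w ≠ z → ∀ m,
    T'.edge (w, m) = T.edge (w, m) ∧ T'.corner (w, m) = T.corner (w, m)

lemma FlippedAt.insert {T T' : Tangle n k} {x y z i j l} (h : FlippedAt T T' x y z i j l)
    (hT : T.Valid) (hT' : T'.Valid) (p : D.Crossing × ZMod 4) :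
    (insert hT p).FlippedAt (Tangle.insert hT' p) id id id (.inr x) (.inr y) (.inr z) i j l := by
  obtain ⟨h1, h2, h3, h4, h5, h6, h7, h8⟩ := h
  refine ⟨?_, ?_, ?_, ?_, ?_, ?_, ?_, ?_⟩ <;>
    simp only [id, insEdge_inr, insCorner_inr, *]

theorem TriangleMove.omega3 {T T' : Tangle n k} {x y z i j l r}
    (h : TriangleMove T T' x y z i j l r) (hT : T.Valid) (hT' : T'.Valid)
    (p : D.Crossing × ZMod 4) : (insert hT p).Omega3 (insert hT' p) := by
  refine ⟨.inr x, .inr y, .inr z, i, j, l, ⟨fun e => h.ne_xy (Sum.inr.inj e),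
    fun e => h.ne_yz (Sum.inr.inj e), fun e => h.ne_zx (Sum.inr.inj e), ?_, ?_, ?_, h.parity,
    insert_onlyCorners hT p h.corner (C := {(x, i), (y, j), (z, l)}) h.only ?_⟩,
    Equiv.refl _, Equiv.refl _, Equiv.refl _, h.flip_x.insert hT hT' p, h.flip_y.insert hT hT' p,
    h.flip_z.insert hT hT' p, ?_, ?_⟩
  · simp only [insEdge_inr, h.edge_xy]
  · simp only [insEdge_inr, h.edge_yz]
  · simp only [insEdge_inr, h.edge_zx]
  · rintro w m (hz | hz | hz)
    · cases hz; exact .inl rfl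
    · cases hz; exact .inr (.inl rfl)
    · cases hz; exact .inr (.inr rfl)
  · rintro (w | w) h1 h2 h3 m
    · exact ⟨rfl, rfl⟩
    · obtain ⟨h4, h5⟩ := h.others w (fun e => h1 (congrArg _ e)) (fun e => h2 (congrArg _ e))
        (fun e => h3 (congrArg _ e)) m
      change T'.insEdge p (.inr w, m) = T.insEdge p (.inr w, m) ∧
        T'.insCorner p D.cornerAt (.inr w, m) = T.insCorner p D.cornerAt (.inr w, m)
      simp only [insEdge_inr, insCorner_inr, h4, h5, and_self]
  · intro e he
    obtain ⟨f, rfl, hf⟩ := (insert_isFreeLoop p hT).1 he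
    change (insert hT' p).sides (.inl f) = _
    rw [insert_sides_loop p hT hf, insert_sides_loop p hT' hf, Sym2.map_map]
    rfl

/-- A tangle with a single crossing, which is a kink. -/
structure IsKink (T : Tangle 1 1) (i : ZMod 4) : Prop where
  edge0 : T.edge (0, i) = some 1
  edge1 : T.edge (0, i + 1) = some 1
  corner0 : T.corner (0, i) = .inr 0
  corner1 : ∀ j, j ≠ i → ∃ b, T.corner (0, j) = .inl b
  ends : (T.edge (0, i + 2) = none ∧ T.edge (0, i + 3) = some 0) ∨
    (T.edge (0, i + 2) = some 0 ∧ T.edge (0, i + 3) = none)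

/-- This case stands apart because a `Tangle` has an entry and therefore a crossing: when the last
kink is removed, the result is `D` itself and not an insertion. -/
theorem IsKink.omega1Down {T : Tangle 1 1} {i} (h : IsKink T i) (hT : T.Valid)
    (p : D.Crossing × ZMod 4) : (insert hT p).Omega1Down D := by
  have honly : ∀ y j, T.corner (y, j) = .inr 0 → (y, j) ∈ ({(0, i)} : Set (Fin 1 × ZMod 4)) := by
    intro y j hy
    have : y = 0 := Subsingleton.elim _ _
    subst this
    by_contra hj
    obtain ⟨b, hb⟩ := h.corner1 j (fun e => hj (by rw [e]; rfl))
    rw [hb] at hy; cases hy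
  have hr : (insert hT p).corner (.inr 0) i = .inr 0 := by
    rw [insert_corner, insCorner_inr, h.corner0]; rfl
  have he : (insert hT p).edge (.inr 0) i = .inr 1 := by
    rw [insert_edge, insEdge_inr, h.edge0]; rfl
  refine ⟨.inr 0, i, ?_, insert_onlyCorners hT p h.corner0 (C := {(0, i)}) honly ?_, ?_⟩
  · rw [insert_edge, insert_edge, insEdge_inr, insEdge_inr, h.edge0, h.edge1]
  · rintro y j hy
    cases hy
    rfl
  rw [hr, he]
  have htwo : ∀ a : Fin 2, a = 0 ∨ a = 1 := by decide
  -- Either of the two ends outside the kink may be the entry, and the relation is oriented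
  -- accordingly.
  have hG : ∀ a b : D.Edge ⊕ Fin 2, a = (insert hT p).edge (.inr 0) (i + 2) ∧
      b = (insert hT p).edge (.inr 0) (i + 3) ↔
      (T.edge (0, i + 2) = none ∧ a = .inl (D.edgeAt p) ∧ b = .inr 0) ∨
      (T.edge (0, i + 2) ≠ none ∧ b = .inl (D.edgeAt p) ∧ a = .inr 0) := by
    intro a b
    simp only [insEdge_inr]
    rcases h.ends with ⟨h1, h2⟩ | ⟨h1, h2⟩ <;> rw [h1, h2] <;> simp [embEdge, and_comm]
  refine ⟨.inl, Sum.elim id fun _ => D.edgeAt p, Sum.elim id fun _ => D.cornerAt p,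
    Sum.inl_injective, ?_, ?_, ?_, ?_, ?_, ?_, ?_, ?_⟩
  · ext x
    rcases x with w | x
    · simp
    · have : x = 0 := Subsingleton.elim _ _
      simp [this]
  · rw [Set.eq_univ_iff_forall]
    exact fun e => ⟨.inl e, by simp, rfl⟩
  · intro e e' he he'
    constructor
    · have key : ∀ e, e ∉ ({.inr 1} : Set (D.Edge ⊕ Fin 2)) → EqvGen (fun a b =>
          a = (insert hT p).edge (.inr 0) (i + 2) ∧ b = (insert hT p).edge (.inr 0) (i + 3)) e
          (.inl (Sum.elim id (fun _ => D.edgeAt p) e)) := by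
        rintro (e | a) he
        · exact EqvGen.refl _
        · have ha : a = 0 := (htwo a).resolve_right fun h => he (by rw [h]; rfl)
          subst ha
          by_cases h0 : T.edge (0, i + 2) = none
          · exact EqvGen.symm _ _ (EqvGen.rel _ _ ((hG _ _).2 (.inl ⟨h0, rfl, rfl⟩)))
          · exact EqvGen.rel _ _ ((hG _ _).2 (.inr ⟨h0, rfl, rfl⟩))
      intro hee
      have h1 := key e he
      rw [hee] at h1
      exact h1.trans _ _ _ ((key e' he').symm)
    · intro hr
      clear he he'
      induction hr with
      | rel _ _ hr =>
        rcases (hG _ _).1 hr with ⟨_, rfl, rfl⟩ | ⟨_, rfl, rfl⟩ <;> rfl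
      | refl => rfl
      | symm _ _ _ ih => exact ih.symm
      | trans _ _ _ _ _ ih1 ih2 => exact ih1.trans ih2
  · rw [Set.eq_univ_iff_forall]
    exact fun e => ⟨.inl e, by simp, rfl⟩
  · intro s s' hs hs'
    rcases s with s | a
    · rcases s' with s' | a'
      · constructor
        · rintro rfl; exact EqvGen.refl _
        · intro hr
          have : ∀ a b : D.Region ⊕ Fin 1, EqvGen (fun _ _ => False) a b → a = b := by
            intro a b hr
            induction hr with
            | rel _ _ hr => cases hr
            | refl => rfl
            | symm _ _ _ ih => exact ih.symm
            | trans _ _ _ _ _ ih1 ih2 => exact ih1.trans ih2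
          exact Sum.inl.inj (this _ _ hr)
      · exact absurd (by rw [Subsingleton.elim a' 0]) hs'
    · exact absurd (by rw [Subsingleton.elim a 0]) hs
  · intro x j
    change D.edge x j = Sum.elim id _ (T.insEdge p (.inl x, j))
    by_cases h1 : (x, j) = p
    · subst h1; rw [insEdge_p (p := (x, j))]; rfl
    · rw [insEdge_old (d := (x, j)) h1]; rfl
  · intro x j
    rfl
  · have hside : ∀ d : D.Crossing × ZMod 4, d ≠ p →
        (insert hT p).sides (.inl (D.edgeAt d)) = s(.inl (D.cornerAt d), .inl (D.cornerAt (cw d))) := by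
      intro d hd
      rw [← insEdge_old (T := T) hd]
      exact (insert hT p).sides_edgeAt (.inl d.1, d.2)
    rintro (e | a) he
    · by_cases hl : D.IsFreeLoop e
      · rw [insert_sides_loop p hT hl, Sym2.map_map]
        simp
      · simp only [LinkDiagram.IsFreeLoop, not_forall, not_not] at hl
        obtain ⟨x, j, rfl⟩ := hl
        have hd : ∃ d, d ≠ p ∧ D.edgeAt d = D.edge x j := by
          by_cases hx : (x, j) = p
          · exact ⟨D.mate p, D.mate_ne p, by rw [← hx, D.edgeAt_mate]; rfl⟩
          · exact ⟨_, hx, rfl⟩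
        obtain ⟨d, hd, hde⟩ := hd
        rw [← hde, hside d hd]
        exact D.sides_edgeAt d
    · have ha : a = 0 := (htwo a).resolve_right fun h => he (by rw [h]; rfl)
      subst ha
      have h1 := (insert hT p).sides_edgeAt (.inl p.1, p.2)
      change (insert hT p).sides (T.insEdge p (.inl p.1, p.2)) = _ at h1
      rw [insEdge_p] at h1
      rw [h1]
      exact D.sides_edgeAt p

end Tangle

/-! ### The seven-crossing gadget and its unknotting -/

open Relation

namespace Tangle

variable {n k n' k' : ℕ}

/-- A region of a tangle, from its number in a table. -/
def regionOfNat (m : ℕ) : Bool ⊕ Fin n :=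
  match m with
  | 0 => .inl true
  | 1 => .inl false
  -- The default for numbers out of range is never reached by the tables below.
  | m + 2 => if h : m < n then .inr ⟨m, h⟩ else .inl true

/-- An edge of a tangle, from its number in a table. -/
def edgeOfNat (m : ℕ) : Option (Fin (k + 1)) := if h : m < k + 1 then some ⟨m, h⟩ else none

/-- A tangle given by tables, in which the numbers `0` and `1` stand for the regions on the left
and on the right side. -/
def ofTables (entry : Fin (k + 1) → Fin n × ZMod 4) (edge corner : Fin n → Fin 4 → ℕ)
    (rep : Fin n → Fin n × ZMod 4) : Tangle n k where
  entry := entry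
  edge d := edgeOfNat (edge d.1 d.2)
  corner d := regionOfNat (corner d.1 d.2)
  rep := rep

/-- A deletion given by tables. -/
def Deletion.ofTables (f : Fin n' → Fin n) (g : Fin (k + 1) → ℕ) (g' : Fin (k' + 1) → Fin (k + 1))
    (h : Fin n → ℕ) (h' : Fin n' → Fin n) : Deletion n k n' k' where
  f := f
  g a := edgeOfNat (g a)
  g' := g'
  h r := regionOfNat (h r)
  h' := h'

/-- A tangle, given by tables. -/
def gadget : Tangle 7 13 := ofTables
  ![(0, 0), (1, 0), (2, 1), (3, 0), (4, 1), (5, 0), (6, 1), (2, 2), (1, 3), (6, 0), (5, 1), (0, 1), (3, 3), (4, 2)]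
  ![![0, 11, 1, 12], ![1, 9, 2, 8], ![8, 2, 7, 3], ![3, 13, 4, 12], ![14, 4, 13, 5], ![5, 10, 6, 11], ![9, 6, 10, 7]]
  ![![1, 2, 3, 0], ![2, 4, 5, 3], ![5, 4, 6, 3], ![6, 7, 0, 3], ![0, 7, 6, 1], ![6, 8, 2, 1], ![2, 8, 6, 4]]
  ![(0, 1), (0, 2), (1, 1), (1, 2), (2, 2), (3, 1), (5, 1)]

/-- In the edge tables the number `k + 1`, here `14`, falls outside the range and stands for `none`,
the edge that leaves the tangle. -/
lemma valid_gadget : gadget.Valid := by constructor <;> decide +kernel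

/-- A tangle, given by tables. -/
def tangleA : Tangle 9 17 := ofTables
  ![(0, 0), (1, 0), (2, 1), (3, 0), (4, 1), (5, 0), (6, 1), (2, 2), (8, 0), (7, 0), (1, 3), (6, 0), (5, 1), (0, 1), (7, 1), (8, 3), (3, 3), (4, 2)]
  ![![0, 13, 1, 14], ![1, 11, 2, 10], ![8, 2, 7, 3], ![3, 17, 4, 16], ![18, 4, 17, 5], ![5, 12, 6, 13], ![11, 6, 12, 7], ![9, 14, 10, 15], ![8, 16, 9, 15]]
  ![![1, 2, 3, 0], ![2, 4, 5, 3], ![5, 4, 6, 7], ![6, 8, 0, 7], ![0, 8, 6, 1], ![6, 9, 2, 1], ![2, 9, 6, 4], ![0, 3, 5, 10], ![7, 0, 10, 5]]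
  ![(0, 1), (0, 2), (1, 1), (1, 2), (2, 2), (2, 3), (3, 1), (5, 1), (7, 3)]

lemma valid_tangleA : tangleA.Valid := by constructor <;> decide +kernel

/-- A tangle, given by tables. -/
def tangleB : Tangle 9 17 := ofTables
  ![(1, 0), (0, 0), (2, 1), (3, 0), (4, 1), (5, 0), (6, 1), (2, 2), (8, 0), (1, 3), (7, 0), (6, 0), (5, 1), (7, 1), (0, 1), (8, 3), (3, 3), (4, 2)]
  ![![1, 14, 2, 15], ![0, 10, 1, 9], ![8, 2, 7, 3], ![3, 17, 4, 16], ![18, 4, 17, 5], ![5, 12, 6, 13], ![11, 6, 12, 7], ![10, 13, 11, 14], ![8, 16, 9, 15]]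
  ![![3, 4, 5, 10], ![1, 3, 10, 0], ![5, 4, 6, 7], ![6, 8, 0, 7], ![0, 8, 6, 1], ![6, 9, 2, 1], ![2, 9, 6, 4], ![1, 2, 4, 3], ![7, 0, 10, 5]]
  ![(5, 2), (0, 0), (0, 1), (0, 2), (2, 2), (2, 3), (3, 1), (5, 1), (0, 3)]

lemma valid_tangleB : tangleB.Valid := by constructor <;> decide +kernel

/-- A tangle, given by tables. -/
def tangleC : Tangle 9 17 := ofTables
  ![(1, 0), (2, 1), (0, 0), (3, 0), (4, 1), (5, 0), (6, 1), (8, 0), (2, 2), (1, 3), (7, 0), (6, 0), (5, 1), (7, 1), (8, 3), (0, 1), (3, 3), (4, 2)]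
  ![![2, 15, 3, 16], ![0, 10, 1, 9], ![9, 1, 8, 2], ![3, 17, 4, 16], ![18, 4, 17, 5], ![5, 12, 6, 13], ![11, 6, 12, 7], ![10, 13, 11, 14], ![7, 15, 8, 14]]
  ![![5, 6, 7, 0], ![1, 3, 10, 0], ![10, 3, 5, 0], ![6, 8, 0, 7], ![0, 8, 6, 1], ![6, 9, 2, 1], ![2, 9, 6, 4], ![1, 2, 4, 3], ![6, 5, 3, 4]]
  ![(5, 2), (1, 1), (6, 3), (0, 0), (0, 1), (0, 2), (3, 1), (5, 1), (1, 2)]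

lemma valid_tangleC : tangleC.Valid := by constructor <;> decide +kernel

/-- A tangle, given by tables. -/
def tangleD : Tangle 7 13 := ofTables
  ![(0, 0), (1, 1), (2, 1), (3, 0), (4, 1), (6, 0), (1, 2), (0, 3), (5, 0), (4, 0), (3, 1), (5, 1), (6, 3), (2, 2)]
  ![![0, 8, 1, 7], ![7, 1, 6, 2], ![14, 2, 13, 3], ![3, 10, 4, 11], ![9, 4, 10, 5], ![8, 11, 9, 12], ![5, 13, 6, 12]]
  ![![1, 2, 3, 0], ![3, 2, 4, 0], ![0, 4, 5, 1], ![5, 6, 7, 1], ![7, 6, 5, 8], ![1, 7, 8, 2], ![5, 4, 2, 8]]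
  ![(0, 1), (0, 2), (1, 2), (2, 2), (3, 1), (3, 2), (4, 3)]

lemma valid_tangleD : tangleD.Valid := by constructor <;> decide +kernel

/-- A tangle, given by tables. -/
def tangleE : Tangle 7 13 := ofTables
  ![(0, 0), (1, 1), (2, 1), (4, 1), (3, 0), (6, 0), (1, 2), (0, 3), (4, 0), (5, 0), (5, 1), (3, 1), (6, 3), (2, 2)]
  ![![0, 8, 1, 7], ![7, 1, 6, 2], ![14, 2, 13, 3], ![4, 11, 5, 12], ![8, 3, 9, 4], ![9, 10, 10, 11], ![5, 13, 6, 12]]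
  ![![1, 2, 3, 0], ![3, 2, 4, 0], ![0, 4, 5, 1], ![7, 5, 8, 2], ![1, 5, 7, 2], ![5, 6, 5, 7], ![5, 4, 2, 8]]
  ![(0, 1), (0, 2), (1, 2), (2, 2), (5, 1), (3, 0), (3, 2)]

lemma valid_tangleE : tangleE.Valid := by constructor <;> decide +kernel

/-- A tangle, given by tables. -/
def tangleF : Tangle 5 9 := ofTables
  ![(0, 0), (1, 1), (2, 1), (3, 1), (1, 2), (0, 3), (3, 0), (4, 0), (4, 1), (2, 2)]
  ![![0, 6, 1, 5], ![5, 1, 4, 2], ![10, 2, 9, 3], ![6, 3, 7, 4], ![7, 8, 8, 9]]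
  ![![1, 2, 3, 0], ![3, 2, 4, 0], ![0, 4, 5, 1], ![1, 5, 4, 2], ![5, 6, 5, 4]]
  ![(0, 1), (0, 2), (1, 2), (2, 2), (4, 1)]

lemma valid_tangleF : tangleF.Valid := by constructor <;> decide +kernel

/-- A tangle, given by tables. -/
def tangleG : Tangle 4 7 := ofTables
  ![(0, 0), (1, 1), (2, 1), (3, 1), (1, 2), (0, 3), (3, 0), (2, 2)]
  ![![0, 6, 1, 5], ![5, 1, 4, 2], ![8, 2, 7, 3], ![6, 3, 7, 4]]
  ![![1, 2, 3, 0], ![3, 2, 4, 0], ![0, 4, 5, 1], ![1, 5, 4, 2]]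
  ![(0, 1), (0, 2), (1, 2), (2, 2)]

lemma valid_tangleG : tangleG.Valid := by constructor <;> decide +kernel

/-- A tangle, given by tables. -/
def tangleH : Tangle 2 3 := ofTables
  ![(0, 0), (1, 1), (1, 2), (0, 3)]
  ![![0, 4, 1, 3], ![3, 1, 2, 2]]
  ![![1, 0, 2, 0], ![2, 0, 3, 0]]
  ![(0, 2), (1, 2)]

lemma valid_tangleH : tangleH.Valid := by constructor <;> decide +kernel

/-- A tangle, given by tables. -/
def tangleI : Tangle 1 1 := ofTables
  ![(0, 0), (0, 3)]
  ![![0, 2, 1, 1]]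
  ![![1, 0, 2, 0]]
  ![(0, 2)]

lemma valid_tangleI : tangleI.Valid := by constructor <;> decide +kernel

/-- Read backwards, this is the move Ω₂↑ that adds the crossings `7` and `8` to the gadget. In the
tables of a deletion the entries `0` at deleted edges and regions, here the edges `9`, `15` and the
region `8`, are placeholders. -/
lemma bigonRemoval_tangleA : BigonRemoval
    (.ofTables ![0, 1, 2, 3, 4, 5, 6] ![0, 1, 2, 3, 4, 5, 6, 7, 8, 0, 8, 9, 10, 11, 12, 0, 12, 13] ![0, 1, 2, 3, 4, 5, 6, 7, 8, 11, 12, 13, 14, 17] ![2, 3, 4, 5, 6, 3, 7, 8, 0] ![0, 1, 2, 3, 4, 6, 7] : Deletion 9 17 7 13)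
    tangleA gadget 7 8 3 2 15 9 8 := by
  constructor
  case valid => constructor <;> decide +kernel
  all_goals decide +kernel

lemma triangleMove_tangleA : TriangleMove tangleA tangleB 0 1 7 2 3 1 1 := by
  constructor
  case flip_x | flip_y | flip_z => constructor <;> decide +kernel
  all_goals decide +kernel

lemma triangleMove_tangleB : TriangleMove tangleB tangleC 0 2 8 2 0 3 3 := by
  constructor
  case flip_x | flip_y | flip_z => constructor <;> decide +kernel
  all_goals decide +kernel

lemma bigonRemoval_tangleC : BigonRemoval
    (.ofTables ![1, 2, 4, 5, 6, 7, 8] ![0, 1, 2, 0, 2, 3, 4, 5, 6, 7, 8, 9, 10, 11, 12, 13, 0, 13] ![0, 1, 2, 5, 6, 7, 8, 9, 10, 11, 12, 13, 14, 15] ![7, 2, 8, 4, 5, 0, 4, 6, 3] ![1, 8, 3, 4, 7, 0, 2] : Deletion 9 17 7 13)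
    tangleC tangleD 0 3 2 3 3 16 5 := by
  constructor
  case valid => constructor <;> decide +kernel
  all_goals decide +kernel

lemma triangleMove_tangleD : TriangleMove tangleD tangleE 3 4 5 2 0 1 5 := by
  constructor
  case flip_x | flip_y | flip_z => constructor <;> decide +kernel
  all_goals decide +kernel

lemma bigonRemoval_tangleE : BigonRemoval
    (.ofTables ![0, 1, 2, 4, 5] ![0, 1, 2, 3, 4, 0, 4, 5, 6, 7, 8, 9, 0, 9] ![0, 1, 2, 3, 4, 7, 8, 9, 10, 11] ![2, 3, 4, 5, 6, 4, 0] ![0, 1, 2, 3, 4] : Deletion 7 13 5 9)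
    tangleE tangleF 3 6 2 3 5 12 6 := by
  constructor
  case valid => constructor <;> decide +kernel
  all_goals decide +kernel

lemma kinkRemoval_tangleF : KinkRemoval
    (.ofTables ![0, 1, 2, 3] ![0, 1, 2, 3, 4, 5, 6, 7, 0, 7] ![0, 1, 2, 3, 4, 5, 6, 7] ![2, 3, 4, 5, 0] ![0, 1, 2, 3] : Deletion 5 9 4 7)
    tangleF tangleG 4 1 8 4 := by
  constructor
  case valid => constructor <;> decide +kernel
  all_goals decide +kernel

lemma bigonRemoval_tangleG : BigonRemoval
    (.ofTables ![0, 1] ![0, 1, 2, 0, 2, 3, 4, 0] ![0, 1, 2, 5] ![0, 2, 3, 0] ![1, 2] : Deletion 4 7 2 3)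
    tangleG tangleH 2 3 2 1 7 3 3 := by
  constructor
  case valid => constructor <;> decide +kernel
  all_goals decide +kernel

lemma kinkRemoval_tangleH : KinkRemoval
    (.ofTables ![0] ![0, 1, 0, 1] ![0, 1] ![2, 0] ![0] : Deletion 2 3 1 1)
    tangleH tangleI 1 2 2 1 := by
  constructor
  case valid => constructor <;> decide +kernel
  all_goals decide +kernel

lemma isKink_tangleI : IsKink tangleI 2 := by constructor <;> decide +kernel

/-- The gadget first grows from seven to nine crossings. Two Ω₃-type moves then open a new removable
bigon, and from there the number of crossings only falls: seven, where one more Ω₃-type move is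
made, then five, four, two, one and none. -/
theorem eqvGen_insert_gadget {D : LinkDiagram} (p : D.Crossing × ZMod 4) :
    EqvGen LinkDiagram.NonIncreasingStep (insert valid_gadget p) D := by
  have h1 : ∀ {D D' : LinkDiagram}, D.Omega1Down D' → EqvGen LinkDiagram.NonIncreasingStep D D' :=
    fun h => .rel _ _ (.inr (.inl h))
  have h2 : ∀ {D D' : LinkDiagram}, D.Omega2Down D' → EqvGen LinkDiagram.NonIncreasingStep D D' :=
    fun h => .rel _ _ (.inr (.inr (.inl h)))
  have h3 : ∀ {D D' : LinkDiagram}, D.Omega3 D' → EqvGen LinkDiagram.NonIncreasingStep D D' :=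
    fun h => .rel _ _ (.inr (.inr (.inr h)))
  refine .trans _ _ _ (.symm _ _ (h2
    (bigonRemoval_tangleA.omega2Down valid_tangleA valid_gadget p))) ?_
  refine .trans _ _ _ (h3 (triangleMove_tangleA.omega3 valid_tangleA valid_tangleB p)) ?_
  refine .trans _ _ _ (h3 (triangleMove_tangleB.omega3 valid_tangleB valid_tangleC p)) ?_
  refine .trans _ _ _ (h2 (bigonRemoval_tangleC.omega2Down valid_tangleC valid_tangleD p)) ?_
  refine .trans _ _ _ (h3 (triangleMove_tangleD.omega3 valid_tangleD valid_tangleE p)) ?_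
  refine .trans _ _ _ (h2 (bigonRemoval_tangleE.omega2Down valid_tangleE valid_tangleF p)) ?_
  refine .trans _ _ _ (h1 (kinkRemoval_tangleF.omega1Down valid_tangleF valid_tangleG p)) ?_
  refine .trans _ _ _ (h2 (bigonRemoval_tangleG.omega2Down valid_tangleG valid_tangleH p)) ?_
  refine .trans _ _ _ (h1 (kinkRemoval_tangleH.omega1Down valid_tangleH valid_tangleI p)) ?_
  exact h1 (isKink_tangleI.omega1Down valid_tangleI p)

end Tangle

/-! ### Stuck diagrams, and how gadgets lead to them -/

open Relation

namespace LinkDiagram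

variable {D D' : LinkDiagram}

/-- Two crossings are the corners of a two-sided region `r`, one side of which lies above the
other. -/
def Omega2Config (D : LinkDiagram) (x y : D.Crossing) (i j : ZMod 4) : Prop :=
  x ≠ y ∧ D.edge x i = D.edge y (j + 1) ∧ D.edge y j = D.edge x (i + 1) ∧
    (IsOver i ↔ IsOver (j + 1)) ∧ D.OnlyCorners (D.corner x i) {(x, i), (y, j)}

/-- A region at which a move `Ω₂↓` or `Ω₃` can be made. -/
def IsMovable (D : LinkDiagram) (r : D.Region) : Prop :=
  (∃ x y i j, D.Omega2Config x y i j ∧ D.corner x i = r) ∨ D.IsOmega3Triangle r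

/-- Reduced, and without any region at which a move `Ω₂↓` or `Ω₃` can be made. -/
def IsStuck (D : LinkDiagram) : Prop := D.IsReduced ∧ ∀ r, ¬ D.IsMovable r

lemma Isotopic.numCrossings_eq (h : D.Isotopic D') : D'.numCrossings = D.numCrossings := by
  obtain ⟨f, -⟩ := h
  exact (Nat.card_congr f).symm

lemma isOver_add {i t : ZMod 4} (ht : t = 0 ∨ t = 2) : IsOver (i + t) ↔ IsOver i := by
  unfold IsOver
  rcases ht with rfl | rfl <;> revert i <;> decide

/-- An isomorphism carries over the incidences, and turning the numbering at a crossing by two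
places preserves the parity of the ends. -/
lemma Isotopic.isStuck (h : D.Isotopic D') (hD : D.IsStuck) : D'.IsStuck := by
  obtain ⟨f, g, h, t, ht, he, hc, hs⟩ := h
  have hcoord : ∀ x' i', ∃ x i, x' = f x ∧ i' = i + t x := fun x' i' =>
    ⟨f.symm x', i' - t (f.symm x'), by simp, by simp⟩
  have hc' : ∀ x i k, D'.corner (f x) (i + t x + k) = h (D.corner x (i + k)) := by
    intro x i k
    rw [← hc]; congr 1; ring
  have he' : ∀ x i k, D'.edge (f x) (i + t x + k) = g (D.edge x (i + k)) := by
    intro x i k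
    rw [← he]; congr 1; ring
  have honly : ∀ x i (C : Set (D.Crossing × ZMod 4)) (C' : Set (D'.Crossing × ZMod 4)),
      D'.OnlyCorners (D'.corner (f x) (i + t x)) C' →
      (∀ y j, (f y, j + t y) ∈ C' → (y, j) ∈ C) → D.OnlyCorners (D.corner x i) C := by
    intro x i C C' ho hC
    refine ⟨fun y j hy => hC _ _ (ho.1 _ _ ?_), fun e hl hm => ho.2 (g e) ?_ ?_⟩
    · rw [hc, hc, hy]
    · intro x' i' hx
      obtain ⟨y, j, rfl, rfl⟩ := hcoord x' i'
      rw [he] at hx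
      exact hl _ _ (g.injective hx)
    · rw [hs, hc, Sym2.mem_map]
      exact ⟨_, hm, rfl⟩
  have hmem : ∀ x i y j, ((f y, j + t y) : D'.Crossing × ZMod 4) = (f x, i + t x) →
      (y, j) = (x, i) := by
    intro x i y j hyx
    obtain ⟨h1, h2⟩ := Prod.ext_iff.1 hyx
    have h1 := f.injective h1
    subst h1
    rw [add_left_injective _ h2]
  refine ⟨fun x' i' hx => ?_, fun r => ?_⟩
  · obtain ⟨x, i, rfl, rfl⟩ := hcoord x' i'
    rw [hc, hc'] at hx
    exact hD.1 x i (h.injective hx)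
  · rintro (⟨x', y', i', j', ⟨h1, h2, h3, h4, h5⟩, -⟩ |
      ⟨x', y', z', i', j', k', ⟨h1, h2, h3, h4, h5, h6, h7, h8⟩, -⟩)
    · obtain ⟨x, i, rfl, rfl⟩ := hcoord x' i'
      obtain ⟨y, j, rfl, rfl⟩ := hcoord y' j'
      refine hD.2 (D.corner x i) (.inl ⟨x, y, i, j, ⟨fun e => h1 (by rw [e]), ?_, ?_, ?_, ?_⟩, rfl⟩)
      · rw [he, he'] at h2; exact g.injective h2
      · rw [he, he'] at h3; exact g.injective h3
      · rwa [isOver_add (ht x), show j + t y + 1 = j + 1 + t y by ring, isOver_add (ht y)] at h4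
      · refine honly _ _ _ _ h5 ?_
        rintro z l (hz | hz)
        · exact .inl (hmem _ _ _ _ hz)
        · exact .inr (hmem _ _ _ _ hz)
    · obtain ⟨x, i, rfl, rfl⟩ := hcoord x' i'
      obtain ⟨y, j, rfl, rfl⟩ := hcoord y' j'
      obtain ⟨z, k, rfl, rfl⟩ := hcoord z' k'
      refine hD.2 (D.corner x i) (.inr ⟨x, y, z, i, j, k, ⟨fun e => h1 (by rw [e]),
        fun e => h2 (by rw [e]), fun e => h3 (by rw [e]), ?_, ?_, ?_, ?_, ?_⟩, rfl⟩)
      · rw [he, he'] at h4; exact g.injective h4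
      · rw [he, he'] at h5; exact g.injective h5
      · rw [he, he'] at h6; exact g.injective h6
      · rwa [isOver_add (ht x), isOver_add (ht y), isOver_add (ht z)] at h7
      · refine honly _ _ _ _ h8 ?_
        rintro w l (hz | hz | hz)
        · exact .inl (hmem _ _ _ _ hz)
        · exact .inr (.inl (hmem _ _ _ _ hz))
        · exact .inr (.inr (hmem _ _ _ _ hz))

/-- The two opposite corners beside a kink lie in one region, so a crossing at which Ω₁↓ applies is
nugatory. -/
lemma IsReduced.edge_ne (h : D.IsReduced) (x i) : D.edge x i ≠ D.edge x (i + 1) := by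
  intro he
  have h1 : i + 1 ≠ i := by
    have : ∀ i : ZMod 4, i + 1 ≠ i := by decide
    exact this i
  have h2 := D.corner_eq x (i + 1) x i (fun e => h1 (congrArg Prod.snd e)) he.symm
  refine h x (i + 1) (h2.trans ?_)
  have : ∀ i : ZMod 4, i - 1 = i + 1 + 2 := by decide
  rw [this]

lemma IsStuck.not_omega3 (h : D.IsStuck) : ¬ D.Omega3 D' := by
  rintro ⟨x, y, z, i, j, k, hc, -⟩
  exact h.2 _ (.inr ⟨x, y, z, i, j, k, hc, rfl⟩)

lemma IsStuck.isotopic (h : D.IsStuck) (hs : D.NonIncreasingStep D') : D.Isotopic D' := by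
  rcases hs with hs | ⟨x, i, hx, -⟩ | ⟨x, y, i, j, h1, h2, h3, h4, h5, -⟩ | hs
  · exact hs
  · exact absurd hx (h.1.edge_ne x i)
  · exact absurd (.inl ⟨x, y, i, j, ⟨h1, h2, h3, h4, h5⟩, rfl⟩) (h.2 (D.corner x i))
  · exact absurd hs h.not_omega3

/-- Only isotopies can be made, and they lead to stuck diagrams again. -/
lemma IsStuck.numCrossings_eq (h : D.IsStuck) (hs : ReflTransGen NonIncreasingStep D D') :
    D'.numCrossings = D.numCrossings := by
  suffices D'.IsStuck ∧ D'.numCrossings = D.numCrossings from this.2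
  induction hs with
  | refl => exact ⟨h, rfl⟩
  | tail _ hs ih =>
    have := ih.1.isotopic hs
    exact ⟨this.isStuck ih.1, this.numCrossings_eq.trans ih.2⟩

end LinkDiagram

lemma Link.crossingNumber_le {L : Link} {D : LinkDiagram} (h : L.HasDiagram D) :
    L.crossingNumber ≤ D.numCrossings := Nat.sInf_le ⟨D, h, rfl⟩

lemma Link.HasDiagram.congr {L : Link} {D D' : LinkDiagram} (h : L.HasDiagram D)
    (h' : EqvGen LinkDiagram.NonIncreasingStep D' D) : L.HasDiagram D' :=
  (Quotient.sound (s := LinkDiagram.linkSetoid) h').trans h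

lemma LinkDiagram.IsStuck.isRigidHardDiagram {L : Link} {D : LinkDiagram} (h : D.IsStuck)
    (hL : L.HasDiagram D) (hc : L.crossingNumber < D.numCrossings) : L.IsRigidHardDiagram D := by
  refine ⟨⟨hL, h.1, hc, fun D' hD' hs => ?_⟩, fun ⟨_, h3⟩ => h.not_omega3 h3⟩
  rw [← hD'.2, h.numCrossings_eq hs] at hc
  exact hc.ne rfl

namespace Tangle

open LinkDiagram

variable {D : LinkDiagram}

/-- That opposite corners differ in the table is not enough: after insertion they are certain to
differ only if one of them is an inner region, as `embRegion` need not separate the left region from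
the right one. -/
lemma gadget_inner (x : Fin 7) (i : ZMod 4) : gadget.corner (x, i) ≠ gadget.corner (x, i + 2) ∧
    ((gadget.corner (x, i)).isRight = true ∨ (gadget.corner (x, i + 2)).isRight = true) := by
  revert x i; decide +kernel

/-- The inner two-sided regions alternate: neither side lies above the other at both crossings. -/
lemma gadget_bigon : ∀ (x : Fin 7) (i : ZMod 4) (y : Fin 7) (j : ZMod 4),
    gadget.edge (x, i) = gadget.edge (y, j + 1) → gadget.edge (y, j) = gadget.edge (x, i + 1) →
    x ≠ y → (gadget.corner (x, i)).isRight = true →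
    ¬ ((i = 1 ∨ i = 3) ↔ (j + 1 = 1 ∨ j + 1 = 3)) := by
  decide +kernel

/-- The inner triangles are cyclic, each side passing over the next. The hypotheses are interspersed
with the quantifiers so that most cases are discarded early. -/
lemma gadget_triangle : ∀ (x : Fin 7) (i : ZMod 4) (y : Fin 7) (j : ZMod 4),
    gadget.edge (x, i) = gadget.edge (y, j + 1) → x ≠ y → (gadget.corner (x, i)).isRight = true →
    ∀ (z : Fin 7) (l : ZMod 4), gadget.edge (y, j) = gadget.edge (z, l + 1) →
    gadget.edge (z, l) = gadget.edge (x, i + 1) → y ≠ z → z ≠ x →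
    ((i = 1 ∨ i = 3) ↔ (j = 1 ∨ j = 3)) ∧ ((j = 1 ∨ j = 3) ↔ (l = 1 ∨ l = 3)) := by
  decide +kernel

/-- Three corners of the gadget in the left region, and in the next lemma three in the right one.
Together with the corner of `D` beside the edge this gives four, too many for a two-sided or a
triangular region. -/
lemma gadget_left : gadget.corner (0, 3) = .inl true ∧ gadget.corner (3, 2) = .inl true ∧
    gadget.corner (4, 0) = .inl true := by decide +kernel

lemma gadget_right : gadget.corner (0, 0) = .inl false ∧ gadget.corner (4, 3) = .inl false ∧
    gadget.corner (5, 3) = .inl false := by decide +kernel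

variable (p : D.Crossing × ZMod 4)

lemma embRegion_isRight {n : ℕ} {Y : Type} (c : D.Crossing × ZMod 4 → Y) (r : Bool ⊕ Fin n) :
    (embRegion p c r).isRight = r.isRight := by cases r <;> rfl

lemma isReduced_insert_gadget (h : D.IsReduced) : (insert valid_gadget p).IsReduced := by
  rintro (w | x) i hx
  · exact h w i (Sum.inl.inj hx)
  · change embRegion p D.cornerAt (gadget.corner (x, i)) =
      embRegion p D.cornerAt (gadget.corner (x, i + 2)) at hx
    obtain ⟨h1, h2⟩ := gadget_inner x i
    have h3 := congrArg Sum.isRight hx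
    rw [embRegion_isRight, embRegion_isRight] at h3
    have h4 : (gadget.corner (x, i)).isRight = true := by
      rcases h2 with h2 | h2
      · exact h2
      · rw [h3, h2]
    obtain ⟨r, hr⟩ := Sum.isRight_iff.1 h4
    rw [hr] at hx
    exact h1 (hr.trans (embRegion_eq_inr.1 hx.symm).symm)

lemma embEdge_injective {k : ℕ} : Function.Injective (embEdge D p (k := k)) := by
  rintro (_ | a) (_ | b) h <;> simp_all [embEdge]

lemma insert_edge_inl {n k : ℕ} {T : Tangle n k} (hT : T.Valid) {x y : D.Crossing} {i j}
    (h : (insert hT p).edge (.inl x) i = (insert hT p).edge (.inl y) j) :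
    D.edge x i = D.edge y j := by
  classical
  change (if (x, i) = p then Sum.inr 0 else Sum.inl (D.edge x i)) =
    (if (y, j) = p then Sum.inr 0 else Sum.inl (D.edge y j)) at h
  split_ifs at h with h1 h2
  · rw [← h2, Prod.mk.injEq] at h1
    rw [h1.1, h1.2]
  · exact Sum.inl.inj h

lemma card_le_of_onlyCorners {D : LinkDiagram} {r : D.Region} {C : Finset (D.Crossing × ZMod 4)}
    (h : D.OnlyCorners r C) {ι : Type} [Fintype ι] (s : ι → D.Crossing × ZMod 4)
    (hs : Function.Injective s) (hr : ∀ a, D.cornerAt (s a) = r) : Fintype.card ι ≤ C.card := by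
  classical
  rw [← Finset.card_univ]
  exact Finset.card_le_card_of_injOn s (fun a _ => by exact_mod_cast h.1 _ _ (hr a)) hs.injOn

lemma insert_gadget_not_onlyCorners {C : Finset ((D.Crossing ⊕ Fin 7) × ZMod 4)} (hC : C.card ≤ 3) :
    ¬ (insert valid_gadget p).OnlyCorners (.inl (D.cornerAt p)) C ∧
    ¬ (insert valid_gadget p).OnlyCorners (.inl (D.cornerAt (cw p))) C := by
  constructor
  · intro h
    have := card_le_of_onlyCorners (D := insert valid_gadget p) h (ι := Fin 4)
      ![(.inl p.1, p.2), (.inr 0, 3), (.inr 3, 2), (.inr 4, 0)]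
      (by
        intro a b hab
        fin_cases a <;> fin_cases b <;> first | rfl | (exfalso; revert hab; simp))
      (by
        obtain ⟨h1, h2, h3⟩ := gadget_left
        intro a
        fin_cases a
        · rfl
        · exact congrArg (embRegion p D.cornerAt) h1
        · exact congrArg (embRegion p D.cornerAt) h2
        · exact congrArg (embRegion p D.cornerAt) h3)
    rw [Fintype.card_fin] at this
    omega
  · intro h
    have := card_le_of_onlyCorners (D := insert valid_gadget p) h (ι := Fin 4)
      ![(.inl (cw p).1, (cw p).2), (.inr 0, 0), (.inr 4, 3), (.inr 5, 3)]
      (by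
        intro a b hab
        fin_cases a <;> fin_cases b <;> first | rfl | (exfalso; revert hab; simp))
      (by
        obtain ⟨h1, h2, h3⟩ := gadget_right
        intro a
        fin_cases a
        · rfl
        · exact congrArg (embRegion p D.cornerAt) h1
        · exact congrArg (embRegion p D.cornerAt) h2
        · exact congrArg (embRegion p D.cornerAt) h3)
    rw [Fintype.card_fin] at this
    omega

lemma onlyCorners_of_insert {n k : ℕ} {T : Tangle n k} (hT : T.Valid) {r : D.Region}
    {C : Set (D.Crossing × ZMod 4)} {C' : Set ((D.Crossing ⊕ Fin n) × ZMod 4)}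
    (h : (insert hT p).OnlyCorners (.inl r) C') (hC : ∀ x i, (.inl x, i) ∈ C' → (x, i) ∈ C) :
    D.OnlyCorners r C := by
  refine ⟨fun x i hx => hC _ _ (h.1 (.inl x) i (congrArg Sum.inl hx)), fun e he hr => ?_⟩
  refine h.2 (.inl e) ((insert_isFreeLoop p hT).2 ⟨e, rfl, he⟩) ?_
  rw [insert_sides_loop p hT he, Sym2.mem_map]
  exact ⟨r, hr, rfl⟩

/-- A movable region of the new diagram is not inner, by the tables, and not beside the gadget, by
the count of corners. All its crossings and sides then belong to `D`, where they show the same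
configuration. So the insertion creates no movable region and destroys those beside the edge. -/
lemma isMovable_insert_gadget {s} (h : (insert valid_gadget p).IsMovable s) :
    ∃ r, s = .inl r ∧ D.IsMovable r ∧ r ≠ D.cornerAt p ∧ r ≠ D.cornerAt (cw p) := by
  classical
  have hnext : ∀ x i y j, x ≠ y → (insert valid_gadget p).edge x i =
      (insert valid_gadget p).edge y (j + 1) →
      (insert valid_gadget p).corner y j = (insert valid_gadget p).corner x i := by
    intro x i y j hxy he
    rw [(insert valid_gadget p).corner_eq x i y (j + 1) (fun e => hxy (congrArg Prod.fst e)) he,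
      add_sub_cancel_right]
  have hcorner : ∀ r, s = .inl r → r ≠ D.cornerAt p → r ≠ D.cornerAt (cw p) → ∀ x i,
      (insert valid_gadget p).corner x i = s → ∃ w, x = .inl w ∧ D.corner w i = r := by
    rintro r hs h1 h2 (w | x) i hx
    · exact ⟨w, rfl, Sum.inl.inj (hx.trans hs)⟩
    · exfalso
      change embRegion p D.cornerAt (gadget.corner (x, i)) = s at hx
      rw [hs] at hx
      rcases hr : gadget.corner (x, i) with (_ | _) | b <;> rw [hr] at hx
      · exact h2 (Sum.inl.inj hx).symm
      · exact h1 (Sum.inl.inj hx).symm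
      · cases hx
  have hinner : ∀ x i, (insert valid_gadget p).corner x i = s → ∀ a, s = .inr a →
      ∃ y, x = .inr y ∧ (gadget.corner (y, i)).isRight = true := by
    rintro (w | x) i hx a ha
    · rw [ha] at hx; cases hx
    · refine ⟨x, rfl, ?_⟩
      change embRegion p D.cornerAt (gadget.corner (x, i)) = s at hx
      rw [← embRegion_isRight p D.cornerAt, hx, ha]; rfl
  rcases h with ⟨x, y, i, j, ⟨h1, h2, h3, h4, h5⟩, rfl⟩ |
      ⟨x, y, z, i, j, k, ⟨h1, h2, h3, h4, h5, h6, h7, h8⟩, rfl⟩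
  · have hy := hnext x i y j h1 h2
    rcases hs : (insert valid_gadget p).corner x i with r | a
    · have h6 := insert_gadget_not_onlyCorners p (C := {(x, i), (y, j)})
        (Finset.card_le_two.trans (by norm_num))
      rw [hs] at h5
      have h7 : r ≠ D.cornerAt p := by
        rintro rfl; exact h6.1 (by simpa using h5)
      have h8 : r ≠ D.cornerAt (cw p) := by
        rintro rfl; exact h6.2 (by simpa using h5)
      obtain ⟨x, rfl, hx⟩ := hcorner r hs h7 h8 x i rfl
      obtain ⟨y, rfl, -⟩ := hcorner r hs h7 h8 y j hy
      refine ⟨r, rfl, .inl ⟨x, y, i, j, ⟨fun e => h1 (by rw [e]), insert_edge_inl p _ h2,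
        insert_edge_inl p _ h3, h4, ?_⟩, hx⟩, h7, h8⟩
      rw [hx]
      refine onlyCorners_of_insert p _ h5 ?_
      rintro w l (hw | hw) <;> cases hw
      · exact .inl rfl
      · exact .inr rfl
    · exfalso
      obtain ⟨x, rfl, hx⟩ := hinner x i rfl a hs
      obtain ⟨y, rfl, -⟩ := hinner y j hy a hs
      exact gadget_bigon x i y j (embEdge_injective p h2) (embEdge_injective p h3)
        (fun e => h1 (by rw [e])) hx h4
  · have hy := hnext x i y j h1 h4
    have hz := (hnext y j z k h2 h5).trans hy
    rcases hs : (insert valid_gadget p).corner x i with r | a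
    · have h9 := insert_gadget_not_onlyCorners p (C := {(x, i), (y, j), (z, k)})
        Finset.card_le_three
      rw [hs] at h8
      have h10 : r ≠ D.cornerAt p := by
        rintro rfl; exact h9.1 (by simpa using h8)
      have h11 : r ≠ D.cornerAt (cw p) := by
        rintro rfl; exact h9.2 (by simpa using h8)
      obtain ⟨x, rfl, hx⟩ := hcorner r hs h10 h11 x i rfl
      obtain ⟨y, rfl, -⟩ := hcorner r hs h10 h11 y j hy
      obtain ⟨z, rfl, -⟩ := hcorner r hs h10 h11 z k hz
      refine ⟨r, rfl, .inr ⟨x, y, z, i, j, k, ⟨fun e => h1 (by rw [e]), fun e => h2 (by rw [e]),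
        fun e => h3 (by rw [e]), insert_edge_inl p _ h4, insert_edge_inl p _ h5,
        insert_edge_inl p _ h6, h7, ?_⟩, hx⟩, h10, h11⟩
      rw [hx]
      refine onlyCorners_of_insert p _ h8 ?_
      rintro w l (hw | hw | hw) <;> cases hw
      · exact .inl rfl
      · exact .inr (.inl rfl)
      · exact .inr (.inr rfl)
    · exfalso
      obtain ⟨x, rfl, hx⟩ := hinner x i rfl a hs
      obtain ⟨y, rfl, -⟩ := hinner y j hy a hs
      obtain ⟨z, rfl, -⟩ := hinner z k hz a hs
      exact h7 (gadget_triangle x i y j (embEdge_injective p h4)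
        (fun e => h1 (by rw [e])) hx z k (embEdge_injective p h5) (embEdge_injective p h6)
        (fun e => h2 (by rw [e])) (fun e => h3 (by rw [e])))

end Tangle

namespace LinkDiagram

open Tangle

/-- The number of regions at which a move `Ω₂↓` or `Ω₃` can be made. -/
noncomputable def numMovable (D : LinkDiagram) : ℕ := {r | D.IsMovable r}.ncard

/-- Only the region on one side of the edge is counted as destroyed; this is enough for the bound.
-/
lemma numMovable_insert_gadget_le {D : LinkDiagram} (p : D.Crossing × ZMod 4) :
    (insert valid_gadget p).numMovable ≤ ({r | D.IsMovable r} \ {D.cornerAt p}).ncard := by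
  rw [← Set.ncard_image_of_injective _ (Sum.inl_injective (α := D.Region) (β := Fin 7))]
  refine Set.ncard_le_ncard ?_ (Set.toFinite _)
  intro s hs
  obtain ⟨r, rfl, h1, h2, -⟩ := isMovable_insert_gadget p hs
  exact ⟨r, ⟨h1, h2⟩, rfl⟩

/-- Each gadget is inserted beside a movable region that is still present, and it lowers their
number by at least one. -/
lemma exists_isStuck_of_numMovable_le (m : ℕ) (D : LinkDiagram) (hD : D.IsReduced)
    (hm : D.numMovable ≤ m) : ∃ D' : LinkDiagram, EqvGen NonIncreasingStep D' D ∧ D'.IsStuck ∧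
      D.numCrossings ≤ D'.numCrossings ∧ D'.numCrossings ≤ D.numCrossings + 7 * m := by
  induction m generalizing D with
  | zero =>
    refine ⟨D, .refl _, ⟨hD, fun r hr => ?_⟩, le_rfl, by omega⟩
    have := (Set.ncard_eq_zero (Set.toFinite _)).1 (Nat.le_zero.1 hm)
    exact (Set.ext_iff.1 this r).1 hr
  | succ m ih =>
    by_cases h : ∃ r, D.IsMovable r
    · obtain ⟨r, hr⟩ := h
      obtain ⟨p, hp⟩ : ∃ p, D.cornerAt p = r := by
        rcases hr with ⟨x, y, i, j, -, hx⟩ | ⟨x, y, z, i, j, k, -, hx⟩ <;> exact ⟨(x, i), hx⟩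
      obtain ⟨D', h1, h2, h3, h4⟩ := ih (insert valid_gadget p) (isReduced_insert_gadget p hD) (by
        refine (numMovable_insert_gadget_le p).trans ?_
        rw [hp, Set.ncard_sdiff_singleton_of_mem (s := {r | D.IsMovable r}) hr]
        unfold numMovable at hm
        omega)
      rw [numCrossings_insert] at h3 h4
      exact ⟨D', h1.trans _ _ _ (eqvGen_insert_gadget p), h2, by omega, by omega⟩
    · push Not at h
      exact ⟨D, .refl _, ⟨hD, h⟩, le_rfl, by omega⟩

theorem exists_isStuck {D : LinkDiagram} (hX : Nonempty D.Crossing) (hD : D.IsReduced) :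
    ∃ D' : LinkDiagram, EqvGen NonIncreasingStep D' D ∧ D'.IsStuck ∧
      D.numCrossings < D'.numCrossings ∧
      D'.numCrossings ≤ D.numCrossings + 7 * max 1 D.numMovable := by
  -- The first gadget is inserted in any case, so that the number of crossings becomes strictly
  -- larger. This is the origin of `max 1`.
  obtain ⟨p, hp⟩ : ∃ p, (insert valid_gadget (D := D) p).numMovable ≤ max 1 D.numMovable - 1 := by
    by_cases h : ∃ r, D.IsMovable r
    · obtain ⟨r, hr⟩ := h
      obtain ⟨p, hp⟩ : ∃ p, D.cornerAt p = r := by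
        rcases hr with ⟨x, y, i, j, -, hx⟩ | ⟨x, y, z, i, j, k, -, hx⟩ <;> exact ⟨(x, i), hx⟩
      refine ⟨p, (numMovable_insert_gadget_le p).trans ?_⟩
      rw [hp, Set.ncard_sdiff_singleton_of_mem (s := {r | D.IsMovable r}) hr]
      unfold numMovable
      omega
    · push Not at h
      refine ⟨(Classical.choice hX, 0), (numMovable_insert_gadget_le _).trans ?_⟩
      have : {r | D.IsMovable r} = ∅ := Set.eq_empty_iff_forall_notMem.2 h
      rw [this]
      simp
  obtain ⟨D', h1, h2, h3, h4⟩ := exists_isStuck_of_numMovable_le _ (insert valid_gadget p)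
    (isReduced_insert_gadget p hD) hp
  rw [numCrossings_insert] at h3 h4
  exact ⟨D', h1.trans _ _ _ (eqvGen_insert_gadget p), h2, by omega, by omega⟩

end LinkDiagram

/-! ### Making a diagram reduced, and the first statement -/

open Relation

namespace LinkDiagram

variable {D : LinkDiagram}

/-- The crossing `x` is nugatory, with the opposite corners `i` and `i + 2` in one region. -/
def IsNugatory (D : LinkDiagram) (x : D.Crossing) (i : ZMod 4) : Prop :=
  D.corner x i = D.corner x (i + 2)

lemma isNugatory_add_two {x i} : D.IsNugatory x (i + 2) ↔ D.IsNugatory x i := by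
  have : ∀ i : ZMod 4, i + 2 + 2 = i := by decide
  unfold IsNugatory
  rw [this, eq_comm]

open Classical in
/-- The weight of a crossing, according to its opposite corners that belong to one region. -/
noncomputable def defectAt (D : LinkDiagram) (x : D.Crossing) : ℕ :=
  if D.IsNugatory x 0 then if D.IsNugatory x 1 then 4 else 1 else if D.IsNugatory x 1 then 1 else 0

open Classical in
lemma defectAt_eq (x : D.Crossing) (i) : D.defectAt x = if D.IsNugatory x i then
    if D.IsNugatory x (i + 1) then 4 else 1 else if D.IsNugatory x (i + 1) then 1 else 0 := by
  have h2 : D.IsNugatory x 2 ↔ D.IsNugatory x 0 := isNugatory_add_two (i := 0)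
  have h3 : D.IsNugatory x 3 ↔ D.IsNugatory x 1 := isNugatory_add_two (i := 1)
  have e1 : (1 : ZMod 4) + 1 = 2 := by decide
  have e2 : (2 : ZMod 4) + 1 = 3 := by decide
  have e3 : (3 : ZMod 4) + 1 = 0 := by decide
  have : ∀ i : ZMod 4, i = 0 ∨ i = 1 ∨ i = 2 ∨ i = 3 := by decide
  unfold defectAt
  rcases this i with rfl | rfl | rfl | rfl <;> simp only [e1, e2, e3, h2, h3, zero_add] <;>
    split_ifs <;> rfl

/-- The total weight of the nugatory crossings. -/
noncomputable def defect (D : LinkDiagram) : ℕ := ∑ᶠ x, D.defectAt x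

lemma adjacent_corner (x : D.Crossing) (i) : D.Adjacent (x, i) (x, i + 1) where
  ne h := by
    have : ∀ i : ZMod 4, i ≠ i + 1 := by decide
    exact this i (congrArg Prod.snd h)
  adj := .inl (by simp [cw])

/-- One strand at `x` is pushed across the other at the corner `i`. This corner then lies in a small
region of its own, so that `x` is no longer nugatory with respect to `i` and `i + 2`. Each of the
two new crossings is nugatory, in one direction, exactly if `x` is nugatory at `i + 1` too. So the
weight falls from `4` to `1 + 1 + 1` or from `1` to `0`, which is the reason for the weight `4`. -/
lemma defect_push_lt {x : D.Crossing} {i} (h : D.IsNugatory x i) :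
    (push (adjacent_corner x i) 0).defect < D.defect := by
  classical
  have e2 : ∀ i : ZMod 4, i + 2 ≠ i := by decide
  have e1 : ∀ i : ZMod 4, i + 1 ≠ i := by decide
  have e3 : ∀ i : ZMod 4, i + 1 + 2 ≠ i := by decide
  have e4 : ∀ i : ZMod 4, i - 1 = i + 1 + 2 := by decide
  have e5 : ∀ i : ZMod 4, i + 1 - 1 = i := by decide
  have hcp : cw (x, i + 1) = (x, i) := by simp [cw]
  have hold : ∀ w j, (w, j) ≠ (x, i) → (push (adjacent_corner x i) 0).corner (.inl w) j =
      .inl (D.corner w j) := fun w j hw =>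
    pushCorner_old (d := (w, j)) hw (by rw [hcp]; exact hw) 0
  have hnear : (push (adjacent_corner x i) 0).corner (.inl x) i = .inr false :=
    pushCorner_near (d := (x, i)) (.inl rfl) 0
  have hw : ∀ w, w ≠ x → (push (adjacent_corner x i) 0).defectAt (.inl w) = D.defectAt w := by
    intro w hw
    have : ∀ j, (push (adjacent_corner x i) 0).IsNugatory (.inl w) j ↔ D.IsNugatory w j := by
      intro j
      unfold IsNugatory
      rw [hold w j (fun e => hw (congrArg Prod.fst e)),
        hold w _ (fun e => hw (congrArg Prod.fst e))]
      exact Sum.inl_injective.eq_iff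
    unfold defectAt
    simp only [this]
  have hx0 : ¬ (push (adjacent_corner x i) 0).IsNugatory (.inl x) i := by
    unfold IsNugatory
    rw [hnear, hold x (i + 2) (fun e => e2 i (congrArg Prod.snd e))]
    exact Sum.inr_ne_inl
  have hx1 : (push (adjacent_corner x i) 0).IsNugatory (.inl x) (i + 1) ↔
      D.IsNugatory x (i + 1) := by
    unfold IsNugatory
    rw [hold x _ (fun e => e1 i (congrArg Prod.snd e)),
      hold x _ (fun e => e3 i (congrArg Prod.snd e))]
    exact Sum.inl_injective.eq_iff
  have hy0 : ¬ (push (adjacent_corner x i) 0).IsNugatory (.inr false) 0 := by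
    unfold IsNugatory
    rw [push_corner, push_corner, pushCorner_y0, pushCorner_y2]
    simp
  have hy1 : (push (adjacent_corner x i) 0).IsNugatory (.inr false) (0 + 1) ↔
      D.IsNugatory x (i + 1) := by
    unfold IsNugatory
    rw [push_corner, push_corner, pushCorner_y1, show (0 : ZMod 4) + 1 + 2 = 0 + 3 by decide,
      pushCorner_y3, Sum.inl_injective.eq_iff]
    simp only [cw, cornerAt, e4]
    exact eq_comm
  have hz0 : (push (adjacent_corner x i) 0).IsNugatory (.inr true) 0 ↔
      D.IsNugatory x (i + 1) := by
    unfold IsNugatory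
    rw [push_corner, push_corner, pushCorner_z0, pushCorner_z2, Sum.inl_injective.eq_iff]
    simp only [cw, cornerAt, e4]
  have hz1 : ¬ (push (adjacent_corner x i) 0).IsNugatory (.inr true) (0 + 1) := by
    unfold IsNugatory
    rw [push_corner, push_corner, pushCorner_z1, show (0 : ZMod 4) + 1 + 2 = 0 + 3 by decide,
      pushCorner_z3]
    simp
  let := Fintype.ofFinite D.Crossing
  unfold defect
  rw [finsum_eq_sum_of_fintype, finsum_eq_sum_of_fintype]
  have hsum : ∑ w, (push (adjacent_corner x i) 0).defectAt w =
      ∑ w, (push (adjacent_corner x i) 0).defectAt (.inl w) +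
      ((push (adjacent_corner x i) 0).defectAt (.inr true) +
      (push (adjacent_corner x i) 0).defectAt (.inr false)) := by
    exact (Fintype.sum_sum_type _).trans (by rw [Fintype.sum_bool])
  have hE : ∑ w ∈ Finset.univ.erase x, (push (adjacent_corner x i) 0).defectAt (.inl w) =
      ∑ w ∈ Finset.univ.erase x, D.defectAt w :=
    Finset.sum_congr rfl fun w hw' => hw w (Finset.ne_of_mem_erase hw')
  rw [hsum, ← Finset.add_sum_erase _ _ (Finset.mem_univ x),
    ← Finset.add_sum_erase _ _ (Finset.mem_univ x),
    hE, defectAt_eq _ i, defectAt_eq (D := D) x i, defectAt_eq (D := push _ 0) (Sum.inr true : D.Crossing ⊕ Bool) 0,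
    defectAt_eq (D := push _ 0) (Sum.inr false : D.Crossing ⊕ Bool) 0, if_neg hx0, if_pos h, if_neg hy0]
  simp only [if_neg hz1]
  by_cases h1 : D.IsNugatory x (i + 1)
  · rw [if_pos (hx1.2 h1), if_pos h1, if_pos (hy1.2 h1), if_pos (hz0.2 h1)]
    omega
  · rw [if_neg (mt hx1.1 h1), if_neg h1, if_neg (mt hy1.1 h1), if_neg (mt hz0.1 h1)]
    omega

/-- Nugatory crossings are not removed but spoiled by additional crossings. This suffices for the
first statement, in which the size of the diagram does not matter. -/
theorem exists_isReduced (hX : Nonempty D.Crossing) : ∃ D' : LinkDiagram,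
    EqvGen NonIncreasingStep D' D ∧ D'.IsReduced ∧ Nonempty D'.Crossing ∧
      D.numCrossings ≤ D'.numCrossings := by
  induction hn : D.defect using Nat.strong_induction_on generalizing D with
  | _ n ih =>
    by_cases h : D.IsReduced
    · exact ⟨D, .refl _, h, hX, le_rfl⟩
    · unfold IsReduced at h
      push Not at h
      obtain ⟨x, i, h⟩ := h
      obtain ⟨D', h1, h2, h3, h4⟩ := ih _ (hn ▸ defect_push_lt h) ⟨(Sum.inr true : D.Crossing ⊕ Bool)⟩ rfl
      rw [numCrossings_push] at h4
      exact ⟨D', h1.trans _ _ _ (.rel _ _ (.inr (.inr (.inl (omega2Down_push _ _))))), h2, h3,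
        by omega⟩

section kink

variable (D) (e : D.Edge) (b : D.Region)

/-- The corners of a crossing with a kink, on a circle between the regions `a` and `b`. -/
def kinkCorner (a b : D.Region) : ZMod 4 → D.Region ⊕ Unit :=
  (![.inr (), .inl b, .inl a, .inl b] : Fin 4 → D.Region ⊕ Unit)

/-- The edges at a crossing with a kink on the circle `e`. -/
def kinkEdge : ZMod 4 → D.Edge ⊕ Unit :=
  (![.inr (), .inr (), .inl e, .inl e] : Fin 4 → D.Edge ⊕ Unit)

variable {D e b}

lemma zmod4_cases (i : ZMod 4) : i = 0 ∨ i = 1 ∨ i = 2 ∨ i = 3 := by revert i; decide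

/-- A figure eight has three faces. The corners `1` and `3` lie on a common one, `0` and `2` each on
its own; `v` numbers the corners accordingly. -/
lemma card_kink_face : Nat.card (Quot fun p q : Unit × ZMod 4 =>
    ∃ j, p ≠ (q.1, j) ∧ D.kinkEdge e p.2 = D.kinkEdge e j ∧ q.2 = j - 1) = 3 := by
  let r : Unit × ZMod 4 → Unit × ZMod 4 → Prop := fun p q =>
    ∃ j, p ≠ (q.1, j) ∧ D.kinkEdge e p.2 = D.kinkEdge e j ∧ q.2 = j - 1
  let v : ZMod 4 → Fin 3 := (![0, 1, 2, 1] : Fin 4 → Fin 3)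
  have hv : ∀ p q, r p q → v p.2 = v q.2 := by
    rintro ⟨⟨⟩, i⟩ ⟨⟨⟩, k⟩ ⟨j, h1, h2, h3⟩
    have h1 : i ≠ j := fun h => h1 (by rw [h])
    dsimp only at h2 h3
    subst h3
    rcases zmod4_cases i with rfl | rfl | rfl | rfl <;>
      rcases zmod4_cases j with rfl | rfl | rfl | rfl <;>
      first | exact absurd rfl h1 | rfl | (cases h2)
  have h13 : Quot.mk r ((), 1) = Quot.mk r ((), 3) := Quot.sound ⟨0, by decide, rfl, by decide⟩
  have : Function.Bijective (Quot.lift (fun p : Unit × ZMod 4 => v p.2) hv) := by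
    constructor
    · intro f g
      induction f using Quot.ind with | _ p
      induction g using Quot.ind with | _ q
      obtain ⟨⟨⟩, i⟩ := p
      obtain ⟨⟨⟩, k⟩ := q
      intro (h : v i = v k)
      rcases zmod4_cases i with rfl | rfl | rfl | rfl <;>
        rcases zmod4_cases k with rfl | rfl | rfl | rfl <;>
        first | rfl | exact h13 | exact h13.symm | exact absurd h (by decide)
    · intro f
      fin_cases f
      · exact ⟨Quot.mk _ ((), 0), rfl⟩
      · exact ⟨Quot.mk _ ((), 1), rfl⟩
      · exact ⟨Quot.mk _ ((), 2), rfl⟩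
  rw [Nat.card_congr (Equiv.ofBijective _ this), Nat.card_eq_fintype_card, Fintype.card_fin]

open Classical in
/-- The diagram after a kink has been added to a circle of a diagram without crossings. -/
noncomputable abbrev addKink (hX : IsEmpty D.Crossing) {a : D.Region} (h : D.sides e = s(a, b)) :
    LinkDiagram where
  Crossing := Unit
  Edge := D.Edge ⊕ Unit
  Region := D.Region ⊕ Unit
  finite_crossing := inferInstance
  finite_edge := inferInstance
  finite_region := inferInstance
  edge _ := D.kinkEdge e
  corner _ := D.kinkCorner a b
  sides := Sum.elim (fun f => (D.sides f).map .inl) fun _ => s(.inr (), .inl b)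
  ends_edge f := by
    rcases f with f | f
    · by_cases hf : f = e
      · right
        rw [← Set.ncard_pair (a := ((), (2 : ZMod 4))) (b := ((), 3)) (by decide)]
        congr 1
        ext ⟨⟨⟩, i⟩
        rcases zmod4_cases i with rfl | rfl | rfl | rfl <;> simp [kinkEdge, hf] <;> decide
      · left
        rw [Set.ncard_eq_zero (Set.toFinite _)]
        ext ⟨⟨⟩, i⟩
        rcases zmod4_cases i with rfl | rfl | rfl | rfl <;> simp [kinkEdge, Ne.symm hf]
    · right
      rw [← Set.ncard_pair (a := ((), (0 : ZMod 4))) (b := ((), 1)) (by decide)]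
      congr 1
      ext ⟨⟨⟩, i⟩
      rcases zmod4_cases i with rfl | rfl | rfl | rfl <;> simp [kinkEdge] <;> decide
  corner_eq := by
    rintro ⟨⟩ i ⟨⟩ j h1 h2
    have h1 : i ≠ j := fun h => h1 (by rw [h])
    rcases zmod4_cases i with rfl | rfl | rfl | rfl <;>
      rcases zmod4_cases j with rfl | rfl | rfl | rfl <;>
      first | exact absurd rfl h1 | rfl | (cases h2)
  sides_edge _ i := by
    rcases zmod4_cases i with rfl | rfl | rfl | rfl
    · rfl
    · exact Sym2.eq_swap
    · change (D.sides e).map (Sum.inl (β := Unit)) = _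
      rw [h]; rfl
    · change (D.sides e).map (Sum.inl (β := Unit)) = _
      rw [h]; exact Sym2.eq_swap
  connected := by
    have hD : ∀ r s : D.Region, ReflTransGen (fun r s => ∃ f : D.Edge ⊕ Unit,
        Sum.elim (fun f => (D.sides f).map .inl) (fun _ => s(.inr (), .inl b)) f = s(r, s))
        (.inl r : D.Region ⊕ Unit) (.inl s) := by
      intro r s
      induction D.connected r s with
      | refl => exact .refl
      | tail _ hf ih =>
        obtain ⟨f, hf⟩ := hf
        exact ih.tail ⟨.inl f, by simp [hf]⟩
    rintro (r | r) (s | s)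
    · exact hD r s
    · exact (hD r b).tail ⟨.inr (), Sym2.eq_swap⟩
    · exact ReflTransGen.head ⟨.inr (), rfl⟩ (hD b s)
    · exact .refl
  euler := by
    have h1 := D.euler'
    have h2 : Nat.card {f : D.Edge // D.IsFreeLoop f} = Nat.card D.Edge := by
      refine Nat.card_congr (Equiv.subtypeUnivEquiv fun f x => hX.elim x)
    have h3 : Nat.card D.Face = 0 := by
      have : IsEmpty D.Face := ⟨fun f => hX.elim (Quot.exists_rep f).choose.1⟩
      exact Nat.card_of_isEmpty
    have h4 : Nat.card D.Crossing = 0 := Nat.card_of_isEmpty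
    have h5 : Nat.card {f : D.Edge ⊕ Unit // ∀ (_ : Unit) i, D.kinkEdge e i ≠ f} =
        Nat.card D.Edge - 1 := by
      have : Nat.card {f : D.Edge ⊕ Unit // ∀ (_ : Unit) i, D.kinkEdge e i ≠ f} =
          Nat.card ({e}ᶜ : Set D.Edge) := by
        have hk : ∀ f : ({e}ᶜ : Set D.Edge), ∀ (_ : Unit) i, D.kinkEdge e i ≠ .inl f.1 := by
          intro f _ i hi
          rcases zmod4_cases i with rfl | rfl | rfl | rfl
          · cases hi
          · cases hi
          · exact f.2 (Sum.inl.inj hi).symm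
          · exact f.2 (Sum.inl.inj hi).symm
        refine (Nat.card_congr (Equiv.ofBijective (fun f : ({e}ᶜ : Set D.Edge) =>
          ⟨.inl f.1, hk f⟩) ⟨fun f g hfg => ?_, ?_⟩)).symm
        · simpa [Subtype.ext_iff] using hfg
        · rintro ⟨f | f, hf⟩
          · exact ⟨⟨f, fun he => hf () 2 (congrArg _ (Eq.symm he))⟩, rfl⟩
          · exact absurd rfl (hf () 0)
      rw [this, Nat.card_coe_set_eq, Set.ncard_compl, Set.ncard_singleton]
    have h6 : 0 < Nat.card D.Edge := Nat.card_pos_iff.2 ⟨⟨e⟩, inferInstance⟩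
    have h7 : Nat.card (D.Region ⊕ Unit) = Nat.card D.Region + 1 := by
      rw [Nat.card_sum, Nat.card_unique (α := Unit)]
    -- One circle is exchanged for a crossing and three faces, and one region is added: both sides
    -- of the equation grow by two.
    rw [card_kink_face, h5, h7, Nat.card_unique (α := Unit)]
    omega

lemma addKink_omega1Down (hX : IsEmpty D.Crossing) {a : D.Region} (h : D.sides e = s(a, b)) :
    (addKink hX h).Omega1Down D := by
  refine ⟨(), 0, rfl, ⟨?_, ?_⟩, fun x => hX.elim x, Sum.elim id fun _ => e,
    Sum.elim id fun _ => b, fun x => hX.elim x, ?_, ?_, ?_, ?_, ?_, fun x => hX.elim x,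
    fun x => hX.elim x, ?_⟩
  · rintro ⟨⟩ i hi
    rcases zmod4_cases i with rfl | rfl | rfl | rfl
    · rfl
    all_goals cases hi
  · rintro (f | f) hf hm
    · change (Sum.inr () : D.Region ⊕ Unit) ∈ (D.sides f).map .inl at hm
      rw [Sym2.mem_map] at hm
      obtain ⟨_, _, hs⟩ := hm
      cases hs
    · exact hf () 0 rfl
  · ext ⟨⟩
    simp
  · rw [Set.eq_univ_iff_forall]
    exact fun f => ⟨.inl f, fun h => Sum.inl_ne_inr (Set.mem_singleton_iff.1 h), rfl⟩
  · have hinj : ∀ f g : D.Edge ⊕ Unit, EqvGen (fun f g => f = (.inl e : D.Edge ⊕ Unit) ∧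
        g = .inl e) f g → f = g := by
      intro f g hfg
      induction hfg with
      | rel _ _ hr => exact hr.1.trans hr.2.symm
      | refl => rfl
      | symm _ _ _ ih => exact ih.symm
      | trans _ _ _ _ _ ih1 ih2 => exact ih1.trans ih2
    rintro (f | f) (g | g) hf hg
    · exact ⟨fun (hfg : f = g) => by rw [hfg]; exact .refl _, fun hfg => Sum.inl.inj (hinj _ _ hfg)⟩
    · exact absurd rfl hg
    · exact absurd rfl hf
    · exact absurd rfl hf
  · rw [Set.eq_univ_iff_forall]
    exact fun f => ⟨.inl f, fun h => Sum.inl_ne_inr (Set.mem_singleton_iff.1 h), rfl⟩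
  · have hinj : ∀ f g : D.Region ⊕ Unit, EqvGen (fun _ _ => False) f g → f = g := by
      intro f g hfg
      induction hfg with
      | rel _ _ hr => exact hr.elim
      | refl => rfl
      | symm _ _ _ ih => exact ih.symm
      | trans _ _ _ _ _ ih1 ih2 => exact ih1.trans ih2
    rintro (f | f) (g | g) hf hg
    · exact ⟨fun (hfg : f = g) => by rw [hfg]; exact .refl _, fun hfg => Sum.inl.inj (hinj _ _ hfg)⟩
    · exact absurd rfl hg
    · exact absurd rfl hf
    · exact absurd rfl hf
  · rintro (f | f) hf
    · change D.sides f = ((D.sides f).map (Sum.inl (β := Unit))).map _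
      rw [Sym2.map_map]
      simp
    · exact absurd rfl hf

end kink

/-- A diagram without crossings gets a kink, then nugatory crossings are eliminated, then gadgets
are inserted. No stage lowers the number of crossings, and the last one raises it. -/
theorem exists_isStuck_of_nonempty_edge (hE : Nonempty D.Edge) : ∃ D' : LinkDiagram,
    EqvGen NonIncreasingStep D' D ∧ D'.IsStuck ∧ D.numCrossings < D'.numCrossings := by
  have hX : ∃ D' : LinkDiagram, EqvGen NonIncreasingStep D' D ∧ Nonempty D'.Crossing ∧
      D.numCrossings ≤ D'.numCrossings := by
    rcases isEmpty_or_nonempty D.Crossing with hX | hX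
    · obtain ⟨e⟩ := hE
      obtain ⟨a, b, h⟩ : ∃ a b, D.sides e = s(a, b) := by
        induction D.sides e with | _ a b => exact ⟨a, b, rfl⟩
      refine ⟨addKink hX (e := e) (b := b) h, .rel _ _ (.inr (.inl (addKink_omega1Down hX h))), ⟨()⟩,
        ?_⟩
      unfold numCrossings
      rw [Nat.card_of_isEmpty]
      exact Nat.zero_le _
    · exact ⟨D, .refl _, hX, le_rfl⟩
  obtain ⟨D1, h1, h2, h3⟩ := hX
  obtain ⟨D2, h4, h5, h6, h7⟩ := exists_isReduced h2
  obtain ⟨D3, h8, h9, h10, -⟩ := exists_isStuck h6 h5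
  exact ⟨D3, h8.trans _ _ _ (h4.trans _ _ _ h1), h9, by omega⟩

end LinkDiagram

theorem Link.exists_isRigidHardDiagram {L : Link} (hL : L.IsNonempty) :
    ∃ D, L.IsRigidHardDiagram D := by
  obtain ⟨D, hD, hE⟩ := hL
  obtain ⟨D', h1, h2, h3⟩ := D.exists_isStuck_of_nonempty_edge hE
  exact ⟨D', h2.isRigidHardDiagram (hD.congr h1) ((Link.crossingNumber_le hD).trans_lt h3)⟩

/-! ### Deleting crossings and splicing the loose ends -/

open Relation

namespace LinkDiagram

variable {D : LinkDiagram}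

/-- The next corner along a face. -/
noncomputable def next (D : LinkDiagram) (d : D.Crossing × ZMod 4) : D.Crossing × ZMod 4 :=
  cw (D.mate d)

lemma cornerAt_next (d) : D.cornerAt (D.next d) = D.cornerAt d := D.cornerAt_cw_mate d

lemma next_injective : Function.Injective D.next := fun d e h => by
  have := cw_inj.1 h
  rw [← D.mate_mate d, this, D.mate_mate]

/-- An injective map of a finite set that maps `C` into itself permutes `C`, so closure under `next`
holds backwards as well. -/
lemma next_mem_iff {C : Set (D.Crossing × ZMod 4)} (h : ∀ d ∈ C, D.next d ∈ C) {d} :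
    D.next d ∈ C ↔ d ∈ C := by
  refine ⟨fun hd => ?_, h d⟩
  have hC : D.next '' C = C := by
    refine Set.eq_of_subset_of_ncard_le ?_ ?_ (Set.toFinite _)
    · rintro _ ⟨d, hd, rfl⟩
      exact h d hd
    · rw [Set.ncard_image_of_injective _ next_injective]
  rw [← hC] at hd
  obtain ⟨e, he, hed⟩ := hd
  rwa [← next_injective hed]

/-- Membership in `C` is constant along faces, and in a connected diagram a region is a single face.
Thus all corners of a region are found by following one face until it closes. -/
lemma IsConnected.mem_of_cornerAt_eq [Nonempty D.Crossing] (hD : D.IsConnected)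
    {C : Set (D.Crossing × ZMod 4)} (h : ∀ d ∈ C, D.next d ∈ C) {p d} (hp : p ∈ C)
    (hd : D.cornerAt d = D.cornerAt p) : d ∈ C := by
  have hα : IsFaceMap D.edgeAt fun d => d ∈ C := by
    rw [D.isFaceMap_iff]
    exact fun d => propext (next_mem_iff h).symm
  have := hD.isMap.eq_of_region_eq hD.card_region_le hα hd
  exact (cast this.symm hp :)

lemma IsConnected.onlyCorners [Nonempty D.Crossing] (hD : D.IsConnected)
    {C : Set (D.Crossing × ZMod 4)} (h : ∀ d ∈ C, D.next d ∈ C) {p} (hp : p ∈ C) :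
    D.OnlyCorners (D.cornerAt p) C :=
  ⟨fun _ _ hx => hD.mem_of_cornerAt_eq h hp hx, fun e he => absurd he (hD.not_isFreeLoop e)⟩

lemma IsConnected.sides_ne [Nonempty D.Crossing] (hD : D.IsConnected) (p) :
    D.cornerAt p ≠ D.cornerAt (cw p) := hD.isMap.sides_ne hD.card_region_le p

/-- A property of crossings that is preserved along edges holds everywhere. -/
lemma IsConnected.forall_of_mate [Nonempty D.Crossing] (hD : D.IsConnected)
    {P : D.Crossing → Prop} (h : ∀ d, P d.1 → P (D.mate d).1) {x} (hx : P x) (y) : P y := by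
  induction hD.isMap.conn x y with
  | refl => exact hx
  | @tail y z _ hyz ih =>
    obtain ⟨i, j, hij⟩ := hyz
    rcases D.edgeAt_eq_iff.1 hij.symm with he | he
    · have := congrArg Prod.fst he
      dsimp only at this
      rw [this]; exact ih
    · have := h (y, i) ih
      rwa [← he] at this

/-- A way to delete the crossings in `S` and to join the edges that lead to them: an edge at an end
`s` in `S` is joined to the edge at `τ s`. -/
structure Splice (D : LinkDiagram) (S : Set D.Crossing)
    (τ : D.Crossing × ZMod 4 → D.Crossing × ZMod 4) : Prop where
  mem : ∀ s, s.1 ∈ S → (D.mate s).1 ∉ S → (τ s).1 ∈ S ∧ (D.mate (τ s)).1 ∉ S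
  invol : ∀ s, s.1 ∈ S → (D.mate s).1 ∉ S → τ (τ s) = s
  ne : ∀ s, s.1 ∈ S → (D.mate s).1 ∉ S → τ s ≠ s

/-- A dart of the remaining crossings, as a dart of the whole diagram. -/
def inc {S : Set D.Crossing} (d : {w // w ∉ S} × ZMod 4) : D.Crossing × ZMod 4 := (d.1.1, d.2)

lemma inc_injective {S : Set D.Crossing} : Function.Injective (inc (S := S)) := by
  rintro ⟨⟨x, hx⟩, i⟩ ⟨⟨y, hy⟩, j⟩ h
  simpa [inc] using h

lemma exists_inc {S : Set D.Crossing} {d : D.Crossing × ZMod 4} (h : d.1 ∉ S) :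
    ∃ d' : {w // w ∉ S} × ZMod 4, inc d' = d := ⟨(⟨d.1, h⟩, d.2), rfl⟩

namespace Splice

variable {S : Set D.Crossing} {τ : D.Crossing × ZMod 4 → D.Crossing × ZMod 4}

/-- One jump by `τ` is enough, because the end to which it leads is again joined to a crossing
outside `S`. -/
lemma exists_mate (h : D.Splice S τ) (d : {w // w ∉ S} × ZMod 4) :
    ∃ d' : {w // w ∉ S} × ZMod 4, ((D.mate (inc d)).1 ∈ S → inc d' = D.mate (τ (D.mate (inc d)))) ∧
      ((D.mate (inc d)).1 ∉ S → inc d' = D.mate (inc d)) := by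
  by_cases hd : (D.mate (inc d)).1 ∈ S
  · obtain ⟨d', hd'⟩ := exists_inc (h.mem _ hd (by rw [D.mate_mate]; exact d.1.2)).2
    exact ⟨d', fun _ => hd', fun h => absurd hd h⟩
  · obtain ⟨d', hd'⟩ := exists_inc hd
    exact ⟨d', fun h => absurd h hd, fun _ => hd'⟩

/-- The matching of the remaining darts. -/
noncomputable def mate (h : D.Splice S τ) (d : {w // w ∉ S} × ZMod 4) : {w // w ∉ S} × ZMod 4 :=
  (h.exists_mate d).choose

variable (h : D.Splice S τ) {d : {w // w ∉ S} × ZMod 4}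

lemma inc_mate_of_mem (hd : (D.mate (inc d)).1 ∈ S) :
    inc (h.mate d) = D.mate (τ (D.mate (inc d))) := (h.exists_mate d).choose_spec.1 hd

lemma inc_mate_of_notMem (hd : (D.mate (inc d)).1 ∉ S) : inc (h.mate d) = D.mate (inc d) :=
  (h.exists_mate d).choose_spec.2 hd

lemma inc_mate_of_eq_mate {s} (hs : s.1 ∈ S) (hd : inc d = D.mate s) :
    inc (h.mate d) = D.mate (τ s) := by
  have : D.mate (inc d) = s := by rw [hd, D.mate_mate]
  rw [h.inc_mate_of_mem (by rwa [this]), this]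

lemma mate_mate (d) : h.mate (h.mate d) = d := by
  apply inc_injective
  by_cases hd : (D.mate (inc d)).1 ∈ S
  · have hs := h.mem _ hd (by rw [D.mate_mate]; exact d.1.2)
    rw [h.inc_mate_of_eq_mate hs.1 (h.inc_mate_of_mem hd),
      h.invol _ hd (by rw [D.mate_mate]; exact d.1.2), D.mate_mate]
  · have h1 := h.inc_mate_of_notMem hd
    rw [h.inc_mate_of_notMem (by rw [h1, D.mate_mate]; exact d.1.2), h1, D.mate_mate]

lemma mate_ne (d) : h.mate d ≠ d := by
  intro he
  have he := congrArg inc he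
  by_cases hd : (D.mate (inc d)).1 ∈ S
  · rw [h.inc_mate_of_mem hd, D.mate_eq_comm] at he
    exact h.ne _ hd (by rw [D.mate_mate]; exact d.1.2) he
  · rw [h.inc_mate_of_notMem hd] at he
    exact D.mate_ne _ he

/-- The edges of the remaining diagram. -/
abbrev Edge : Type := Quot fun d e => e = h.mate d

/-- The edge of the remaining diagram at a dart. -/
def edgeAt (d : {w // w ∉ S} × ZMod 4) : h.Edge := Quot.mk _ d

lemma edgeAt_mate (d) : h.edgeAt (h.mate d) = h.edgeAt d :=
  (Quot.sound (r := fun d e => e = h.mate d) (a := d) (b := h.mate d) rfl).symm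

lemma edgeAt_eq_iff {d e} : h.edgeAt e = h.edgeAt d ↔ e = d ∨ e = h.mate d := by
  constructor
  · intro he
    let f : h.Edge → Set ({w // w ∉ S} × ZMod 4) := Quot.lift (fun d => {d, h.mate d}) (by
      rintro d e rfl
      rw [h.mate_mate, Set.pair_comm])
    have : e ∈ f (h.edgeAt d) := by
      rw [← he]; exact .inl rfl
    exact this
  · rintro (rfl | rfl)
    · rfl
    · exact h.edgeAt_mate d

lemma ends (e) : ∃ p q, p ≠ q ∧ ∀ s, h.edgeAt s = e ↔ s = p ∨ s = q := by
  obtain ⟨d, rfl⟩ := Quot.exists_rep e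
  exact ⟨d, h.mate d, (h.mate_ne d).symm, fun s => h.edgeAt_eq_iff⟩

lemma isFaceMap_iff {Y : Type} {c : {w // w ∉ S} × ZMod 4 → Y} :
    IsFaceMap h.edgeAt c ↔ ∀ d, c d = c (cw (h.mate d)) := by
  constructor
  · exact fun hc d => hc d _ (h.mate_ne d).symm (h.edgeAt_mate d).symm
  · intro hc p q hpq he
    rw [hc p, (h.edgeAt_eq_iff.1 he.symm).resolve_left hpq.symm]

/-- The regions beside two spliced ends have to agree under `ρ`; the condition for `s` treats one
side of the new edge and the condition for `τ s` the other. Away from `S` nothing changes. -/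
lemma isFaceMap {R : Type} {ρ : D.Region → R} (hρ : ∀ s, s.1 ∈ S → (D.mate s).1 ∉ S →
    ρ (D.cornerAt (cw s)) = ρ (D.cornerAt (τ s))) :
    IsFaceMap h.edgeAt fun d => ρ (D.cornerAt (inc d)) := by
  rw [h.isFaceMap_iff]
  intro d
  change _ = ρ (D.cornerAt (cw (inc (h.mate d))))
  by_cases hd : (D.mate (inc d)).1 ∈ S
  · rw [h.inc_mate_of_mem hd, D.cornerAt_cw_mate,
      ← hρ _ hd (by rw [D.mate_mate]; exact d.1.2), D.cornerAt_cw_mate]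
  · rw [h.inc_mate_of_notMem hd, D.cornerAt_cw_mate]

/-- A corner at a deleted crossing that lies beside an outer end shares its region with a corner at
the crossing to which this end leads. -/
lemma exists_kept_corner {p} (hp : p.1 ∈ S → (D.mate p).1 ∉ S ∨ (D.mate (p.1, p.2 + 1)).1 ∉ S) :
    ∃ d : {w // w ∉ S} × ZMod 4, D.cornerAt (inc d) = D.cornerAt p := by
  by_cases hS : p.1 ∈ S
  · rcases hp hS with hp | hp
    · obtain ⟨d, hd⟩ := exists_inc (S := S) (d := cw (D.mate p)) hp
      exact ⟨d, by rw [hd, D.cornerAt_cw_mate]⟩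
    · obtain ⟨d, hd⟩ := exists_inc hp
      refine ⟨d, ?_⟩
      rw [hd, D.cornerAt_mate]
      simp [cw]
  · obtain ⟨d, hd⟩ := exists_inc hS
    exact ⟨d, by rw [hd]⟩

open Classical in
/-- The edge of the remaining diagram that contains an edge of the whole diagram. -/
noncomputable def edgeMap (h : D.Splice S τ) (e₀ : h.Edge) (e : D.Edge) : h.Edge :=
  if he : ∃ d : {w // w ∉ S} × ZMod 4, D.edgeAt (inc d) = e then h.edgeAt he.choose else e₀

lemma edgeMap_edgeAt (e₀ d) : h.edgeMap e₀ (D.edgeAt (inc d)) = h.edgeAt d := by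
  have he : ∃ d', D.edgeAt (inc d') = D.edgeAt (inc d) := ⟨d, rfl⟩
  rw [edgeMap, dif_pos he]
  have hc := he.choose_spec
  set d' := he.choose
  rcases D.edgeAt_eq_iff.1 hc with h1 | h1
  · rw [inc_injective h1]
  · rw [h.edgeAt_eq_iff]
    right
    apply inc_injective
    rw [h.inc_mate_of_notMem (by rw [← h1]; exact d'.1.2), h1]

/-- Both old edges become parts of the same new edge, because their ends outside `S` are mates after
the splice. -/
lemma edgeMap_splice (e₀) {s} (hs : s.1 ∈ S) (hs' : (D.mate s).1 ∉ S) :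
    h.edgeMap e₀ (D.edgeAt s) = h.edgeMap e₀ (D.edgeAt (τ s)) := by
  obtain ⟨d, hd⟩ := exists_inc hs'
  obtain ⟨e, he⟩ := exists_inc (h.mem s hs hs').2
  rw [← D.edgeAt_mate s, ← D.edgeAt_mate (τ s), ← hd, ← he, edgeMap_edgeAt, edgeMap_edgeAt,
    h.edgeAt_eq_iff]
  right
  apply inc_injective
  rw [h.inc_mate_of_eq_mate (h.mem s hs hs').1 he, h.invol s hs hs', hd]

/-- The relation of a diagram to the diagram that remains after a splice. -/
theorem deletesTo {R : Type} {ρ : D.Region → R} {B : Set D.Edge} {r : D.Region}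
    {M : D.Edge → D.Edge → Prop} {N : D.Region → D.Region → Prop} {D' : LinkDiagram}
    [Nonempty {w // w ∉ S}]
    (f : D'.Crossing → {w // w ∉ S}) (hf : Function.Bijective f)
    (g : h.Edge → D'.Edge) (hg : Function.Bijective g)
    (k : R → D'.Region) (hk : Function.Bijective k)
    (hedge : ∀ x i, D'.edge x i = g (h.edgeAt (f x, i)))
    (hcorner : ∀ x i, D'.corner x i = k (ρ (D.cornerAt (inc (f x, i)))))
    (hB : ∀ e, e ∉ B ↔ ∃ d : {w // w ∉ S} × ZMod 4, D.edgeAt (inc d) = e)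
    (hM : ∀ s, s.1 ∈ S → (D.mate s).1 ∉ S → EqvGen M (D.edgeAt s) (D.edgeAt (τ s)))
    (hM' : ∀ e e', M e e' → ∃ s, s.1 ∈ S ∧ (D.mate s).1 ∉ S ∧ e = D.edgeAt s ∧
      e' = D.edgeAt (τ s))
    (hr : ∀ d : {w // w ∉ S} × ZMod 4, D.cornerAt (inc d) ≠ r)
    (hsurj : ∀ t, ∃ d : {w // w ∉ S} × ZMod 4, ρ (D.cornerAt (inc d)) = t)
    (hN : ∀ s s', s ≠ r → s' ≠ r → ρ s = ρ s' → EqvGen N s s')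
    (hN' : ∀ s s', N s s' → ρ s = ρ s') : D.DeletesTo D' S B r M N := by
  classical
  obtain ⟨x₀⟩ := ‹Nonempty {w // w ∉ S}›
  have e₀ : h.Edge := h.edgeAt (x₀, 0)
  have hG : ∀ x i, D'.edge x i = g (h.edgeMap e₀ (D.edge (f x).1 i)) := fun x i => by
    rw [hedge]
    exact congrArg g (h.edgeMap_edgeAt e₀ (f x, i)).symm
  have hMe : ∀ e e', EqvGen M e e' → h.edgeMap e₀ e = h.edgeMap e₀ e' := by
    intro e e' hr
    induction hr with
    | rel _ _ hr =>
      obtain ⟨s, h1, h2, rfl, rfl⟩ := hM' _ _ hr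
      exact h.edgeMap_splice e₀ h1 h2
    | refl => rfl
    | symm _ _ _ ih => exact ih.symm
    | trans _ _ _ _ _ ih1 ih2 => exact ih1.trans ih2
  have hNe : ∀ e e', EqvGen N e e' → ρ e = ρ e' := by
    intro e e' hr
    induction hr with
    | rel _ _ hr => exact hN' _ _ hr
    | refl => rfl
    | symm _ _ _ ih => exact ih.symm
    | trans _ _ _ _ _ ih1 ih2 => exact ih1.trans ih2
  refine ⟨fun x => (f x).1, fun e => g (h.edgeMap e₀ e), fun s => k (ρ s),
    Subtype.val_injective.comp hf.injective, ?_, ?_, ?_, ?_, ?_, hG, fun x i => hcorner x i, ?_⟩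
  · rw [Set.range_comp' Subtype.val f, hf.surjective.range_eq, Set.image_univ]
    ext w
    simp
  · rw [Set.eq_univ_iff_forall]
    intro e
    obtain ⟨e, rfl⟩ := hg.surjective e
    obtain ⟨d, rfl⟩ := Quot.exists_rep e
    exact ⟨_, (hB _).2 ⟨d, rfl⟩, congrArg g (h.edgeMap_edgeAt e₀ d)⟩
  · intro e e' he he'
    rw [hg.injective.eq_iff]
    refine ⟨fun heq => ?_, hMe e e'⟩
    obtain ⟨d, rfl⟩ := (hB e).1 he
    obtain ⟨d', rfl⟩ := (hB e').1 he'
    rw [h.edgeMap_edgeAt, h.edgeMap_edgeAt] at heq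
    rcases h.edgeAt_eq_iff.1 heq.symm with rfl | rfl
    · exact .refl _
    · by_cases hd : (D.mate (inc d)).1 ∈ S
      · have := hM _ hd (by rw [D.mate_mate]; exact d.1.2)
        rw [h.inc_mate_of_mem hd, D.edgeAt_mate]
        rwa [D.edgeAt_mate] at this
      · rw [h.inc_mate_of_notMem hd, D.edgeAt_mate]
        exact .refl _
  · rw [Set.eq_univ_iff_forall]
    intro t
    obtain ⟨t, rfl⟩ := hk.surjective t
    obtain ⟨d, hd⟩ := hsurj t
    exact ⟨_, hr d, congrArg k hd⟩
  · intro s s' hs hs'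
    rw [hk.injective.eq_iff]
    exact ⟨hN s s' hs hs', hNe s s'⟩
  · intro e he
    obtain ⟨d, rfl⟩ := (hB e).1 he
    obtain ⟨x, hx⟩ := hf.surjective d.1
    have h1 := D'.sides_edge x d.2
    rw [hG, hcorner, hcorner, hx] at h1
    rw [D.sides_edgeAt, Sym2.map_mk]
    exact h1

end Splice

end LinkDiagram

/-! ### The move Ω₁↓ on a connected diagram -/

open Relation

namespace LinkDiagram

variable {D : LinkDiagram}

lemma mk_add_cases (s : D.Crossing × ZMod 4) (i : ZMod 4) : s = (s.1, i) ∨ s = (s.1, i + 1) ∨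
    s = (s.1, i + 2) ∨ s = (s.1, i + 3) := by
  obtain ⟨x, k⟩ := s
  rcases sub_offset_cases k i with rfl | rfl | rfl | rfl <;> simp

namespace Splice

variable {S : Set D.Crossing} {τ : D.Crossing × ZMod 4 → D.Crossing × ZMod 4} (h : D.Splice S τ)

/-- A set of remaining crossings without edges to the other remaining crossings. -/
def IsClosed (P : Set {w // w ∉ S}) : Prop := ∀ d, d.1 ∈ P → (h.mate d).1 ∈ P

variable {P : Set {w // w ∉ S}}

lemma IsClosed.mate_mem_iff (hP : h.IsClosed P) (d) : (h.mate d).1 ∈ P ↔ d.1 ∈ P :=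
  ⟨fun hd => by simpa only [h.mate_mate] using hP _ hd, hP d⟩

lemma IsClosed.compl (hP : h.IsClosed P) : h.IsClosed Pᶜ := fun d hd hd' =>
  hd ((IsClosed.mate_mem_iff h hP d).1 hd')

lemma IsClosed.mem_iff (hP : h.IsClosed P) {d e s} (hs : s.1 ∈ S) (hd : inc d = D.mate s)
    (he : inc e = D.mate (τ s)) : d.1 ∈ P ↔ e.1 ∈ P := by
  rw [← IsClosed.mate_mem_iff h hP]
  have := inc_injective ((h.inc_mate_of_eq_mate hs hd).trans he.symm)
  rw [this]

/-- A closed set that is adjacent to all deleted ends is everything. -/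
lemma IsClosed.eq_univ [Nonempty D.Crossing] (hD : D.IsConnected) (hP : h.IsClosed P) (hS : S.Nonempty)
    (hout : ∀ d : {w // w ∉ S} × ZMod 4, (D.mate (inc d)).1 ∈ S → d.1 ∈ P) : P = Set.univ := by
  obtain ⟨s₀, hs₀⟩ := hS
  rw [Set.eq_univ_iff_forall]
  intro w
  have := hD.forall_of_mate (P := fun w => ∀ hw : w ∉ S, (⟨w, hw⟩ : {w // w ∉ S}) ∈ P) ?_
    (x := s₀) (fun hw => absurd hs₀ hw) w.1
  · exact this w.2
  · intro d hd hw
    obtain ⟨e, he⟩ := exists_inc hw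
    have he1 : (⟨(D.mate d).1, hw⟩ : {w // w ∉ S}) = e.1 := by
      ext; exact (congrArg Prod.fst he).symm
    rw [he1]
    by_cases hdS : d.1 ∈ S
    · exact hout e (by rw [he, D.mate_mate]; exact hdS)
    · obtain ⟨f, hf⟩ := exists_inc hdS
      have : h.mate f = e := inc_injective (by
        rw [h.inc_mate_of_notMem (by rw [hf]; exact hw), hf, he])
      rw [← this]
      refine hP f ?_
      have := hd hdS
      rwa [show (⟨d.1, hdS⟩ : {w // w ∉ S}) = f.1 by ext; exact (congrArg Prod.fst hf).symm] at this

/-- Otherwise the complement, which is closed too, would be adjacent to all deleted ends and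
therefore be everything. -/
lemma IsClosed.exists_outer [Nonempty D.Crossing] (hD : D.IsConnected) (hP : h.IsClosed P)
    (hS : S.Nonempty) (hne : P.Nonempty) :
    ∃ d : {w // w ∉ S} × ZMod 4, (D.mate (inc d)).1 ∈ S ∧ d.1 ∈ P := by
  by_contra! hc
  have := IsClosed.eq_univ h hD (IsClosed.compl h hP) hS fun d hd => hc d hd
  obtain ⟨x, hx⟩ := hne
  have hx' : x ∈ Pᶜ := by rw [this]; trivial
  exact hx' hx

lemma conn (H : ∀ P : Set {w // w ∉ S}, P.Nonempty → h.IsClosed P → P = Set.univ) (x y) :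
    ReflTransGen (fun x y => ∃ i j, h.edgeAt (x, i) = h.edgeAt (y, j)) x y := by
  have := H {y | ReflTransGen (fun x y => ∃ i j, h.edgeAt (x, i) = h.edgeAt (y, j)) x y}
    ⟨x, .refl⟩ fun d hd => hd.tail ⟨d.2, (h.mate d).2, (h.edgeAt_mate d).symm⟩
  exact Set.eq_univ_iff_forall.1 this y

lemma mate_diagram {R : Type} [Finite R] [Nonempty {w // w ∉ S}]
    {γ : {w // w ∉ S} × ZMod 4 → R} (hm : IsMap h.edgeAt γ)
    (hR : Nat.card {w // w ∉ S} + 2 ≤ Nat.card R) (d) : (hm.diagram hR).mate d = h.mate d := by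
  have h1 := (hm.diagram hR).edgeAt_mate d
  have h2 : h.edgeAt ((hm.diagram hR).mate d) = h.edgeAt d := h1
  exact (h.edgeAt_eq_iff.1 h2).resolve_left ((hm.diagram hR).mate_ne d)

end Splice

section Kink

variable {x : D.Crossing} {i : ZMod 4}

lemma kink_outer (hk : D.mate (x, i) = (x, i + 1)) (hne : D.mate (x, i + 2) ≠ (x, i + 3)) :
    (D.mate (x, i + 2)).1 ≠ x ∧ (D.mate (x, i + 3)).1 ≠ x := by
  have hk' := D.mate_eq_comm.1 hk
  have hc : ∀ i : ZMod 4, i + 1 ≠ i + 2 ∧ i ≠ i + 2 ∧ i ≠ i + 3 ∧ i + 1 ≠ i + 3 := by decide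
  obtain ⟨h1, h2, h3, h4⟩ := hc i
  constructor <;> intro hx
  · rcases mk_add_cases (D.mate (x, i + 2)) i with h | h | h | h <;> rw [hx] at h
    · rw [D.mate_eq_comm, hk] at h
      exact h1 (congrArg Prod.snd h).symm
    · rw [D.mate_eq_comm, ← hk'] at h
      exact h2 (congrArg Prod.snd h).symm
    · exact D.mate_ne _ h
    · exact hne h
  · rcases mk_add_cases (D.mate (x, i + 3)) i with h | h | h | h <;> rw [hx] at h
    · rw [D.mate_eq_comm, hk] at h
      exact h4 (congrArg Prod.snd h).symm
    · rw [D.mate_eq_comm, ← hk'] at h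
      exact h3 (congrArg Prod.snd h).symm
    · rw [D.mate_eq_comm] at h
      exact hne h.symm
    · exact D.mate_ne _ h

lemma kink_outer_cases (hk : D.mate (x, i) = (x, i + 1)) {s : D.Crossing × ZMod 4}
    (hs : s.1 ∈ ({x} : Set D.Crossing)) (hm : (D.mate s).1 ∉ ({x} : Set _)) :
    s = (x, i + 2) ∨ s = (x, i + 3) := by
  have h1 := D.mate_eq_comm.1 hk
  obtain rfl : s.1 = x := hs
  rcases mk_add_cases s i with h | h | h | h
  · rw [h, hk] at hm; exact absurd rfl hm
  · rw [h, ← h1] at hm; exact absurd rfl hm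
  · exact .inl h
  · exact .inr h

/-- The reflection `k ↦ 2 * i + 1 - k` exchanges the outer ends `i + 2` and `i + 3`, which are
joined when the kink disappears. Were they joined to each other already, a crossingless circle would
remain; this is excluded here. -/
lemma kink_splice (hk : D.mate (x, i) = (x, i + 1)) (hne : D.mate (x, i + 2) ≠ (x, i + 3)) :
    D.Splice {x} fun s => (s.1, 2 * i + 1 - s.2) := by
  obtain ⟨h2, h3⟩ := kink_outer hk hne
  have ho := fun s => kink_outer_cases hk (s := s)
  have e2 : ∀ i : ZMod 4, 2 * i + 1 - (i + 2) = i + 3 := by decide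
  have e3 : ∀ i : ZMod 4, 2 * i + 1 - (i + 3) = i + 2 := by decide
  have e4 : ∀ i : ZMod 4, i + 3 ≠ i + 2 := by decide
  refine ⟨fun s hs hm => ?_, fun s hs hm => ?_, fun s hs hm => ?_⟩
  · rcases ho s hs hm with rfl | rfl
    · simpa only [e2] using ⟨rfl, h3⟩
    · simpa only [e3] using ⟨rfl, h2⟩
  · ext
    · rfl
    · simp
  · rcases ho s hs hm with rfl | rfl
    · simp only [e2]
      exact fun he => e4 i (congrArg Prod.snd he)
    · simp only [e3]
      exact fun he => e4 i (congrArg Prod.snd he).symm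

/-- A crossing with a one-sided region can be removed by a move `Ω₁↓`. -/
theorem IsConnected.exists_omega1Down [Nonempty D.Crossing] (hD : D.IsConnected)
    (hk : D.mate (x, i) = (x, i + 1)) (hne : D.mate (x, i + 2) ≠ (x, i + 3)) :
    ∃ D', D.Omega1Down D' ∧ D'.numCrossings + 1 = D.numCrossings := by
  classical
  obtain ⟨h2, h3⟩ := kink_outer hk hne
  have h1 := D.mate_eq_comm.1 hk
  have h := kink_splice hk hne
  have honly : D.OnlyCorners (D.cornerAt (x, i)) {(x, i)} := by
    refine hD.onlyCorners (fun d hd => ?_) rfl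
    rw [Set.mem_singleton_iff] at hd
    subst hd
    rw [next, hk]
    simp [cw]
  have h13 : D.cornerAt (x, i + 1) = D.cornerAt (x, i + 3) := by
    have := D.cornerAt_mate (x, i)
    rwa [hk, cw, sub_one_eq_add_three] at this
  have hkept : ∀ d : {w // w ∉ ({x} : Set _)} × ZMod 4, D.cornerAt (inc d) ≠ D.cornerAt (x, i) := by
    intro d hd
    have := honly.1 _ _ hd
    exact d.1.2 (congrArg Prod.fst this)
  have hr : D.cornerAt (x, i + 1) ≠ D.cornerAt (x, i) := by
    have := hD.sides_ne (x, i + 1)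
    simpa [cw] using this
  -- The region inside the kink disappears. Its image is arbitrary, as no remaining corner lies in
  -- it.
  let ρ : D.Region → {s // s ≠ D.cornerAt (x, i)} := fun s =>
    if hs : s = D.cornerAt (x, i) then ⟨_, hr⟩ else ⟨s, hs⟩
  have hρv : ∀ s, s ≠ D.cornerAt (x, i) → (ρ s).1 = s := fun s hs => by simp [ρ, hs]
  have hρ : ∀ s : D.Crossing × ZMod 4, s.1 ∈ ({x} : Set D.Crossing) → (D.mate s).1 ∉ ({x} : Set _) →
      ρ (D.cornerAt (cw s)) = ρ (D.cornerAt (s.1, 2 * i + 1 - s.2)) := by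
    intro s hs hm
    rcases kink_outer_cases hk hs hm with rfl | rfl
    · have : ∀ i : ZMod 4, i + 2 - 1 = i + 1 ∧ 2 * i + 1 - (i + 2) = i + 3 := by decide
      simp only [cw, this i, h13]
    · have : ∀ i : ZMod 4, i + 3 - 1 = i + 2 ∧ 2 * i + 1 - (i + 3) = i + 2 := by decide
      simp only [cw, this i]
  have hsurj : ∀ t, ∃ d : {w // w ∉ ({x} : Set D.Crossing)} × ZMod 4,
      ρ (D.cornerAt (inc d)) = t := by
    rintro ⟨t, ht⟩
    obtain ⟨p, rfl⟩ := hD.isMap.surj t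
    obtain ⟨d, hd⟩ := Splice.exists_kept_corner (S := {x}) (p := p) (by
      intro hp
      obtain rfl : p.1 = x := hp
      rcases mk_add_cases p i with h | h | h | h
      · rw [h] at ht; exact absurd rfl ht
      · right; rw [h, add_assoc]; exact h2
      · left; rw [h]; exact h2
      · left; rw [h]; exact h3)
    exact ⟨d, Subtype.ext (by rw [hd, hρv _ ht])⟩
  have : Nonempty {w // w ∉ ({x} : Set D.Crossing)} := ⟨⟨_, h2⟩⟩
  have hmap : IsMap h.edgeAt fun d => ρ (D.cornerAt (inc d)) := by
    refine ⟨h.ends, h.isFaceMap hρ, h.conn fun P hne hP => ?_, hsurj⟩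
    -- The mates of the two outer ends are joined by the splice, so a closed set that contains one
    -- of them contains both.
    obtain ⟨d, hd, hdP⟩ := Splice.IsClosed.exists_outer h hD hP ⟨x, rfl⟩ hne
    refine Splice.IsClosed.eq_univ h hD hP ⟨x, rfl⟩ fun e he => ?_
    have key : ∀ d : {w // w ∉ ({x} : Set D.Crossing)} × ZMod 4,
        (D.mate (inc d)).1 ∈ ({x} : Set D.Crossing) →
        inc d = D.mate (x, i + 2) ∨ inc d = D.mate (x, i + 3) := by
      intro d hd
      obtain ⟨s, hs⟩ : ∃ s, s = D.mate (inc d) := ⟨_, rfl⟩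
      have hs' : inc d = D.mate s := D.mate_eq_comm.1 hs.symm
      rw [← hs] at hd
      obtain hd : s.1 = x := hd
      rw [hs']
      have hsk := mk_add_cases s i
      rw [hd] at hsk
      rcases hsk with rfl | rfl | rfl | rfl
      · rw [hk] at hs'; exact absurd (congrArg Prod.fst hs') d.1.2
      · rw [← h1] at hs'; exact absurd (congrArg Prod.fst hs') d.1.2
      · exact .inl rfl
      · exact .inr rfl
    have hτ : ∀ i : ZMod 4, 2 * i + 1 - (i + 2) = i + 3 ∧ 2 * i + 1 - (i + 3) = i + 2 := by decide
    rcases key d hd with h4 | h4 <;> rcases key e he with h5 | h5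
    · have := inc_injective (h4.trans h5.symm); rwa [← this]
    · exact (Splice.IsClosed.mem_iff h hP (s := (x, i + 2)) rfl h4
        (by simpa only [(hτ i).1] using h5)).1 hdP
    · exact (Splice.IsClosed.mem_iff h hP (s := (x, i + 3)) rfl h4
        (by simpa only [(hτ i).2] using h5)).1 hdP
    · have := inc_injective (h4.trans h5.symm); rwa [← this]
  have hcard : Nat.card {w // w ∉ ({x} : Set D.Crossing)} + 1 = Nat.card D.Crossing := by
    have := Set.ncard_add_ncard_compl ({x} : Set D.Crossing)
    rw [Set.ncard_singleton, add_comm] at this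
    exact this
  have hcard' : Nat.card {s // s ≠ D.cornerAt (x, i)} + 1 = Nat.card D.Region := by
    have := Set.ncard_add_ncard_compl ({D.cornerAt (x, i)} : Set D.Region)
    rw [Set.ncard_singleton, add_comm] at this
    exact this
  -- One crossing and one region less, so the remaining map is planar again.
  have hR : Nat.card {w // w ∉ ({x} : Set D.Crossing)} + 2 ≤
      Nat.card {s // s ≠ D.cornerAt (x, i)} := by
    have := hD.card_region
    omega
  refine ⟨hmap.diagram hR, ⟨x, i, ?_, honly, ?_⟩, hcard⟩
  · exact (D.edgeAt_mate (x, i)).symm.trans (by rw [hk]; rfl)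
  · refine h.deletesTo (ρ := ρ) id Function.bijective_id id Function.bijective_id id
      Function.bijective_id (fun _ _ => rfl) (fun _ _ => rfl) ?_ ?_ ?_ hkept hsurj ?_ ?_
    · intro e
      rw [Set.mem_singleton_iff]
      constructor
      · intro he
        obtain ⟨p, rfl⟩ := hD.exists_end e
        by_cases hp : p.1 = x
        · have hpk := mk_add_cases p i
          rw [hp] at hpk
          rcases hpk with rfl | rfl | rfl | rfl
          · exact absurd rfl he
          · rw [← D.edgeAt_mate, ← h1] at he; exact absurd rfl he
          · obtain ⟨d, hd⟩ := exists_inc (S := {x}) h2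
            exact ⟨d, by rw [hd, D.edgeAt_mate]⟩
          · obtain ⟨d, hd⟩ := exists_inc (S := {x}) h3
            exact ⟨d, by rw [hd, D.edgeAt_mate]⟩
        · obtain ⟨d, hd⟩ := exists_inc (S := {x}) hp
          exact ⟨d, by rw [hd]⟩
      · rintro ⟨d, rfl⟩ he
        rcases (D.edgeAt_eq_iff (p := (x, i))).1 he with h4 | h4
        · exact d.1.2 (congrArg Prod.fst h4)
        · rw [hk] at h4; exact d.1.2 (congrArg Prod.fst h4)
    · intro s hs hm
      have hτ : ∀ i : ZMod 4, 2 * i + 1 - (i + 2) = i + 3 ∧ 2 * i + 1 - (i + 3) = i + 2 := by decide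
      rcases kink_outer_cases hk hs hm with rfl | rfl
      · exact .rel _ _ ⟨rfl, by simp only [(hτ i).1]; rfl⟩
      · exact .symm _ _ (.rel _ _ ⟨by simp only [(hτ i).2]; rfl, rfl⟩)
    · rintro _ _ ⟨rfl, rfl⟩
      refine ⟨(x, i + 2), rfl, h2, rfl, ?_⟩
      have hτ : ∀ i : ZMod 4, 2 * i + 1 - (i + 2) = i + 3 := by decide
      simp only [hτ i]; rfl
    · intro s s' hs hs' he
      have := congrArg Subtype.val he
      rw [hρv s hs, hρv s' hs'] at this
      rw [this]; exact .refl _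
    · exact fun _ _ h => h.elim

end Kink

end LinkDiagram

/-! ### The move Ω₂↓ on a connected diagram, when the result is connected -/

open Relation

namespace LinkDiagram

variable {D : LinkDiagram}

/-- Two crossings that are joined by the two sides of a two-sided region, and whose other ends are
joined to other crossings. -/
structure Bigon (D : LinkDiagram) (x y : D.Crossing) (i j : ZMod 4) : Prop where
  ne : x ≠ y
  mate_zero : D.mate (x, i) = (y, j + 1)
  mate_one : D.mate (x, i + 1) = (y, j)
  mate_two : (D.mate (x, i + 2)).1 ≠ x ∧ (D.mate (x, i + 2)).1 ≠ y
  mate_three : (D.mate (x, i + 3)).1 ≠ x ∧ (D.mate (x, i + 3)).1 ≠ y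
  mate_two' : (D.mate (y, j + 2)).1 ≠ x ∧ (D.mate (y, j + 2)).1 ≠ y
  mate_three' : (D.mate (y, j + 3)).1 ≠ x ∧ (D.mate (y, j + 3)).1 ≠ y

namespace Bigon

variable {x y : D.Crossing} {i j : ZMod 4} (b : D.Bigon x y i j)
include b

lemma symm : D.Bigon y x j i where
  ne := b.ne.symm
  mate_zero := (D.mate_eq_comm.1 b.mate_one).symm
  mate_one := (D.mate_eq_comm.1 b.mate_zero).symm
  mate_two := b.mate_two'.symm
  mate_three := b.mate_three'.symm
  mate_two' := b.mate_two.symm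
  mate_three' := b.mate_three.symm

lemma cases {s : D.Crossing × ZMod 4} (hs : s.1 ∈ ({x, y} : Set D.Crossing))
    (hm : (D.mate s).1 ∉ ({x, y} : Set D.Crossing)) :
    s = (x, i + 2) ∨ s = (x, i + 3) ∨ s = (y, j + 2) ∨ s = (y, j + 3) := by
  rcases hs with hs | hs
  · rcases mk_add_cases s i with h | h | h | h <;> rw [hs] at h
    · rw [h, b.mate_zero] at hm; simp at hm
    · rw [h, b.mate_one] at hm; simp at hm
    · exact .inl h
    · exact .inr (.inl h)
  · obtain hs : s.1 = y := hs
    rcases mk_add_cases s j with h | h | h | h <;> rw [hs] at h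
    · rw [h, b.symm.mate_zero] at hm; simp at hm
    · rw [h, b.symm.mate_one] at hm; simp at hm
    · exact .inr (.inr (.inl h))
    · exact .inr (.inr (.inr h))

lemma corner_one : D.cornerAt (x, i + 1) = D.cornerAt (y, j + 3) := by
  have := D.cornerAt_cw_mate (x, i + 1)
  rw [b.mate_one, cw, sub_one_eq_add_three] at this
  exact this.symm

lemma corner_zero : D.cornerAt (x, i) = D.cornerAt (y, j) := by
  have := D.cornerAt_cw_mate (x, i)
  rw [b.mate_zero, cw] at this
  simpa using this.symm

lemma onlyCorners [Nonempty D.Crossing] (hD : D.IsConnected) :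
    D.OnlyCorners (D.cornerAt (x, i)) {(x, i), (y, j)} := by
  refine hD.onlyCorners (fun d hd => ?_) (.inl rfl)
  rcases hd with rfl | hd
  · rw [next, b.mate_zero]; right; simp [cw]
  · rw [Set.mem_singleton_iff] at hd
    subst hd
    rw [next, b.symm.mate_zero]; left; simp [cw]

end Bigon

open Classical in
/-- At the two sides of a two-sided region, the end across the region. -/
noncomputable def across (x y : D.Crossing) (i j : ZMod 4) (s : D.Crossing × ZMod 4) :
    D.Crossing × ZMod 4 := (if s.1 = x then y else x, i + j + 1 - s.2)

namespace Bigon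

variable {x y : D.Crossing} {i j : ZMod 4} (b : D.Bigon x y i j)

lemma across_two : across x y i j (x, i + 2) = (y, j + 3) := by
  have : ∀ i j : ZMod 4, i + j + 1 - (i + 2) = j + 3 := by decide
  simp [across, this]

lemma across_three : across x y i j (x, i + 3) = (y, j + 2) := by
  have : ∀ i j : ZMod 4, i + j + 1 - (i + 3) = j + 2 := by decide
  simp [across, this]

include b

lemma across_two' : across x y i j (y, j + 2) = (x, i + 3) := by
  have : ∀ i j : ZMod 4, i + j + 1 - (j + 2) = i + 3 := by decide
  simp [across, this, b.ne.symm]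

lemma across_three' : across x y i j (y, j + 3) = (x, i + 2) := by
  have : ∀ i j : ZMod 4, i + j + 1 - (j + 3) = i + 2 := by decide
  simp [across, this, b.ne.symm]

lemma splice : D.Splice {x, y} (across x y i j) := by
  have m2 : (D.mate (x, i + 2)).1 ∉ ({x, y} : Set D.Crossing) := by simpa using b.mate_two
  have m3 : (D.mate (x, i + 3)).1 ∉ ({x, y} : Set D.Crossing) := by simpa using b.mate_three
  have n2 : (D.mate (y, j + 2)).1 ∉ ({x, y} : Set D.Crossing) := by simpa using b.mate_two'
  have n3 : (D.mate (y, j + 3)).1 ∉ ({x, y} : Set D.Crossing) := by simpa using b.mate_three'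
  refine ⟨fun s hs hm => ?_, fun s hs hm => ?_, fun s hs hm => ?_⟩ <;>
  rcases b.cases hs hm with rfl | rfl | rfl | rfl
  · rw [across_two]; exact ⟨.inr rfl, n3⟩
  · rw [across_three]; exact ⟨.inr rfl, n2⟩
  · rw [b.across_two']; exact ⟨.inl rfl, m3⟩
  · rw [b.across_three']; exact ⟨.inl rfl, m2⟩
  · rw [across_two, b.across_three']
  · rw [across_three, b.across_two']
  · rw [b.across_two', across_three]
  · rw [b.across_three', across_two]
  · rw [across_two]; exact fun h => b.ne (congrArg Prod.fst h).symm
  · rw [across_three]; exact fun h => b.ne (congrArg Prod.fst h).symm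
  · rw [b.across_two']; exact fun h => b.ne (congrArg Prod.fst h)
  · rw [b.across_three']; exact fun h => b.ne (congrArg Prod.fst h)

lemma edge_iff [Nonempty D.Crossing] (hD : D.IsConnected) (e : D.Edge) :
    e ∉ ({D.edge x i, D.edge y j} : Set D.Edge) ↔
      ∃ d : {w // w ∉ ({x, y} : Set D.Crossing)} × ZMod 4, D.edgeAt (inc d) = e := by
  constructor
  · intro he
    obtain ⟨p, rfl⟩ := hD.exists_end e
    by_cases hp : p.1 ∈ ({x, y} : Set D.Crossing)
    · by_cases hm : (D.mate p).1 ∈ ({x, y} : Set D.Crossing)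
      · exfalso
        apply he
        rcases hp with hp | hp
        · rcases mk_add_cases p i with h | h | h | h <;> rw [hp] at h
          · left; rw [h]; rfl
          · right; rw [h, ← D.edgeAt_mate, b.mate_one]; rfl
          · rw [h] at hm; exact absurd hm (by simpa using b.mate_two)
          · rw [h] at hm; exact absurd hm (by simpa using b.mate_three)
        · obtain hp : p.1 = y := hp
          rcases mk_add_cases p j with h | h | h | h <;> rw [hp] at h
          · right; rw [h]; rfl
          · left; rw [h, ← D.edgeAt_mate, b.symm.mate_one]; rfl
          · rw [h] at hm; exact absurd hm (by simpa using b.mate_two')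
          · rw [h] at hm; exact absurd hm (by simpa using b.mate_three')
      · obtain ⟨d, hd⟩ := exists_inc hm
        exact ⟨d, by rw [hd, D.edgeAt_mate]⟩
    · obtain ⟨d, hd⟩ := exists_inc hp
      exact ⟨d, by rw [hd]⟩
  · rintro ⟨d, rfl⟩ (he | he)
    · rcases (D.edgeAt_eq_iff (p := (x, i))).1 he with h4 | h4
      · exact d.1.2 (.inl (congrArg Prod.fst h4))
      · rw [b.mate_zero] at h4; exact d.1.2 (.inr (congrArg Prod.fst h4))
    · rcases (D.edgeAt_eq_iff (p := (y, j))).1 he with h4 | h4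
      · exact d.1.2 (.inr (congrArg Prod.fst h4))
      · rw [b.symm.mate_zero] at h4; exact d.1.2 (.inl (congrArg Prod.fst h4))

/-- The regions at the four ends of a two-sided region match if the two opposite regions do. -/
lemma region_eq {R : Type} {ρ : D.Region → R}
    (hρ : ρ (D.cornerAt (x, i + 2)) = ρ (D.cornerAt (y, j + 2))) (s : D.Crossing × ZMod 4)
    (hs : s.1 ∈ ({x, y} : Set D.Crossing)) (hm : (D.mate s).1 ∉ ({x, y} : Set D.Crossing)) :
    ρ (D.cornerAt (cw s)) = ρ (D.cornerAt (across x y i j s)) := by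
  have h2 : ∀ i : ZMod 4, i + 2 - 1 = i + 1 ∧ i + 3 - 1 = i + 2 := by decide
  rcases b.cases hs hm with rfl | rfl | rfl | rfl
  · rw [across_two, ← b.corner_one, cw, (h2 i).1]
  · rw [across_three, ← hρ, cw, (h2 i).2]
  · rw [b.across_two', ← b.symm.corner_one, cw, (h2 j).1]
  · rw [b.across_three', hρ, cw, (h2 j).2]

/-- The part common to the connected and the disconnected outcome, which differ in the set `R` of
regions and in the construction of `D'`. -/
lemma omega2Down [Nonempty D.Crossing] [Nonempty {w // w ∉ ({x, y} : Set D.Crossing)}]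
    (hD : D.IsConnected) (hover : IsOver i ↔ IsOver (j + 1)) {R : Type} {ρ : D.Region → R}
    (hsurj : ∀ t, ∃ d : {w // w ∉ ({x, y} : Set D.Crossing)} × ZMod 4,
      ρ (D.cornerAt (inc d)) = t)
    (hρ : ρ (D.cornerAt (x, i + 2)) = ρ (D.cornerAt (y, j + 2)))
    (hN : ∀ s s', s ≠ D.corner x i → s' ≠ D.corner x i → ρ s = ρ s' →
      EqvGen (fun s s' => s = D.corner x (i + 2) ∧ s' = D.corner y (j + 2)) s s')
    {D' : LinkDiagram} (f : D'.Crossing → {w // w ∉ ({x, y} : Set D.Crossing)})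
    (hf : Function.Bijective f)
    (g : b.splice.Edge → D'.Edge) (hg : Function.Bijective g)
    (k : R → D'.Region) (hk : Function.Bijective k)
    (hedge : ∀ x i, D'.edge x i = g (b.splice.edgeAt (f x, i)))
    (hcorner : ∀ x i, D'.corner x i = k (ρ (D.cornerAt (inc (f x, i))))) : D.Omega2Down D' := by
  refine ⟨x, y, i, j, b.ne, ?_, ?_, hover, b.onlyCorners hD, ?_⟩
  · exact (D.edgeAt_mate (x, i)).symm.trans (by rw [b.mate_zero]; rfl)
  · exact (D.edgeAt_mate (y, j)).symm.trans (by rw [b.symm.mate_zero]; rfl)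
  · refine b.splice.deletesTo (ρ := ρ) f hf g hg k hk hedge hcorner (b.edge_iff hD) ?_ ?_ ?_ hsurj
      hN ?_
    · intro s hs hm
      rcases b.cases hs hm with rfl | rfl | rfl | rfl
      · rw [across_two]; exact .rel _ _ (.inl ⟨rfl, rfl⟩)
      · rw [across_three]; exact .rel _ _ (.inr ⟨rfl, rfl⟩)
      · rw [b.across_two']; exact .symm _ _ (.rel _ _ (.inr ⟨rfl, rfl⟩))
      · rw [b.across_three']; exact .symm _ _ (.rel _ _ (.inl ⟨rfl, rfl⟩))
    · rintro _ _ (⟨rfl, rfl⟩ | ⟨rfl, rfl⟩)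
      · exact ⟨(x, i + 2), .inl rfl, by simpa using b.mate_two, rfl, by rw [across_two]; rfl⟩
      · exact ⟨(x, i + 3), .inl rfl, by simpa using b.mate_three, rfl, by rw [across_three]; rfl⟩
    · intro d hd
      rcases (b.onlyCorners hD).1 _ _ hd with h | h
      · exact d.1.2 (.inl (congrArg Prod.fst h))
      · exact d.1.2 (.inr (congrArg Prod.fst h))
    · rintro _ _ ⟨rfl, rfl⟩
      exact hρ

lemma corner_ne [Nonempty D.Crossing] (hD : D.IsConnected)
    (d : {w // w ∉ ({x, y} : Set D.Crossing)} × ZMod 4) :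
    D.cornerAt (inc d) ≠ D.cornerAt (x, i) := by
  intro hd
  rcases (b.onlyCorners hD).1 _ _ hd with h | h
  · exact d.1.2 (.inl (congrArg Prod.fst h))
  · exact d.1.2 (.inr (congrArg Prod.fst h))

lemma exists_kept [Nonempty D.Crossing] (hD : D.IsConnected) {t : D.Region}
    (ht : t ≠ D.cornerAt (x, i)) :
    ∃ d : {w // w ∉ ({x, y} : Set D.Crossing)} × ZMod 4, D.cornerAt (inc d) = t := by
  obtain ⟨p, rfl⟩ := hD.isMap.surj t
  refine Splice.exists_kept_corner fun hp => ?_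
  have m2 : (D.mate (x, i + 2)).1 ∉ ({x, y} : Set D.Crossing) := by simpa using b.mate_two
  have m3 : (D.mate (x, i + 3)).1 ∉ ({x, y} : Set D.Crossing) := by simpa using b.mate_three
  have n2 : (D.mate (y, j + 2)).1 ∉ ({x, y} : Set D.Crossing) := by simpa using b.mate_two'
  have n3 : (D.mate (y, j + 3)).1 ∉ ({x, y} : Set D.Crossing) := by simpa using b.mate_three'
  have h2 : ∀ i : ZMod 4, i + 1 + 1 = i + 2 := by decide
  rcases hp with hp | hp
  · rcases mk_add_cases p i with h | h | h | h <;> rw [hp] at h <;> subst h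
    · exact absurd rfl ht
    · right; simpa only [h2] using m2
    · left; exact m2
    · left; exact m3
  · obtain hp : p.1 = y := hp
    rcases mk_add_cases p j with h | h | h | h <;> rw [hp] at h <;> subst h
    · exact absurd b.corner_zero.symm ht
    · right; simpa only [h2] using n2
    · left; exact n2
    · left; exact n3

lemma nonempty_kept : Nonempty {w // w ∉ ({x, y} : Set D.Crossing)} :=
  ⟨⟨_, by simpa using b.mate_two⟩⟩

lemma card_kept : Nat.card {w // w ∉ ({x, y} : Set D.Crossing)} + 2 = Nat.card D.Crossing := by
  have := Set.ncard_add_ncard_compl ({x, y} : Set D.Crossing)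
  rw [Set.ncard_pair b.ne, add_comm] at this
  exact this

/-- The mates of the four outer ends. -/
lemma exists_outer : ∃ a₂ a₃ b₂ b₃ : {w // w ∉ ({x, y} : Set D.Crossing)} × ZMod 4,
    inc a₂ = D.mate (x, i + 2) ∧ inc a₃ = D.mate (x, i + 3) ∧ inc b₂ = D.mate (y, j + 2) ∧
    inc b₃ = D.mate (y, j + 3) := by
  obtain ⟨a₂, h1⟩ := exists_inc (S := {x, y}) (d := D.mate (x, i + 2)) (by simpa using b.mate_two)
  obtain ⟨a₃, h2⟩ := exists_inc (S := {x, y}) (d := D.mate (x, i + 3)) (by simpa using b.mate_three)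
  obtain ⟨b₂, h3⟩ := exists_inc (S := {x, y}) (d := D.mate (y, j + 2)) (by simpa using b.mate_two')
  obtain ⟨b₃, h4⟩ := exists_inc (S := {x, y}) (d := D.mate (y, j + 3)) (by simpa using b.mate_three')
  exact ⟨a₂, a₃, b₂, b₃, h1, h2, h3, h4⟩

lemma outer_cases (d : {w // w ∉ ({x, y} : Set D.Crossing)} × ZMod 4)
    (hd : (D.mate (inc d)).1 ∈ ({x, y} : Set D.Crossing)) :
    inc d = D.mate (x, i + 2) ∨ inc d = D.mate (x, i + 3) ∨ inc d = D.mate (y, j + 2) ∨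
      inc d = D.mate (y, j + 3) := by
  have h := b.cases hd (by rw [D.mate_mate]; exact d.1.2)
  simpa only [D.mate_eq_comm] using h

/-- If the remaining diagram falls apart, then a component contains exactly one of the two sides. -/
lemma conn_or [Nonempty D.Crossing] (hD : D.IsConnected) :
    (∀ P, P.Nonempty → b.splice.IsClosed P → P = Set.univ) ∨
    ∃ P, b.splice.IsClosed P ∧
      (∀ d, inc d = D.mate (x, i + 2) → d.1 ∈ P) ∧ (∀ d, inc d = D.mate (y, j + 3) → d.1 ∈ P) ∧
      (∀ d, inc d = D.mate (x, i + 3) → d.1 ∉ P) ∧ (∀ d, inc d = D.mate (y, j + 2) → d.1 ∉ P) := by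
  by_cases hc : ∀ P, P.Nonempty → b.splice.IsClosed P → P = Set.univ
  · exact .inl hc
  push Not at hc
  obtain ⟨P, hne, hP, hu⟩ := hc
  right
  obtain ⟨a₂, a₃, b₂, b₃, h2, h3, k2, k3⟩ := b.exists_outer
  have e1 : ∀ P, b.splice.IsClosed P → (a₂.1 ∈ P ↔ b₃.1 ∈ P) := fun P hP =>
    Splice.IsClosed.mem_iff b.splice hP (s := (x, i + 2)) (.inl rfl) h2 (by rw [across_two, k3])
  have e2 : ∀ P, b.splice.IsClosed P → (a₃.1 ∈ P ↔ b₂.1 ∈ P) := fun P hP =>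
    Splice.IsClosed.mem_iff b.splice hP (s := (x, i + 3)) (.inl rfl) h3 (by rw [across_three, k2])
  have huniq : ∀ {d e : {w // w ∉ ({x, y} : Set D.Crossing)} × ZMod 4} {s}, inc d = s →
      inc e = s → d = e := fun h h' => inc_injective (h.trans h'.symm)
  -- The outer mates `a₂`, `b₃` are joined by the splice, and so are `a₃`, `b₂`. A closed set that
  -- meets both pairs is adjacent to all four outer ends and is everything.
  have key : ∀ P, b.splice.IsClosed P → P ≠ Set.univ → a₂.1 ∈ P → a₃.1 ∉ P := by
    intro P hP hu h4 h5
    refine hu (Splice.IsClosed.eq_univ b.splice hD hP ⟨x, .inl rfl⟩ fun d hd => ?_)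
    rcases b.outer_cases d hd with h | h | h | h
    · rwa [huniq h h2]
    · rwa [huniq h h3]
    · rw [huniq h k2]; exact (e2 P hP).1 h5
    · rw [huniq h k3]; exact (e1 P hP).1 h4
  have fin : ∀ P, b.splice.IsClosed P → P ≠ Set.univ → a₂.1 ∈ P → ∃ P, b.splice.IsClosed P ∧
      (∀ d, inc d = D.mate (x, i + 2) → d.1 ∈ P) ∧ (∀ d, inc d = D.mate (y, j + 3) → d.1 ∈ P) ∧
      (∀ d, inc d = D.mate (x, i + 3) → d.1 ∉ P) ∧ (∀ d, inc d = D.mate (y, j + 2) → d.1 ∉ P) := by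
    intro P hP hu h4
    have h5 := key P hP hu h4
    refine ⟨P, hP, fun d h => ?_, fun d h => ?_, fun d h => ?_, fun d h => ?_⟩
    · rwa [huniq h h2]
    · rw [huniq h k3]; exact (e1 P hP).1 h4
    · rwa [huniq h h3]
    · rw [huniq h k2]; exact fun h6 => h5 ((e2 P hP).2 h6)
  by_cases h4 : a₂.1 ∈ P
  · exact fin P hP hu h4
  · refine fin Pᶜ (Splice.IsClosed.compl _ hP) (fun he => ?_) h4
    obtain ⟨w, hw⟩ := hne
    have : w ∈ Pᶜ := by rw [he]; trivial
    exact this hw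

/-- If the two opposite regions are different then the remaining diagram is connected. -/
lemma conn_of_ne [Nonempty D.Crossing] (hD : D.IsConnected)
    (hne : D.cornerAt (x, i + 2) ≠ D.cornerAt (y, j + 2)) (P) (hne' : P.Nonempty)
    (hP : b.splice.IsClosed P) : P = Set.univ := by
  refine (b.conn_or hD).resolve_right ?_ P hne' hP
  rintro ⟨P, hP, p2, q3, p3, q2⟩
  -- Follow the face of the corner `(x, i + 2)` into `P`. It could leave `P` only through the bigon:
  -- at `x` it would have to lie on both sides of an edge, at `y` it would have to be the region of
  -- `(y, j + 2)`, which is a different one. So the face stays in `P` and never comes back to its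
  -- starting corner, which is impossible.
  let Q : Set (D.Crossing × ZMod 4) :=
    {d | (∃ e, inc e = d ∧ e.1 ∈ P) ∧ D.cornerAt d = D.cornerAt (x, i + 2)}
  have hQ : ∀ d ∈ Q, D.next d ∈ Q := by
    rintro _ ⟨⟨e, rfl, he⟩, hc⟩
    refine ⟨?_, by rw [cornerAt_next, hc]⟩
    by_cases hm : (D.mate (inc e)).1 ∈ ({x, y} : Set D.Crossing)
    · exfalso
      rcases b.outer_cases e hm with h | h | h | h
      · rw [h, D.cornerAt_mate] at hc
        exact hD.sides_ne _ hc.symm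
      · exact p3 e h he
      · exact q2 e h he
      · rw [h, D.cornerAt_mate, cw] at hc
        have : ∀ i : ZMod 4, i + 3 - 1 = i + 2 := by decide
        rw [this] at hc
        exact hne hc.symm
    · have h1 := b.splice.inc_mate_of_notMem hm
      refine ⟨cw (b.splice.mate e), ?_, hP e he⟩
      rw [next, ← h1]; rfl
  obtain ⟨a₂, -, -, -, h2, -⟩ := b.exists_outer
  have h3 : D.next (x, i + 2) ∈ Q :=
    ⟨⟨cw a₂, by rw [next, ← h2]; rfl, p2 a₂ h2⟩, cornerAt_next _⟩
  obtain ⟨⟨e, he, -⟩, -⟩ := (next_mem_iff hQ).1 h3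
  exact e.1.2 (.inl (congrArg Prod.fst he))

/-- If the two opposite regions at a two-sided region are different, then the move `Ω₂↓` leads to a
connected diagram. -/
theorem exists_connected [Nonempty D.Crossing] (hD : D.IsConnected)
    (hover : IsOver i ↔ IsOver (j + 1)) (hne : D.cornerAt (x, i + 2) ≠ D.cornerAt (y, j + 2)) :
    ∃ (D' : LinkDiagram) (f : D'.Crossing → {w // w ∉ ({x, y} : Set D.Crossing)}),
      D.Omega2Down D' ∧ D'.IsConnected ∧ Function.Bijective f ∧
      ∀ d, Prod.map f id (D'.mate d) = b.splice.mate (Prod.map f id d) := by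
  classical
  have := b.nonempty_kept
  let r := D.cornerAt (x, i)
  have hy : D.cornerAt (y, j + 2) ≠ r := by
    obtain ⟨-, -, b₂, -, -, -, h2, -⟩ := b.exists_outer
    have := b.corner_ne hD (cw b₂)
    rwa [show inc (cw b₂) = cw (inc b₂) from rfl, h2, D.cornerAt_cw_mate] at this
  have hx : D.cornerAt (x, i + 2) ≠ r := by
    obtain ⟨b₂, -, -, -, h2, -⟩ := b.exists_outer
    have := b.corner_ne hD (cw b₂)
    rwa [show inc (cw b₂) = cw (inc b₂) from rfl, h2, D.cornerAt_cw_mate] at this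
  let R := {s // s ∉ ({r, D.cornerAt (x, i + 2)} : Set D.Region)}
  -- The region opposite to the bigon at `x` is merged into the one at `y`, and the bigon
  -- disappears; its own image does not matter. With two crossings and two regions less the map
  -- stays planar.
  let ρ : D.Region → R := fun s =>
    if hs : s ∈ ({r, D.cornerAt (x, i + 2)} : Set D.Region) then
      ⟨D.cornerAt (y, j + 2), by simpa using ⟨hy, hne.symm⟩⟩ else ⟨s, hs⟩
  have hρ1 : ∀ s, s ∉ ({r, D.cornerAt (x, i + 2)} : Set D.Region) → (ρ s).1 = s := fun s hs =>
    congrArg Subtype.val (dif_neg hs)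
  have hρ2 : (ρ (D.cornerAt (x, i + 2))).1 = D.cornerAt (y, j + 2) := by simp [ρ]
  have hρ3 : ρ (D.cornerAt (x, i + 2)) = ρ (D.cornerAt (y, j + 2)) := by
    ext
    rw [hρ2, hρ1]
    simpa using ⟨hy, hne.symm⟩
  have hsurj : ∀ t, ∃ d : {w // w ∉ ({x, y} : Set D.Crossing)} × ZMod 4,
      ρ (D.cornerAt (inc d)) = t := by
    rintro ⟨t, ht⟩
    obtain ⟨d, rfl⟩ := b.exists_kept hD (t := t) fun h => ht (.inl h)
    exact ⟨d, Subtype.ext (hρ1 _ ht)⟩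
  have hm : IsMap b.splice.edgeAt fun d => ρ (D.cornerAt (inc d)) :=
    ⟨b.splice.ends, b.splice.isFaceMap (b.region_eq hρ3),
      b.splice.conn fun P h1 h2 => b.conn_of_ne hD hne P h1 h2, hsurj⟩
  have hR : Nat.card {w // w ∉ ({x, y} : Set D.Crossing)} + 2 ≤ Nat.card R := by
    have h1 := b.card_kept
    have h2 := hD.card_region
    have h3 := Set.ncard_add_ncard_compl ({r, D.cornerAt (x, i + 2)} : Set D.Region)
    rw [Set.ncard_pair hx.symm] at h3
    have h4 : Nat.card R = ({r, D.cornerAt (x, i + 2)} : Set D.Region)ᶜ.ncard := rfl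
    omega
  refine ⟨hm.diagram hR, id, ?_, isConnected_diagram hm hR, Function.bijective_id, fun d => ?_⟩
  · refine b.omega2Down hD hover hsurj hρ3 ?_ id Function.bijective_id id Function.bijective_id
      id Function.bijective_id (fun _ _ => rfl) (fun _ _ => rfl)
    intro s s' hs hs' he
    have he := congrArg Subtype.val he
    by_cases h1 : s = D.cornerAt (x, i + 2) <;> by_cases h2 : s' = D.cornerAt (x, i + 2)
    · rw [h1, h2]; exact .refl _
    · rw [h1, hρ2, hρ1 s' (by simpa using ⟨hs', h2⟩)] at he
      rw [h1, ← he]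
      exact .rel _ _ ⟨rfl, rfl⟩
    · rw [h2, hρ2, hρ1 s (by simpa using ⟨hs, h1⟩)] at he
      rw [h2, he]
      exact .symm _ _ (.rel _ _ ⟨rfl, rfl⟩)
    · rw [hρ1 s (by simpa using ⟨hs, h1⟩), hρ1 s' (by simpa using ⟨hs', h2⟩)] at he
      rw [he]; exact .refl _
  · exact b.splice.mate_diagram hm hR d

end Bigon

end LinkDiagram

/-! ### The move Ω₂↓ on a connected diagram, when the result is disconnected -/

open Relation

namespace LinkDiagram

variable {D : LinkDiagram}

namespace Bigon

variable {x y : D.Crossing} {i j : ZMod 4} (b : D.Bigon x y i j)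
include b

/-- The face rule spelled out around a bigon: separate equations for the ends at `x` and `y` and for
their mates, and `hk` for the edges that do not meet the bigon. -/
lemma isFaceMap_of_eq {Y : Type} {α : D.Crossing × ZMod 4 → Y}
    (hk : ∀ d : {w // w ∉ ({x, y} : Set D.Crossing)} × ZMod 4,
      (D.mate (inc d)).1 ∉ ({x, y} : Set D.Crossing) → α (inc d) = α (D.next (inc d)))
    (h0 : α (x, i) = α (y, j)) (h1 : α (x, i + 1) = α (y, j + 3)) (h1' : α (y, j + 1) = α (x, i + 3))
    (n2 : α (x, i + 2) = α (D.next (x, i + 2))) (n3 : α (x, i + 3) = α (D.next (x, i + 3)))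
    (n2' : α (y, j + 2) = α (D.next (y, j + 2))) (n3' : α (y, j + 3) = α (D.next (y, j + 3)))
    (m2 : α (D.mate (x, i + 2)) = α (x, i + 1)) (m3 : α (D.mate (x, i + 3)) = α (x, i + 2))
    (m2' : α (D.mate (y, j + 2)) = α (y, j + 1)) (m3' : α (D.mate (y, j + 3)) = α (y, j + 2)) :
    IsFaceMap D.edgeAt α := by
  rw [D.isFaceMap_iff]
  have e : ∀ i : ZMod 4, i - 1 = i + 3 ∧ i + 2 - 1 = i + 1 ∧ i + 3 - 1 = i + 2 := by decide
  intro d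
  change α d = α (D.next d)
  by_cases hd : d.1 ∈ ({x, y} : Set D.Crossing)
  · rcases hd with hd | hd
    · rcases mk_add_cases d i with h | h | h | h <;> rw [hd] at h <;> subst h
      · rw [next, b.mate_zero, h0]; simp [cw]
      · rw [next, b.mate_one, h1, cw, (e j).1]
      · exact n2
      · exact n3
    · obtain hd : d.1 = y := hd
      rcases mk_add_cases d j with h | h | h | h <;> rw [hd] at h <;> subst h
      · rw [next, b.symm.mate_zero, ← h0]; simp [cw]
      · rw [next, b.symm.mate_one, h1', cw, (e i).1]
      · exact n2'
      · exact n3'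
  · obtain ⟨d, rfl⟩ := exists_inc hd
    by_cases hm : (D.mate (inc d)).1 ∈ ({x, y} : Set D.Crossing)
    · rcases b.outer_cases d hm with h | h | h | h <;> rw [h, next, D.mate_mate, cw]
      · rw [m2, (e i).2.1]
      · rw [m3, (e i).2.2]
      · rw [m2', (e j).2.1]
      · rw [m3', (e j).2.2]
    · exact hk d hm

/-- Remaining corners in one region of the whole diagram belong to the same face of the remaining
diagram, as long as both belong to the same component. -/
lemma face_eq [Nonempty D.Crossing] (hD : D.IsConnected)
    {S : Set D.Crossing} {τ : D.Crossing × ZMod 4 → D.Crossing × ZMod 4} (h : D.Splice S τ)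
    (hS : S = {x, y}) (t2 : τ (x, i + 2) = (y, j + 3)) (t3 : τ (x, i + 3) = (y, j + 2))
    (heq : D.cornerAt (x, i + 2) = D.cornerAt (y, j + 2)) {P : Set {w // w ∉ S}} (hP : h.IsClosed P)
    (p2 : ∀ d, inc d = D.mate (x, i + 2) → d.1 ∈ P) (q3 : ∀ d, inc d = D.mate (y, j + 3) → d.1 ∈ P)
    (p3 : ∀ d, inc d = D.mate (x, i + 3) → d.1 ∉ P) (q2 : ∀ d, inc d = D.mate (y, j + 2) → d.1 ∉ P)
    {d d' : {w // w ∉ S} × ZMod 4}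
    (hdd : D.cornerAt (inc d) = D.cornerAt (inc d'))
    (hd : D.cornerAt (inc d) = D.cornerAt (x, i + 2) → d.1 ∈ P ∧ d'.1 ∈ P) :
    (Quot.mk (FaceRel h.edgeAt) d) = Quot.mk _ d' := by
  subst hS
  classical
  set O := D.cornerAt (x, i + 2) with hO
  obtain ⟨a₂, a₃, b₂, b₃, h2, h3, k2, k3⟩ := b.exists_outer
  let mk' : {w // w ∉ ({x, y} : Set D.Crossing)} × ZMod 4 → Quot (FaceRel h.edgeAt) :=
    Quot.mk _
  have hmk : ∀ d, mk' d = mk' (cw (h.mate d)) :=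
    h.isFaceMap_iff.1 (isFaceMap_mk _)
  have h23 : h.mate a₂ = b₃ := inc_injective <| by
    rw [h.inc_mate_of_eq_mate (s := (x, i + 2)) (.inl rfl) h2, t2, k3]
  have h32 : h.mate b₃ = a₂ := by rw [← h23, h.mate_mate]
  have h23' : h.mate a₃ = b₂ := inc_injective <| by
    rw [h.inc_mate_of_eq_mate (s := (x, i + 3)) (.inl rfl) h3, t3, k2]
  have h32' : h.mate b₂ = a₃ := by rw [← h23', h.mate_mate]
  -- `α` extends the faces of the spliced diagram to all corners of `D`. In `D` the region `O` is
  -- one face running through both parts of the spliced diagram; the corners of it outside `P`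
  -- receive the value of its corners inside, namely the face of `b₃`. This makes `α` a face map of
  -- `D`, which is constant on regions by planarity.
  let α : D.Crossing × ZMod 4 → Quot (FaceRel h.edgeAt) := fun d =>
    if hd : d.1 ∈ ({x, y} : Set D.Crossing) then
      if d = (x, i + 1) ∨ d = (y, j + 3) then mk' a₂
      else if d = (y, j + 1) ∨ d = (x, i + 3) then mk' b₂ else mk' b₃
    else if D.cornerAt d = O ∧ (⟨d.1, hd⟩ : {w // w ∉ ({x, y} : Set D.Crossing)}) ∉ P then mk' b₃
    else mk' (⟨d.1, hd⟩, d.2)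
  have hαk : ∀ d, α (inc d) = if D.cornerAt (inc d) = O ∧ d.1 ∉ P then mk' b₃ else mk' d :=
    fun d => dif_neg d.1.2
  have e1 : ∀ i : ZMod 4, i ≠ i + 1 ∧ i ≠ i + 3 ∧ i + 2 ≠ i + 1 ∧ i + 2 ≠ i + 3 ∧ i + 3 ≠ i + 1 ∧
      i + 1 ≠ i + 3 := by decide
  have hx0 : α (x, i) = mk' b₃ := by simp [α, b.ne, (by decide : (1 : ZMod 4) ≠ 0), (by decide : (3 : ZMod 4) ≠ 0)]
  have hy0 : α (y, j) = mk' b₃ := by simp [α, b.ne.symm, (by decide : (1 : ZMod 4) ≠ 0), (by decide : (3 : ZMod 4) ≠ 0)]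
  have hx1 : α (x, i + 1) = mk' a₂ := by simp [α]
  have hy3 : α (y, j + 3) = mk' a₂ := by simp [α]
  have hy1 : α (y, j + 1) = mk' b₂ := by simp [α, b.ne.symm, e1 j]
  have hx3 : α (x, i + 3) = mk' b₂ := by simp [α, b.ne, e1 i]
  have hx2 : α (x, i + 2) = mk' b₃ := by simp [α, b.ne, e1 i]
  have hy2 : α (y, j + 2) = mk' b₃ := by simp [α, b.ne.symm, e1 j]
  have hin : ∀ d, (D.cornerAt (inc d) = O → d.1 ∈ P) → α (inc d) = mk' d := fun d hd => by
    rw [hαk, if_neg (fun h => h.2 (hd h.1))]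
  have hout : ∀ d, D.cornerAt (inc d) = O → d.1 ∉ P → α (inc d) = mk' b₃ := fun d hd hd' => by
    rw [hαk, if_pos ⟨hd, hd'⟩]
  have hcw : ∀ d : {w // w ∉ ({x, y} : Set D.Crossing)} × ZMod 4, inc (cw d) = cw (inc d) :=
    fun _ => rfl
  have e : ∀ i : ZMod 4, i + 2 - 1 = i + 1 ∧ i + 3 - 1 = i + 2 := by decide
  have hα : IsFaceMap D.edgeAt α := by
    refine b.isFaceMap_of_eq ?_ (hx0.trans hy0.symm) (hx1.trans hy3.symm) (hy1.trans hx3.symm)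
      ?_ ?_ ?_ ?_ ?_ ?_ ?_ ?_
    · intro d hm
      have h1 := h.inc_mate_of_notMem hm
      have hn : D.next (inc d) = inc (cw (h.mate d)) := by rw [hcw, h1]; rfl
      have hc : D.cornerAt (inc (cw (h.mate d))) = D.cornerAt (inc d) := by
        rw [← hn, cornerAt_next]
      rw [hn, hαk, hαk, hc, ← hmk d]
      simp only [cw_fst, Splice.IsClosed.mate_mem_iff h hP]
    · rw [hx2, next, ← h2, ← hcw, hin (cw a₂) fun _ => p2 a₂ h2, hmk b₃, h32]
    · rw [hx3, next, ← h3, ← hcw, hin (cw a₃) fun hc => ?_, hmk b₂, h32']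
      rw [hcw, h3, D.cornerAt_cw_mate] at hc
      exact absurd (by rw [hc, hO, cw, (e i).2]) (hD.sides_ne (x, i + 3))
    · rw [hy2, next, ← k2, ← hcw, hout (cw b₂) (by rw [hcw, k2, D.cornerAt_cw_mate, ← heq]) (q2 b₂ k2)]
    · rw [hy3, next, ← k3, ← hcw, hin (cw b₃) fun hc => ?_, hmk a₂, h23]
      rw [hcw, k3, D.cornerAt_cw_mate] at hc
      exact absurd (by rw [hc, heq, cw, (e j).2]) (hD.sides_ne (y, j + 3))
    · rw [hx1, ← h2, hin _ fun _ => p2 _ h2]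
    · rw [hx2, ← h3, hout _ (by rw [h3, D.cornerAt_mate, cw, (e i).2]) (p3 _ h3)]
    · rw [hy1, ← k2, hin _ fun h => ?_]
      rw [k2, D.cornerAt_mate] at h
      exact absurd (heq.symm.trans h.symm) (hD.sides_ne (y, j + 2))
    · rw [hy2, ← k3, hin _ fun _ => q3 _ k3]
  have := hD.isMap.eq_of_region_eq hD.card_region_le hα hdd
  rwa [hin _ fun h => (hd h).1, hin _ fun h => (hd (hdd.trans h)).2] at this

/-- If the two opposite regions at a two-sided region coincide, then the move `Ω₂↓` leads to a
disconnected diagram. -/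
theorem exists_disconnected [Nonempty D.Crossing] (hD : D.IsConnected)
    (hover : IsOver i ↔ IsOver (j + 1)) (heq : D.cornerAt (x, i + 2) = D.cornerAt (y, j + 2)) :
    ∃ D' : LinkDiagram, D.Omega2Down D' ∧ Nonempty D'.Edge ∧ ¬ D'.IsConnected := by
  classical
  have := b.nonempty_kept
  set r := D.cornerAt (x, i) with hr
  set O := D.cornerAt (x, i + 2) with hO
  have hOr : O ≠ r := by
    obtain ⟨b₂, -, -, -, h2, -⟩ := b.exists_outer
    have := b.corner_ne hD (cw b₂)
    rwa [show inc (cw b₂) = cw (inc b₂) from rfl, h2, D.cornerAt_cw_mate] at this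
  let R := {s // s ≠ r}
  let ρ : D.Region → R := fun s => if hs : s = r then ⟨O, hOr⟩ else ⟨s, hs⟩
  have hρ1 : ∀ s, s ≠ r → (ρ s).1 = s := fun s hs => congrArg Subtype.val (dif_neg hs)
  have hρr : ρ r = ρ O := by
    ext; rw [hρ1 O hOr]; simp [ρ]
  have hρ3 : ρ (D.cornerAt (x, i + 2)) = ρ (D.cornerAt (y, j + 2)) := by rw [← heq]
  have hsurj : ∀ t, ∃ d : {w // w ∉ ({x, y} : Set D.Crossing)} × ZMod 4,
      ρ (D.cornerAt (inc d)) = t := by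
    rintro ⟨t, ht⟩
    obtain ⟨d, rfl⟩ := b.exists_kept hD (t := t) ht
    exact ⟨d, Subtype.ext (hρ1 _ ht)⟩
  have hface : IsFaceMap b.splice.edgeAt fun d => ρ (D.cornerAt (inc d)) :=
    b.splice.isFaceMap (b.region_eq hρ3)
  have hcR : Nat.card R + 1 = Nat.card D.Region := by
    have := Set.ncard_add_ncard_compl ({r} : Set D.Region)
    rw [Set.ncard_singleton, add_comm] at this
    exact this
  have h1 := b.card_kept
  have h2 := hD.card_region
  -- Two crossings vanish but only one region does, so there is one region too many for a connected
  -- map.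
  have hnc : ¬ ∀ x y, ReflTransGen (fun x y => ∃ i j, b.splice.edgeAt (x, i) =
      b.splice.edgeAt (y, j)) x y := by
    intro hc
    have hm : IsMap b.splice.edgeAt fun d => ρ (D.cornerAt (inc d)) :=
      ⟨b.splice.ends, hface, hc, hsurj⟩
    have := hm.card_le_and_exact.1
    omega
  obtain ⟨P, hP, p2, q3, p3, q2⟩ := (b.conn_or hD).resolve_left fun h =>
    hnc (b.splice.conn h)
  -- The region `O` falls into two faces, one in `P` and one outside; every other remaining region
  -- stays a single face. The name `r` of the vanished bigon is reused for the second face of `O`.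
  have hF : Nat.card (Quot (FaceRel b.splice.edgeAt)) = Nat.card D.Region := by
    let c : {w // w ∉ ({x, y} : Set D.Crossing)} × ZMod 4 → D.Region := fun d =>
      if D.cornerAt (inc d) = O ∧ d.1 ∉ P then r else D.cornerAt (inc d)
    have hc : IsFaceMap b.splice.edgeAt c := by
      rw [b.splice.isFaceMap_iff]
      intro d
      have h3 := congrArg Subtype.val (b.splice.isFaceMap_iff.1 hface d)
      rw [hρ1 _ (b.corner_ne hD d), hρ1 _ (b.corner_ne hD _)] at h3
      simp only [c, cw_fst, Splice.IsClosed.mate_mem_iff b.splice hP, h3]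
    obtain ⟨a₂, a₃, b₂, b₃, k2, k3, l2, l3⟩ := b.exists_outer
    refine Nat.card_congr (Equiv.ofBijective hc.lift ⟨?_, ?_⟩)
    · intro f f' hff
      obtain ⟨d, rfl⟩ := Quot.exists_rep f
      obtain ⟨d', rfl⟩ := Quot.exists_rep f'
      rw [hc.lift_mk, hc.lift_mk] at hff
      simp only [c] at hff
      by_cases g1 : D.cornerAt (inc d) = O ∧ d.1 ∉ P <;>
        by_cases g2 : D.cornerAt (inc d') = O ∧ d'.1 ∉ P
      · refine b.symm.face_eq hD b.splice (Set.pair_comm x y) b.across_two' b.across_three' heq.symm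
          (Splice.IsClosed.compl _ hP) q2 p3 (fun d hd h => h (q3 d hd)) (fun d hd h => h (p2 d hd))
          (g1.1.trans g2.1.symm) fun _ => ⟨g1.2, g2.2⟩
      · rw [if_pos g1, if_neg g2] at hff
        exact absurd hff.symm (b.corner_ne hD d')
      · rw [if_neg g1, if_pos g2] at hff
        exact absurd hff (b.corner_ne hD d)
      · rw [if_neg g1, if_neg g2] at hff
        refine b.face_eq hD b.splice rfl across_two across_three heq hP p2 q3 p3 q2 hff fun h => ?_
        push Not at g1 g2
        exact ⟨g1 h, g2 (hff ▸ h)⟩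
    · intro t
      by_cases ht : t = r
      · refine ⟨Quot.mk _ a₃, ?_⟩
        rw [hc.lift_mk, ht]
        refine if_pos ⟨?_, p3 _ k3⟩
        have e : ∀ i : ZMod 4, i + 3 - 1 = i + 2 := by decide
        rw [k3, D.cornerAt_mate, cw, e]
      · by_cases htO : t = O
        · refine ⟨Quot.mk _ (cw a₂), ?_⟩
          rw [hc.lift_mk, htO]
          have : D.cornerAt (inc (cw a₂)) = O := by
            rw [show inc (cw a₂) = cw (inc a₂) from rfl, k2, D.cornerAt_cw_mate]
          simp only [c, this]
          exact if_neg fun h => h.2 (p2 a₂ k2)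
        · obtain ⟨d, rfl⟩ := b.exists_kept hD (t := t) ht
          exact ⟨Quot.mk _ d, by rw [hc.lift_mk]; exact if_neg fun h => htO h.1⟩
  -- The spliced graph is not connected, so the colouring is pulled back along `ρ` to `D`, where
  -- `color_const` applies.
  have hcol : ∀ c : R → Set R, (∀ d : {w // w ∉ ({x, y} : Set D.Crossing)} × ZMod 4,
      c (ρ (D.cornerAt (inc d))) = c (ρ (D.cornerAt (inc (cw d))))) → ∀ s t, c s = c t := by
    intro c hc s t
    have hm : ∀ p : D.Crossing × ZMod 4, (D.mate p).1 ∉ ({x, y} : Set D.Crossing) →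
        c (ρ (D.cornerAt p)) = c (ρ (D.cornerAt (cw p))) := by
      intro p hp
      obtain ⟨d, hd⟩ := exists_inc hp
      have := hc d
      rw [show inc (cw d) = cw (inc d) from rfl, hd, D.cornerAt_cw_mate, D.cornerAt_mate] at this
      exact this.symm
    have e : ∀ i : ZMod 4, i - 1 = i + 3 ∧ i + 1 - 1 = i ∧ i + 2 - 1 = i + 1 ∧ i + 3 - 1 = i + 2 := by
      decide
    have g2 := hm (x, i + 2) (by simpa using b.mate_two)
    have g3 := hm (x, i + 3) (by simpa using b.mate_three)
    have g2' := hm (y, j + 2) (by simpa using b.mate_two')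
    have g3' := hm (y, j + 3) (by simpa using b.mate_three')
    simp only [cw, e i, e j, ← heq, ← hO] at g2 g3 g2' g3'
    have key : ∀ p, c (ρ (D.cornerAt p)) = c (ρ (D.cornerAt (cw p))) := by
      intro p
      by_cases hp : p.1 ∈ ({x, y} : Set D.Crossing)
      · rcases hp with hp | hp
        · rcases mk_add_cases p i with h | h | h | h <;> rw [hp] at h <;> subst h <;>
            simp only [cw, e i, ← hO, ← hr]
          · rw [hρr, g3]
          · rw [hρr, g2]
          · exact g2
          · exact g3
        · obtain hp : p.1 = y := hp
          rcases mk_add_cases p j with h | h | h | h <;> rw [hp] at h <;> subst h <;>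
            simp only [cw, e j, ← heq, ← b.corner_zero, ← hr]
          · rw [hρr, g3']
          · rw [hρr, g2']
          · exact g2'
          · exact g3'
      · obtain ⟨d, rfl⟩ := exists_inc hp
        exact hc d
    have := hD.isMap.color_const (fun s => c (ρ s)) key s.1 t.1
    have hs : ∀ s : R, ρ s.1 = s := fun s => Subtype.ext (hρ1 _ s.2)
    simpa only [hs] using this
  refine ⟨diagramOfRegions b.splice.edgeAt (fun d => ρ (D.cornerAt (inc d))) b.splice.ends hface
    hcol (by rw [hF]; omega), ?_, ?_, fun hcon => hnc ?_⟩
  · refine b.omega2Down hD hover hsurj hρ3 ?_ id Function.bijective_id id Function.bijective_id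
      id Function.bijective_id (fun _ _ => rfl) (fun _ _ => rfl)
    intro s s' hs hs' he
    have he := congrArg Subtype.val he
    rw [hρ1 s hs, hρ1 s' hs'] at he
    rw [he]; exact .refl _
  · obtain ⟨a₂, -⟩ := b.exists_outer
    exact ⟨b.splice.edgeAt a₂⟩
  · exact hcon.isMap.conn

end Bigon

end LinkDiagram

/-! ### The Ω₃-type moves on a connected diagram -/

open Relation

namespace LinkDiagram

variable {D : LinkDiagram}

/-- Three crossings joined by the sides of a triangular region. -/
structure Triangle (D : LinkDiagram) (x y z : D.Crossing) (i j k : ZMod 4) : Prop where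
  ne_xy : x ≠ y
  ne_yz : y ≠ z
  ne_zx : z ≠ x
  mate_x : D.mate (x, i) = (y, j + 1)
  mate_y : D.mate (y, j) = (z, k + 1)
  mate_z : D.mate (z, k) = (x, i + 1)

namespace Triangle

variable {x y z : D.Crossing} {i j k : ZMod 4} (t : D.Triangle x y z i j k)
include t

lemma rotate : D.Triangle y z x j k i :=
  ⟨t.ne_yz, t.ne_zx, t.ne_xy, t.mate_y, t.mate_z, t.mate_x⟩

lemma corner_eq : D.cornerAt (x, i) = D.cornerAt (y, j) := by
  have := D.cornerAt_cw_mate (x, i)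
  rw [t.mate_x] at this
  simpa [cw] using this.symm

lemma corner_side : D.cornerAt (x, i + 3) = D.cornerAt (y, j + 1) := by
  have := D.cornerAt_mate (x, i)
  rw [t.mate_x, cw, sub_one_eq_add_three] at this
  exact this.symm

end Triangle

open Classical in
/-- The end of the original diagram from which an end continues after a triangle is turned. -/
noncomputable def turnDart (x y z : D.Crossing) (i j k : ZMod 4) (d : D.Crossing × ZMod 4) :
    D.Crossing × ZMod 4 :=
  if d = (x, i) then (y, j + 3) else if d = (x, i + 1) then (z, k + 2)
  else if d = (x, i + 2) then (x, i) else if d = (x, i + 3) then (x, i + 1)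
  else if d = (y, j) then (z, k + 3) else if d = (y, j + 1) then (x, i + 2)
  else if d = (y, j + 2) then (y, j) else if d = (y, j + 3) then (y, j + 1)
  else if d = (z, k) then (x, i + 3) else if d = (z, k + 1) then (y, j + 2)
  else if d = (z, k + 2) then (z, k) else if d = (z, k + 3) then (z, k + 1) else d

open Classical in
/-- The inverse of `turnDart`. -/
noncomputable def unturnDart (x y z : D.Crossing) (i j k : ZMod 4) (d : D.Crossing × ZMod 4) :
    D.Crossing × ZMod 4 :=
  if d = (x, i) then (x, i + 2) else if d = (x, i + 1) then (x, i + 3)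
  else if d = (x, i + 2) then (y, j + 1) else if d = (x, i + 3) then (z, k)
  else if d = (y, j) then (y, j + 2) else if d = (y, j + 1) then (y, j + 3)
  else if d = (y, j + 2) then (z, k + 1) else if d = (y, j + 3) then (x, i)
  else if d = (z, k) then (z, k + 2) else if d = (z, k + 1) then (z, k + 3)
  else if d = (z, k + 2) then (x, i + 1) else if d = (z, k + 3) then (y, j) else d

open Classical in
/-- The regions after a triangle is turned. -/
noncomputable def turnCorner (x y z : D.Crossing) (i j k : ZMod 4) (d : D.Crossing × ZMod 4) :
    D.Region :=
  if d = (x, i + 3) then D.cornerAt (y, j + 2) else if d = (y, j + 3) then D.cornerAt (z, k + 2)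
  else if d = (z, k + 3) then D.cornerAt (x, i + 2) else D.cornerAt (turnDart x y z i j k d)

namespace Triangle

variable {x y z : D.Crossing} {i j k : ZMod 4} (t : D.Triangle x y z i j k)

section
include t

omit t in
lemma turnDart_x : turnDart x y z i j k (x, i) = (y, j + 3) ∧
    turnDart x y z i j k (x, i + 1) = (z, k + 2) ∧ turnDart x y z i j k (x, i + 2) = (x, i) ∧
    turnDart x y z i j k (x, i + 3) = (x, i + 1) := by
  have e : ∀ i : ZMod 4, i + 1 ≠ i ∧ i + 2 ≠ i ∧ i + 3 ≠ i ∧ i + 2 ≠ i + 1 ∧ i + 3 ≠ i + 1 ∧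
    i + 3 ≠ i + 2 := by decide
  obtain ⟨h1, h2, h3, h4, h5, h6⟩ := e i
  simp only [turnDart, Prod.mk.injEq, true_and, if_true, h1, h2, h3, h4, h5, h6, if_false, and_self]

lemma turnDart_y : turnDart x y z i j k (y, j) = (z, k + 3) ∧
    turnDart x y z i j k (y, j + 1) = (x, i + 2) ∧ turnDart x y z i j k (y, j + 2) = (y, j) ∧
    turnDart x y z i j k (y, j + 3) = (y, j + 1) := by
  have e : ∀ i : ZMod 4, i + 1 ≠ i ∧ i + 2 ≠ i ∧ i + 3 ≠ i ∧ i + 2 ≠ i + 1 ∧ i + 3 ≠ i + 1 ∧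
    i + 3 ≠ i + 2 := by decide
  obtain ⟨h1, h2, h3, h4, h5, h6⟩ := e j
  simp only [turnDart, Prod.mk.injEq, true_and, if_true, h1, h2, h3, h4, h5, h6, if_false,
    and_self, t.ne_xy.symm, false_and]

lemma turnDart_z : turnDart x y z i j k (z, k) = (x, i + 3) ∧
    turnDart x y z i j k (z, k + 1) = (y, j + 2) ∧ turnDart x y z i j k (z, k + 2) = (z, k) ∧
    turnDart x y z i j k (z, k + 3) = (z, k + 1) := by
  have e : ∀ i : ZMod 4, i + 1 ≠ i ∧ i + 2 ≠ i ∧ i + 3 ≠ i ∧ i + 2 ≠ i + 1 ∧ i + 3 ≠ i + 1 ∧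
    i + 3 ≠ i + 2 := by decide
  obtain ⟨h1, h2, h3, h4, h5, h6⟩ := e k
  simp only [turnDart, Prod.mk.injEq, true_and, if_true, h1, h2, h3, h4, h5, h6, if_false,
    and_self, t.ne_zx, t.ne_yz.symm, false_and]

omit t in
lemma unturnDart_x : unturnDart x y z i j k (x, i) = (x, i + 2) ∧
    unturnDart x y z i j k (x, i + 1) = (x, i + 3) ∧ unturnDart x y z i j k (x, i + 2) = (y, j + 1) ∧
    unturnDart x y z i j k (x, i + 3) = (z, k) := by
  have e : ∀ i : ZMod 4, i + 1 ≠ i ∧ i + 2 ≠ i ∧ i + 3 ≠ i ∧ i + 2 ≠ i + 1 ∧ i + 3 ≠ i + 1 ∧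
    i + 3 ≠ i + 2 := by decide
  obtain ⟨h1, h2, h3, h4, h5, h6⟩ := e i
  simp only [unturnDart, Prod.mk.injEq, true_and, if_true, h1, h2, h3, h4, h5, h6, if_false,
    and_self]

lemma unturnDart_y : unturnDart x y z i j k (y, j) = (y, j + 2) ∧
    unturnDart x y z i j k (y, j + 1) = (y, j + 3) ∧ unturnDart x y z i j k (y, j + 2) = (z, k + 1) ∧
    unturnDart x y z i j k (y, j + 3) = (x, i) := by
  have e : ∀ i : ZMod 4, i + 1 ≠ i ∧ i + 2 ≠ i ∧ i + 3 ≠ i ∧ i + 2 ≠ i + 1 ∧ i + 3 ≠ i + 1 ∧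
    i + 3 ≠ i + 2 := by decide
  obtain ⟨h1, h2, h3, h4, h5, h6⟩ := e j
  simp only [unturnDart, Prod.mk.injEq, true_and, if_true, h1, h2, h3, h4, h5, h6, if_false,
    and_self, t.ne_xy.symm, false_and]

lemma unturnDart_z : unturnDart x y z i j k (z, k) = (z, k + 2) ∧
    unturnDart x y z i j k (z, k + 1) = (z, k + 3) ∧ unturnDart x y z i j k (z, k + 2) = (x, i + 1) ∧
    unturnDart x y z i j k (z, k + 3) = (y, j) := by
  have e : ∀ i : ZMod 4, i + 1 ≠ i ∧ i + 2 ≠ i ∧ i + 3 ≠ i ∧ i + 2 ≠ i + 1 ∧ i + 3 ≠ i + 1 ∧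
    i + 3 ≠ i + 2 := by decide
  obtain ⟨h1, h2, h3, h4, h5, h6⟩ := e k
  simp only [unturnDart, Prod.mk.injEq, true_and, if_true, h1, h2, h3, h4, h5, h6, if_false,
    and_self, t.ne_zx, t.ne_yz.symm, false_and]

lemma dart_cases (d : D.Crossing × ZMod 4) :
    ((d = (x, i) ∨ d = (x, i + 1) ∨ d = (x, i + 2) ∨ d = (x, i + 3)) ∨
    (d = (y, j) ∨ d = (y, j + 1) ∨ d = (y, j + 2) ∨ d = (y, j + 3)) ∨
    (d = (z, k) ∨ d = (z, k + 1) ∨ d = (z, k + 2) ∨ d = (z, k + 3))) ∨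
    (d.1 ≠ x ∧ d.1 ≠ y ∧ d.1 ≠ z) := by
  by_cases h1 : d.1 = x
  · subst h1; exact .inl (.inl (mk_add_cases d i))
  by_cases h2 : d.1 = y
  · subst h2; exact .inl (.inr (.inl (mk_add_cases d j)))
  by_cases h3 : d.1 = z
  · subst h3; exact .inl (.inr (.inr (mk_add_cases d k)))
  exact .inr ⟨h1, h2, h3⟩

omit t in
lemma turnDart_of_ne {d : D.Crossing × ZMod 4} (h : d.1 ≠ x ∧ d.1 ≠ y ∧ d.1 ≠ z) :
    turnDart x y z i j k d = d := by
  obtain ⟨h1, h2, h3⟩ := h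
  simp only [turnDart, Prod.ext_iff, h1, h2, h3, false_and, if_false]

omit t in
lemma unturnDart_of_ne {d : D.Crossing × ZMod 4} (h : d.1 ≠ x ∧ d.1 ≠ y ∧ d.1 ≠ z) :
    unturnDart x y z i j k d = d := by
  obtain ⟨h1, h2, h3⟩ := h
  simp only [unturnDart, Prod.ext_iff, h1, h2, h3, false_and, if_false]

lemma turnDart_unturnDart (d) : turnDart x y z i j k (unturnDart x y z i j k d) = d := by
  obtain ⟨x0, x1, x2, x3⟩ := turnDart_x
  obtain ⟨y0, y1, y2, y3⟩ := t.turnDart_y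
  obtain ⟨z0, z1, z2, z3⟩ := t.turnDart_z
  obtain ⟨x0', x1', x2', x3'⟩ := unturnDart_x
  obtain ⟨y0', y1', y2', y3'⟩ := t.unturnDart_y
  obtain ⟨z0', z1', z2', z3'⟩ := t.unturnDart_z
  rcases t.dart_cases d with
    ((rfl | rfl | rfl | rfl) | (rfl | rfl | rfl | rfl) | (rfl | rfl | rfl | rfl)) | h
  · rw [x0', x2]
  · rw [x1', x3]
  · rw [x2', y1]
  · rw [x3', z0]
  · rw [y0', y2]
  · rw [y1', y3]
  · rw [y2', z1]
  · rw [y3', x0]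
  · rw [z0', z2]
  · rw [z1', z3]
  · rw [z2', x1]
  · rw [z3', y0]
  · rw [unturnDart_of_ne h, turnDart_of_ne h]

lemma unturnDart_turnDart (d) : unturnDart x y z i j k (turnDart x y z i j k d) = d := by
  have hs : Function.Surjective (turnDart x y z i j k) := fun d =>
    ⟨_, t.turnDart_unturnDart d⟩
  exact (Finite.injective_iff_surjective.2 hs) (t.turnDart_unturnDart _)

/-- The edges after the triangle is turned. -/
lemma turn_edge_eq_iff {d e : D.Crossing × ZMod 4} :
    D.edgeAt (turnDart x y z i j k e) = D.edgeAt (turnDart x y z i j k d) ↔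
      e = d ∨ e = unturnDart x y z i j k (D.mate (turnDart x y z i j k d)) := by
  have hi : Function.LeftInverse (unturnDart x y z i j k) (turnDart x y z i j k) :=
    t.unturnDart_turnDart
  rw [D.edgeAt_eq_iff, hi.injective.eq_iff]
  refine or_congr_right ⟨fun h => ?_, fun h => ?_⟩
  · rw [← h, t.unturnDart_turnDart]
  · rw [h, t.turnDart_unturnDart]

/-- The tables are symmetric under rotation of the triangle, which transfers what is checked at `x`
to `y` and `z`. -/
lemma turnDart_rotate (d) : turnDart y z x j k i d = turnDart x y z i j k d := by
  obtain ⟨x0, x1, x2, x3⟩ := turnDart_x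
  obtain ⟨y0, y1, y2, y3⟩ := t.turnDart_y
  obtain ⟨z0, z1, z2, z3⟩ := t.turnDart_z
  obtain ⟨x0', x1', x2', x3'⟩ := t.rotate.turnDart_z
  obtain ⟨y0', y1', y2', y3'⟩ := turnDart_x
  obtain ⟨z0', z1', z2', z3'⟩ := t.rotate.turnDart_y
  rcases t.dart_cases d with
    ((rfl | rfl | rfl | rfl) | (rfl | rfl | rfl | rfl) | (rfl | rfl | rfl | rfl)) | h
  · rw [x0, x0']
  · rw [x1, x1']
  · rw [x2, x2']
  · rw [x3, x3']
  · rw [y0, y0']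
  · rw [y1, y1']
  · rw [y2, y2']
  · rw [y3, y3']
  · rw [z0, z0']
  · rw [z1, z1']
  · rw [z2, z2']
  · rw [z3, z3']
  · rw [turnDart_of_ne h, turnDart_of_ne ⟨h.2.1, h.2.2, h.1⟩]

lemma unturnDart_rotate (d) : unturnDart y z x j k i d = unturnDart x y z i j k d := by
  rw [← t.turnDart_unturnDart d, t.unturnDart_turnDart, ← t.turnDart_rotate,
    t.rotate.unturnDart_turnDart]

lemma turnCorner_rotate (d) : turnCorner y z x j k i d = turnCorner x y z i j k d := by
  have hd := t.turnDart_rotate d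
  unfold turnCorner
  rw [hd]
  by_cases h1 : d = (x, i + 3)
  · subst h1
    simp [t.ne_xy, t.ne_zx.symm]
  · simp [h1]

lemma turnCorner_x : turnCorner x y z i j k (x, i) = D.cornerAt (y, j + 3) ∧
    turnCorner x y z i j k (x, i + 1) = D.cornerAt (z, k + 2) ∧
    turnCorner x y z i j k (x, i + 2) = D.cornerAt (x, i) ∧
    turnCorner x y z i j k (x, i + 3) = D.cornerAt (y, j + 2) := by
  have e : ∀ i : ZMod 4, i ≠ i + 3 ∧ i + 1 ≠ i + 3 ∧ i + 2 ≠ i + 3 := by decide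
  obtain ⟨h1, h2, h3⟩ := e i
  obtain ⟨x0, x1, x2, x3⟩ :=
    turnDart_x (x := x) (y := y) (z := z) (i := i) (j := j) (k := k)
  simp only [turnCorner, Prod.mk.injEq, true_and, h1, h2, h3, if_false, t.ne_xy, t.ne_zx.symm,
    false_and, x0, x1, x2, and_self, if_true]

lemma turnCorner_y : turnCorner x y z i j k (y, j) = D.cornerAt (z, k + 3) ∧
    turnCorner x y z i j k (y, j + 1) = D.cornerAt (x, i + 2) ∧
    turnCorner x y z i j k (y, j + 2) = D.cornerAt (y, j) ∧
    turnCorner x y z i j k (y, j + 3) = D.cornerAt (z, k + 2) := by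
  simpa only [t.turnCorner_rotate] using t.rotate.turnCorner_x

lemma turnCorner_z : turnCorner x y z i j k (z, k) = D.cornerAt (x, i + 3) ∧
    turnCorner x y z i j k (z, k + 1) = D.cornerAt (y, j + 2) ∧
    turnCorner x y z i j k (z, k + 2) = D.cornerAt (z, k) ∧
    turnCorner x y z i j k (z, k + 3) = D.cornerAt (x, i + 2) := by
  simpa only [t.turnCorner_rotate, t.rotate.turnCorner_rotate] using t.rotate.rotate.turnCorner_x

omit t in
lemma turnCorner_of_ne {d : D.Crossing × ZMod 4} (h : d.1 ≠ x ∧ d.1 ≠ y ∧ d.1 ≠ z) :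
    turnCorner x y z i j k d = D.cornerAt d := by
  rw [turnCorner, turnDart_of_ne h]
  obtain ⟨h1, h2, h3⟩ := h
  simp only [Prod.ext_iff, h1, h2, h3, false_and, if_false]

/-- An edge that leaves the triangle now ends at another of the three crossings, but keeps its
regions on both sides. -/
lemma turnCorner_outer_x :
    turnCorner x y z i j k (unturnDart x y z i j k (x, i + 2)) = D.cornerAt (x, i + 2) ∧
    turnCorner x y z i j k (cw (unturnDart x y z i j k (x, i + 2))) = D.cornerAt (cw (x, i + 2)) ∧
    turnCorner x y z i j k (unturnDart x y z i j k (x, i + 3)) = D.cornerAt (x, i + 3) ∧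
    turnCorner x y z i j k (cw (unturnDart x y z i j k (x, i + 3))) = D.cornerAt (cw (x, i + 3)) := by
  have e : ∀ i : ZMod 4, i + 2 - 1 = i + 1 ∧ i + 3 - 1 = i + 2 ∧ i + 1 - 1 = i ∧ i - 1 = i + 3 := by
    decide
  simp only [unturnDart_x, t.turnCorner_y, t.turnCorner_z, cw, e, true_and,
    and_true]
  exact t.rotate.rotate.corner_side

lemma turnCorner_inner_x :
    turnCorner x y z i j k (unturnDart x y z i j k (x, i)) =
      turnCorner x y z i j k (cw (unturnDart x y z i j k (D.mate (x, i)))) ∧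
    turnCorner x y z i j k (unturnDart x y z i j k (x, i + 1)) =
      turnCorner x y z i j k (cw (unturnDart x y z i j k (D.mate (x, i + 1)))) := by
  have e : ∀ i : ZMod 4, i + 2 - 1 = i + 1 ∧ i + 3 - 1 = i + 2 ∧ i + 1 - 1 = i ∧ i - 1 = i + 3 := by
    decide
  have hz : D.mate (x, i + 1) = (z, k) := (D.mate_eq_comm.1 t.mate_z).symm
  rw [t.mate_x, hz]
  simp only [unturnDart_x, t.unturnDart_y, t.unturnDart_z, t.turnCorner_x, t.turnCorner_y,
    t.turnCorner_z, cw, e, and_true]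
  exact t.corner_eq

/-- The six ends on the sides of the triangle are mates of each other and are treated by the tables.
Every other end has the same two regions beside it as before the move. -/
lemma isFaceMap_turn :
    IsFaceMap (fun d => D.edgeAt (turnDart x y z i j k d)) (turnCorner x y z i j k) := by
  have key : ∀ d, turnCorner x y z i j k (unturnDart x y z i j k d) =
      turnCorner x y z i j k (cw (unturnDart x y z i j k (D.mate d))) := by
    have hx : D.mate (x, i + 1) = (z, k) := (D.mate_eq_comm.1 t.mate_z).symm
    have hy : D.mate (y, j + 1) = (x, i) := (D.mate_eq_comm.1 t.mate_x).symm
    have hz : D.mate (z, k + 1) = (y, j) := (D.mate_eq_comm.1 t.mate_y).symm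
    have ix := t.turnCorner_inner_x
    have iy := t.rotate.turnCorner_inner_x
    have iz := t.rotate.rotate.turnCorner_inner_x
    have ox := t.turnCorner_outer_x
    have oy := t.rotate.turnCorner_outer_x
    have oz := t.rotate.rotate.turnCorner_outer_x
    simp only [t.rotate.turnCorner_rotate, t.turnCorner_rotate, t.rotate.unturnDart_rotate,
      t.unturnDart_rotate] at iy iz oy oz
    let I : Set (D.Crossing × ZMod 4) :=
      {(x, i), (x, i + 1), (y, j), (y, j + 1), (z, k), (z, k + 1)}
    have hI : ∀ d, d ∈ I → D.mate d ∈ I := by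
      rintro d (rfl | rfl | rfl | rfl | rfl | rfl)
      · rw [t.mate_x]; simp [I]
      · rw [hx]; simp [I]
      · rw [t.mate_y]; simp [I]
      · rw [hy]; simp [I]
      · rw [t.mate_z]; simp [I]
      · rw [hz]; simp [I]
    have hO : ∀ d, d ∉ I → turnCorner x y z i j k (unturnDart x y z i j k d) = D.cornerAt d ∧
        turnCorner x y z i j k (cw (unturnDart x y z i j k d)) = D.cornerAt (cw d) := by
      intro d hd
      rcases t.dart_cases d with
        ((rfl | rfl | rfl | rfl) | (rfl | rfl | rfl | rfl) | (rfl | rfl | rfl | rfl)) | h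
      · exact absurd (by simp [I]) hd
      · exact absurd (by simp [I]) hd
      · exact ⟨ox.1, ox.2.1⟩
      · exact ⟨ox.2.2.1, ox.2.2.2⟩
      · exact absurd (by simp [I]) hd
      · exact absurd (by simp [I]) hd
      · exact ⟨oy.1, oy.2.1⟩
      · exact ⟨oy.2.2.1, oy.2.2.2⟩
      · exact absurd (by simp [I]) hd
      · exact absurd (by simp [I]) hd
      · exact ⟨oz.1, oz.2.1⟩
      · exact ⟨oz.2.2.1, oz.2.2.2⟩
      · rw [unturnDart_of_ne h, turnCorner_of_ne h, turnCorner_of_ne (d := cw d) h]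
        exact ⟨rfl, rfl⟩
    intro d
    by_cases hd : d ∈ I
    · rcases hd with rfl | rfl | rfl | rfl | rfl | rfl
      exacts [ix.1, ix.2, iy.1, iy.2, iz.1, iz.2]
    · have hm : D.mate d ∉ I := fun h => hd (by simpa using hI _ h)
      rw [(hO d hd).1, (hO _ hm).2, ← D.cornerAt_mate, D.mate_mate]
  intro p q hpq he
  have h1 := (t.turn_edge_eq_iff.1 he.symm).resolve_left hpq.symm
  rw [h1, ← key, t.unturnDart_turnDart]

/-- The three crossings remain joined by the turned sides, and `turnDart` moves ends only among
them, so connectedness persists. Every region keeps a corner; as the sets of crossings and regions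
are the same, the map stays planar. -/
lemma isMap_turn [Nonempty D.Crossing] (hD : D.IsConnected) :
    IsMap (fun d => D.edgeAt (turnDart x y z i j k d)) (turnCorner x y z i j k) where
  ends e := by
    obtain ⟨p, rfl⟩ := hD.exists_end e
    refine ⟨unturnDart x y z i j k p, unturnDart x y z i j k (D.mate p), fun h => ?_, fun s => ?_⟩
    · have := congrArg (turnDart x y z i j k) h
      rw [t.turnDart_unturnDart, t.turnDart_unturnDart] at this
      exact D.mate_ne p this.symm
    · have := t.turn_edge_eq_iff (d := unturnDart x y z i j k p) (e := s)
      rwa [t.turnDart_unturnDart] at this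
  face := t.isFaceMap_turn
  conn := by
    set r := fun a b : D.Crossing => ∃ i' j', D.edgeAt (turnDart x y z i j k (a, i')) =
      D.edgeAt (turnDart x y z i j k (b, j')) with hr
    have hsymm : ∀ {a b}, ReflTransGen r a b → ReflTransGen r b a := by
      intro a b h
      induction h with
      | refl => exact .refl
      | tail _ h ih =>
        obtain ⟨i', j', h⟩ := h
        exact ih.head ⟨j', i', h.symm⟩
    have key : ∀ {x y z : D.Crossing} {i j k : ZMod 4} (t : D.Triangle x y z i j k),
        D.edgeAt (turnDart x y z i j k (x, i + 2)) = D.edgeAt (turnDart x y z i j k (y, j + 3)) := by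
      intro x y z i j k t
      rw [(turnDart_x).2.2.1, t.turnDart_y.2.2.2, ← t.mate_x, D.edgeAt_mate]
    have hxy : ReflTransGen r x y := .single ⟨_, _, key t⟩
    have hyz : ReflTransGen r y z := .single ⟨_, _, by
      simpa only [t.turnDart_rotate] using key t.rotate⟩
    have hxz := hxy.trans hyz
    have hτ : ∀ d, ReflTransGen r d.1 (turnDart x y z i j k d).1 := by
      obtain ⟨x0, x1, x2, x3⟩ := turnDart_x (x := x) (y := y) (z := z) (i := i) (j := j) (k := k)
      obtain ⟨y0, y1, y2, y3⟩ := t.turnDart_y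
      obtain ⟨z0, z1, z2, z3⟩ := t.turnDart_z
      intro d
      rcases t.dart_cases d with
        ((rfl | rfl | rfl | rfl) | (rfl | rfl | rfl | rfl) | (rfl | rfl | rfl | rfl)) | h
      · rw [x0]; exact hxy
      · rw [x1]; exact hxz
      · rw [x2]
      · rw [x3]
      · rw [y0]; exact hyz
      · rw [y1]; exact hsymm hxy
      · rw [y2]
      · rw [y3]
      · rw [z0]; exact hsymm hxz
      · rw [z1]; exact hsymm hyz
      · rw [z2]
      · rw [z3]
      · rw [turnDart_of_ne h]
    intro a b
    refine hD.forall_of_mate (P := fun b => ReflTransGen r a b) (fun d hd => ?_) .refl b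
    have h1 := hτ (unturnDart x y z i j k d)
    have h2 := hτ (unturnDart x y z i j k (D.mate d))
    rw [t.turnDart_unturnDart] at h1 h2
    refine (hd.trans (hsymm h1)).trans (ReflTransGen.trans (.single ?_) h2)
    refine ⟨(unturnDart x y z i j k d).2, (unturnDart x y z i j k (D.mate d)).2, ?_⟩
    simp only [Prod.mk.eta, t.turnDart_unturnDart, D.edgeAt_mate]
  surj r := by
    obtain ⟨p, rfl⟩ := hD.isMap.surj r
    have hx := t.turnCorner_x
    have hy := t.turnCorner_y
    have hz := t.turnCorner_z
    have hs := t.corner_side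
    have hs' := t.rotate.corner_side
    have hs'' := t.rotate.rotate.corner_side
    rcases t.dart_cases p with
      ((rfl | rfl | rfl | rfl) | (rfl | rfl | rfl | rfl) | (rfl | rfl | rfl | rfl)) | h
    · exact ⟨_, hx.2.2.1⟩
    · exact ⟨_, hy.1.trans hs''⟩
    · exact ⟨_, hy.2.1⟩
    · exact ⟨_, hz.1⟩
    · exact ⟨_, hy.2.2.1⟩
    · exact ⟨_, hz.1.trans hs⟩
    · exact ⟨_, hx.2.2.2⟩
    · exact ⟨_, hx.1⟩
    · exact ⟨_, hz.2.2.1⟩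
    · exact ⟨_, hx.1.trans hs'⟩
    · exact ⟨_, hx.2.1⟩
    · exact ⟨_, hy.1⟩
    · exact ⟨p, turnCorner_of_ne h⟩

lemma onlyCorners [Nonempty D.Crossing] (hD : D.IsConnected) :
    D.OnlyCorners (D.cornerAt (x, i)) {(x, i), (y, j), (z, k)} := by
  refine hD.onlyCorners (fun d hd => ?_) (.inl rfl)
  rcases hd with rfl | rfl | hd
  · rw [next, t.mate_x]; right; left; simp [cw]
  · rw [next, t.mate_y]; right; right; simp [cw]
  · rw [Set.mem_singleton_iff] at hd
    subst hd
    rw [next, t.mate_z]; left; simp [cw]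

end

/-- The diagram after the triangle is turned. -/
noncomputable abbrev turn [Nonempty D.Crossing] (hD : D.IsConnected) : LinkDiagram :=
  (t.isMap_turn hD).diagram hD.card_region_le

lemma isConnected_turn [Nonempty D.Crossing] (hD : D.IsConnected) : (t.turn hD).IsConnected :=
  isConnected_diagram _ _

lemma mate_turn [Nonempty D.Crossing] (hD : D.IsConnected) (d) :
    (t.turn hD).mate d = unturnDart x y z i j k (D.mate (turnDart x y z i j k d)) :=
  (t.turn_edge_eq_iff.1 ((t.turn hD).edgeAt_mate d)).resolve_left ((t.turn hD).mate_ne d)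

lemma mate_turn_unturnDart [Nonempty D.Crossing] (hD : D.IsConnected) (d : D.Crossing × ZMod 4) :
    (t.turn hD).mate (unturnDart x y z i j k d) = unturnDart x y z i j k (D.mate d) := by
  rw [t.mate_turn hD]
  exact congrArg (fun e => unturnDart x y z i j k (D.mate e)) (t.turnDart_unturnDart d)

lemma flippedAt_turn [Nonempty D.Crossing] (hD : D.IsConnected) :
    D.FlippedAt (t.turn hD) id id id x y z i j k := by
  obtain ⟨x0, x1, x2, x3⟩ := turnDart_x (x := x) (y := y) (z := z) (i := i) (j := j) (k := k)
  obtain ⟨c0, c1, c2, c3⟩ := t.turnCorner_x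
  exact ⟨congrArg D.edgeAt x0, congrArg D.edgeAt x1, congrArg D.edgeAt x2, congrArg D.edgeAt x3,
    c0, c1, c2, c3⟩

/-- A triangle can be turned by an `Ω₃`-type move if the sides do not lie cyclically above each
other. -/
theorem omega3_turn [Nonempty D.Crossing] (hD : D.IsConnected)
    (hover : ¬ ((IsOver i ↔ IsOver j) ∧ (IsOver j ↔ IsOver k))) : D.Omega3 (t.turn hD) := by
  have edge_eq : ∀ {p q}, D.mate p = q → D.edgeAt p = D.edgeAt q := fun h => by
    rw [← h, D.edgeAt_mate]
  have hrot : ∀ d, turnDart z x y k i j d = turnDart x y z i j k d := fun d => by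
    rw [t.rotate.turnDart_rotate, t.turnDart_rotate]
  have hrotc : ∀ d, turnCorner z x y k i j d = turnCorner x y z i j k d := fun d => by
    rw [t.rotate.turnCorner_rotate, t.turnCorner_rotate]
  refine ⟨x, y, z, i, j, k, ⟨t.ne_xy, t.ne_yz, t.ne_zx, edge_eq t.mate_x, edge_eq t.mate_y,
    edge_eq t.mate_z, hover, t.onlyCorners hD⟩, .refl _, .refl _, .refl _, t.flippedAt_turn hD,
    ?_, ?_, ?_, fun e he => absurd he (hD.not_isFreeLoop e)⟩
  · have := t.rotate.flippedAt_turn hD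
    simpa only [FlippedAt, t.turnDart_rotate, t.turnCorner_rotate, id_eq, Equiv.refl_apply] using this
  · have := t.rotate.rotate.flippedAt_turn hD
    simpa only [FlippedAt, hrot, hrotc, id_eq, Equiv.refl_apply] using this
  · intro w h1 h2 h3 m
    exact ⟨congrArg D.edgeAt (turnDart_of_ne (d := (w, m)) ⟨h1, h2, h3⟩),
      turnCorner_of_ne (d := (w, m)) ⟨h1, h2, h3⟩⟩

end Triangle

end LinkDiagram

/-! ### Passing a strand across a crossing -/

open Relation

namespace LinkDiagram

variable {D : LinkDiagram}

lemma isConnected_of_mate [hX : Nonempty D.Crossing] (hloop : ∀ e, ¬ D.IsFreeLoop e)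
    (h : ∀ P : D.Crossing → Prop, (∀ d, P d.1 → P (D.mate d).1) → ∀ x, P x → ∀ y, P y) :
    D.IsConnected := by
  obtain ⟨x₀⟩ := hX
  have hend : ∀ e, ∃ p, D.edgeAt p = e := fun e => by
    have := hloop e
    simp only [IsFreeLoop, not_forall, not_not] at this
    obtain ⟨x, i, hx⟩ := this
    exact ⟨(x, i), hx⟩
  refine ⟨⟨D.edge x₀ 0⟩, fun e e' => ?_⟩
  obtain ⟨p, rfl⟩ := hend e
  obtain ⟨q, rfl⟩ := hend e'
  refine h (fun x => ∀ i, ReflTransGen (fun a b => ∃ x i j, D.edge x i = a ∧ D.edge x j = b)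
    (D.edgeAt p) (D.edge x i)) (fun d hd i => ?_) p.1 (fun i => .single ⟨p.1, p.2, i, rfl, rfl⟩)
    q.1 q.2
  exact (hd d.2).tail ⟨(D.mate d).1, (D.mate d).2, i, D.edgeAt_mate d, rfl⟩

section Push

variable {p q : D.Crossing × ZMod 4} (h : D.Adjacent p q) (o : ZMod 4)

lemma mate_push_pushDart (d : D.Crossing × ZMod 4) :
    (push h o).mate (pushDart p q o d) = pushDart p q o (D.mate d) := by
  have hE := pushExtension h.ne o
  refine ((push h o).eq_mate ?_ fun he => D.mate_ne d (hE.inj he)).symm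
  rw [push_edgeAt, push_edgeAt, hE.edge_map, hE.edge_map, D.edgeAt_mate]

lemma mate_push_left (k : Fin 4) :
    (push h o).mate (pushLeft p q o k) = pushRight D.Crossing o k := by
  have hE := pushExtension h.ne o
  refine ((push h o).eq_mate ?_ (hE.ne k).symm).symm
  rw [push_edgeAt, push_edgeAt, hE.edge_left, hE.edge_right]

lemma isConnected_push [Nonempty D.Crossing] (hD : D.IsConnected) : (push h o).IsConnected := by
  have : Nonempty (push h o).Crossing := ⟨(.inr true : D.Crossing ⊕ Bool)⟩
  refine isConnected_of_mate (fun e he => ?_) fun P hP x hx => ?_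
  · obtain ⟨f, -, hf⟩ := (push_isFreeLoop h o).1 he
    exact hD.not_isFreeLoop f hf
  · have hP' : ∀ d, P ((push h o).mate d).1 → P d.1 := fun d hd => by
      simpa only [mate_mate] using hP _ hd
    have h1 : P (Sum.inl p.1 : D.Crossing ⊕ Bool) ↔ P (Sum.inr false : D.Crossing ⊕ Bool) := by
      have h1 := hP (Sum.inl p.1, p.2)
      have h2 := hP' (Sum.inl p.1, p.2)
      rw [show (push h o).mate (Sum.inl p.1, p.2) = _ from mate_push_left h o 0] at h1 h2
      exact ⟨h1, h2⟩
    have h2 : P (Sum.inr false : D.Crossing ⊕ Bool) ↔ P (Sum.inr true : D.Crossing ⊕ Bool) := by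
      have h1 := hP (Sum.inr false, o + 3)
      have h2 := hP' (Sum.inr false, o + 3)
      rw [show (push h o).mate (Sum.inr false, o + 3) = _ from mate_push_left h o 1] at h1 h2
      exact ⟨h1, h2⟩
    have h3 : P (Sum.inl q.1 : D.Crossing ⊕ Bool) ↔ P (Sum.inr false : D.Crossing ⊕ Bool) := by
      have h1 := hP (Sum.inl q.1, q.2)
      have h2 := hP' (Sum.inl q.1, q.2)
      rw [show (push h o).mate (Sum.inl q.1, q.2) = _ from mate_push_left h o 2] at h1 h2
      exact ⟨h1, h2⟩
    have h4 : ∀ d : D.Crossing × ZMod 4, P (Sum.inl d.1 : D.Crossing ⊕ Bool) ↔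
        P (pushDart p q o d).1 := by
      intro d
      by_cases hp : d = p
      · subst hp
        rw [pushDart_p, h1, h2]
      · by_cases hq : d = q
        · subst hq
          rw [pushDart_q h.ne, h3, h2]
        · rw [pushDart_old hp hq]
    have h5 : ∀ d : D.Crossing × ZMod 4, P (Sum.inl d.1 : D.Crossing ⊕ Bool) →
        P (Sum.inl (D.mate d).1 : D.Crossing ⊕ Bool) := by
      intro d hd
      rw [h4] at hd ⊢
      have := hP _ hd
      rwa [mate_push_pushDart] at this
    have h6 : ∃ w : D.Crossing, P (Sum.inl w : D.Crossing ⊕ Bool) := by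
      obtain w | b := (x : D.Crossing ⊕ Bool)
      · exact ⟨w, hx⟩
      · refine ⟨p.1, h1.2 ?_⟩
        cases b
        · exact hx
        · exact h2.2 hx
    obtain ⟨w, hw⟩ := h6
    have h7 := hD.forall_of_mate (P := fun w => P (Sum.inl w : D.Crossing ⊕ Bool)) h5 hw
    intro y
    obtain w | b := (y : D.Crossing ⊕ Bool)
    · exact h7 w
    · cases b
      · exact h1.1 (h7 _)
      · exact h2.1 (h1.1 (h7 _))

end Push

lemma eqvGen_of_step {D D' : LinkDiagram} (h : D.NonIncreasingStep D') :
    EqvGen NonIncreasingStep D D' := .rel _ _ h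

/-- The result of passing a strand across the crossing `v`: the strand leaves the crossing `c`
through the end `s`, and the edge at the end `s + 1` leads to the end `b` of `v`. -/
structure Passed (D D' : LinkDiagram) (c v : D.Crossing) (s b : ZMod 4)
    (ι : D.Crossing ⊕ Bool ≃ D'.Crossing)
    (σ : D.Crossing × ZMod 4 → D'.Crossing × ZMod 4) : Prop where
  mate_map : ∀ d, D'.mate (σ d) = σ (D.mate d)
  map_old : ∀ d : D.Crossing × ZMod 4, d.1 ≠ c → d.1 ≠ v → σ d = (ι (.inl d.1), d.2)
  map_c0 : σ (c, s) = (ι (.inr true), s)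
  map_c2 : σ (c, s + 2) = (ι (.inr false), s + 2)
  map_v1 : σ (v, b + 1) = (ι (.inr true), s + 1)
  map_v2 : σ (v, b + 2) = (ι (.inl c), s + 1)
  map_v3 : σ (v, b + 3) = (ι (.inr false), s + 1)
  mate_y0 : D'.mate (ι (.inr false), s) = (ι (.inl c), s + 2)
  mate_c0 : D'.mate (ι (.inl c), s) = (ι (.inr true), s + 2)
  mate_y3 : D'.mate (ι (.inr false), s + 3) = (ι (.inl v), b + 3)
  mate_c3 : D'.mate (ι (.inl c), s + 3) = (ι (.inl v), b + 2)
  mate_z3 : D'.mate (ι (.inr true), s + 3) = (ι (.inl v), b + 1)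

/-- Ω₂↑ followed by Ω₃. The strand at `(c, s)` is pushed across the edge at `(v, b + 1)`. The offset
`s + 1` gives it the ends `s` and `s + 2` at the new crossings, so it lies above or below as it does
at `c`. Then `c`, `inr false` and `v` bound a triangle; turning it brings `v` to the other side of
the strand, which now runs through `inr false`, `c` and `inr true`. -/
theorem IsConnected.exists_passed [Nonempty D.Crossing] (hD : D.IsConnected) {c v : D.Crossing}
    {s b : ZMod 4} (hcv : c ≠ v) (hm : D.mate (c, s + 1) = (v, b)) :
    ∃ (D' : LinkDiagram) (ι : D.Crossing ⊕ Bool ≃ D'.Crossing)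
      (σ : D.Crossing × ZMod 4 → D'.Crossing × ZMod 4), D'.IsConnected ∧
      EqvGen NonIncreasingStep D D' ∧ Passed D D' c v s b ι σ := by
  have hne : ((c, s) : D.Crossing × ZMod 4) ≠ (v, b + 1) := fun h => hcv (congrArg Prod.fst h)
  have hcw : cw ((v, b + 1) : D.Crossing × ZMod 4) = (v, b) := by simp [cw]
  have hm' : D.mate (v, b) = (c, s + 1) := (D.mate_eq_comm.1 hm).symm
  have hA : D.Adjacent (c, s) (v, b + 1) :=
    ⟨hne, .inr ⟨by rw [hcw]; exact fun h => hcv (congrArg Prod.fst h).symm, by rw [hcw, hm']⟩⟩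
  have e : ∀ s : ZMod 4, s + 1 + 1 = s + 2 ∧ s + 1 + 2 = s + 3 ∧ s + 1 + 3 = s := by decide
  have e' : ∀ s : ZMod 4, s + 1 ≠ s ∧ s ≠ s + 1 ∧ s + 2 ≠ s ∧ s + 3 ≠ s + 1 ∧ s + 2 ≠ s + 1 := by decide
  have : Nonempty (push hA (s + 1)).Crossing := ⟨(.inr true : D.Crossing ⊕ Bool)⟩
  have l0 : (push hA (s + 1)).mate (.inl c, s) = (.inr false, s + 1 + 1) := mate_push_left hA (s + 1) 0
  have l1 : (push hA (s + 1)).mate (.inr false, s + 1 + 3) = (.inr true, s + 1 + 1) :=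
    mate_push_left hA (s + 1) 1
  have l2 : (push hA (s + 1)).mate (.inl v, b + 1) = (.inr false, s + 1) :=
    mate_push_left hA (s + 1) 2
  have l3 : (push hA (s + 1)).mate (.inr false, s + 1 + 2) = (.inr true, s + 1 + 2) :=
    mate_push_left hA (s + 1) 3
  have l2' := ((push hA (s + 1)).mate_eq_comm.1 l2).symm
  have pv : pushDart (c, s) (v, b + 1) (s + 1) (v, b) = (.inl v, b) :=
    pushDart_old (fun h => hcv (congrArg Prod.fst h).symm) (by simp [e']) _
  have pc : pushDart (c, s) (v, b + 1) (s + 1) (c, s + 1) = (.inl c, s + 1) :=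
    pushDart_old (by simp [e']) (fun h => hcv (congrArg Prod.fst h)) _
  have mv : (push hA (s + 1)).mate (.inl v, b) = (.inl c, s + 1) := by
    have := mate_push_pushDart hA (s + 1) (v, b)
    rwa [hm', pv, pc] at this
  have t : (push hA (s + 1)).Triangle (.inl c : D.Crossing ⊕ Bool) (.inr false : D.Crossing ⊕ Bool)
      (.inl v : D.Crossing ⊕ Bool) s (s + 1) b :=
    ⟨by simp, by simp, by simpa using hcv.symm, l0, l2', mv⟩
  have hcon := isConnected_push hA (s + 1) hD
  -- The strand is at the same level at `c` and at the first new crossing, so the triangle is not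
  -- cyclic.
  have hover : ¬ ((IsOver s ↔ IsOver (s + 1)) ∧ (IsOver (s + 1) ↔ IsOver b)) := by
    have : ∀ s : ZMod 4, ¬ (IsOver s ↔ IsOver (s + 1)) := by unfold IsOver; decide
    exact fun h => this s h.1
  have l1' := ((push hA (s + 1)).mate_eq_comm.1 l1).symm
  have l0' := ((push hA (s + 1)).mate_eq_comm.1 l0).symm
  have l3' := ((push hA (s + 1)).mate_eq_comm.1 l3).symm
  have mv' := ((push hA (s + 1)).mate_eq_comm.1 mv).symm
  obtain ⟨c0, c1, c2, c3⟩ := Triangle.unturnDart_x (D := push hA (s + 1))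
    (x := (.inl c : D.Crossing ⊕ Bool)) (y := (.inr false : D.Crossing ⊕ Bool))
    (z := (.inl v : D.Crossing ⊕ Bool)) (i := s) (j := s + 1) (k := b)
  obtain ⟨y0, y1, y2, y3⟩ := t.unturnDart_y
  obtain ⟨v0, v1, v2, v3⟩ := t.unturnDart_z
  have hz : ∀ k, unturnDart (D := push hA (s + 1)) (.inl c : D.Crossing ⊕ Bool)
      (.inr false : D.Crossing ⊕ Bool) (.inl v : D.Crossing ⊕ Bool) s (s + 1) b
      ((.inr true : D.Crossing ⊕ Bool), k) = ((.inr true : D.Crossing ⊕ Bool), k) := fun k =>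
    Triangle.unturnDart_of_ne ⟨Sum.inr_ne_inl, by simp, Sum.inr_ne_inl⟩
  have hm := t.mate_turn_unturnDart hcon
  have hmk : ∀ {a a' b' b'' : (push hA (s + 1)).Crossing × ZMod 4},
      unturnDart (D := push hA (s + 1)) (.inl c : D.Crossing ⊕ Bool)
        (.inr false : D.Crossing ⊕ Bool) (.inl v : D.Crossing ⊕ Bool) s (s + 1) b a = a' →
      (push hA (s + 1)).mate a = b' → unturnDart (D := push hA (s + 1)) (.inl c : D.Crossing ⊕ Bool)
        (.inr false : D.Crossing ⊕ Bool) (.inl v : D.Crossing ⊕ Bool) s (s + 1) b b' = b'' →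
      (t.turn hcon).mate a' = b'' := by
    rintro a _ _ _ rfl rfl rfl
    exact hm a
  refine ⟨t.turn hcon, .refl _, fun d => unturnDart (D := push hA (s + 1))
    (.inl c : D.Crossing ⊕ Bool) (.inr false : D.Crossing ⊕ Bool) (.inl v : D.Crossing ⊕ Bool)
    s (s + 1) b (pushDart (c, s) (v, b + 1) (s + 1) d), t.isConnected_turn hcon, ?_, ?_⟩
  · exact .trans _ _ _ (.symm _ _ (eqvGen_of_step (.inr (.inr (.inl (omega2Down_push hA (s + 1)))))))
      (eqvGen_of_step (.inr (.inr (.inr (t.omega3_turn hcon hover)))))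
  · constructor
    · intro d
      exact (hm _).trans (congrArg _ (mate_push_pushDart hA (s + 1) d))
    · intro d h1 h2
      dsimp only
      rw [pushDart_old (fun h => h1 (congrArg Prod.fst h)) (fun h => h2 (congrArg Prod.fst h))]
      exact Triangle.unturnDart_of_ne ⟨by simpa using h1, Sum.inl_ne_inr, by simpa using h2⟩
    · dsimp only
      rw [pushDart_p, hz, (e s).2.2]; rfl
    · dsimp only
      rw [pushDart_old (by simp [e']) (fun h => hcv (congrArg Prod.fst h)), c2, (e s).1]; rfl
    · dsimp only
      rw [pushDart_q hne, hz]; rfl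
    · dsimp only
      rw [pushDart_old (fun h => hcv (congrArg Prod.fst h).symm) (by simp [e']), v2]; rfl
    · dsimp only
      rw [pushDart_old (fun h => hcv (congrArg Prod.fst h).symm) (by simp [e']), v3]; rfl
    · have := hmk y1 l0' c0
      rw [(e s).2.2] at this
      exact this
    · have := hmk y3 l1 (hz _)
      rw [(e s).1] at this
      exact this
    · have := hmk y0 l2' v1
      rw [(e s).2.1] at this
      exact this
    · exact hmk c1 mv' v0
    · have := hmk (hz _) l3' y2
      rw [(e s).2.1] at this
      exact this

end LinkDiagram

/-! ### Sweeping a strand over the crossings to its left -/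

open Relation

namespace LinkDiagram

variable {D : LinkDiagram}

/-- The end opposite to `d`. -/
def opposite (d : D.Crossing × ZMod 4) : D.Crossing × ZMod 4 := (d.1, d.2 + 2)

/-- The end to the left of `d`. -/
def left (d : D.Crossing × ZMod 4) : D.Crossing × ZMod 4 := (d.1, d.2 + 1)

/-- The end to the right of `d`. -/
def right (d : D.Crossing × ZMod 4) : D.Crossing × ZMod 4 := (d.1, d.2 + 3)

/-- The strand that starts at `a` leaves the crossings that it passes through the ends in `l`, the
last of which is `t`. -/
def Strand (D : LinkDiagram) : (D.Crossing × ZMod 4) → List (D.Crossing × ZMod 4) →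
    (D.Crossing × ZMod 4) → Prop
  | a, [], t => a = t
  | a, p :: l, t => D.mate a = opposite p ∧ Strand D p l t

lemma strand_append {a t : D.Crossing × ZMod 4} {l l' : List (D.Crossing × ZMod 4)} :
    D.Strand a (l ++ l') t ↔ ∃ b, D.Strand a l b ∧ D.Strand b l' t := by
  induction l generalizing a with
  | nil => simp [Strand]
  | cons p l ih => simp only [List.cons_append, Strand, ih]; tauto

lemma Strand.mem {a t : D.Crossing × ZMod 4} {l : List (D.Crossing × ZMod 4)} (h : D.Strand a l t)
    (hl : l ≠ []) : t ∈ l := by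
  induction l generalizing a with
  | nil => exact absurd rfl hl
  | cons p l ih =>
    obtain ⟨-, h⟩ := h
    by_cases hn : l = []
    · subst hn
      rw [show p = t from h]
      exact List.mem_cons_self
    · exact List.mem_cons_of_mem _ (ih h hn)

/-- The ends to the left of a strand, the ends of the crossings in `U`, and the last end. -/
def sweepSet (l : List (D.Crossing × ZMod 4)) (t : D.Crossing × ZMod 4) (U : Set D.Crossing) :
    Set (D.Crossing × ZMod 4) := {d | d.1 ∈ U ∨ (∃ p ∈ l, d = left p) ∨ d = t}

/-- A strand that lies above or below everything it crosses, and that is the only connection of the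
crossings `U` to its left with the rest of the diagram. -/
structure IsSweep (D : LinkDiagram) (a : D.Crossing × ZMod 4) (l : List (D.Crossing × ZMod 4))
    (t : D.Crossing × ZMod 4) (U : Set D.Crossing) : Prop where
  strand : D.Strand a l t
  ne_nil : l ≠ []
  nodup : (l.map Prod.fst).Nodup
  parity : ∀ p ∈ l, ∀ q ∈ l, IsOver p.2 ↔ IsOver q.2
  disj : ∀ p ∈ l, p.1 ∉ U
  start : ∀ p ∈ l, a.1 ≠ p.1
  start_notMem : a.1 ∉ U
  mate_right : ∀ p ∈ l, ∀ q ∈ l, (D.mate (right p)).1 ≠ q.1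
  stable : ∀ d ∈ sweepSet l t U, D.mate d ∈ sweepSet l t U

namespace IsSweep

variable {a t : D.Crossing × ZMod 4} {l : List (D.Crossing × ZMod 4)} {U : Set D.Crossing}
  (h : D.IsSweep a l t U)
include h

lemma mem : t ∈ l := h.strand.mem h.ne_nil

lemma eq_of_fst_eq {p q : D.Crossing × ZMod 4} (hp : p ∈ l) (hq : q ∈ l) (hpq : p.1 = q.1) :
    p = q := List.inj_on_of_nodup_map h.nodup hp hq hpq

omit h in
lemma left_mem {p} (hp : p ∈ l) : left p ∈ sweepSet l t U := .inr (.inl ⟨p, hp, rfl⟩)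

lemma right_notMem {p} (hp : p ∈ l) : right p ∉ sweepSet l t U := by
  have e : ∀ i : ZMod 4, i + 3 ≠ i + 1 ∧ i + 3 ≠ i := by decide
  rintro (h1 | ⟨q, hq, h1⟩ | h1)
  · exact h.disj p hp h1
  · obtain rfl := h.eq_of_fst_eq hp hq (by have := congrArg Prod.fst h1; exact this)
    exact (e p.2).1 (congrArg Prod.snd h1)
  · obtain rfl := h.eq_of_fst_eq hp h.mem (by have := congrArg Prod.fst h1; exact this)
    exact (e p.2).2 (congrArg Prod.snd h1)

/-- The sweep set is stable under the involution `mate`, hence so is its complement, to which the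
right ends belong. -/
lemma mate_right_notMem {p} (hp : p ∈ l) : (D.mate (right p)).1 ∉ U := by
  intro h1
  have := h.stable _ (.inl h1)
  rw [D.mate_mate] at this
  exact h.right_notMem hp this

end IsSweep

lemma Passed.strand {D' : LinkDiagram} {c v : D.Crossing} {s b : ZMod 4}
    {ι : D.Crossing ⊕ Bool ≃ D'.Crossing} {σ : D.Crossing × ZMod 4 → D'.Crossing × ZMod 4}
    (h : Passed D D' c v s b ι σ) {a t : D.Crossing × ZMod 4} {l : List (D.Crossing × ZMod 4)}
    (hl : ∀ p ∈ l, p.1 ≠ c ∧ p.1 ≠ v) (hs : D.Strand a l t) : D'.Strand (σ a) (l.map σ) (σ t) := by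
  induction l generalizing a with
  | nil => exact congrArg σ hs
  | cons p l ih =>
    obtain ⟨h1, h2⟩ := hs
    have hp := hl p List.mem_cons_self
    refine ⟨?_, ih (fun p hp => hl p (List.mem_cons_of_mem _ hp)) h2⟩
    rw [h.mate_map, h1, h.map_old p hp.1 hp.2, h.map_old (opposite p) hp.1 hp.2]
    rfl

/-- The strand of a sweep can be passed across a neighbouring crossing. -/
theorem IsSweep.exists_pass [Nonempty D.Crossing] (hD : D.IsConnected)
    {a t : D.Crossing × ZMod 4} {l : List (D.Crossing × ZMod 4)} {U : Set D.Crossing}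
    (h : D.IsSweep a l t U) {p} (hp : p ∈ l) (hU : (D.mate (left p)).1 ∈ U) :
    ∃ (D' : LinkDiagram) (a' t' : D'.Crossing × ZMod 4) (l' : List (D'.Crossing × ZMod 4))
      (U' : Set D'.Crossing), D'.IsConnected ∧ EqvGen NonIncreasingStep D D' ∧
      D'.IsSweep a' l' t' U' ∧ U'.ncard < U.ncard ∧ l'.length = l.length + 2 ∧
      D'.numCrossings = D.numCrossings + 2 := by
  obtain ⟨A, B, rfl⟩ := List.append_of_mem hp
  obtain ⟨c, s⟩ := p
  rcases hm : D.mate (left (c, s)) with ⟨v, b⟩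
  rw [hm] at hU
  change D.mate (c, s + 1) = (v, b) at hm
  change v ∈ U at hU
  have hcv : c ≠ v := fun he => h.disj _ hp (he ▸ hU)
  obtain ⟨D', ι, σ, hD', heqv, hσ⟩ := hD.exists_passed hcv hm
  have hnd := h.nodup
  simp only [List.map_append, List.map_cons, List.nodup_append, List.nodup_cons] at hnd
  obtain ⟨hA, ⟨hcB, hB⟩, hAB⟩ := hnd
  have hl : ∀ q, q ∈ A ∨ q ∈ B → q.1 ≠ c ∧ q.1 ≠ v := by
    intro q hq
    constructor
    · rintro rfl
      rcases hq with hq | hq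
      · exact hAB _ (List.mem_map_of_mem hq) _ List.mem_cons_self rfl
      · exact hcB (List.mem_map_of_mem hq)
    · rintro rfl
      refine h.disj q ?_ hU
      simp only [List.mem_append, List.mem_cons]; tauto
  have hσl : ∀ q, q ∈ A ∨ q ∈ B → σ q = (ι (.inl q.1), q.2) := fun q hq =>
    hσ.map_old q (hl q hq).1 (hl q hq).2
  have hmem : ∀ q, q ∈ A ∨ q ∈ B → q ∈ A ++ (c, s) :: B := by
    intro q hq; simp only [List.mem_append, List.mem_cons]; tauto
  have hσfst : ∀ q, q ∈ A ∨ q ∈ B → (σ q).1 = ι (.inl q.1) := fun q hq => by rw [hσl q hq]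
  have hmem' : ∀ q, q ∈ A.map σ ++ (ι (.inr false), s) :: (ι (.inl c), s) :: (ι (.inr true), s) ::
      B.map σ ↔ (∃ q', (q' ∈ A ∨ q' ∈ B) ∧ σ q' = q) ∨ q = (ι (.inr false), s) ∨
        q = (ι (.inl c), s) ∨ q = (ι (.inr true), s) := by
    intro q
    simp only [List.mem_append, List.mem_cons, List.mem_map]
    constructor
    · rintro (⟨q', h1, h2⟩ | h1 | h1 | h1 | ⟨q', h1, h2⟩)
      exacts [.inl ⟨q', .inl h1, h2⟩, .inr (.inl h1), .inr (.inr (.inl h1)), .inr (.inr (.inr h1)),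
        .inl ⟨q', .inr h1, h2⟩]
    · rintro (⟨q', h1 | h1, h2⟩ | h1 | h1 | h1)
      exacts [.inl ⟨q', h1, h2⟩, .inr (.inr (.inr (.inr ⟨q', h1, h2⟩))), .inr (.inl h1),
        .inr (.inr (.inl h1)), .inr (.inr (.inr (.inl h1)))]
  have hfst : ∀ w : D.Crossing, (∀ q ∈ A ++ (c, s) :: B, w ≠ q.1) →
      ∀ q ∈ A.map σ ++ (ι (.inr false), s) :: (ι (.inl c), s) :: (ι (.inr true), s) :: B.map σ,
      ι (.inl w) ≠ q.1 := by
    intro w hw q hq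
    rcases (hmem' q).1 hq with ⟨q', h1, rfl⟩ | rfl | rfl | rfl
    · rw [hσfst q' h1]
      exact fun he => hw q' (hmem q' h1) (Sum.inl_injective (ι.injective he))
    · exact fun he => by simpa using ι.injective he
    · exact fun he => hw (c, s) hp (Sum.inl_injective (ι.injective he))
    · exact fun he => by simpa using ι.injective he
  have hav : a.1 ≠ v := fun he => h.start_notMem (he ▸ hU)
  have hσa : σ a = (ι (.inl a.1), a.2) := hσ.map_old a (h.start _ hp) hav
  obtain ⟨d, hs1, hs2, hs3⟩ := strand_append.1 h.strand
  have hmv : D.mate (v, b) = (c, s + 1) := (D.mate_eq_comm.1 hm).symm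
  have hvl : ∀ q ∈ A ++ (c, s) :: B, v ≠ q.1 := fun q hq he => h.disj q hq (he ▸ hU)
  have e1 : ∀ i : ZMod 4, i + 1 ≠ i := by decide
  -- The crossing `c` of the strand is replaced by three crossings, and `v` has left `U`.
  refine ⟨D', σ a, σ t, A.map σ ++ (ι (.inr false), s) :: (ι (.inl c), s) :: (ι (.inr true), s) ::
    B.map σ, (fun w => ι (.inl w)) '' (U \ {v}), hD', heqv, ?_, ?_, ?_, ?_⟩
  · constructor
    · rw [strand_append]
      refine ⟨σ d, hσ.strand (fun q hq => hl q (.inl hq)) hs1, ?_, ?_, ?_, ?_⟩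
      · rw [hσ.mate_map, hs2]; exact hσ.map_c2
      · exact hσ.mate_y0
      · exact hσ.mate_c0
      · have := hσ.strand (fun q hq => hl q (.inr hq)) hs3
        rwa [hσ.map_c0] at this
    · simp
    · have hA' : (A.map σ).map Prod.fst = (A.map Prod.fst).map fun w => ι (.inl w) := by
        rw [List.map_map, List.map_map]
        exact List.map_congr_left fun q hq => hσfst q (.inl hq)
      have hB' : (B.map σ).map Prod.fst = (B.map Prod.fst).map fun w => ι (.inl w) := by
        rw [List.map_map, List.map_map]
        exact List.map_congr_left fun q hq => hσfst q (.inr hq)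
      have hinj : Function.Injective fun w : D.Crossing => ι (.inl w) :=
        ι.injective.comp Sum.inl_injective
      have hAB' : ∀ x ∈ A.map Prod.fst, ∀ y ∈ B.map Prod.fst, x ≠ y := fun x hx y hy =>
        hAB x hx y (List.mem_cons_of_mem _ hy)
      have hAc : c ∉ A.map Prod.fst := fun hc => hAB c hc c List.mem_cons_self rfl
      rw [List.map_append, List.map_cons, List.map_cons, List.map_cons, hA', hB']
      simp only [List.nodup_append, List.nodup_cons, List.nodup_map_iff hinj, hA, hB, true_and,
        List.mem_cons, List.mem_map (f := fun w => ι (.inl w)), ι.injective.eq_iff]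
      refine ⟨⟨?_, ?_, ?_, trivial⟩, ?_⟩
      · simp
      · rintro (h1 | ⟨w, hw, h1⟩)
        · simp at h1
        · obtain rfl := Sum.inl_injective h1
          exact hcB hw
      · simp
      · rintro _ ⟨w, hw, rfl⟩ x (rfl | rfl | rfl | ⟨w', hw', rfl⟩) he
        · simpa using ι.injective he
        · obtain rfl := Sum.inl_injective (ι.injective he)
          exact hAc hw
        · simpa using ι.injective he
        · obtain rfl := Sum.inl_injective (ι.injective he)
          exact hAB' _ hw _ hw' rfl
    · have : ∀ q ∈ A.map σ ++ (ι (.inr false), s) :: (ι (.inl c), s) :: (ι (.inr true), s) ::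
          B.map σ, IsOver q.2 ↔ IsOver s := by
        intro q hq
        rcases (hmem' q).1 hq with ⟨q', h1, rfl⟩ | rfl | rfl | rfl
        · rw [hσl q' h1]
          exact h.parity q' (hmem q' h1) (c, s) hp
        · rfl
        · rfl
        · rfl
      exact fun q hq q' hq' => (this q hq).trans (this q' hq').symm
    · rintro q hq ⟨w, ⟨hw, -⟩, he⟩
      exact hfst w (fun q hq he => h.disj q hq (he ▸ hw)) q hq he
    · rw [hσa]
      exact hfst _ h.start
    · rw [hσa]
      rintro ⟨w, ⟨hw, -⟩, he⟩
      rw [Sum.inl_injective (ι.injective he)] at hw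
      exact h.start_notMem hw
    · intro q hq
      rcases (hmem' q).1 hq with ⟨q', h1, rfl⟩ | rfl | rfl | rfl
      · have h2 : right (σ q') = σ (right q') := by
          rw [hσl q' h1, hσ.map_old (right q') (hl q' h1).1 (hl q' h1).2]; rfl
        rw [h2, hσ.mate_map]
        have h3 := h.mate_right q' (hmem q' h1)
        have h4 := h.mate_right_notMem (hmem q' h1)
        rw [hσ.map_old _ (h3 _ hp) fun he => h4 (he ▸ hU)]
        exact hfst _ h3
      · intro r hr
        have h2 := hσ.mate_y3
        rw [show right (ι (.inr false), s) = (ι (.inr false), s + 3) from rfl, h2]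
        exact hfst v hvl r hr
      · intro r hr
        have h2 := hσ.mate_c3
        rw [show right (ι (.inl c), s) = (ι (.inl c), s + 3) from rfl, h2]
        exact hfst v hvl r hr
      · intro r hr
        have h2 := hσ.mate_z3
        rw [show right (ι (.inr true), s) = (ι (.inr true), s + 3) from rfl, h2]
        exact hfst v hvl r hr
    -- The new sweep set is the image of the old one without the edge from `c` to `v`. The two ends
    -- removed are mates of each other, so stability is inherited.
    · have key : ∀ x, x ∈ sweepSet (A.map σ ++ (ι (.inr false), s) :: (ι (.inl c), s) ::
          (ι (.inr true), s) :: B.map σ) (σ t) ((fun w => ι (.inl w)) '' (U \ {v})) ↔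
          ∃ d ∈ sweepSet (A ++ (c, s) :: B) t U, d ≠ (c, s + 1) ∧ d ≠ (v, b) ∧ σ d = x := by
        intro x
        constructor
        · rintro (⟨w, ⟨hw, hwv⟩, he⟩ | ⟨q, hq, rfl⟩ | rfl)
          · have hwc : w ≠ c := by
              rintro rfl; exact h.disj _ hp hw
            refine ⟨(w, x.2), .inl hw, fun h => hwc (congrArg Prod.fst h),
              fun h => hwv (congrArg Prod.fst h), ?_⟩
            rw [hσ.map_old (w, x.2) hwc hwv]
            exact Prod.ext he rfl
          · have e : ∀ b : ZMod 4, b + 1 ≠ b ∧ b + 2 ≠ b ∧ b + 3 ≠ b := by decide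
            rcases (hmem' q).1 hq with ⟨q', h1, rfl⟩ | rfl | rfl | rfl
            · refine ⟨left q', left_mem (hmem q' h1), fun h => (hl q' h1).1 (congrArg Prod.fst h),
                fun h => (hl q' h1).2 (congrArg Prod.fst h), ?_⟩
              rw [hσl q' h1, hσ.map_old (left q') (hl q' h1).1 (hl q' h1).2]; rfl
            · exact ⟨(v, b + 3), .inl hU, fun h => hcv (congrArg Prod.fst h).symm,
                fun h => (e b).2.2 (congrArg Prod.snd h), hσ.map_v3⟩
            · exact ⟨(v, b + 2), .inl hU, fun h => hcv (congrArg Prod.fst h).symm,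
                fun h => (e b).2.1 (congrArg Prod.snd h), hσ.map_v2⟩
            · exact ⟨(v, b + 1), .inl hU, fun h => hcv (congrArg Prod.fst h).symm,
                fun h => (e b).1 (congrArg Prod.snd h), hσ.map_v1⟩
          · refine ⟨t, .inr (.inr rfl), fun he => ?_, fun he => ?_, rfl⟩
            · have := h.eq_of_fst_eq h.mem hp (by have := congrArg Prod.fst he; exact this)
              rw [this] at he
              exact e1 s (congrArg Prod.snd he).symm
            · exact hvl t h.mem (congrArg Prod.fst he).symm
        · rintro ⟨d, hd, h1, h2, rfl⟩
          rcases hd with hd | ⟨q, hq, rfl⟩ | rfl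
          · by_cases hdv : d.1 = v
            · have hk := mk_add_cases d b
              rw [hdv] at hk
              rcases hk with rfl | rfl | rfl | rfl
              · exact absurd rfl h2
              · exact .inr (.inl ⟨_, (hmem' _).2 (.inr (.inr (.inr rfl))), hσ.map_v1⟩)
              · exact .inr (.inl ⟨_, (hmem' _).2 (.inr (.inr (.inl rfl))), hσ.map_v2⟩)
              · exact .inr (.inl ⟨_, (hmem' _).2 (.inr (.inl rfl)), hσ.map_v3⟩)
            · have hdc : d.1 ≠ c := fun he => h.disj _ hp (he ▸ hd)
              left
              rw [hσ.map_old d hdc hdv]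
              exact ⟨d.1, ⟨hd, hdv⟩, rfl⟩
          · have hq' : q ∈ A ∨ q ∈ B := by
              simp only [List.mem_append, List.mem_cons] at hq
              rcases hq with hq | rfl | hq
              exacts [.inl hq, absurd rfl h1, .inr hq]
            refine .inr (.inl ⟨σ q, (hmem' _).2 (.inl ⟨q, hq', rfl⟩), ?_⟩)
            rw [hσl q hq', hσ.map_old (left q) (hl q hq').1 (hl q hq').2]; rfl
          · exact .inr (.inr rfl)
      intro x hx
      obtain ⟨d, hd, h1, h2, rfl⟩ := (key x).1 hx
      refine (key _).2 ⟨D.mate d, h.stable d hd, fun he => h2 ?_, fun he => h1 ?_,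
        (hσ.mate_map d).symm⟩
      · rw [D.mate_eq_comm.1 he, hm]
      · rw [D.mate_eq_comm.1 he, hmv]
  · rw [Set.ncard_image_of_injective _ (show Function.Injective fun w => ι (.inl w) from
      ι.injective.comp Sum.inl_injective)]
    exact Set.ncard_sdiff_singleton_lt_of_mem hU
  · simp only [List.length_append, List.length_cons, List.length_map]; omega
  · have := Nat.card_congr ι
    rw [Nat.card_sum, Nat.card_eq_fintype_card (α := Bool), Fintype.card_bool] at this
    exact this.symm

end LinkDiagram

/-! ### Innermost arcs beside a strand -/

open Relation

namespace LinkDiagram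

variable {D : LinkDiagram}

/-- There is an even number of edge-ends at the crossings in a set. -/
lemma not_almost_stable {U : Set D.Crossing} {u : D.Crossing × ZMod 4} (hu : u.1 ∈ U)
    (h : ∀ d : D.Crossing × ZMod 4, d.1 ∈ U → d ≠ u → (D.mate d).1 ∈ U ∧ D.mate d ≠ u) : False := by
  classical
  cases nonempty_fintype D.Crossing
  let T : Finset (D.Crossing × ZMod 4) := Finset.univ.filter fun d => d.1 ∈ U ∧ d ≠ u
  -- The ends other than `u` are paired off by `mate`, so their number is even; but together with
  -- `u` it is four times the number of crossings in `U`.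
  have h1 : ∑ _d ∈ T, (1 : ZMod 2) = 0 := by
    refine Finset.sum_involution (fun d _ => D.mate d) (fun _ _ => by decide)
      (fun d _ _ => D.mate_ne d) (fun d hd => ?_) (fun d _ => D.mate_mate d)
    simp only [T, Finset.mem_filter, Finset.mem_univ, true_and] at hd ⊢
    exact h d hd.1 hd.2
  have h2 : Finset.univ.filter (fun d : D.Crossing × ZMod 4 => d.1 ∈ U) = insert u T := by
    ext d
    simp only [T, Finset.mem_filter, Finset.mem_univ, true_and, Finset.mem_insert]
    by_cases hd : d = u
    · simp [hd, hu]
    · simp [hd]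
  have h3 : Finset.univ.filter (fun d : D.Crossing × ZMod 4 => d.1 ∈ U) =
      (Finset.univ.filter fun x => x ∈ U) ×ˢ (Finset.univ : Finset (ZMod 4)) := by
    ext d; simp
  have h4 : u ∉ T := by simp [T]
  have h5 := congrArg Finset.card h2
  rw [h3, Finset.card_product, Finset.card_insert_of_notMem h4, Finset.card_univ, ZMod.card] at h5
  rw [Finset.sum_const, nsmul_eq_mul, mul_one, ZMod.natCast_eq_zero_iff] at h1
  omega

namespace IsSweep

variable {a t : D.Crossing × ZMod 4} {l : List (D.Crossing × ZMod 4)} {U : Set D.Crossing}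

/-- Otherwise the edges from `U` lead to `U`, except for one that may lead to `t`. If there is such
an edge, an odd number of ends in `U` would be paired off; if there is none, `U` is separated from
the strand, against connectedness. -/
lemma exists_mate_left_mem [Nonempty D.Crossing] (hD : D.IsConnected) (h : D.IsSweep a l t U)
    (hU : U.Nonempty) : ∃ p ∈ l, (D.mate (left p)).1 ∈ U := by
  by_contra! hc
  obtain ⟨w, hw⟩ := hU
  have key : ∀ d : D.Crossing × ZMod 4, d.1 ∈ U → (D.mate d).1 ∈ U ∨ D.mate d = t := by
    intro d hd
    rcases h.stable d (.inl hd) with h1 | ⟨p, hp, h1⟩ | h1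
    · exact .inl h1
    · refine absurd ?_ (hc p hp)
      rw [← h1, D.mate_mate]; exact hd
    · exact .inr h1
  by_cases ht : (D.mate t).1 ∈ U
  · refine not_almost_stable ht fun d hd hne => ⟨(key d hd).resolve_right fun h1 => ?_, fun h1 => ?_⟩
    · exact hne (D.mate_eq_comm.1 h1)
    · have : d = t := by rw [← D.mate_mate d, h1, D.mate_mate]
      exact h.disj t h.mem (this ▸ hd)
  · refine h.disj t h.mem (hD.forall_of_mate (P := fun w => w ∈ U) (fun d hd => ?_) hw t.1)
    refine (key d hd).resolve_right fun h1 => ht ?_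
    rw [← h1, D.mate_mate]; exact hd

end IsSweep

/-- The edges of a strand form a mod 2 chain from its start to its end. -/
lemma Strand.exists_chain {a t : D.Crossing × ZMod 4} {l : List (D.Crossing × ZMod 4)} [DecidableEq D.Crossing]
    (h : D.Strand a l t) : ∃ z : D.Edge → ZMod 2,
      IsMap.boundary D.edgeAt z = Pi.single a.1 1 + Pi.single t.1 1 ∧
      ∀ d, (∀ q ∈ l, d ≠ opposite q ∧ D.mate d ≠ opposite q) → z (D.edgeAt d) = 0 := by
  classical
  induction l generalizing a with
  | nil =>
    obtain rfl : a = t := h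
    refine ⟨0, ?_, fun _ _ => rfl⟩
    rw [map_zero, ← Pi.single_add, CharTwo.add_self_eq_zero, Pi.single_zero]
  | cons p l ih =>
    obtain ⟨h1, h2⟩ := h
    obtain ⟨z, hz, hz'⟩ := ih h2
    refine ⟨Pi.single (D.edgeAt a) 1 + z, ?_, fun d hd => ?_⟩
    · rw [map_add, hz, IsMap.boundary_single (D.mate_ne a).symm fun s => D.edgeAt_eq_iff, h1]
      change Pi.single a.1 1 + Pi.single p.1 1 + _ = _
      rw [add_assoc, ← add_assoc (Pi.single p.1 1) (Pi.single p.1 1), ← Pi.single_add,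
        CharTwo.add_self_eq_zero, Pi.single_zero, zero_add]
    · have h3 : D.edgeAt d ≠ D.edgeAt a := by
        intro he
        have h4 := hd p List.mem_cons_self
        rcases D.edgeAt_eq_iff.1 he with rfl | rfl
        · exact h4.2 h1
        · exact h4.1 h1
      rw [Pi.add_apply, Pi.single_eq_of_ne h3, hz' d fun q hq => hd q (List.mem_cons_of_mem _ hq),
        zero_add]

/-- Both corners lie on the left of the edge from `p` to `q`. -/
lemma corner_of_mate_eq_opposite {p q : D.Crossing × ZMod 4} (h : D.mate p = opposite q) :
    D.cornerAt (left q) = D.cornerAt p := by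
  have := D.cornerAt_cw_mate p
  rw [h] at this
  have e : ∀ i : ZMod 4, i + 2 - 1 = i + 1 := by decide
  rw [← this, cw, opposite, e]; rfl

lemma cw_left (p : D.Crossing × ZMod 4) : cw (left p) = p := by simp [cw, left]

/-- A colouring that does not change at the ends to the left of a strand is constant on the left
side of the strand. -/
lemma Strand.color_eq {a t : D.Crossing × ZMod 4} {l : List (D.Crossing × ZMod 4)}
    {c : D.Region → ZMod 2} (h : D.Strand a l t)
    (hc : ∀ p ∈ l, c (D.cornerAt (left p)) = c (D.cornerAt p)) :
    (∀ p ∈ l, c (D.cornerAt p) = c (D.cornerAt a)) ∧ c (D.cornerAt t) = c (D.cornerAt a) := by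
  induction l generalizing a with
  | nil =>
    obtain rfl : a = t := h
    exact ⟨fun _ h => absurd h List.not_mem_nil, rfl⟩
  | cons p l ih =>
    obtain ⟨h1, h2⟩ := h
    obtain ⟨h3, h4⟩ := ih h2 fun p hp => hc p (List.mem_cons_of_mem _ hp)
    have h5 : c (D.cornerAt p) = c (D.cornerAt a) := by
      rw [← hc p List.mem_cons_self, corner_of_mate_eq_opposite h1]
    refine ⟨fun q hq => ?_, h4.trans h5⟩
    rcases List.mem_cons.1 hq with rfl | hq
    · exact h5
    · exact (h3 q hq).trans h5

namespace IsSweep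

variable {a t : D.Crossing × ZMod 4} {l : List (D.Crossing × ZMod 4)}

lemma mate_left (h : D.IsSweep a l t ∅) {p} (hp : p ∈ l) :
    (∃ q ∈ l, D.mate (left p) = left q) ∨ D.mate (left p) = t :=
  (h.stable _ (left_mem hp)).resolve_left fun h => h

lemma left_inj (h : D.IsSweep a l t ∅) {p q} (hp : p ∈ l) (hq : q ∈ l) (he : left p = left q) :
    p = q := h.eq_of_fst_eq hp hq (by have := congrArg Prod.fst he; exact this)

lemma left_ne (h : D.IsSweep a l t ∅) {p} (hp : p ∈ l) : left p ≠ t := fun he => by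
  have e : ∀ i : ZMod 4, i + 1 ≠ i := by decide
  obtain rfl := h.eq_of_fst_eq hp h.mem (by have := congrArg Prod.fst he; exact this)
  exact e _ (congrArg Prod.snd he)

/-- The arcs to the left of the strand do not cross. -/
lemma mem_of_mate_left [Nonempty D.Crossing] (hD : D.IsConnected)
    {A B C : List (D.Crossing × ZMod 4)} {x y : D.Crossing × ZMod 4}
    (h : D.IsSweep a (A ++ x :: (B ++ y :: C)) t ∅) (hxy : D.mate (left x) = left y) {i}
    (hi : i ∈ B) : ∃ q ∈ B, D.mate (left i) = left q := by
  classical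
  have hyx : D.mate (left y) = left x := (D.mate_eq_comm.1 hxy).symm
  have hx : x ∈ A ++ x :: (B ++ y :: C) := by simp
  have hy : y ∈ A ++ x :: (B ++ y :: C) := by simp
  have hA : ∀ q ∈ A, q ∈ A ++ x :: (B ++ y :: C) := fun q hq => by simp [hq]
  have hB : ∀ q ∈ B, q ∈ A ++ x :: (B ++ y :: C) := fun q hq => by simp [hq]
  have hC : ∀ q ∈ C, q ∈ A ++ x :: (B ++ y :: C) := fun q hq => by simp [hq]
  have hnd := h.nodup.of_map
  simp only [List.nodup_append, List.nodup_cons, List.mem_append, List.mem_cons] at hnd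
  obtain ⟨-, ⟨hxB, -, ⟨hyC, -⟩, hBy⟩, hAx⟩ := hnd
  obtain ⟨d, hs1, hs2, hs3⟩ := strand_append.1 h.strand
  obtain ⟨d', hs4, hs5, hs6⟩ := strand_append.1 hs3
  have hs7 : D.Strand x (B ++ [y]) y := strand_append.2 ⟨d', hs4, hs5, rfl⟩
  obtain ⟨z, hz, hz'⟩ := hs7.exists_chain
  have hout : ∀ d ∈ sweepSet (A ++ x :: (B ++ y :: C)) t ∅, ∀ q ∈ A ++ x :: (B ++ y :: C),
      d ≠ opposite q := by
    have e : ∀ i : ZMod 4, i + 1 ≠ i + 2 ∧ i ≠ i + 2 := by decide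
    rintro d (hd | ⟨p, hp, rfl⟩ | rfl) q hq he
    · exact hd
    · obtain rfl := h.eq_of_fst_eq hp hq (by have := congrArg Prod.fst he; exact this)
      exact (e p.2).1 (congrArg Prod.snd he)
    · obtain rfl := h.eq_of_fst_eq h.mem hq (by have := congrArg Prod.fst he; exact this)
      exact (e d.2).2 (congrArg Prod.snd he)
  have hzS : ∀ d ∈ sweepSet (A ++ x :: (B ++ y :: C)) t ∅, z (D.edgeAt d) = 0 := by
    intro d hd
    refine hz' d fun q hq => ?_
    have hq' : q ∈ A ++ x :: (B ++ y :: C) := by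
      rcases List.mem_append.1 hq with hq | hq
      · exact hB q hq
      · rw [List.mem_singleton.1 hq]; exact hy
    exact ⟨hout d hd q hq', hout _ (h.stable d hd) q hq'⟩
  -- The strand from `x` to `y` and the arc between their left ends form a closed curve, and `c`
  -- colours its two sides.
  obtain ⟨c, hc⟩ := hD.isMap.jordan hD.card_region_le (z + Pi.single (D.edgeAt (left x)) 1)
    (fun w => by
      have : IsMap.boundary D.edgeAt (z + Pi.single (D.edgeAt (left x)) 1) = 0 := by
        rw [map_add, hz, IsMap.boundary_single (D.mate_ne (left x)).symm fun s => D.edgeAt_eq_iff,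
          hxy]
        exact CharTwo.add_self_eq_zero _
      exact congrFun this w)
  -- The edges at the other left ends do not belong to the curve, so the colour on the left of the
  -- strand changes at `x` and at `y` only.
  have hcl : ∀ p ∈ A ++ x :: (B ++ y :: C), p ≠ x → p ≠ y →
      c (D.cornerAt (left p)) = c (D.cornerAt p) := by
    intro p hp hpx hpy
    have h1 := hc (left p)
    rw [Pi.add_apply, hzS _ (left_mem hp), Pi.single_eq_of_ne, zero_add, cw_left] at h1
    · exact CharTwo.add_eq_zero.1 h1.symm
    · intro he
      rcases D.edgeAt_eq_iff.1 he with he | he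
      · exact hpx (h.left_inj hp hx he)
      · rw [hxy] at he; exact hpy (h.left_inj hp hy he)
  have hcx : 1 = c (D.cornerAt (left x)) + c (D.cornerAt x) := by
    have h1 := hc (left x)
    rwa [Pi.add_apply, hzS _ (left_mem hx), Pi.single_eq_same, zero_add, cw_left] at h1
  have hcy : 1 = c (D.cornerAt (left y)) + c (D.cornerAt y) := by
    have h1 := hc (left y)
    rwa [Pi.add_apply, hzS _ (left_mem hy), ← hxy, D.edgeAt_mate, Pi.single_eq_same, zero_add, hxy,
      cw_left] at h1
  have kA := hs1.color_eq (c := c) fun p hp => hcl p (hA p hp)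
    (fun he => hAx p hp x (.inl rfl) he) (fun he => hAx p hp y (.inr (.inr (.inl rfl))) he)
  have kB := hs4.color_eq (c := c) fun p hp => hcl p (hB p hp)
    (fun he => hxB (.inl (he ▸ hp))) (fun he => hBy p hp y (.inl rfl) he)
  have kC := hs6.color_eq (c := c) fun p hp => hcl p (hC p hp)
    (fun he => hxB (.inr (.inr (he ▸ hp)))) (fun he => hyC (he ▸ hp))
  rw [corner_of_mate_eq_opposite hs2] at hcx
  rw [corner_of_mate_eq_opposite hs5, kB.2] at hcy
  have hi' : c (D.cornerAt (left i)) = c (D.cornerAt x) := by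
    rw [hcl i (hB i hi) (fun he => hxB (.inl (he ▸ hi))) (fun he => hBy i hi y (.inl rfl) he),
      kB.1 i hi]
  -- So the strand has one colour on its left along `A` and `C` and the other one along `B`; an edge
  -- from a left end in `B` cannot lead to `A`, to `C` or to the last end `t`.
  have hdy : c (D.cornerAt d) = c (D.cornerAt y) := by
    rw [add_comm] at hcy
    exact add_right_cancel (hcx.symm.trans hcy)
  have hne : c (D.cornerAt x) ≠ c (D.cornerAt y) := fun he => by
    rw [he, CharTwo.add_self_eq_zero] at hcy
    exact one_ne_zero hcy
  have hi2 : D.cornerAt (left i) = D.cornerAt (cw (D.mate (left i))) :=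
    (D.cornerAt_cw_mate _).symm
  rcases h.mate_left (hB i hi) with ⟨q, hq, he⟩ | he
  · rw [he, cw_left] at hi2
    rw [hi2] at hi'
    simp only [List.mem_append, List.mem_cons] at hq
    rcases hq with hq | rfl | hq | rfl | hq
    · exact absurd (hi'.symm.trans ((kA.1 q hq).trans (kA.2.symm.trans hdy))) hne
    · have : left i = left y := by rw [D.mate_eq_comm.1 he, hxy]
      exact absurd (h.left_inj (hB i hi) hy this) fun he => hBy i hi y (.inl rfl) he
    · exact ⟨q, hq, he⟩
    · have : left i = left x := by rw [D.mate_eq_comm.1 he, hyx]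
      exact absurd (h.left_inj (hB i hi) hx this) fun he => hxB (.inl (he ▸ hi))
    · exact absurd (hi'.symm.trans (kC.1 q hq)) hne
  · exfalso
    have h1 := hc t
    rw [Pi.add_apply, hzS t (.inr (.inr rfl)), Pi.single_eq_of_ne, zero_add] at h1
    · rw [he] at hi2
      rw [hi2, ← CharTwo.add_eq_zero.1 h1.symm, kC.2] at hi'
      exact hne hi'.symm
    · intro he
      rcases D.edgeAt_eq_iff.1 he with he | he
      · exact h.left_ne hx he.symm
      · rw [hxy] at he; exact h.left_ne hy he.symm

/-- Two consecutive crossings of the strand are joined on its left. -/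
lemma exists_adjacent [Nonempty D.Crossing] (hD : D.IsConnected) (h : D.IsSweep a l t ∅)
    (hl : 2 ≤ l.length) : ∃ A x y C, l = A ++ x :: y :: C ∧ D.mate (left x) = left y := by
  -- An arc with crossings of the strand between its ends encloses a shorter arc; an innermost one
  -- joins neighbours.
  have key : ∀ n A x B y C, B.length = n → l = A ++ x :: (B ++ y :: C) → D.mate (left x) = left y →
      ∃ A x y C, l = A ++ x :: y :: C ∧ D.mate (left x) = left y := by
    intro n
    induction n using Nat.strong_induction_on with
    | _ n ih =>
      intro A x B y C hn hl hxy
      cases B with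
      | nil => exact ⟨A, x, y, C, hl, hxy⟩
      | cons i B =>
        obtain ⟨q, hq, he⟩ := mem_of_mate_left hD (hl ▸ h) hxy (List.mem_cons_self (a := i) (l := B))
        rcases List.mem_cons.1 hq with rfl | hq
        · exact absurd he (D.mate_ne _)
        · obtain ⟨B₁, B₂, rfl⟩ := List.append_of_mem hq
          refine ih B₁.length ?_ (A ++ [x]) i B₁ q (B₂ ++ y :: C) rfl ?_ he
          · simp only [List.length_cons, List.length_append] at hn; omega
          · rw [hl]; simp
  -- Of two left ends at most one leads to `t`, so another arc exists.
  obtain ⟨p, hp, q, hq, hpq, he⟩ : ∃ p ∈ l, ∃ q ∈ l, p ≠ q ∧ D.mate (left p) = left q := by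
    match l, hl, h with
    | p :: q :: l, _, h =>
      have hp : p ∈ p :: q :: l := by simp
      have hq : q ∈ p :: q :: l := by simp
      rcases h.mate_left hp with ⟨r, hr, he⟩ | he
      · exact ⟨p, hp, r, hr, fun e => D.mate_ne _ (e ▸ he), he⟩
      · rcases h.mate_left hq with ⟨r, hr, he'⟩ | he'
        · exact ⟨q, hq, r, hr, fun e => D.mate_ne _ (e ▸ he'), he'⟩
        · have := h.left_inj hp hq (by rw [D.mate_eq_comm.1 he, D.mate_eq_comm.1 he'])
          have hnd := h.nodup
          simp [this] at hnd
  obtain ⟨A, B, hl'⟩ := List.append_of_mem hp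
  have hq' := hq
  rw [hl'] at hq'
  simp only [List.mem_append, List.mem_cons] at hq'
  rcases hq' with hq' | rfl | hq'
  · obtain ⟨A₁, A₂, rfl⟩ := List.append_of_mem hq'
    exact key _ A₁ q A₂ p B rfl (by rw [hl']; simp) (D.mate_eq_comm.1 he).symm
  · exact absurd rfl hpq
  · obtain ⟨A₁, A₂, rfl⟩ := List.append_of_mem hq'
    exact key _ A p A₁ q A₂ rfl hl' he

end IsSweep

end LinkDiagram

/-! ### Removing the swept strand -/

open Relation

namespace LinkDiagram

variable {D : LinkDiagram}

/-- The move `Ω₂↓` in terms of the crossings of the whole diagram. -/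
theorem Bigon.exists_collapse [Nonempty D.Crossing] {x y : D.Crossing} {i j : ZMod 4}
    (b : D.Bigon x y i j) (hD : D.IsConnected) (hover : IsOver i ↔ IsOver (j + 1))
    (hne : D.cornerAt (x, i + 2) ≠ D.cornerAt (y, j + 2)) :
    ∃ (D' : LinkDiagram) (κ : D.Crossing → D'.Crossing), D'.IsConnected ∧ D.Omega2Down D' ∧
      Nonempty D'.Crossing ∧ D'.numCrossings + 2 = D.numCrossings ∧
      (∀ v w, v ∉ ({x, y} : Set _) → w ∉ ({x, y} : Set _) → κ v = κ w → v = w) ∧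
      (∀ d : D.Crossing × ZMod 4, d.1 ∉ ({x, y} : Set _) → (D.mate d).1 ∉ ({x, y} : Set _) →
        D'.mate (κ d.1, d.2) = (κ (D.mate d).1, (D.mate d).2)) ∧
      ∀ s : D.Crossing × ZMod 4, s.1 ∈ ({x, y} : Set _) → (D.mate s).1 ∉ ({x, y} : Set _) →
        D'.mate (κ (D.mate s).1, (D.mate s).2) =
          (κ (D.mate (across x y i j s)).1, (D.mate (across x y i j s)).2) := by
  classical
  obtain ⟨D', f, h1, h2, h3, h4⟩ := b.exists_connected hD hover hne
  have ⟨w₀⟩ := b.nonempty_kept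
  let e := Equiv.ofBijective f h3
  let κ : D.Crossing → D'.Crossing := fun w =>
    if hw : w ∉ ({x, y} : Set D.Crossing) then e.symm ⟨w, hw⟩ else e.symm w₀
  have hκ : ∀ w (hw : w ∉ ({x, y} : Set D.Crossing)), f (κ w) = ⟨w, hw⟩ := fun w hw => by
    simp only [κ, dif_pos hw]
    exact e.apply_symm_apply _
  have hκ' : ∀ w', κ (f w').1 = w' := fun w' => h3.injective (hκ _ (f w').2)
  have hval : ∀ d' : D'.Crossing × ZMod 4, (κ (inc (Prod.map f id d')).1, (inc (Prod.map f id d')).2) =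
      d' := fun d' => Prod.ext (hκ' d'.1) rfl
  have hinc : ∀ d : D.Crossing × ZMod 4, d.1 ∉ ({x, y} : Set D.Crossing) →
      inc (Prod.map f id (κ d.1, d.2)) = d := fun d hd =>
    Prod.ext (congrArg Subtype.val (hκ d.1 hd)) rfl
  refine ⟨D', κ, h2, h1, ⟨e.symm w₀⟩, ?_, fun v w hv hw hvw => ?_, fun d hd hm => ?_,
    fun s hs hm => ?_⟩
  · rw [← show _ = D.numCrossings from b.card_kept]
    exact congrArg (· + 2) (Nat.card_congr e)
  · have := hκ v hv
    rw [hvw, hκ w hw] at this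
    exact (congrArg Subtype.val this).symm
  · have h5 := h4 (κ d.1, d.2)
    have h6 := b.splice.inc_mate_of_notMem (d := Prod.map f id (κ d.1, d.2)) (by rwa [hinc d hd])
    rw [← h5, hinc d hd] at h6
    rw [← hval (D'.mate _), h6]
  · have h5 := h4 (κ (D.mate s).1, (D.mate s).2)
    have h6 := b.splice.inc_mate_of_eq_mate (d := Prod.map f id (κ (D.mate s).1, (D.mate s).2)) hs
      (hinc _ hm)
    rw [← h5] at h6
    rw [← hval (D'.mate _), h6]

namespace IsSweep

variable {a t : D.Crossing × ZMod 4} {l : List (D.Crossing × ZMod 4)}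

/-- Two consecutive crossings of the strand that are joined on its left can be removed. -/
theorem exists_omega2Down [Nonempty D.Crossing] (hD : D.IsConnected)
    {A C : List (D.Crossing × ZMod 4)} {x y : D.Crossing × ZMod 4}
    (h : D.IsSweep a (A ++ x :: y :: C) t ∅) (hxy : D.mate (left x) = left y) :
    (∃ D' : LinkDiagram, D.Omega2Down D' ∧ Nonempty D'.Edge ∧ ¬ D'.IsConnected) ∨
    ∃ (D' : LinkDiagram) (a' t' : D'.Crossing × ZMod 4) (l' : List (D'.Crossing × ZMod 4)),
      D'.IsConnected ∧ Nonempty D'.Crossing ∧ D.Omega2Down D' ∧ D'.IsSweep a' l' t' ∅ ∧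
      l'.length + 2 = (A ++ x :: y :: C).length ∧ D'.numCrossings + 2 = D.numCrossings := by
  have hyx : D.mate (left y) = left x := (D.mate_eq_comm.1 hxy).symm
  have hx : x ∈ A ++ x :: y :: C := by simp
  have hy : y ∈ A ++ x :: y :: C := by simp
  have hAC : ∀ q, q ∈ A ∨ q ∈ C → q ∈ A ++ x :: y :: C := fun q hq => by
    simp only [List.mem_append, List.mem_cons]; tauto
  have hnd := h.nodup
  simp only [List.map_append, List.map_cons, List.nodup_append, List.nodup_cons, List.mem_cons] at hnd
  obtain ⟨hA, ⟨hxyC, hyC, hC⟩, hA'⟩ := hnd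
  have hxy1 : x.1 ≠ y.1 := fun he => hxyC (.inl he)
  have hoff : ∀ q, q ∈ A ∨ q ∈ C → q.1 ∉ ({x.1, y.1} : Set D.Crossing) := by
    rintro q (hq | hq) (he | he)
    · exact hA' _ (List.mem_map_of_mem hq) _ (.inl rfl) he
    · exact hA' _ (List.mem_map_of_mem hq) _ (.inr (.inl rfl)) he
    · exact hxyC (.inr (he ▸ List.mem_map_of_mem hq))
    · exact hyC (Set.mem_singleton_iff.1 he ▸ List.mem_map_of_mem hq)
  have hoff' : ∀ w, (∀ q ∈ A ++ x :: y :: C, w ≠ q.1) → w ∉ ({x.1, y.1} : Set D.Crossing) := by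
    rintro w hw (he | he)
    · exact hw x hx he
    · exact hw y hy he
  obtain ⟨d, hs1, hs2, hs3, hs4⟩ := strand_append.1 h.strand
  have hd : d.1 ∉ ({x.1, y.1} : Set D.Crossing) := by
    by_cases hn : A = []
    · subst hn
      obtain rfl : a = d := hs1
      exact hoff' _ h.start
    · exact hoff d (.inl (hs1.mem hn))
  have hmd : D.mate (opposite x) = d := (D.mate_eq_comm.1 hs2).symm
  have hpair : ∀ p ∈ A ++ x :: y :: C, p ≠ x → p ≠ y → ∀ q, D.mate (left p) = left q →
      q ≠ x ∧ q ≠ y := by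
    intro p hp h1 h2 q he
    constructor
    · rintro rfl
      exact h2 (h.left_inj hp hy (by rw [D.mate_eq_comm.1 he, hxy]))
    · rintro rfl
      exact h1 (h.left_inj hp hx (by rw [D.mate_eq_comm.1 he, hyx]))
  have hmem : ∀ p, p ∈ A ++ x :: y :: C → p ≠ x → p ≠ y → p ∈ A ∨ p ∈ C := by
    intro p hp h1 h2
    simp only [List.mem_append, List.mem_cons] at hp; tauto
  -- The last end is joined to a left end, at a crossing other than `x` and `y`, since the left ends
  -- of these two are joined to each other.
  have hmt : ∃ q, (q ∈ A ∨ q ∈ C) ∧ D.mate t = left q := by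
    rcases h.stable t (.inr (.inr rfl)) with h1 | ⟨q, hq, h1⟩ | h1
    · exact h1.elim
    · have h2 : D.mate (left q) = t := (D.mate_eq_comm.1 h1).symm
      refine ⟨q, hmem q hq ?_ ?_, h1⟩
      · rintro rfl; rw [hxy] at h2; exact h.left_ne hy h2
      · rintro rfl; rw [hyx] at h2; exact h.left_ne hx h2
    · exact absurd h1 (D.mate_ne _)
  have hmy : (D.mate y).1 ∉ ({x.1, y.1} : Set D.Crossing) := by
    cases C with
    | nil =>
      obtain rfl : y = t := hs4
      obtain ⟨q, hq, he⟩ := hmt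
      rw [he]; exact hoff q hq
    | cons z C =>
      rw [hs4.1]
      exact hoff z (.inr List.mem_cons_self)
  have e : ∀ i : ZMod 4, i + 1 + 1 = i + 2 ∧ i + 1 + 2 = i + 3 ∧ i + 1 + 3 = i := by decide
  have hdis : ∀ {w : D.Crossing}, w ∉ ({x.1, y.1} : Set D.Crossing) → w ≠ x.1 ∧ w ≠ y.1 :=
    fun hw => by simpa using hw
  have b : D.Bigon x.1 y.1 x.2 (y.2 + 1) := by
    refine ⟨hxy1, ?_, hxy, ?_, ?_, ?_, ?_⟩
    · rw [(e y.2).1]; exact hs3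
    · rw [show ((x.1, x.2 + 2) : D.Crossing × ZMod 4) = opposite x from rfl, hmd]
      exact hdis hd
    · exact ⟨h.mate_right x hx x hx, h.mate_right x hx y hy⟩
    · rw [(e y.2).2.1]
      exact ⟨h.mate_right y hy x hx, h.mate_right y hy y hy⟩
    · rw [(e y.2).2.2]
      exact hdis hmy
  have hover : IsOver x.2 ↔ IsOver (y.2 + 1 + 1) := by
    rw [(e y.2).1, isOver_add (.inr rfl)]
    exact h.parity x hx y hy
  by_cases hO : D.cornerAt (x.1, x.2 + 2) = D.cornerAt (y.1, y.2 + 1 + 2)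
  · exact .inl (b.exists_disconnected hD hover hO)
  right
  obtain ⟨D', κ, hD', h2, hne, hcard, hκ, hm, hm'⟩ := b.exists_collapse hD hover hO
  let κ' : D.Crossing × ZMod 4 → D'.Crossing × ZMod 4 := fun d => (κ d.1, d.2)
  have mate_map : ∀ d : D.Crossing × ZMod 4, d.1 ∉ ({x.1, y.1} : Set D.Crossing) →
      (D.mate d).1 ∉ ({x.1, y.1} : Set D.Crossing) → D'.mate (κ' d) = κ' (D.mate d) := hm
  have hmd' : D'.mate (κ' d) = κ' (D.mate y) := by
    have := hm' (opposite x) (.inl rfl) (by rw [hmd]; exact hd)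
    rw [hmd, show opposite x = (x.1, x.2 + 2) from rfl, Bigon.across_two, (e y.2).2.2] at this
    exact this
  have strand_map : ∀ {a t l}, D.Strand a l t → a.1 ∉ ({x.1, y.1} : Set D.Crossing) →
      (∀ q ∈ l, q.1 ∉ ({x.1, y.1} : Set D.Crossing)) → D'.Strand (κ' a) (l.map κ') (κ' t) := by
    intro a t l hs ha hl
    induction l generalizing a with
    | nil => exact congrArg κ' hs
    | cons p l ih =>
      obtain ⟨h1, h2⟩ := hs
      have hp := hl p List.mem_cons_self
      refine ⟨?_, ih h2 hp fun q hq => hl q (List.mem_cons_of_mem _ hq)⟩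
      rw [mate_map a ha (by rw [h1]; exact hp), h1]; rfl
  have ha := hoff' _ h.start
  -- If `y` was the last crossing, the shortened strand ends at `d`, the end from which it used to
  -- enter `x`; otherwise the old last end survives.
  obtain ⟨t', hs', ht'⟩ : ∃ t', D'.Strand (κ' a) ((A ++ C).map κ') t' ∧
      ((C = [] ∧ t = y ∧ t' = κ' d) ∨ (t ∈ C ∧ t' = κ' t)) := by
    have h4 := strand_map hs1 ha fun q hq => hoff q (.inl hq)
    cases C with
    | nil => exact ⟨κ' d, by rwa [List.append_nil], .inl ⟨rfl, hs4.symm, rfl⟩⟩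
    | cons z C =>
      obtain ⟨h5, h6⟩ := hs4
      refine ⟨κ' t, ?_, .inr ⟨Strand.mem (a := y) ⟨h5, h6⟩ (by simp), rfl⟩⟩
      rw [List.map_append, strand_append]
      refine ⟨κ' d, h4, ?_, strand_map h6 (hoff z (.inr List.mem_cons_self))
        fun q hq => hoff q (.inr (List.mem_cons_of_mem _ hq))⟩
      rw [hmd', h5]; rfl
  have hmemAC : ∀ {q}, q ∈ A ++ C ↔ q ∈ A ∨ q ∈ C := List.mem_append
  have hfst : ∀ w, w ∉ ({x.1, y.1} : Set D.Crossing) → (∀ q ∈ A ++ x :: y :: C, w ≠ q.1) →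
      ∀ q ∈ (A ++ C).map κ', κ w ≠ q.1 := by
    intro w hw hwq q hq he
    obtain ⟨q', hq', rfl⟩ := List.mem_map.1 hq
    exact hwq q' (hAC q' (hmemAC.1 hq')) (hκ _ _ hw (hoff q' (hmemAC.1 hq')) he)
  have hleft : ∀ q, q ∈ A ∨ q ∈ C → κ' (left q) ∈ sweepSet ((A ++ C).map κ') t' ∅ := fun q hq =>
    .inr (.inl ⟨κ' q, List.mem_map_of_mem (hmemAC.2 hq), rfl⟩)
  refine ⟨D', κ' a, t', (A ++ C).map κ', hD', hne, h2, ?_, ?_, hcard⟩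
  · obtain ⟨r, hr, hrt⟩ := hmt
    have hrt' : D.mate (left r) = t := (D.mate_eq_comm.1 hrt).symm
    have hrlt : D'.mate t' = κ' (left r) := by
      rcases ht' with ⟨-, rfl, rfl⟩ | ⟨h1, rfl⟩
      · rw [hmd', hrt]
      · rw [mate_map t (hoff t (.inr h1)) (by rw [hrt]; exact hoff r hr), hrt]
    refine ⟨hs', ?_, ?_, ?_, fun _ _ => id, ?_, id, ?_, ?_⟩
    · intro hn
      rw [List.map_eq_nil_iff] at hn
      have := hmemAC.2 hr
      rw [hn] at this
      exact List.not_mem_nil this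
    · rw [List.map_map, show Prod.fst ∘ κ' = κ ∘ Prod.fst from rfl, ← List.map_map]
      refine List.Nodup.map_on ?_ ?_
      · intro v hv w hw hvw
        obtain ⟨v, hv', rfl⟩ := List.mem_map.1 hv
        obtain ⟨w, hw', rfl⟩ := List.mem_map.1 hw
        exact hκ _ _ (hoff v (hmemAC.1 hv')) (hoff w (hmemAC.1 hw')) hvw
      · rw [List.map_append, List.nodup_append]
        exact ⟨hA, hC, fun v hv w hw => hA' v hv w (.inr (.inr hw))⟩
    · intro p hp q hq
      obtain ⟨p, hp', rfl⟩ := List.mem_map.1 hp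
      obtain ⟨q, hq', rfl⟩ := List.mem_map.1 hq
      exact h.parity p (hAC p (hmemAC.1 hp')) q (hAC q (hmemAC.1 hq'))
    · exact hfst _ ha h.start
    · intro p hp
      obtain ⟨p, hp', rfl⟩ := List.mem_map.1 hp
      have h1 := h.mate_right p (hAC p (hmemAC.1 hp'))
      rw [show right (κ' p) = κ' (right p) from rfl, mate_map (right p) (hoff p (hmemAC.1 hp'))
        (hoff' _ h1)]
      exact hfst _ (hoff' _ h1) h1
    · rintro _ (h1 | ⟨p, hp, rfl⟩ | rfl)
      · exact h1.elim
      · obtain ⟨p, hp', rfl⟩ := List.mem_map.1 hp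
        have hp := hmemAC.1 hp'
        rw [show left (κ' p) = κ' (left p) from rfl]
        rcases h.mate_left (hAC p hp) with ⟨q, hq, he⟩ | he
        · have hpx : p ≠ x := fun he => hoff p hp (.inl (congrArg Prod.fst he))
          have hpy : p ≠ y := fun he => hoff p hp (.inr (congrArg Prod.fst he))
          obtain ⟨h1, h2⟩ := hpair p (hAC p hp) hpx hpy q he
          have hq' := hmem q hq h1 h2
          rw [mate_map (left p) (hoff p hp) (by rw [he]; exact hoff q hq'), he]
          exact hleft q hq'
        · obtain rfl : p = r := h.left_inj (hAC p hp) (hAC r hr) (by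
            rw [D.mate_eq_comm.1 he, D.mate_eq_comm.1 hrt'])
          exact .inr (.inr (D'.mate_eq_comm.1 hrlt).symm)
      · rw [hrlt]
        exact hleft r hr
  · simp only [List.length_map, List.length_append, List.length_cons]; omega

/-- A strand without crossings to its left can be removed. -/
theorem exists_of_empty (n : ℕ) (D : LinkDiagram) [Nonempty D.Crossing] (hD : D.IsConnected)
    {a t : D.Crossing × ZMod 4} {l : List (D.Crossing × ZMod 4)} (h : D.IsSweep a l t ∅)
    (hn : l.length = n) :
    (∃ D' : LinkDiagram, EqvGen NonIncreasingStep D D' ∧ Nonempty D'.Edge ∧ ¬ D'.IsConnected) ∨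
    ∃ D' : LinkDiagram, EqvGen NonIncreasingStep D D' ∧
      D'.numCrossings + l.length = D.numCrossings := by
  induction n using Nat.strong_induction_on generalizing D with
  | _ n ih =>
    by_cases h2 : 2 ≤ l.length
    · obtain ⟨A, x, y, C, rfl, hxy⟩ := h.exists_adjacent hD h2
      rcases h.exists_omega2Down hD hxy with ⟨D', h3, h4⟩ | ⟨D', a', t', l', h3, h4, h5, h6, h7, h8⟩
      · exact .inl ⟨D', eqvGen_of_step (.inr (.inr (.inl h3))), h4⟩
      · have h9 := eqvGen_of_step (D := D) (D' := D') (.inr (.inr (.inl h5)))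
        rcases ih l'.length (by omega) D' h3 h6 rfl with ⟨D'', k1, k2⟩ | ⟨D'', k1, k2⟩
        · exact .inl ⟨D'', .trans _ _ _ h9 k1, k2⟩
        · exact .inr ⟨D'', .trans _ _ _ h9 k1, by omega⟩
    · right
      match l, h2, h with
      | [], _, h => exact absurd rfl h.ne_nil
      | [p], _, h =>
        obtain rfl : p = t := h.strand.2
        -- A single crossing with nothing on its left is a kink. It is not a figure eight, because
        -- the strand starts at another crossing.
        have h3 : D.mate p = left p := by
          rcases h.stable p (.inr (.inr rfl)) with h1 | ⟨q, hq, h1⟩ | h1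
          · exact h1.elim
          · rw [List.mem_singleton] at hq
            rw [h1, hq]
          · exact absurd h1 (D.mate_ne _)
        have h4 : D.mate (opposite p) = a := (D.mate_eq_comm.1 h.strand.1).symm
        obtain ⟨D', h5, h6⟩ := hD.exists_omega1Down (x := p.1) (i := p.2) h3 fun he => by
          have := h.start p (by simp)
          rw [← h4, show opposite p = (p.1, p.2 + 2) from rfl, he] at this
          exact this rfl
        exact ⟨D', eqvGen_of_step (.inr (.inl h5)), h6⟩
      | p :: q :: l, h2, _ => exact absurd (by simp) h2

/-- A strand can be swept over the crossings to its left. -/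
theorem exists_sweep (n : ℕ) (D : LinkDiagram) [Nonempty D.Crossing] (hD : D.IsConnected)
    {a t : D.Crossing × ZMod 4} {l : List (D.Crossing × ZMod 4)} {U : Set D.Crossing}
    (h : D.IsSweep a l t U) (hn : U.ncard = n) :
    (∃ D' : LinkDiagram, EqvGen NonIncreasingStep D D' ∧ Nonempty D'.Edge ∧ ¬ D'.IsConnected) ∨
    ∃ D' : LinkDiagram, EqvGen NonIncreasingStep D D' ∧
      D'.numCrossings + l.length = D.numCrossings := by
  induction n using Nat.strong_induction_on generalizing D with
  | _ n ih =>
    rcases U.eq_empty_or_nonempty with rfl | hU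
    · exact exists_of_empty _ D hD h rfl
    · obtain ⟨p, hp, hpU⟩ := h.exists_mate_left_mem hD hU
      -- A pass takes a crossing out of `U` and raises the length of the strand and the number of
      -- crossings by two each, so their difference is unchanged.
      obtain ⟨D', a', t', l', U', h1, h2, h3, h4, h5, h6⟩ := h.exists_pass hD hp hpU
      have : Nonempty D'.Crossing := ⟨a'.1⟩
      rcases ih U'.ncard (by omega) D' h1 h3 rfl with ⟨D'', k1, k2⟩ | ⟨D'', k1, k2⟩
      · exact .inl ⟨D'', .trans _ _ _ h2 k1, k2⟩
      · exact .inr ⟨D'', .trans _ _ _ h2 k1, by omega⟩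

end IsSweep

end LinkDiagram

/-! ### Minimal diagrams of non-split, non-trivial links are reduced -/

open Relation

namespace LinkDiagram

variable {D : LinkDiagram}

/-- The diagram that consists of one circle. -/
abbrev circle : LinkDiagram where
  Crossing := Empty
  Edge := Unit
  Region := Bool
  finite_crossing := inferInstance
  finite_edge := inferInstance
  finite_region := inferInstance
  edge := fun x => x.elim
  corner := fun x => x.elim
  sides := fun _ => s(true, false)
  ends_edge := fun _ => .inl (by rw [Set.ncard_eq_zero]; exact Set.eq_empty_of_isEmpty _)
  corner_eq := fun x => x.elim
  sides_edge := fun x => x.elim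
  connected := by
    have h1 : ReflTransGen (fun r s : Bool => ∃ _e : Unit, s(true, false) = s(r, s)) true false :=
      .single ⟨(), rfl⟩
    have h2 : ReflTransGen (fun r s : Bool => ∃ _e : Unit, s(true, false) = s(r, s)) false true :=
      .single ⟨(), Sym2.eq_swap⟩
    rintro (_ | _) (_ | _)
    exacts [.refl, h2, h1, .refl]
  euler := by
    have h1 : Nat.card (Quot fun p q : Empty × ZMod 4 =>
        ∃ j, p ≠ (q.1, j) ∧ p.1.elim = (q.1.elim : Unit) ∧ q.2 = j - 1) = 0 := by
      have : IsEmpty (Quot fun p q : Empty × ZMod 4 =>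
        ∃ j, p ≠ (q.1, j) ∧ p.1.elim = (q.1.elim : Unit) ∧ q.2 = j - 1) :=
        ⟨fun q => (Quot.exists_rep q).elim fun p _ => p.1.elim⟩
      exact Nat.card_of_isEmpty
    have h2 : Nat.card {e : Unit // ∀ (x : Empty) (_ : ZMod 4), (x.elim : Unit) ≠ e} = 1 := by
      rw [Nat.card_eq_one_iff_unique]
      exact ⟨inferInstance, ⟨(), fun x => x.elim⟩⟩
    rw [show Nat.card Bool = 2 by simp, show Nat.card Empty = 0 by simp]
    exact (congrArg₂ (fun a b => 0 + a + 2 * b + 2) h1 h2).symm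

/-- A connected diagram with two kinks at one crossing becomes a circle when one is removed. -/
theorem IsConnected.omega1Down_circle [Nonempty D.Crossing] (hD : D.IsConnected) {x : D.Crossing}
    {i : ZMod 4} (hk : D.mate (x, i) = (x, i + 1)) (hk' : D.mate (x, i + 2) = (x, i + 3)) :
    D.Omega1Down circle := by
  classical
  have hk1 : D.mate (x, i + 1) = (x, i) := (D.mate_eq_comm.1 hk).symm
  have hk1' : D.mate (x, i + 3) = (x, i + 2) := (D.mate_eq_comm.1 hk').symm
  have hx : ∀ y, y = x := by
    refine hD.forall_of_mate (P := fun y => y = x) (fun d hd => ?_) (x := x) rfl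
    rcases mk_add_cases d i with h | h | h | h <;> rw [hd] at h <;> rw [h]
    · rw [hk]
    · rw [hk1]
    · rw [hk']
    · rw [hk1']
  have e : ∀ i : ZMod 4, i + 1 - 1 = i ∧ i + 2 - 1 = i + 1 ∧ i + 3 - 1 = i + 2 ∧ i - 1 = i + 3 := by
    decide
  have e' : ∀ i : ZMod 4, i + 2 ≠ i ∧ i + 2 ≠ i + 1 ∧ i + 1 ≠ i ∧ i + 3 ≠ i := by decide
  have hf1 := hD.sides_ne (x, i + 1)
  have hf2 := hD.sides_ne (x, i + 2)
  simp only [cw, (e i).1, (e i).2.1] at hf1 hf2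
  have hc : D.cornerAt (x, i + 1) = D.cornerAt (x, i + 3) := by
    have := D.cornerAt_mate (x, i)
    rw [hk] at this
    simpa only [cw, (e i).2.2.2] using this
  have ho : D.OnlyCorners (D.corner x i) {(x, i)} :=
    hD.onlyCorners (C := {(x, i)}) (fun d hd => by
      rw [Set.mem_singleton_iff] at hd ⊢
      rw [hd, next, hk, cw, (e i).1]) (p := (x, i)) rfl
  have hf3 : D.cornerAt (x, i + 2) ≠ D.cornerAt (x, i) := fun h =>
    (e' i).1 (congrArg Prod.snd (Set.mem_singleton_iff.1 (ho.1 _ _ h)))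
  have hE : D.edgeAt (x, i + 1) = D.edgeAt (x, i) := by rw [← hk, D.edgeAt_mate]
  have hE' : D.edgeAt (x, i + 3) = D.edgeAt (x, i + 2) := by rw [← hk', D.edgeAt_mate]
  have hne : D.edgeAt (x, i + 2) ≠ D.edgeAt (x, i) := by
    intro h
    rcases D.edgeAt_eq_iff.1 h with h | h
    · exact (e' i).1 (congrArg Prod.snd h)
    · rw [hk] at h
      exact (e' i).2.1 (congrArg Prod.snd h)
  have hedge : ∀ a : D.Edge, a = D.edgeAt (x, i) ∨ a = D.edgeAt (x, i + 2) := by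
    intro a
    obtain ⟨d, rfl⟩ := hD.exists_end a
    rcases mk_add_cases d i with h | h | h | h <;> rw [hx d.1] at h <;> rw [h]
    exacts [.inl rfl, .inl hE, .inr rfl, .inr hE']
  have hreg : ∀ a : D.Region, a = D.cornerAt (x, i) ∨ a = D.cornerAt (x, i + 1) ∨
      a = D.cornerAt (x, i + 2) := by
    intro a
    obtain ⟨d, rfl⟩ := hD.isMap.surj a
    rcases mk_add_cases d i with h | h | h | h <;> rw [hx d.1] at h <;> rw [h]
    exacts [.inl rfl, .inr (.inl rfl), .inr (.inr rfl), .inr (.inl hc.symm)]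
  refine ⟨x, i, hE.symm, ho, fun y => y.elim, fun _ => (), fun a => decide (a = D.cornerAt (x, i + 2)),
    fun y => y.elim, ?_, ?_, ?_, ?_, ?_, fun y => y.elim, fun y => y.elim, ?_⟩
  · ext y
    simp [hx y]
  · rw [Set.eq_univ_iff_forall]
    exact fun _ => ⟨D.edgeAt (x, i + 2), hne, rfl⟩
  · intro a b ha hb
    have ha := (hedge a).resolve_left ha
    have hb := (hedge b).resolve_left hb
    rw [ha, hb]
    exact ⟨fun _ => .refl _, fun _ => rfl⟩
  · rw [Set.eq_univ_iff_forall]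
    rintro (_ | _)
    · exact ⟨D.cornerAt (x, i + 1), hf1, decide_eq_false hf2.symm⟩
    · exact ⟨D.cornerAt (x, i + 2), hf3, decide_eq_true rfl⟩
  · intro a b ha hb
    have ha := (hreg a).resolve_left ha
    have hb := (hreg b).resolve_left hb
    constructor
    · intro h
      have h : a = D.cornerAt (x, i + 2) ↔ b = D.cornerAt (x, i + 2) := decide_eq_decide.1 h
      have : a = b := by
        rcases ha with ha | ha <;> rcases hb with hb | hb
        · rw [ha, hb]
        · exact (h.2 hb).trans hb.symm
        · exact ha.trans (h.1 ha).symm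
        · rw [ha, hb]
      exact this ▸ .refl _
    · intro h
      suffices h' : a = b by rw [h']
      clear * - h
      induction h with
      | rel _ _ h => exact h.elim
      | refl => rfl
      | symm _ _ _ ih => exact ih.symm
      | trans _ _ _ _ _ ih ih' => exact ih.trans ih'
  · intro a ha
    rw [(hedge a).resolve_left ha, D.sides_edgeAt]
    simp only [cw, (e i).2.1, Sym2.map_mk]
    rw [decide_eq_false hf2.symm]
    simp

section nugatory

variable {x : D.Crossing} {i : ZMod 4}

/-- A closed curve through a nugatory crossing passes both or none of the two ends beside a corner
of the region that meets the crossing twice. -/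
lemma IsConnected.eq_of_isNugatory [Nonempty D.Crossing] (hD : D.IsConnected) (hx : D.IsNugatory x i)
    (z : D.Edge → ZMod 2) (hz : ∀ y, ∑ k, z (D.edgeAt (y, k)) = 0) :
    z (D.edgeAt (x, i)) = z (D.edgeAt (x, i + 3)) := by
  have e : ∀ i : ZMod 4, i - 1 = i + 3 ∧ i + 3 - 1 = i + 2 := by decide
  obtain ⟨c, hc⟩ := hD.isMap.jordan hD.card_region_le z hz
  have h1 := hc (x, i)
  have h2 := hc (x, i + 3)
  simp only [cw, (e i).1, (e i).2] at h1 h2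
  have hx : D.cornerAt (x, i) = D.cornerAt (x, i + 2) := hx
  rw [h1, h2, hx, add_comm]

open Classical in
/-- Adding an edge to a chain changes its boundary at the two ends. -/
lemma sum_add_single {z : D.Edge → ZMod 2} {d : D.Crossing × ZMod 4} {y : D.Crossing} :
    ∑ k, (z + Pi.single (D.edgeAt d) 1 : D.Edge → ZMod 2) (D.edgeAt (y, k)) = ∑ k, z (D.edgeAt (y, k)) +
      ((if y = d.1 then 1 else 0) + if y = (D.mate d).1 then 1 else 0) := by
  have := IsMap.boundary_single (ε := D.edgeAt) (D.mate_ne d).symm (e := D.edgeAt d)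
    fun s => D.edgeAt_eq_iff
  have h := congrFun this y
  rw [IsMap.boundary_apply] at h
  simp only [Pi.add_apply, Finset.sum_add_distrib]
  congr 1
  rw [h]
  simp [Pi.single_apply]

open Classical in
/-- The crossings that are reached from `x` without the edges at the ends `i` and `i + 3`. -/
def branch (D : LinkDiagram) (x : D.Crossing) (i : ZMod 4) : Set D.Crossing :=
  {w | w ≠ x ∧ ∃ z : D.Edge → ZMod 2,
    (∀ y, ∑ k, z (D.edgeAt (y, k)) = (if y = x then 1 else 0) + if y = w then 1 else 0) ∧
    z (D.edgeAt (x, i)) = 0 ∧ z (D.edgeAt (x, i + 3)) = 0}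

lemma branch_start {d : D.Crossing × ZMod 4} (hd : d = (x, i + 1) ∨ d = (x, i + 2))
    (h : (D.mate d).1 ≠ x) : (D.mate d).1 ∈ D.branch x i := by
  classical
  have e : ∀ i : ZMod 4, i ≠ i + 1 ∧ i ≠ i + 2 ∧ i + 3 ≠ i + 1 ∧ i + 3 ≠ i + 2 := by decide
  have hdx : d.1 = x := by rcases hd with rfl | rfl <;> rfl
  have hne : ∀ k, (x, k) ≠ d → D.edgeAt (x, k) ≠ D.edgeAt d := by
    intro k hk he
    exact h (congrArg Prod.fst (D.eq_mate he hk)).symm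
  refine ⟨h, 0 + Pi.single (D.edgeAt d) 1, fun y => ?_, ?_, ?_⟩
  · rw [sum_add_single, hdx]
    simp
  · rw [zero_add, Pi.single_eq_of_ne (hne i ?_)]
    rcases hd with rfl | rfl <;> simp [(e i).1, (e i).2.1]
  · rw [zero_add, Pi.single_eq_of_ne (hne _ ?_)]
    rcases hd with rfl | rfl <;> simp [(e i).2.2.1, (e i).2.2.2]

/-- The chain from `x` is prolonged by the edge at `d`. If this edge returns to `x`, the chain
becomes a cycle, which uses both or none of the ends `i`, `i + 3`; the return through just one of
them is therefore impossible. -/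
lemma IsConnected.branch_step [Nonempty D.Crossing] (hD : D.IsConnected) (hx : D.IsNugatory x i)
    {d : D.Crossing × ZMod 4} (hd : d.1 ∈ D.branch x i) :
    (D.mate d).1 ∈ D.branch x i ∨ D.mate d = (x, i + 1) ∨ D.mate d = (x, i + 2) := by
  classical
  obtain ⟨h0, z, h1, h2, h3⟩ := hd
  have e : ∀ i : ZMod 4, i ≠ i + 3 := by decide
  by_cases h : (D.mate d).1 = x
  · have hz : ∀ y, ∑ k, (z + Pi.single (D.edgeAt d) 1 : D.Edge → ZMod 2) (D.edgeAt (y, k)) = 0 := by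
      intro y
      rw [sum_add_single, h1, h, add_comm (if y = d.1 then (1 : ZMod 2) else 0)]
      exact CharTwo.add_self_eq_zero _
    have key := hD.eq_of_isNugatory hx _ hz
    have hne : ∀ k, (x, k) ≠ D.mate d → D.edgeAt (x, k) ≠ D.edgeAt d := by
      intro k hk he
      refine hk (D.eq_mate he fun he' => h0 ?_)
      rw [← he']
    simp only [Pi.add_apply, h2, h3, zero_add] at key
    rcases mk_add_cases (D.mate d) i with h4 | h4 | h4 | h4 <;> rw [h] at h4
    · rw [← h4, D.edgeAt_mate, Pi.single_eq_same, Pi.single_eq_of_ne (hne _ _)] at key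
      · exact absurd key one_ne_zero
      · rw [h4]; simp [(e i).symm]
    · exact .inr (.inl h4)
    · exact .inr (.inr h4)
    · rw [← h4, D.edgeAt_mate, Pi.single_eq_same, Pi.single_eq_of_ne (hne _ _)] at key
      · exact absurd key zero_ne_one
      · rw [h4]; simp [e i]
  · have hne : ∀ k, D.edgeAt (x, k) ≠ D.edgeAt d := by
      intro k he
      rcases D.edgeAt_eq_iff.1 he with he | he
      · exact h0 (congrArg Prod.fst he).symm
      · exact h (congrArg Prod.fst he).symm
    refine .inl ⟨h, z + Pi.single (D.edgeAt d) 1, fun y => ?_, ?_, ?_⟩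
    · rw [sum_add_single, h1, add_assoc, ← add_assoc (if y = d.1 then (1 : ZMod 2) else 0),
        CharTwo.add_self_eq_zero, zero_add]
    · rw [Pi.add_apply, h2, Pi.single_eq_of_ne (hne _), add_zero]
    · rw [Pi.add_apply, h3, Pi.single_eq_of_ne (hne _), add_zero]

/-- Such an edge would be a cycle that uses exactly one of the ends `i` and `i + 3`. -/
lemma IsConnected.mate_ne_of_isNugatory [Nonempty D.Crossing] (hD : D.IsConnected) (hx : D.IsNugatory x i)
    {d : D.Crossing × ZMod 4} (hd : d = (x, i) ∨ d = (x, i + 3)) :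
    D.mate d ≠ (x, i + 1) ∧ D.mate d ≠ (x, i + 2) := by
  classical
  have e : ∀ i : ZMod 4, i ≠ i + 1 ∧ i ≠ i + 2 ∧ i + 3 ≠ i + 1 ∧ i + 3 ≠ i + 2 ∧ i ≠ i + 3 := by
    decide
  suffices h : ∀ k, i ≠ k → i + 3 ≠ k → D.mate d ≠ (x, k) from
    ⟨h _ (e i).1 (e i).2.2.1, h _ (e i).2.1 (e i).2.2.2.1⟩
  intro k hk hk' hm
  have hdx : d.1 = x := by rcases hd with rfl | rfl <;> rfl
  have hz : ∀ y, ∑ k, (0 + Pi.single (D.edgeAt d) 1 : D.Edge → ZMod 2) (D.edgeAt (y, k)) = 0 := by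
    intro y
    rw [sum_add_single, hm, hdx]
    simp [CharTwo.add_self_eq_zero]
  have key := hD.eq_of_isNugatory hx _ hz
  simp only [zero_add] at key
  have hne : ∀ j, j ≠ k → (x, j) ≠ d → D.edgeAt (x, j) ≠ D.edgeAt d := by
    intro j hj hj' he
    have := D.eq_mate he hj'
    rw [hm] at this
    exact hj (congrArg Prod.snd this)
  rcases hd with rfl | rfl
  · rw [Pi.single_eq_same, Pi.single_eq_of_ne (hne _ hk' (by simp [(e i).2.2.2.2.symm]))] at key
    exact one_ne_zero key
  · rw [Pi.single_eq_same, Pi.single_eq_of_ne (hne _ hk (by simp [(e i).2.2.2.2]))] at key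
    exact zero_ne_one key

/-- At a nugatory crossing that does not bound a kink, a strand can be swept over one side of the
diagram. -/
theorem IsConnected.isSweep_of_isNugatory [Nonempty D.Crossing] (hD : D.IsConnected) (hx : D.IsNugatory x i)
    (hk : D.mate (x, i + 3) ≠ (x, i)) :
    D.IsSweep (D.mate (x, i + 3)) [(x, i + 1)] (x, i + 1) (D.branch x i) := by
  have e : ∀ i : ZMod 4, i + 1 + 2 = i + 3 ∧ i + 1 + 3 = i ∧ i + 1 + 1 = i + 2 := by decide
  have e' : ∀ i : ZMod 4, i ≠ i + 1 ∧ i ≠ i + 2 ∧ i + 3 ≠ i + 1 ∧ i + 3 ≠ i + 2 := by decide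
  have h3 : (D.mate (x, i + 3)).1 ≠ x := by
    intro h
    rcases mk_add_cases (D.mate (x, i + 3)) i with h4 | h4 | h4 | h4 <;> rw [h] at h4
    exacts [hk h4, (hD.mate_ne_of_isNugatory hx (.inr rfl)).1 h4,
      (hD.mate_ne_of_isNugatory hx (.inr rfl)).2 h4, D.mate_ne _ h4]
  have h0 : (D.mate (x, i)).1 ≠ x := by
    intro h
    rcases mk_add_cases (D.mate (x, i)) i with h4 | h4 | h4 | h4 <;> rw [h] at h4
    exacts [D.mate_ne _ h4, (hD.mate_ne_of_isNugatory hx (.inl rfl)).1 h4,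
      (hD.mate_ne_of_isNugatory hx (.inl rfl)).2 h4, hk (D.mate_eq_comm.1 h4).symm]
  have hl : left (x, i + 1) = (x, i + 2) := by simp only [left, (e i).2.2]
  have hmem : ∀ d, d = (x, i + 1) ∨ d = (x, i + 2) →
      d ∈ sweepSet [(x, i + 1)] (x, i + 1) (D.branch x i) := by
    rintro d (rfl | rfl)
    · exact .inr (.inr rfl)
    · exact .inr (.inl ⟨_, List.mem_singleton_self _, hl.symm⟩)
  refine ⟨⟨?_, rfl⟩, by simp, by simp, by simp, ?_, ?_, ?_, ?_, ?_⟩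
  · rw [D.mate_mate, opposite, (e i).1]
  · simp only [List.mem_singleton, forall_eq]
    exact fun h => h.1 rfl
  · simpa using h3
  · intro h
    rcases hD.branch_step hx h with h4 | h4 | h4 <;> rw [D.mate_mate] at h4
    · exact h4.1 rfl
    · exact (e' i).2.2.1 (congrArg Prod.snd h4)
    · exact (e' i).2.2.2 (congrArg Prod.snd h4)
  · simp only [List.mem_singleton, forall_eq, right, (e i).2.1]
    exact h0
  · have key : ∀ d, d = (x, i + 1) ∨ d = (x, i + 2) →
        D.mate d ∈ sweepSet [(x, i + 1)] (x, i + 1) (D.branch x i) := by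
      intro d hd
      by_cases h : (D.mate d).1 = x
      · rcases mk_add_cases (D.mate d) i with h4 | h4 | h4 | h4 <;> rw [h] at h4
        · have := hD.mate_ne_of_isNugatory hx (.inl rfl)
          rw [← h4, D.mate_mate] at this
          exact (hd.elim this.1 this.2).elim
        · exact hmem _ (.inl h4)
        · exact hmem _ (.inr h4)
        · have := hD.mate_ne_of_isNugatory hx (.inr rfl)
          rw [← h4, D.mate_mate] at this
          exact (hd.elim this.1 this.2).elim
      · exact .inl (branch_start hd h)
    rintro d (h | ⟨p, hp, rfl⟩ | rfl)
    · rcases hD.branch_step hx h with h | h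
      · exact .inl h
      · exact hmem _ h
    · rw [List.mem_singleton.1 hp, hl]
      exact key _ (.inr rfl)
    · exact key _ (.inl rfl)

end nugatory

end LinkDiagram

namespace Link

open LinkDiagram

/-- A minimal diagram of a non-split and non-trivial link is reduced. -/
theorem IsMinimalDiagram.isReduced {L : Link} {D : LinkDiagram} (h : L.IsMinimalDiagram D)
    [Nonempty D.Crossing] (hD : D.IsConnected) (hs : ¬ L.IsSplit) (ht : ¬ L.IsTrivial) :
    D.IsReduced := by
  obtain ⟨hL, hc⟩ := h
  intro x i hx
  have e : ∀ i : ZMod 4, i + 3 + 1 = i ∧ i + 3 + 2 = i + 1 ∧ i + 3 + 3 = i + 2 := by decide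
  have hdrop : ∀ D', EqvGen NonIncreasingStep D D' → D'.numCrossings + 1 = D.numCrossings → False :=
    fun D' h1 h2 => by
      have := crossingNumber_le (hL.congr (.symm _ _ h1))
      omega
  -- If the ends `i + 3` and `i` bound a loop, Ω₁↓ removes it, leaving a bare circle when the other
  -- two ends are joined as well. Otherwise the strand through `x` is swept over the half beyond the
  -- ends `i + 1` and `i + 2`; it has length one, so one crossing is lost.
  by_cases hk : D.mate (x, i + 3) = (x, i)
  · have hk1 : D.mate (x, i + 3) = (x, i + 3 + 1) := by rw [(e i).1, hk]
    by_cases hk2 : D.mate (x, i + 3 + 2) = (x, i + 3 + 3)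
    · exact ht ⟨circle, hL.congr (.symm _ _ (eqvGen_of_step (.inr (.inl
        (hD.omega1Down_circle hk1 hk2))))), inferInstanceAs (IsEmpty Empty)⟩
    · obtain ⟨D', h1, h2⟩ := hD.exists_omega1Down hk1 hk2
      exact hdrop D' (eqvGen_of_step (.inr (.inl h1))) h2
  · rcases IsSweep.exists_sweep _ D hD (hD.isSweep_of_isNugatory hx hk) rfl with
      ⟨D', h1, h2⟩ | ⟨D', h1, h2⟩
    · exact hs ⟨D', hL.congr (.symm _ _ h1), h2⟩
    · exact hdrop D' h1 h2

end Link

/-! ### Bigons with directly joined outer ends: kinks as spacers -/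

open Relation

namespace Tangle

variable {D : LinkDiagram} {k : ℕ} {T : Tangle 1 k} (hT : T.Valid) (p : D.Crossing × ZMod 4)

/-- An old edge is not affected by the insertion of a tangle at another edge. -/
lemma mate_insert_eq_iff {q r : D.Crossing × ZMod 4} :
    (insert hT p).mate (.inl q.1, q.2) = (.inl r.1, r.2) ↔ D.mate q = r ∧ q ≠ p ∧ r ≠ p := by
  have hold : ∀ d, d ≠ p → (insert hT p).edgeAt (.inl d.1, d.2) = .inl (D.edgeAt d) :=
    fun d hd => insEdge_old (T := T) hd
  have hp : (insert hT p).edgeAt (.inl p.1, p.2) = .inr 0 := insEdge_p (T := T)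
  have hinj : ∀ q r : D.Crossing × ZMod 4, ((.inl q.1, q.2) : (D.Crossing ⊕ Fin 1) × ZMod 4) =
      (.inl r.1, r.2) → q = r := fun q r h => Prod.ext (Sum.inl_injective (congrArg Prod.fst h))
        (by have := congrArg Prod.snd h; exact this)
  constructor
  · intro h
    have he := (insert hT p).edgeAt_mate (.inl q.1, q.2)
    rw [h] at he
    have hne : q ≠ r := by
      rintro rfl
      exact (insert hT p).mate_ne _ h
    by_cases hq : q = p
    · have hr : r ≠ p := fun hr => hne (hq.trans hr.symm)
      rw [hold r hr, hq, hp] at he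
      exact absurd he Sum.inl_ne_inr
    · by_cases hr : r = p
      · rw [hold q hq, hr, hp] at he
        exact absurd he Sum.inr_ne_inl
      · rw [hold q hq, hold r hr] at he
        exact ⟨(D.eq_mate (Sum.inl_injective he) hne.symm).symm, hq, hr⟩
  · rintro ⟨rfl, hq, hr⟩
    refine ((insert hT p).eq_mate ?_ fun h => D.mate_ne q (hinj _ _ h)).symm
    rw [hold q hq, hold _ hr, D.edgeAt_mate]

lemma mate_insert_insDart (d : D.Crossing × ZMod 4) :
    (insert hT p).mate (T.insDart p d) = T.insDart p (D.mate d) := by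
  have hE := hT.extension (p := p)
  refine ((insert hT p).eq_mate ?_ fun he => D.mate_ne d (hE.inj he)).symm
  change T.insEdge p _ = T.insEdge p _
  rw [hE.edge_map, hE.edge_map, D.edgeAt_mate]

lemma mate_insert_start :
    (insert hT p).mate (.inl p.1, p.2) = (.inr (T.entry 0).1, (T.entry 0).2) := by
  have hE := hT.extension (p := p)
  refine ((insert hT p).eq_mate ?_ fun he => ?_).symm
  · change T.insEdge p (T.insRight D.Crossing 0) = T.insEdge p (.inl p.1, p.2)
    rw [hE.edge_left, insEdge_p]
  · exact absurd (congrArg Prod.fst he) Sum.inr_ne_inl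

lemma isConnected_insert [Nonempty D.Crossing] (hD : D.IsConnected) :
    (insert hT p).IsConnected := by
  have : Nonempty (insert hT p).Crossing := ⟨(Sum.inl p.1 : D.Crossing ⊕ Fin 1)⟩
  refine LinkDiagram.isConnected_of_mate (fun e he => ?_) fun P hP x hx => ?_
  · obtain ⟨f, -, hf⟩ := (insert_isFreeLoop p hT).1 he
    exact hD.not_isFreeLoop f hf
  · have hnew : ∀ y : Fin 1, y = 0 := fun y => Subsingleton.elim _ _
    have h1 : P (.inl p.1 : D.Crossing ⊕ Fin 1) → P (.inr 0 : D.Crossing ⊕ Fin 1) := fun h => by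
      have := hP (.inl p.1, p.2) h
      rw [mate_insert_start, hnew (T.entry 0).1] at this
      exact this
    have h2 : P (.inr 0 : D.Crossing ⊕ Fin 1) → P (.inl p.1 : D.Crossing ⊕ Fin 1) := fun h => by
      have := hP ((insert hT p).mate (.inl p.1, p.2))
        (by rw [mate_insert_start, hnew (T.entry 0).1]; exact h)
      rw [LinkDiagram.mate_mate] at this
      exact this
    have h3 : ∀ d, P (T.insDart p d).1 ↔ P (.inl d.1 : D.Crossing ⊕ Fin 1) := by
      intro d
      by_cases hd : d = p
      · rw [hd, insDart_p, hnew T.exit.1]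
        exact ⟨h2, h1⟩
      · rw [insDart_old hd]
    have h4 : ∀ y, P (.inl y : D.Crossing ⊕ Fin 1) := by
      have h5 : P (.inl p.1 : D.Crossing ⊕ Fin 1) ∨ ∃ y, P (.inl y : D.Crossing ⊕ Fin 1) := by
        rcases x with y | y
        · exact .inr ⟨y, hx⟩
        · rw [hnew y] at hx
          exact .inl (h2 hx)
      obtain ⟨y, hy⟩ : ∃ y, P (.inl y : D.Crossing ⊕ Fin 1) := h5.elim (fun h => ⟨_, h⟩) id
      refine hD.forall_of_mate (P := fun y => P (.inl y : D.Crossing ⊕ Fin 1)) (fun d hd => ?_) hy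
      have := hP _ ((h3 d).2 hd)
      rw [mate_insert_insDart] at this
      exact (h3 _).1 this
    rintro (y | y)
    · exact h4 y
    · rw [hnew y]
      exact h1 (h4 _)

end Tangle

namespace LinkDiagram

open Tangle

variable {D : LinkDiagram}

/-- Two crossings that are joined by the two sides of a two-sided region, and whose other ends are
joined to each other at most along the two strands. -/
structure PreBigon (D : LinkDiagram) (x y : D.Crossing) (i j : ZMod 4) : Prop where
  ne : x ≠ y
  mate_zero : D.mate (x, i) = (y, j + 1)
  mate_one : D.mate (x, i + 1) = (y, j)
  mate_two_three : D.mate (x, i + 2) ≠ (x, i + 3)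
  mate_two_three' : D.mate (y, j + 2) ≠ (y, j + 3)
  mate_two_two : D.mate (x, i + 2) ≠ (y, j + 2)
  mate_three_three : D.mate (x, i + 3) ≠ (y, j + 3)

namespace PreBigon

variable {x y : D.Crossing} {i j : ZMod 4}

lemma symm (b : D.PreBigon x y i j) : D.PreBigon y x j i where
  ne := b.ne.symm
  mate_zero := (D.mate_eq_comm.1 b.mate_one).symm
  mate_one := (D.mate_eq_comm.1 b.mate_zero).symm
  mate_two_three := b.mate_two_three'
  mate_two_three' := b.mate_two_three
  mate_two_two h := b.mate_two_two (D.mate_eq_comm.1 h).symm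
  mate_three_three h := b.mate_three_three (D.mate_eq_comm.1 h).symm

lemma outer (b : D.PreBigon x y i j) (h : D.mate (x, i + 2) ≠ (y, j + 3))
    (h' : D.mate (x, i + 3) ≠ (y, j + 2)) :
    ((D.mate (x, i + 2)).1 ≠ x ∧ (D.mate (x, i + 2)).1 ≠ y) ∧
    ((D.mate (x, i + 3)).1 ≠ x ∧ (D.mate (x, i + 3)).1 ≠ y) := by
  have e : ∀ i : ZMod 4, i + 2 ≠ i + 1 ∧ i + 2 ≠ i ∧ i + 3 ≠ i + 1 ∧ i + 3 ≠ i := by decide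
  have hx : ∀ k, k ≠ i → k ≠ i + 1 → D.mate (x, k) ≠ (y, j) ∧ D.mate (x, k) ≠ (y, j + 1) ∧
      D.mate (x, k) ≠ (x, i) ∧ D.mate (x, k) ≠ (x, i + 1) := by
    intro k h0 h1
    refine ⟨fun h => ?_, fun h => ?_, fun h => ?_, fun h => ?_⟩
    · rw [← b.mate_one] at h
      exact h1 (congrArg Prod.snd (by simpa only [D.mate_mate] using congrArg D.mate h))
    · rw [← b.mate_zero] at h
      exact h0 (congrArg Prod.snd (by simpa only [D.mate_mate] using congrArg D.mate h))
    · rw [D.mate_eq_comm, b.mate_zero] at h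
      exact b.ne (congrArg Prod.fst h)
    · rw [D.mate_eq_comm, b.mate_one] at h
      exact b.ne (congrArg Prod.fst h)
  have h2 := hx (i + 2) (e i).2.1 (e i).1
  have h3 := hx (i + 3) (e i).2.2.2 (e i).2.2.1
  refine ⟨⟨fun hc => ?_, fun hc => ?_⟩, fun hc => ?_, fun hc => ?_⟩
  · rcases mk_add_cases (D.mate (x, i + 2)) i with h4 | h4 | h4 | h4 <;> rw [hc] at h4
    exacts [h2.2.2.1 h4, h2.2.2.2 h4, D.mate_ne _ h4, b.mate_two_three h4]
  · rcases mk_add_cases (D.mate (x, i + 2)) j with h4 | h4 | h4 | h4 <;> rw [hc] at h4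
    exacts [h2.1 h4, h2.2.1 h4, b.mate_two_two h4, h h4]
  · rcases mk_add_cases (D.mate (x, i + 3)) i with h4 | h4 | h4 | h4 <;> rw [hc] at h4
    exacts [h3.2.2.1 h4, h3.2.2.2 h4, b.mate_two_three (D.mate_eq_comm.1 h4).symm, D.mate_ne _ h4]
  · rcases mk_add_cases (D.mate (x, i + 3)) j with h4 | h4 | h4 | h4 <;> rw [hc] at h4
    exacts [h3.1 h4, h3.2.1 h4, h' h4, b.mate_three_three h4]

lemma bigon (b : D.PreBigon x y i j) (h : D.mate (x, i + 2) ≠ (y, j + 3))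
    (h' : D.mate (x, i + 3) ≠ (y, j + 2)) : D.Bigon x y i j := by
  have h1 := b.outer h h'
  have h2 := b.symm.outer (fun he => h' (D.mate_eq_comm.1 he).symm)
    fun he => h (D.mate_eq_comm.1 he).symm
  exact ⟨b.ne, b.mate_zero, b.mate_one, h1.1, h1.2, h2.1.symm, h2.2.symm⟩

variable {k : ℕ} {T : Tangle 1 k} (hT : T.Valid)

/-- A kink on an outer edge keeps the configuration, while that edge no longer joins `x` to `y`. -/
lemma insert (b : D.PreBigon x y i j) {m} (hm : m = i + 2 ∨ m = i + 3) :
    (Tangle.insert hT (x, m)).PreBigon (Sum.inl x : D.Crossing ⊕ Fin 1)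
      (Sum.inl y : D.Crossing ⊕ Fin 1) i j := by
  have e : ∀ i : ZMod 4, i ≠ i + 2 ∧ i ≠ i + 3 ∧ i + 1 ≠ i + 2 ∧ i + 1 ≠ i + 3 := by decide
  have hi : i ≠ m ∧ i + 1 ≠ m := by
    rcases hm with rfl | rfl
    exacts [⟨(e i).1, (e i).2.2.1⟩, ⟨(e i).2.1, (e i).2.2.2⟩]
  have h := fun q r => mate_insert_eq_iff hT (x, m) (q := q) (r := r)
  refine ⟨fun he => b.ne (Sum.inl_injective he), ?_, ?_, fun he => ?_, fun he => ?_, fun he => ?_,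
    fun he => ?_⟩
  · exact (h (x, i) (y, j + 1)).2 ⟨b.mate_zero, fun h => hi.1 (congrArg Prod.snd h),
      fun h => b.ne (congrArg Prod.fst h).symm⟩
  · exact (h (x, i + 1) (y, j)).2 ⟨b.mate_one, fun h => hi.2 (congrArg Prod.snd h),
      fun h => b.ne (congrArg Prod.fst h).symm⟩
  · exact b.mate_two_three ((h (x, i + 2) (x, i + 3)).1 he).1
  · exact b.mate_two_three' ((h (y, j + 2) (y, j + 3)).1 he).1
  · exact b.mate_two_two ((h (x, i + 2) (y, j + 2)).1 he).1
  · exact b.mate_three_three ((h (x, i + 3) (y, j + 3)).1 he).1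

lemma corner_insert {p : D.Crossing × ZMod 4}
    (heq : D.cornerAt (x, i + 2) = D.cornerAt (y, j + 2)) :
    (Tangle.insert hT p).cornerAt ((Sum.inl x : D.Crossing ⊕ Fin 1), i + 2) =
      (Tangle.insert hT p).cornerAt ((Sum.inl y : D.Crossing ⊕ Fin 1), j + 2) :=
  congrArg (Sum.inl (β := Fin 1)) heq

/-- If the outer ends `i + 3` and `j + 2` are joined, Ω₂↓ would leave a circle without crossings,
which `Bigon` does not cover. A kink added to that edge by Ω₁↑ avoids this. The other pair of outer
ends is treated in the same way in `exists_disconnected`. -/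
lemma exists_disconnected_of_mate_ne [Nonempty D.Crossing] (b : D.PreBigon x y i j)
    (hD : D.IsConnected) (hover : IsOver i ↔ IsOver (j + 1))
    (heq : D.cornerAt (x, i + 2) = D.cornerAt (y, j + 2)) (h : D.mate (x, i + 2) ≠ (y, j + 3)) :
    ∃ D' : LinkDiagram, EqvGen NonIncreasingStep D D' ∧ Nonempty D'.Edge ∧ ¬ D'.IsConnected := by
  have hI := fun p : D.Crossing × ZMod 4 => isKink_tangleI.omega1Down valid_tangleI p
  by_cases h' : D.mate (x, i + 3) = (y, j + 2)
  · have : Nonempty (Tangle.insert valid_tangleI (x, i + 3)).Crossing :=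
      ⟨(Sum.inl x : D.Crossing ⊕ Fin 1)⟩
    have hiff := fun q r => mate_insert_eq_iff valid_tangleI (x, i + 3) (q := q) (r := r)
    obtain ⟨D', h1, h2⟩ := ((b.insert valid_tangleI (m := i + 3) (.inr rfl)).bigon
      (fun he => h ((hiff (x, i + 2) (y, j + 3)).1 he).1)
      (fun he => ((hiff (x, i + 3) (y, j + 2)).1 he).2.1 rfl)).exists_disconnected
      (isConnected_insert _ _ hD) hover (corner_insert _ heq)
    exact ⟨D', .trans _ _ _ (.symm _ _ (eqvGen_of_step (.inr (.inl (hI _)))))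
      (eqvGen_of_step (.inr (.inr (.inl h1)))), h2⟩
  · obtain ⟨D', h1, h2⟩ := (b.bigon h h').exists_disconnected hD hover heq
    exact ⟨D', eqvGen_of_step (.inr (.inr (.inl h1))), h2⟩

/-- If the two opposite regions at a two-sided region coincide, then the link is split. -/
theorem exists_disconnected [Nonempty D.Crossing] (b : D.PreBigon x y i j)
    (hD : D.IsConnected) (hover : IsOver i ↔ IsOver (j + 1))
    (heq : D.cornerAt (x, i + 2) = D.cornerAt (y, j + 2)) :
    ∃ D' : LinkDiagram, EqvGen NonIncreasingStep D D' ∧ Nonempty D'.Edge ∧ ¬ D'.IsConnected := by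
  have hI := fun p : D.Crossing × ZMod 4 => isKink_tangleI.omega1Down valid_tangleI p
  by_cases h : D.mate (x, i + 2) = (y, j + 3)
  · have : Nonempty (Tangle.insert valid_tangleI (x, i + 2)).Crossing :=
      ⟨(Sum.inl x : D.Crossing ⊕ Fin 1)⟩
    have hiff := fun q r => mate_insert_eq_iff valid_tangleI (x, i + 2) (q := q) (r := r)
    obtain ⟨D', h1, h2⟩ := (b.insert valid_tangleI (m := i + 2) (.inl rfl)).exists_disconnected_of_mate_ne
      (isConnected_insert _ _ hD) hover (corner_insert _ heq)
      (fun he => ((hiff (x, i + 2) (y, j + 3)).1 he).2.1 rfl)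
    exact ⟨D', .trans _ _ _ (.symm _ _ (eqvGen_of_step (.inr (.inl (hI _))))) h1, h2⟩
  · exact b.exists_disconnected_of_mate_ne hD hover heq h

/-- Hence spacers are needed only in the disconnecting case: if the opposite regions differ, a
`PreBigon` is already a `Bigon`. -/
lemma corner_eq_of_mate_eq
    (h : D.mate (x, i + 2) = (y, j + 3) ∨ D.mate (x, i + 3) = (y, j + 2)) :
    D.cornerAt (x, i + 2) = D.cornerAt (y, j + 2) := by
  have e : ∀ i : ZMod 4, i + 3 - 1 = i + 2 := by decide
  rcases h with h | h
  · have := D.cornerAt_cw_mate (x, i + 2)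
    rw [h, cw, e] at this
    exact this.symm
  · have := D.cornerAt_mate (x, i + 3)
    rw [h, cw, e] at this
    exact this.symm

end PreBigon

/-- In a reduced diagram neighbouring ends of a crossing are not joined. Each of the two other
excluded edges would force an edge at `x` or `y` to have one region on both sides, against
`sides_ne`. -/
lemma Omega2Config.preBigon [Nonempty D.Crossing] (hD : D.IsConnected) (hr : D.IsReduced)
    {x y : D.Crossing} {i j : ZMod 4} (h : D.Omega2Config x y i j) : D.PreBigon x y i j := by
  obtain ⟨hne, h0, h1, -, -⟩ := h
  have e : ∀ i : ZMod 4, i + 2 + 1 = i + 3 ∧ i + 2 - 1 = i + 1 ∧ i + 3 - 1 = i + 2 ∧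
      i - 1 = i + 3 ∧ i + 1 - 1 = i := by decide
  have hm0 : D.mate (x, i) = (y, j + 1) :=
    (D.eq_mate (p := (x, i)) (s := (y, j + 1)) h0.symm fun he => hne (congrArg Prod.fst he).symm).symm
  have hm1 : D.mate (x, i + 1) = (y, j) :=
    (D.eq_mate (p := (x, i + 1)) (s := (y, j)) h1 fun he => hne (congrArg Prod.fst he).symm).symm
  have hc1 : D.cornerAt (y, j + 3) = D.cornerAt (x, i + 1) := by
    have := D.cornerAt_cw_mate (x, i + 1)
    rwa [hm1, cw, (e j).2.2.2.1] at this
  have hadj : ∀ (z : D.Crossing) (k : ZMod 4), D.mate (z, k + 2) ≠ (z, k + 3) := by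
    intro z k he
    have h2 : D.edgeAt (z, k + 3) = D.edgeAt (z, k + 2) := by rw [← he, D.edgeAt_mate]
    refine hr.edge_ne z (k + 2) ?_
    rw [(e k).1]
    exact h2.symm
  refine ⟨hne, hm0, hm1, hadj x i, hadj y j, fun he => ?_, fun he => ?_⟩
  · have h2 := D.cornerAt_mate (x, i + 2)
    rw [he, cw, (e i).2.1, ← hc1] at h2
    have := hD.sides_ne (y, j + 3)
    rw [cw, (e j).2.2.1] at this
    exact this h2.symm
  · have h2 := D.cornerAt_mate (x, i + 3)
    rw [he, cw, (e i).2.2.1, hc1] at h2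
    have := hD.sides_ne (x, i + 2)
    rw [cw, (e i).2.1] at this
    exact this h2.symm

end LinkDiagram

/-! ### The bound for non-split, non-trivial links -/

namespace Link

open LinkDiagram

/-- No move `Ω₂↓` can be made on a reduced minimal diagram of a non-split link. -/
theorem IsMinimalDiagram.not_omega2Config {L : Link} {D : LinkDiagram} (h : L.IsMinimalDiagram D)
    [hX : Nonempty D.Crossing] (hD : D.IsConnected) (hr : D.IsReduced) (hs : ¬ L.IsSplit)
    {x y : D.Crossing} {i j : ZMod 4} : ¬ D.Omega2Config x y i j := by
  intro ho
  obtain ⟨hL, hc⟩ := h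
  have b := ho.preBigon hD hr
  -- If the regions opposite to the bigon coincide, the link would be split; if they differ, Ω₂↓
  -- would lower the number of crossings below the minimum.
  by_cases heq : D.cornerAt (x, i + 2) = D.cornerAt (y, j + 2)
  · obtain ⟨D', h1, h2⟩ := b.exists_disconnected hD ho.2.2.2.1 heq
    exact hs ⟨D', hL.congr (.symm _ _ h1), h2⟩
  · have b' := b.bigon (fun he => heq (PreBigon.corner_eq_of_mate_eq (.inl he))) fun he => heq (PreBigon.corner_eq_of_mate_eq (.inr he))
    obtain ⟨D', f, h1, -, hf, -⟩ := b'.exists_connected hD ho.2.2.2.1 heq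
    have h2 := crossingNumber_le (hL.congr (.symm _ _ (eqvGen_of_step (.inr (.inr (.inl h1))))))
    have h3 := b'.card_kept
    rw [← Nat.card_congr (Equiv.ofBijective f hf)] at h3
    unfold numCrossings at h2 hc
    omega

/-- A non-split and non-trivial link has a rigid hard diagram with few crossings. -/
theorem exists_isRigidHardDiagram_le (L : Link) (hL : L.IsNonempty) (hs : ¬ L.IsSplit)
    (ht : ¬ L.IsTrivial) :
    ∃ D, L.IsRigidHardDiagram D ∧ D.numCrossings ≤ 7 * L.tri + L.crossingNumber := by
  have hX : ∀ D, L.HasDiagram D → Nonempty D.Crossing := fun D hD => by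
    by_contra hn
    exact ht ⟨D, hD, not_nonempty_iff.1 hn⟩
  have hcon : ∀ D, L.HasDiagram D → D.IsConnected := fun D hD => by
    obtain ⟨x⟩ := hX D hD
    by_contra hn
    exact hs ⟨D, hD, ⟨D.edge x 0⟩, hn⟩
  have hmin : ∃ D, L.IsMinimalDiagram D := by
    obtain ⟨D, hD, -⟩ := hL
    exact Nat.sInf_mem (s := {n | ∃ D, L.HasDiagram D ∧ D.numCrossings = n}) ⟨_, D, hD, rfl⟩
  obtain ⟨D, hD, htri⟩ := Nat.sInf_mem
    (s := {n | ∃ D, L.IsMinimalDiagram D ∧ D.numOmega3Triangles = n})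
    ⟨_, hmin.choose, hmin.choose_spec, rfl⟩
  have := hX D hD.1
  have hr := hD.isReduced (hcon D hD.1) hs ht
  -- No Ω₂↓ is possible on this diagram, so gadgets are needed at the Ω₃-triangles only.
  have hmov : D.numMovable = D.numOmega3Triangles := by
    have : {r | D.IsMovable r} = {r | D.IsOmega3Triangle r} := by
      ext r
      refine ⟨fun h => h.resolve_left ?_, .inr⟩
      rintro ⟨x, y, i, j, h, -⟩
      exact hD.not_omega2Config (hcon D hD.1) hr hs h
    unfold numMovable
    rw [this]
    rfl
  obtain ⟨D', h1, h2, h3, h4⟩ := exists_isStuck this hr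
  refine ⟨D', h2.isRigidHardDiagram (hD.1.congr h1) (hD.2 ▸ h3), ?_⟩
  rw [hmov, htri, hD.2] at h4
  unfold tri
  omega

end Link

theorem theorem2 (L : Link) (hL : L.IsNonempty) :
    (∃ D, L.IsRigidHardDiagram D) ∧
    (¬ L.IsSplit → ¬ L.IsTrivial →
      ∃ D, L.IsRigidHardDiagram D ∧ D.numCrossings ≤ 7 * L.tri + L.crossingNumber) := by
  exact ⟨L.exists_isRigidHardDiagram hL, L.exists_isRigidHardDiagram_le hL⟩
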